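/- **Setting.** Consider planar isentropic MHD with infinite electrical resistivity parameter $\sigma=\infty$ and pressure $p(v)=av^{-\gamma}$, $\gamma\ge 1$, in rescaled coordinates with shock speed $-1$ and left state $(v,u_1,u_2,B_2)=(1,0,0,B_-)$. The constants $\mu>0$, $\tau:=2\mu+\eta>0$, $\mu_0>0$, $I,B_-\in\mathbb R$ are fixed; put $J=B_-^2/(2\mu_0)$, $K=I^2/\mu_0$, and assume $J>0$. With $w=u_2$, $u_1=v-1$ and $B=(B_-+Iw)/v$, profiles are solutions $(\hat v,\hat w)$, $\hat v>0$, of $$\tau v'=v(v-1)+v(p(v)-p(1))+\tfrac{1}{2\mu_0v}\big((B_-+Iw)^2-v^2B_-^2\big),\qquad \mu w'=vw-\tfrac{I}{\mu_0}\big(B_-(1-v)+Iw\big),$$ with limits $(1,0)$ at $-\infty$ and $(v_+,w_+)$, $v_+>0$, at $+\infty$. The profile is that of a Lax $1$-shock if all four characteristic speeds relative to the shock are positive at the left state and, at the right state, none is zero and exactly one is negative; the shock is ordinary if $v_+>K$ and intermediate if $v_+<K$ (here $K<1$). The same equations with $a=0$ define the zero-pressure limit. The integrated eigenvalue equation is $W'=A(x,\lambda)W$,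 $W=(u,V,V',w,\mu w',\alpha)^T\in\mathbb C^6$, with $$A=\begin{pmatrix}0&\lambda&1&0&0&0\\0&0&1&0&0&0\\ \frac{\lambda\hat v}{\tau}&\frac{\lambda\hat v}{\tau}&f-\lambda-\frac{\hat B^2}{\mu_0\tau}&0&\frac{I\hat B}{\mu_0\mu\tau}&-\frac{\lambda\hat B}{\mu_0\tau}\\0&0&0&0&\frac1\mu&0\\0&0&\frac{\mu\hat w'}{\hat v}+\frac{I\hat B}{\mu_0}&\lambda\hat v&\frac{\hat v-K}{\mu}&\frac{\lambda I}{\mu_0}\\0&0&0&0&\frac I\mu&-\lambda\end{pmatrix},\quad f=\tfrac1\tau\big(\hat v-\hat v^{-\gamma}h\big),\quad h=-\hat v^{\gamma+1}\Big(\frac{\tau\hat v'}{\hat v^2}-a\gamma\hat v^{-\gamma-1}\Big),$$ and limits $A_\pm(\lambda)$ as $x\to\pm\infty$. Let $R_1^-,R_2^-$ and $R_1^+,\dots,R_4^+$ be Kato's analytic bases on $\operatorname{Re}\lambda>0$ of the unstable subspace of $A_-$ and of the stable subspace of $A_+$ (that is, $R'=[\Pi',\Pi]R$ with $\Pi$ the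 corresponding spectral projection), extended continuously, as linearly independent vectors, to $\operatorname{Re}\lambda\ge0$; they are determined by their values at a base point $\lambda_0$, $\operatorname{Re}\lambda_0>0$. Let $P_\pm(x,\lambda)$ solve $P_\pm'=AP_\pm-P_\pm A_\pm$ with $|P_\pm-\mathrm{Id}|\le Ce^{-\theta|x|}$ for $x\gtrless0$ and some $C,\theta>0$. The Evans function of the profile is $$D(\lambda)=\det\big(P_-R_1^-,P_-R_2^-,P_+R_1^+,\dots,P_+R_4^+\big)\big|_{x=0},\qquad \operatorname{Re}\lambda\ge0.$$ **Proposition.** If $2J+K<1$, then for $a=0$ there is a profile of an ordinary Lax $1$-shock. Let $\hat\varphi^0=(\hat v^0,\hat w^0)$ be any profile of an ordinary or an intermediate Lax $1$-shock for $a=0$. Then: 1. For all sufficiently small $a>0$ there is a profile of a Lax $1$-shock of the same kind (ordinary or intermediate). 2. If $\hat\varphi^a$ are any such profiles, then they have translates $\hat\varphi^a(\cdot+h(a))$ with $\hat\varphi^a(h(a))\to\hat\varphi^0(0)$ as $a\to0^+$. 3. Let $\hat\varphi^a$ be such profiles, translated so that $\hat\varphi^a(0)\to\hat\varphi^0(0)$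 as $a\to0^+$. Fix $\lambda_0$ with $\operatorname{Re}\lambda_0>0$, a basis of the unstable subspace of $A_-(\lambda_0)$ and one of the stable subspace of $A_+(\lambda_0)$ for $a=0$, and, for small $a>0$, bases of the corresponding subspaces that converge to them as $a\to0^+$. Then the Evans functions $D^a$ of $\hat\varphi^a$ (for small $a>0$) and $D^0$ of $\hat\varphi^0$ with these base-point values exist, and in the large-amplitude limit $a\to0^+$ $$D^a\to D^0\quad\text{uniformly on every compact subset of }\{\operatorname{Re}\lambda\ge0\}.$$ -/

import Mathlib

open Filter Topology Set

noncomputable section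

/-- Parameters of planar isentropic MHD with infinite electrical resistivity parameter
`σ = ∞`, in the rescaled variables with shock speed `-1` and left state
`(v, u₁, u₂, B₂) = (1, 0, 0, Bm)`: adiabatic exponent `γ`, viscosities `μ`, `η`, magnetic
permeability `μ₀`, the constant component `I` of the magnetic field, and the left value `Bm` of its
second component. The pressure is `p(v) = a v ^ (-γ)`; its coefficient `a` is kept separate since
it is the varying parameter. -/
structure MHD where
  γ : ℝ
  μ : ℝ
  η : ℝ
  μ₀ : ℝ
  I : ℝ
  Bm : ℝ
  one_le_γ : 1 ≤ γ
  μ_pos : 0 < μ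
  τ_pos : 0 < 2 * μ + η
  μ₀_pos : 0 < μ₀

namespace MHD

variable (m : MHD)

def τ : ℝ := 2 * m.μ + m.η

def J : ℝ := m.Bm ^ 2 / (2 * m.μ₀)

def K : ℝ := m.I ^ 2 / m.μ₀

/-- The pressure law `p(v) = a v ^ (-γ)`. -/
def pressure (a v : ℝ) : ℝ := a * v ^ (-m.γ)

/-- The magnetic field `B = (B₋ + I w) / v`, where `w = u₂`. -/
def magField (v w : ℝ) : ℝ := (m.Bm + m.I * w) / v

/-- Right-hand side of the `v`-component of the travelling-wave equation:
`τ v' = v (v - 1) + v (p - p₋) + ((B₋ + I w)² - v² B₋²) / (2 μ₀ v)`. -/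
def fieldV (a v w : ℝ) : ℝ :=
  (v * (v - 1) + v * (m.pressure a v - m.pressure a 1)
    + ((m.Bm + m.I * w) ^ 2 - v ^ 2 * m.Bm ^ 2) / (2 * m.μ₀ * v)) / m.τ

/-- Right-hand side of the `w`-component of the travelling-wave equation:
`μ w' = v w - (I / μ₀) (B₋ (1 - v) + I w)`. -/
def fieldW (v w : ℝ) : ℝ :=
  (v * w - m.I / m.μ₀ * (m.Bm * (1 - v) + m.I * w)) / m.μ

/-! ### Profiles and shock type -/

/-- A candidate profile `(v, w)` together with its right end state `(vR, wR)`; the left end state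
is always `(1, 0)`. The component `u₁` is `v - 1` and `B₂` is `magField v w`. -/
structure Profile where
  v : ℝ → ℝ
  w : ℝ → ℝ
  vR : ℝ
  wR : ℝ

/-- `φ` is a viscous shock profile for the pressure coefficient `a`. -/
structure IsProfile (a : ℝ) (φ : Profile) : Prop where
  v_pos : ∀ x, 0 < φ.v x
  vR_pos : 0 < φ.vR
  ode_v : ∀ x, HasDerivAt φ.v (m.fieldV a (φ.v x) (φ.w x)) x
  ode_w : ∀ x, HasDerivAt φ.w (m.fieldW (φ.v x) (φ.w x)) x
  v_left : Tendsto φ.v atBot (𝓝 1)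
  w_left : Tendsto φ.w atBot (𝓝 0)
  v_right : Tendsto φ.v atTop (𝓝 φ.vR)
  w_right : Tendsto φ.w atTop (𝓝 φ.wR)

/-- The Jacobian (in the variables `(v, B, u₁, u₂)`) of the flux of the first-order system without
viscosity, at a state with specific volume `v` and magnetic field `B`, minus the shock speed `-1`.
Its eigenvalues are the characteristic speeds relative to the shock. -/
def charMatrix (a v B : ℝ) : Matrix (Fin 4) (Fin 4) ℝ :=
  !![0, 0, -1, 0;
     0, 0, B / v, -m.I / v;
     -(a * m.γ * v ^ (-m.γ - 1)), B / m.μ₀, 0, 0;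
     0, -m.I / m.μ₀, 0, 0] + 1

/-- The characteristic speeds relative to the shock, with multiplicity. -/
def charSpeeds (a v w : ℝ) : Multiset ℝ :=
  (m.charMatrix a v (m.magField v w)).charpoly.roots

/-- Noncharacteristic Lax `1`-type: all four relative characteristic speeds are positive on the
left, and on the right none vanishes and exactly one is negative. -/
def IsLaxOne (a : ℝ) (φ : Profile) : Prop :=
  (∀ s ∈ m.charSpeeds a 1 0, 0 < s) ∧
  (∀ s ∈ m.charSpeeds a φ.vR φ.wR, s ≠ 0) ∧
  ((m.charSpeeds a φ.vR φ.wR).filter (fun s => s < 0)).card = 1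

/-- A viscous profile of a Lax `1`-shock. The shock is an ordinary one if `K < vR` and an
intermediate one if `vR < K` (since the left state has `v = 1 > K`, the shock then bridges `K`). -/
def IsLaxOneProfile (a : ℝ) (φ : Profile) : Prop :=
  m.IsProfile a φ ∧ m.IsLaxOne a φ

/-- Two profiles both belong to ordinary, or both belong to intermediate, Lax `1`-shocks. -/
def SameKind (φ ψ : Profile) : Prop := m.K < φ.vR ↔ m.K < ψ.vR

/-! ### The integrated eigenvalue system -/

/-- `h(v) = -v ^ (γ + 1) (τ v' / v² - a γ v ^ (-γ - 1))`, with `v'` given by the travelling-wave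
equation. -/
def hFun (a v w : ℝ) : ℝ :=
  -(v ^ (m.γ + 1)) * (m.τ * m.fieldV a v w / v ^ 2 - a * m.γ * v ^ (-m.γ - 1))

/-- `f(v) = τ⁻¹ (v - v ^ (-γ) h(v))`. -/
def fFun (a v w : ℝ) : ℝ := (v - v ^ (-m.γ) * m.hFun a v w) / m.τ

/-- The coefficient matrix of the first-order system `W' = A W` for
`W = (u, V, V', w, μ w', α)`, the integrated eigenvalue equation with eigenvalue parameter `z`,
at a point `(v, w)` of the profile. -/
def evansMatrix (a : ℝ) (z : ℂ) (v w : ℝ) : Matrix (Fin 6) (Fin 6) ℂ :=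
  let B := m.magField v w
  !![0, z, 1, 0, 0, 0;
     0, 0, 1, 0, 0, 0;
     z * (v / m.τ : ℝ), z * (v / m.τ : ℝ), (m.fFun a v w - B ^ 2 / (m.μ₀ * m.τ) : ℝ) - z, 0,
       (m.I * B / (m.μ₀ * m.μ * m.τ) : ℝ), -z * (B / (m.μ₀ * m.τ) : ℝ);
     0, 0, 0, 0, (1 / m.μ : ℝ), 0;
     0, 0, (m.μ * m.fieldW v w / v + m.I * B / m.μ₀ : ℝ), z * (v : ℝ),
       ((v - m.K) / m.μ : ℝ), z * (m.I / m.μ₀ : ℝ);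
     0, 0, 0, 0, (m.I / m.μ : ℝ), -z]

end MHD

/-! ### The Evans function -/

/-- Unstable subspace of a complex matrix: the sum of the generalized eigenspaces of the
eigenvalues with positive real part. -/
def unstableSubspace {n : ℕ} (M : Matrix (Fin n) (Fin n) ℂ) : Submodule ℂ (Fin n → ℂ) :=
  ⨆ (z : ℂ) (_ : 0 < z.re), Module.End.maxGenEigenspace (Matrix.toLin' M) z

/-- Stable subspace of a complex matrix. -/
def stableSubspace {n : ℕ} (M : Matrix (Fin n) (Fin n) ℂ) : Submodule ℂ (Fin n → ℂ) :=
  ⨆ (z : ℂ) (_ : z.re < 0), Module.End.maxGenEigenspace (Matrix.toLin' M) z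

/-- The vectors `b j` form a basis of `E`. -/
def IsFrame {n k : ℕ} (E : Submodule ℂ (Fin n → ℂ)) (b : Fin k → Fin n → ℂ) : Prop :=
  LinearIndependent ℂ b ∧ Submodule.span ℂ (Set.range b) = E

/-- `R` is the analytic basis of the spectral subspace `E z` given by Kato's construction, where
`F z` is the complementary spectral subspace. On the open right half-plane Kato's equation
`R' = [Π', Π] R`, for the projection `Π z` onto `E z` along `F z`, says for `R z ∈ E z` exactly that
`Π R' = 0`, i.e. `R' ∈ F z`. The basis is extended continuously to the imaginary axis (where
the subspaces may fail to be separated), staying linearly independent. -/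
structure IsKatoBasis {n k : ℕ} (E F : ℂ → Submodule ℂ (Fin n → ℂ))
    (R : Fin k → ℂ → Fin n → ℂ) : Prop where
  continuousOn : ∀ j, ContinuousOn (R j) {z : ℂ | 0 ≤ z.re}
  independent : ∀ z : ℂ, 0 ≤ z.re → LinearIndependent ℂ (fun j => R j z)
  frame : ∀ z : ℂ, 0 < z.re → IsFrame (E z) (fun j => R j z)
  differentiable : ∀ z : ℂ, 0 < z.re → ∀ j, DifferentiableAt ℂ (R j) z
  kato : ∀ z : ℂ, 0 < z.re → ∀ j, deriv (R j) z ∈ F z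

/-- `P` conjugates `W' = A(x) W` to `Z' = A∞ Z` through `W = P Z`, i.e. `P' = A P - P A∞`, and
differs from the identity by an exponentially decaying term on the half-line `S`, which is
`(-∞, 0]` or `[0, ∞)`. (Being a linear equation, the equation for `P` extends to the whole line.) -/
structure IsConjugator {n : ℕ} (A : ℝ → Matrix (Fin n) (Fin n) ℂ) (Ainf : Matrix (Fin n) (Fin n) ℂ)
    (S : Set ℝ) (P : ℝ → Matrix (Fin n) (Fin n) ℂ) : Prop where
  ode : ∀ x i j, HasDerivAt (fun y => P y i j) ((A x * P x - P x * Ainf) i j) x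
  decay : ∃ C θ : ℝ, 0 < θ ∧ ∀ x ∈ S, ∀ i j,
    ‖P x i j - (1 : Matrix (Fin n) (Fin n) ℂ) i j‖ ≤ C * Real.exp (-θ * |x|)

namespace MHD

variable (m : MHD)

/-- `A₋`, the limit of the coefficient matrix at `-∞`. -/
def limLeft (a : ℝ) (z : ℂ) : Matrix (Fin 6) (Fin 6) ℂ := m.evansMatrix a z 1 0

/-- `A₊`, the limit of the coefficient matrix at `+∞`. -/
def limRight (a : ℝ) (φ : Profile) (z : ℂ) : Matrix (Fin 6) (Fin 6) ℂ :=
  m.evansMatrix a z φ.vR φ.wR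

/-- `D` is, on the closed right half-plane, the Evans function of the profile `φ` of a Lax
`1`-shock (so that `A₋` has two unstable modes and `A₊` four stable ones), built from the Kato
bases that take the values `bm` and `bp` at the base point `z₀`. -/
def IsEvansFunction (a : ℝ) (φ : Profile) (z₀ : ℂ) (bm : Fin 2 → Fin 6 → ℂ)
    (bp : Fin 4 → Fin 6 → ℂ) (D : ℂ → ℂ) : Prop :=
  ∃ (Rm : Fin 2 → ℂ → Fin 6 → ℂ) (Rp : Fin 4 → ℂ → Fin 6 → ℂ),
    IsKatoBasis (fun z => unstableSubspace (m.limLeft a z))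
      (fun z => stableSubspace (m.limLeft a z)) Rm ∧
    IsKatoBasis (fun z => stableSubspace (m.limRight a φ z))
      (fun z => unstableSubspace (m.limRight a φ z)) Rp ∧
    (∀ j, Rm j z₀ = bm j) ∧ (∀ j, Rp j z₀ = bp j) ∧
    ∀ z : ℂ, 0 ≤ z.re → ∃ Pm Pp : ℝ → Matrix (Fin 6) (Fin 6) ℂ,
      IsConjugator (fun x => m.evansMatrix a z (φ.v x) (φ.w x)) (m.limLeft a z) (Iic 0) Pm ∧
      IsConjugator (fun x => m.evansMatrix a z (φ.v x) (φ.w x)) (m.limRight a φ z) (Ici 0) Pp ∧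
      D z = Matrix.det (fun i j : Fin 6 =>
        (Fin.append (m := 2) (n := 4) (fun l => (Pm 0).mulVec (Rm l z))
          (fun l => (Pp 0).mulVec (Rp l z)) : Fin 6 → Fin 6 → ℂ) j i)

end MHD

end

section

open Real (exp norm_eq_abs exp_add exp_pos abs_exp tendsto_exp_atBot sqrt_nonneg norm_of_nonneg
  sq_sqrt one_le_exp exp_le_one_iff exp_le_exp rpow_nonneg abs_le_sqrt one_rpow)
open Metric (closedBall ball sphere mem_ball mem_sphere sphere_subset_closedBall mem_closedBall
  ball_subset_closedBall isOpen_ball)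
open Complex (norm_real normSq ofReal_re ofReal_im sub_re sub_im mul_re mul_im normSq_apply
  normSq_pos normSq_nonneg abs_re_le_norm re_le_norm neg_re)
open Module.End (maxGenEigenspace mem_maxGenEigenspace)
open BoundedContinuousFunction (coe_ofNormedAddCommGroup ofNormedAddCommGroup norm_le)

noncomputable section

notation "CL(" V ")" => V →L[ℂ] V
notation "ℝ²" => ℝ × ℝ

/-! ### Ordinary differential equations on the line -/

section ODE

variable {E : Type*} [NormedAddCommGroup E] [NormedSpace ℝ E]

theorem norm_integral_le_exp_abs {g : ℝ → E} {C l : ℝ} (hl : 0 < l)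
    (hg : ∀ t, ‖g t‖ ≤ C * exp (l * |t|)) (x : ℝ) :
    ‖∫ t in (0 : ℝ)..x, g t‖ ≤ C / l * exp (l * |x|) := by
  have hC : 0 ≤ C := by simpa using (norm_nonneg _).trans (hg 0)
  have key : ∀ (g : ℝ → E), (∀ t, ‖g t‖ ≤ C * exp (l * |t|)) → ∀ x, 0 ≤ x →
      ‖∫ t in (0 : ℝ)..x, g t‖ ≤ C / l * exp (l * x) := by
    intro g hg x hx
    have h1 : ‖∫ t in (0 : ℝ)..x, g t‖ ≤ ∫ t in (0 : ℝ)..x, C * exp (l * t) := by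
      refine intervalIntegral.norm_integral_le_of_norm_le hx ?_ ?_
      · refine Filter.Eventually.of_forall fun t ht => ?_
        have := hg t
        rwa [abs_of_pos ht.1] at this
      · exact Continuous.intervalIntegrable (by fun_prop) _ _
    have h2 : ∫ t in (0 : ℝ)..x, C * exp (l * t) = C / l * exp (l * x) - C / l := by
      have := intervalIntegral.integral_eq_sub_of_hasDerivAt (a := 0) (b := x)
        (f := fun t => C / l * exp (l * t)) (f' := fun t => C * exp (l * t))
        (fun t _ => by
          have h := (((hasDerivAt_id t).const_mul l).exp).const_mul (C / l)
          refine h.congr_deriv ?_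
          simp only [id, mul_one]
          field_simp) (Continuous.intervalIntegrable (by fun_prop) _ _)
      simpa using this
    have : 0 ≤ C / l := by positivity
    linarith
  rcases le_total 0 x with hx | hx
  · rw [abs_of_nonneg hx]; exact key g hg x hx
  · have h := key (fun t => g (-t)) (fun t => by simpa using hg (-t)) (-x) (by linarith)
    rw [intervalIntegral.integral_comp_neg (fun t => g t), neg_neg, neg_zero,
      intervalIntegral.integral_symm, norm_neg] at h
    rwa [abs_of_nonpos hx]

theorem exists_global_solution [CompleteSpace E] {f : ℝ → E → E} {K : NNReal} {B : ℝ}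
    (hf : Continuous (Function.uncurry f)) (hK : ∀ t, LipschitzWith K (f t))
    (hB : ∀ t, ‖f t 0‖ ≤ B) (y0 : E) :
    ∃ y : ℝ → E, y 0 = y0 ∧ ∀ t, HasDerivAt y (f t (y t)) t := by
  set l : ℝ := 2 * K + 1 with hl
  have hl0 : 0 < l := by positivity
  have hB0 : 0 ≤ B := (norm_nonneg _).trans (hB 0)
  have hgrow : ∀ t x, ‖f t x‖ ≤ K * ‖x‖ + B := by
    intro t x
    have h1 := (hK t).dist_le_mul x 0
    rw [dist_eq_norm, dist_zero_right] at h1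
    have h2 := norm_le_norm_add_norm_sub' (f t x) (f t 0)
    linarith [hB t]
  let u : (BoundedContinuousFunction ℝ E) → ℝ → E := fun p t => exp (l * |t|) • p t
  have hu : ∀ p, Continuous (u p) := fun p => by
    have := p.continuous
    exact Continuous.smul (by fun_prop) this
  let I : (BoundedContinuousFunction ℝ E) → ℝ → E := fun p x => y0 + ∫ t in (0:ℝ)..x, f t (u p t)
  have hcont : ∀ p, Continuous fun t => f t (u p t) := fun p =>
    hf.comp (continuous_id.prodMk (hu p))
  have hI : ∀ p, Continuous (I p) := fun p => by
    refine continuous_const.add ?_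
    exact intervalIntegral.continuous_primitive (fun a b => (hcont p).intervalIntegrable a b) 0
  have hIb : ∀ p x, ‖exp (-(l * |x|)) • I p x‖ ≤ ‖y0‖ + (K * ‖p‖ + B) / l := by
    intro p x
    have h1 : ‖∫ t in (0:ℝ)..x, f t (u p t)‖ ≤ (K * ‖p‖ + B) / l * exp (l * |x|) := by
      refine norm_integral_le_exp_abs hl0 (fun t => ?_) x
      refine (hgrow t _).trans ?_
      have h3 : ‖u p t‖ ≤ exp (l * |t|) * ‖p‖ := by
        simp only [u, norm_smul, norm_eq_abs, abs_exp]
        gcongr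
        exact p.norm_coe_le_norm t
      have h4 : 1 ≤ exp (l * |t|) := one_le_exp (by positivity)
      nlinarith [mul_le_mul_of_nonneg_left h3 K.coe_nonneg]
    rw [norm_smul, norm_eq_abs, abs_exp]
    have h5 : exp (-(l * |x|)) * exp (l * |x|) = 1 := by rw [← exp_add]; simp
    have h6 : exp (-(l * |x|)) ≤ 1 := exp_le_one_iff.2 (by
      have : 0 ≤ l * |x| := by positivity
      linarith)
    calc exp (-(l * |x|)) * ‖I p x‖
        ≤ exp (-(l * |x|)) * (‖y0‖ + (K * ‖p‖ + B) / l * exp (l * |x|)) := by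
          gcongr
          exact (norm_add_le _ _).trans (by gcongr)
      _ = exp (-(l * |x|)) * ‖y0‖ + (K * ‖p‖ + B) / l := by rw [mul_add, mul_left_comm, h5, mul_one]
      _ ≤ ‖y0‖ + (K * ‖p‖ + B) / l := by
          have := mul_le_mul_of_nonneg_right h6 (norm_nonneg y0)
          linarith
  let G : BoundedContinuousFunction ℝ E → BoundedContinuousFunction ℝ E := fun p =>
    ofNormedAddCommGroup (fun x => exp (-(l * |x|)) • I p x)
      (Continuous.smul (by fun_prop) (hI p)) _ (hIb p)
  have hG : ContractingWith (1 / 2) G := by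
    refine ⟨by norm_num, LipschitzWith.of_dist_le_mul fun p q => ?_⟩
    refine (BoundedContinuousFunction.dist_le (by positivity)).2 fun x => ?_
    have e1 : G p x - G q x = exp (-(l * |x|)) •
        ∫ t in (0:ℝ)..x, (f t (u p t) - f t (u q t)) := by
      simp only [G, I, coe_ofNormedAddCommGroup, ← smul_sub]
      rw [intervalIntegral.integral_sub ((hcont p).intervalIntegrable _ _)
        ((hcont q).intervalIntegrable _ _)]
      congr 1
      abel
    rw [dist_eq_norm, e1, norm_smul, norm_eq_abs, abs_exp]
    have h1 : ‖∫ t in (0:ℝ)..x, (f t (u p t) - f t (u q t))‖ ≤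
        (K * dist p q) / l * exp (l * |x|) := by
      refine norm_integral_le_exp_abs hl0 (fun t => ?_) x
      have h2 := (hK t).dist_le_mul (u p t) (u q t)
      rw [dist_eq_norm, dist_eq_norm] at h2
      refine h2.trans ?_
      have h3 : ‖u p t - u q t‖ ≤ exp (l * |t|) * dist p q := by
        simp only [u, ← smul_sub, norm_smul, norm_eq_abs, abs_exp]
        gcongr
        rw [← dist_eq_norm]
        exact BoundedContinuousFunction.dist_coe_le_dist t
      nlinarith [mul_le_mul_of_nonneg_left h3 K.coe_nonneg]
    have h5 : exp (-(l * |x|)) * exp (l * |x|) = 1 := by rw [← exp_add]; simp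
    calc exp (-(l * |x|)) * ‖∫ t in (0:ℝ)..x, (f t (u p t) - f t (u q t))‖
        ≤ exp (-(l * |x|)) * ((K * dist p q) / l * exp (l * |x|)) := by gcongr
      _ = (K * dist p q) / l := by rw [mul_left_comm, h5, mul_one]
      _ ≤ (1 / 2 : NNReal) * dist p q := by
          rw [div_le_iff₀ hl0]
          have : 0 ≤ dist p q := dist_nonneg
          push_cast
          rw [hl]
          nlinarith
  obtain ⟨p, hp⟩ : ∃ p, G p = p := ⟨_, hG.fixedPoint_isFixedPt⟩
  have hup : u p = I p := by
    funext t
    have h1 : G p t = p t := by rw [hp]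
    simp only [G, coe_ofNormedAddCommGroup] at h1
    simp only [u]
    rw [← h1, smul_smul, ← exp_add]
    simp
  refine ⟨I p, by simp [I], fun t => ?_⟩
  have h1 := intervalIntegral.integral_hasDerivAt_right ((hcont p).intervalIntegrable 0 t)
    ((hcont p).stronglyMeasurableAtFilter _ _) (hcont p).continuousAt
  rw [← congrFun hup t]
  exact h1.const_add y0

theorem ode_unique_of_contDiff {F : E → E} {U : Set E} {I : Set ℝ} {y z : ℝ → E}
    (hF : ∀ x ∈ U, ContDiffAt ℝ 1 F x)
    (hI : IsOpen I) (hI' : IsPreconnected I)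
    (hy : ∀ t ∈ I, HasDerivAt y (F (y t)) t) (hz : ∀ t ∈ I, HasDerivAt z (F (z t)) t)
    (hyU : ∀ t ∈ I, y t ∈ U) {t₀ : ℝ} (ht₀ : t₀ ∈ I) (h : y t₀ = z t₀) :
    ∀ t ∈ I, y t = z t := by
  have hyc : ContinuousOn y I := fun t ht => (hy t ht).continuousAt.continuousWithinAt
  have hzc : ContinuousOn z I := fun t ht => (hz t ht).continuousAt.continuousWithinAt
  have hpre : PreconnectedSpace I := isPreconnected_iff_preconnectedSpace.1 hI'
  let S : Set I := {t | y t = z t}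
  have hS : IsClopen S := by
    constructor
    · exact isClosed_eq hyc.domRestrict hzc.domRestrict
    · rw [isOpen_iff_mem_nhds]
      rintro ⟨t, ht⟩ (hS : y t = z t)
      obtain ⟨K, s, hs, hL⟩ := (hF _ (hyU t ht)).exists_lipschitzOnWith
      have hIt : I ∈ 𝓝 t := hI.mem_nhds ht
      have e := ODE_solution_unique_of_eventually (v := fun _ => F) (s := fun _ => s) (K := K)
        (t₀ := t) (f := y) (g := z) (Eventually.of_forall fun _ => hL)
        (by filter_upwards [hIt, (hy t ht).continuousAt hs] with r hr hr'
            exact ⟨hy r hr, hr'⟩)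
        (by filter_upwards [hIt, (hz t ht).continuousAt (by rwa [← hS])] with r hr hr'
            exact ⟨hz r hr, hr'⟩) hS
      rw [nhds_subtype_eq_comap]
      exact mem_comap.2 ⟨_, e, fun r hr => hr⟩
  have := hS.eq_univ ⟨⟨t₀, ht₀⟩, h⟩
  intro t ht
  have h' : (⟨t, ht⟩ : I) ∈ S := by rw [this]; trivial
  exact h'

theorem continuous_of_hasDerivAt {y y' : ℝ → E} (h : ∀ t, HasDerivAt y (y' t) t) : Continuous y :=
  continuous_iff_continuousAt.2 fun t => (h t).continuousAt

theorem hasDerivAt_fst_snd {y : ℝ → ℝ²} {y' : ℝ²} {t : ℝ} (h : HasDerivAt y y' t) :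
    HasDerivAt (fun t => (y t).1) y'.1 t ∧ HasDerivAt (fun t => (y t).2) y'.2 t :=
  ⟨(hasFDerivAt_fst.comp_hasDerivAt t h).congr_deriv (by simp),
    (hasFDerivAt_snd.comp_hasDerivAt t h).congr_deriv (by simp)⟩

theorem hasDerivAt_comp_neg {y : ℝ → E} {y' : E} {s : ℝ} (h : HasDerivAt y y' (-s)) :
    HasDerivAt (fun s => y (-s)) (-y') s := by
  have := h.scomp s (hasDerivAt_neg s)
  simpa [Function.comp_def] using this

theorem dist_solution_le {F : ℝ → E → E} {G : ℝ → E} {K : NNReal} (hF : ∀ t, LipschitzWith K (F t))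
    {e d : ℝ} {y z : ℝ → E} {T : ℝ} (hFG : ∀ t, |t| ≤ T → dist (G t) (F t (z t)) ≤ e)
    (hy : ∀ t, |t| ≤ T → HasDerivAt y (F t (y t)) t) (hz : ∀ t, |t| ≤ T → HasDerivAt z (G t) t)
    (h0 : dist (y 0) (z 0) ≤ d) {t : ℝ} (ht : |t| ≤ T) :
    dist (y t) (z t) ≤ (d + e) * exp ((K + 1) * T) := by
  have hT : 0 ≤ T := (abs_nonneg t).trans ht
  have he : 0 ≤ e := dist_nonneg.trans (hFG 0 (by simpa using hT))
  have hd : 0 ≤ d := dist_nonneg.trans h0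
  have bound : ∀ s, 0 ≤ s → s ≤ T → gronwallBound d (K + 1) (0 + e) (s - 0) ≤
      (d + e) * exp ((K + 1) * T) := by
    intro s hs hsT
    have hK1 : (0:ℝ) < K + 1 := by positivity
    rw [gronwallBound_of_K_ne_0 hK1.ne']
    simp only [zero_add, sub_zero]
    have h1 : exp ((K + 1) * s) ≤ exp ((K + 1) * T) := by gcongr
    have h2 : 1 ≤ exp ((K + 1) * s) := one_le_exp (by positivity)
    have h3 : e / (K + 1) ≤ e := div_le_self he (by linarith [K.coe_nonneg])
    have h4 : e / (K + 1) * (exp ((K + 1) * s) - 1) ≤ e * exp ((K + 1) * T) :=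
      mul_le_mul h3 (by linarith) (by linarith) he
    nlinarith [mul_le_mul_of_nonneg_left h1 hd]
  have hF' : ∀ t, LipschitzWith (K + 1) (F t) := fun t => (hF t).weaken (by simp)
  have habs : ∀ s ∈ Icc 0 T, |s| ≤ T := fun s hs => by rw [abs_of_nonneg hs.1]; exact hs.2
  have habs' : ∀ s ∈ Icc 0 T, |-s| ≤ T := fun s hs => by rw [abs_neg]; exact habs s hs
  rcases le_total 0 t with h | h
  · rw [abs_of_nonneg h] at ht
    have := dist_le_of_approx_trajectories_ODE (v := F) (K := K + 1) (a := 0) (b := T)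
      (f := y) (g := z) (f' := fun s => F s (y s)) (g' := G) (εf := 0) (εg := e) (δ := d)
      hF' (fun s hs => (hy s (habs s hs)).continuousAt.continuousWithinAt)
      (fun s hs => (hy s (habs s ⟨hs.1, hs.2.le⟩)).hasDerivWithinAt) (fun s _ => by simp)
      (fun s hs => (hz s (habs s hs)).continuousAt.continuousWithinAt)
      (fun s hs => (hz s (habs s ⟨hs.1, hs.2.le⟩)).hasDerivWithinAt)
      (fun s hs => hFG _ (habs s ⟨hs.1, hs.2.le⟩)) h0 t ⟨h, ht⟩
    exact this.trans (by simpa using bound t h ht)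
  · rw [abs_of_nonpos h] at ht
    have hz' : ∀ s ∈ Icc 0 T, HasDerivAt (fun s => z (-s)) (-(G (-s))) s := fun s hs =>
      hasDerivAt_comp_neg (hz (-s) (habs' s hs))
    have hy' : ∀ s ∈ Icc 0 T, HasDerivAt (fun s => y (-s)) (-(F (-s) (y (-s)))) s := fun s hs =>
      hasDerivAt_comp_neg (hy (-s) (habs' s hs))
    have := dist_le_of_approx_trajectories_ODE (v := fun s x => -F (-s) x) (K := K + 1) (a := 0)
      (b := T) (f := fun s => y (-s)) (g := fun s => z (-s)) (f' := fun s => -F (-s) (y (-s)))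
      (g' := fun s => -G (-s)) (εf := 0) (εg := e) (δ := d)
      (fun s => (hF' (-s)).neg) (fun s hs => (hy' s hs).continuousAt.continuousWithinAt)
      (fun s hs => (hy' s ⟨hs.1, hs.2.le⟩).hasDerivWithinAt) (fun s _ => by simp)
      (fun s hs => (hz' s hs).continuousAt.continuousWithinAt)
      (fun s hs => (hz' s ⟨hs.1, hs.2.le⟩).hasDerivWithinAt)
      (fun s hs => by rw [dist_neg_neg]; exact hFG _ (habs' s ⟨hs.1, hs.2.le⟩)) (by simpa using h0)
      (-t) ⟨by linarith, ht⟩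
    simp only [neg_neg] at this
    exact this.trans (by simpa using bound (-t) (by linarith) ht)

theorem solution_unique {F : ℝ → E → E} {K : NNReal} (hF : ∀ t, LipschitzWith K (F t))
    {y z : ℝ → E} (hy : ∀ t, HasDerivAt y (F t (y t)) t) (hz : ∀ t, HasDerivAt z (F t (z t)) t)
    (h0 : y 0 = z 0) (t : ℝ) : y t = z t := by
  have := dist_solution_le hF (G := fun t => F t (z t)) (e := 0) (d := 0) (T := |t|)
    (fun _ _ => by simp) (fun s _ => hy s) (fun s _ => hz s) (by simp [h0]) le_rfl
  rw [add_zero, zero_mul] at this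
  exact dist_le_zero.1 this

end ODE

/-! ### Generalized eigenvectors -/

section GenEigen

variable {V : Type*} [AddCommGroup V] [Module ℂ V]

theorem maxGenEigenspace_induction {M : V →ₗ[ℂ] V} {ν : ℂ} {P : V → Prop} (h0 : P 0)
    (hs : ∀ v ∈ maxGenEigenspace M ν, P (M v - ν • v) → P v) :
    ∀ v ∈ maxGenEigenspace M ν, P v := by
  have key : ∀ k v, ((M - ν • (1 : Module.End ℂ V)) ^ k) v = 0 → P v := by
    intro k
    induction k with
    | zero => intro v hv; simp at hv; rwa [hv]
    | succ k ih =>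
      intro v hv
      refine hs v ((mem_maxGenEigenspace _ _ _).2 ⟨_, hv⟩) (ih _ ?_)
      rw [pow_succ, Module.End.mul_apply] at hv
      simpa using hv
  exact fun v hv => ((mem_maxGenEigenspace _ _ _).1 hv).elim fun k hk => key k v hk

theorem map_sub_smul_mem_maxGenEigenspace {M : V →ₗ[ℂ] V} {ν : ℂ} {v : V}
    (hv : v ∈ maxGenEigenspace M ν) :
    M v - ν • v ∈ maxGenEigenspace M ν := by
  obtain ⟨k, hk⟩ := (mem_maxGenEigenspace _ _ _).1 hv
  refine (mem_maxGenEigenspace _ _ _).2 ⟨k, ?_⟩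
  have : ((M - ν • (1 : Module.End ℂ V)) ^ k) ((M - ν • (1 : Module.End ℂ V)) v) = 0 := by
    rw [← Module.End.mul_apply, ← pow_succ, pow_succ', Module.End.mul_apply, hk, map_zero]
  simpa using this

theorem eq_zero_of_mem_maxGenEigenspace {M : V →ₗ[ℂ] V} {ν : ℂ}
    (h : ∀ v, M v = ν • v → v = 0) : ∀ v ∈ maxGenEigenspace M ν, v = 0 :=
  maxGenEigenspace_induction rfl fun v _ hv => h v (sub_eq_zero.1 hv)

theorem eq_zero_or_exists_eigenvector {M : V →ₗ[ℂ] V} {ν : ℂ} {v : V}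
    (hv : v ∈ maxGenEigenspace M ν) : v = 0 ∨ ∃ x, M x = ν • x ∧ x ≠ 0 := by
  by_cases h : ∀ v, M v = ν • v → v = 0
  · exact Or.inl (eq_zero_of_mem_maxGenEigenspace h v hv)
  · push Not at h
    exact Or.inr h

theorem genEigenvector_induction [FiniteDimensional ℂ V] (M : V →ₗ[ℂ] V) {p : V → Prop} (h0 : p 0)
    (add : ∀ v w, p v → p w → p (v + w))
    (h : ∀ ν x, M x = ν • x → x ≠ 0 → ∀ v ∈ maxGenEigenspace M ν, p v) (v : V) : p v :=
  Submodule.iSup_induction (maxGenEigenspace M) (motive := p)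
    (by rw [Module.End.iSup_maxGenEigenspace_eq_top]; trivial) (fun ν w hw => by
      rcases eq_zero_or_exists_eigenvector hw with rfl | ⟨x, hx, hx0⟩
      · exact h0
      · exact h ν x hx hx0 w hw) h0 add

end GenEigen

/-! ### Bounded solutions of hyperbolic linear systems -/

section BoundedSolution

open MeasureTheory

local notation "BCF" => BoundedContinuousFunction ℝ

theorem exists_bounded_solve_neg {μ : ℂ} (hμ : μ.re < 0) :
    ∃ T : BCF ℂ →L[ℂ] BCF ℂ, ∀ g x, HasDerivAt (T g) (μ * T g x + g x) x := by
  have hμ' : 0 < (-μ).re := by simpa using hμ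
  have hint : ∀ (g : BCF ℂ) x, IntegrableOn (fun y : ℝ => Complex.exp (-μ * y) * g y) (Iic x) := by
    intro g x
    exact Integrable.mul_bdd (c := ‖g‖) (integrableOn_exp_mul_complex_Iic hμ' x)
      g.continuous.aestronglyMeasurable (Eventually.of_forall g.norm_coe_le_norm)
  let F : BCF ℂ → ℝ → ℂ := fun g x =>
    Complex.exp (μ * x) * ∫ y : ℝ in Iic x, Complex.exp (-μ * y) * g y
  have hder : ∀ g x, HasDerivAt (F g) (μ * F g x + g x) x := by
    intro g x
    have hc : Continuous fun y : ℝ => Complex.exp (-μ * y) * g y := by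
      have := g.continuous
      fun_prop
    have h1 : HasDerivAt (fun x => ∫ y : ℝ in Iic x, Complex.exp (-μ * y) * g y)
        (Complex.exp (-μ * x) * g x) x := by
      have e : (fun x => ∫ y : ℝ in Iic x, Complex.exp (-μ * y) * g y) = fun x =>
          (∫ y : ℝ in Iic (0:ℝ), Complex.exp (-μ * y) * g y) +
            ∫ y : ℝ in (0:ℝ)..x, Complex.exp (-μ * y) * g y := by
        funext x
        rw [← intervalIntegral.integral_Iic_sub_Iic (hint g 0) (hint g x)]
        ring
      rw [e]
      exact (intervalIntegral.integral_hasDerivAt_right (hc.intervalIntegrable _ _)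
        (hc.stronglyMeasurableAtFilter _ _) hc.continuousAt).const_add _
    have h2 : HasDerivAt (fun x : ℝ => Complex.exp (μ * x)) (Complex.exp (μ * x) * μ) x := by
      have := ((Complex.ofRealCLM.hasDerivAt (x := x)).const_mul μ).cexp
      simpa using this
    refine (h2.mul h1).congr_deriv ?_
    have h4 : Complex.exp (μ * x) * Complex.exp (-μ * x) = 1 := by
      rw [← Complex.exp_add]; simp
    rw [← mul_assoc, h4, one_mul]
    simp only [F]
    ring
  have hbd : ∀ g x, ‖F g x‖ ≤ (-μ.re)⁻¹ * ‖g‖ := by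
    intro g x
    have h1 : ‖∫ y : ℝ in Iic x, Complex.exp (-μ * y) * g y‖ ≤
        ∫ y : ℝ in Iic x, exp (-μ.re * y) * ‖g‖ := by
      refine norm_integral_le_of_norm_le ?_ ?_
      · exact (integrableOn_exp_mul_Iic (a := -μ.re) (by linarith) x).mul_const _
      · refine Eventually.of_forall fun y => ?_
        rw [norm_mul, Complex.norm_exp]
        simp only [mul_re, neg_re, ofReal_re, ofReal_im, mul_zero, sub_zero]
        gcongr
        exact g.norm_coe_le_norm y
    rw [integral_mul_const, integral_exp_mul_Iic (a := -μ.re) (by linarith)] at h1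
    simp only [F, norm_mul, Complex.norm_exp]
    simp only [mul_re, ofReal_re, ofReal_im, mul_zero, sub_zero]
    have h4 : exp (μ.re * x) * exp (-μ.re * x) = 1 := by
      rw [← exp_add]; simp
    calc _ ≤ exp (μ.re * x) * (exp (-μ.re * x) / -μ.re * ‖g‖) := by gcongr
      _ = (exp (μ.re * x) * exp (-μ.re * x)) * ((-μ.re)⁻¹ * ‖g‖) := by
          rw [div_eq_mul_inv]; ring
      _ = _ := by rw [h4, one_mul]
  have hcont : ∀ g, Continuous (F g) := fun g =>
    continuous_iff_continuousAt.2 fun x => (hder g x).continuousAt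
  let T0 : BCF ℂ →ₗ[ℂ] BCF ℂ :=
    { toFun := fun g => ofNormedAddCommGroup (F g) (hcont g) _ (hbd g)
      map_add' := fun g h => by
        ext x
        simp only [coe_ofNormedAddCommGroup, BoundedContinuousFunction.coe_add, Pi.add_apply, F]
        rw [← mul_add, ← integral_add (hint g x) (hint h x)]
        simp only [mul_add]
      map_smul' := fun c g => by
        ext x
        simp only [coe_ofNormedAddCommGroup,
          BoundedContinuousFunction.coe_smul, smul_eq_mul, RingHom.id_apply, F]
        have : ∀ y : ℝ, Complex.exp (-μ * y) * (c * g y) = c * (Complex.exp (-μ * y) * g y) :=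
          fun y => mul_left_comm _ _ _
        simp only [this, integral_const_mul]
        ring }
  refine ⟨T0.mkContinuous (-μ.re)⁻¹ fun g => ?_, fun g x => hder g x⟩
  refine (norm_le ?_).2 (hbd g)
  have : 0 < -μ.re := by linarith
  positivity

theorem exists_bounded_solve {μ : ℂ} (hμ : μ.re ≠ 0) :
    ∃ T : BCF ℂ →L[ℂ] BCF ℂ, ∀ g x, HasDerivAt (T g) (μ * T g x + g x) x := by
  rcases lt_or_gt_of_ne hμ with h | h
  · exact exists_bounded_solve_neg h
  · obtain ⟨T, hT⟩ := exists_bounded_solve_neg (μ := -μ) (by simpa using h)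
    let R : BCF ℂ →L[ℂ] BCF ℂ := LinearMap.mkContinuous
      { toFun := fun g => g.compContinuous ⟨fun x => -x, continuous_neg⟩
        map_add' := fun _ _ => rfl
        map_smul' := fun _ _ => rfl } 1 fun g => by
          rw [one_mul]
          exact (norm_le (norm_nonneg _)).2 fun x => g.norm_coe_le_norm _
    refine ⟨-(R.comp (T.comp R)), fun g x => ?_⟩
    have h1 := (hasDerivAt_comp_neg (hT (R g) (-x))).neg
    have e : R g (-x) = g x := congrArg g (neg_neg x)
    refine h1.congr_deriv ?_
    rw [e]
    change _ = μ * -(T (R g) (-x)) + g x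
    ring

variable {V : Type*} [NormedAddCommGroup V] [NormedSpace ℂ V]

/-- A constant-coefficient system without purely imaginary eigenvalues has a bounded solution
operator on bounded continuous forcing terms. -/
theorem exists_bounded_solve_of_hyperbolic [FiniteDimensional ℂ V] (H : CL(V))
    (hH : ∀ ν : ℂ, ν.re = 0 → ∀ v, H v = ν • v → v = 0) :
    ∃ T : BCF V →L[ℂ] BCF V, ∀ g x, HasDerivAt (T g) (H (T g x) + g x) x := by
  let emb : V → (BCF ℂ →L[ℂ] BCF V) := fun w =>
    (ContinuousLinearMap.toSpanSingleton ℂ w).compLeftContinuousBounded ℝ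
  have hemb : ∀ w g x, emb w g x = g x • w := fun w g x => rfl
  have hmem : ∀ w, ∃ T : BCF ℂ →L[ℂ] BCF V, ∀ g x, HasDerivAt (T g) (H (T g x) + g x • w) x := by
    have h0 : ∃ T : BCF ℂ →L[ℂ] BCF V, ∀ g x, HasDerivAt (T g) (H (T g x) + g x • (0 : V)) x :=
      ⟨0, fun g x => by simp⟩
    refine genEigenvector_induction H.toLinearMap h0 ?_ fun ν x hx hx0 => ?_
    · rintro a b ⟨S, hS⟩ ⟨T, hT⟩
      refine ⟨S + T, fun g x => ((hS g x).add (hT g x)).congr_deriv ?_⟩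
      simp only [add_apply, BoundedContinuousFunction.coe_add, Pi.add_apply, map_add, smul_add]
      abel
    · obtain ⟨τ, hτ⟩ := exists_bounded_solve fun hν => hx0 (hH ν hν x hx)
      refine maxGenEigenspace_induction h0 ?_
      rintro v - ⟨S, hS⟩
      refine ⟨(emb v).comp τ + S.comp τ, fun g x =>
        (((hτ g x).smul_const v).add (hS (τ g) x)).congr_deriv ?_⟩
      simp only [add_apply, BoundedContinuousFunction.coe_add, Pi.add_apply,
        map_add, ContinuousLinearMap.comp_apply, hemb, map_smul, ContinuousLinearMap.coe_coe]
      module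
  choose S hS using hmem
  let b := Module.finBasis ℂ V
  let co : Fin (Module.finrank ℂ V) → (BCF V →L[ℂ] BCF ℂ) := fun i =>
    (LinearMap.toContinuousLinearMap (b.coord i)).compLeftContinuousBounded ℝ
  have hco : ∀ i g x, co i g x = b.repr (g x) i := fun i g x => rfl
  refine ⟨∑ i, (S (b i)).comp (co i), fun g x => ?_⟩
  have h1 := HasDerivAt.fun_sum (u := Finset.univ) fun i _ => hS (b i) (co i g) x
  have e : ∀ y, (∑ i, (S (b i)).comp (co i)) g y = ∑ i, S (b i) (co i g) y := fun y => by
    simp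
  rw [show ((∑ i, (S (b i)).comp (co i)) g : ℝ → V) = fun y => ∑ i, S (b i) (co i g) y from
    funext e]
  refine h1.congr_deriv ?_
  rw [Finset.sum_add_distrib, map_sum]
  congr 1
  simp only [hco]
  exact b.sum_repr (g x)

theorem exists_lyapunov_perron [CompleteSpace V] (T : BCF V →L[ℂ] BCF V)
    {N : ℝ → V → V} {k : NNReal} {B : ℝ} (hN : Continuous (Function.uncurry N))
    (hk : ∀ x, LipschitzWith k (N x)) (hB : ∀ x, ‖N x 0‖ ≤ B) (hTk : ‖T‖ * k ≤ 1 / 2)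
    (h : BCF V) :
    ∃ p g : BCF V, (∀ x, g x = N x (p x)) ∧ p = h + T g := by
  let S : BCF V → BCF V := fun p => ofNormedAddCommGroup
    (fun x => N x (p x)) (hN.comp (continuous_id.prodMk p.continuous)) (B + k * ‖p‖) fun x => by
      have h1 := (hk x).dist_le_mul (p x) 0
      rw [dist_eq_norm, dist_zero_right] at h1
      have h2 := norm_le_norm_add_norm_sub' (N x (p x)) (N x 0)
      have h3 := mul_le_mul_of_nonneg_left (p.norm_coe_le_norm x) k.coe_nonneg
      linarith [hB x]
  have hSd : ∀ p q, dist (S p) (S q) ≤ k * dist p q := fun p q => by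
    refine (BoundedContinuousFunction.dist_le (by positivity)).2 fun x => ?_
    refine ((hk x).dist_le_mul (p x) (q x)).trans ?_
    gcongr
    exact BoundedContinuousFunction.dist_coe_le_dist x
  have hG : ContractingWith (1 / 2) fun p => h + T (S p) := by
    refine ⟨by norm_num, LipschitzWith.of_dist_le_mul fun p q => ?_⟩
    rw [dist_add_left, dist_eq_norm, ← map_sub]
    refine (T.le_opNorm _).trans ?_
    rw [← dist_eq_norm]
    calc ‖T‖ * dist (S p) (S q) ≤ ‖T‖ * (k * dist p q) := by gcongr; exact hSd p q
      _ = (‖T‖ * k) * dist p q := by ring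
      _ ≤ (1 / 2 : NNReal) * dist p q := by
        push_cast
        gcongr
  exact ⟨_, S _, fun _ => rfl, hG.fixedPoint_isFixedPt.symm⟩

end BoundedSolution

/-! ### Conjugation to constant coefficients on a half-line -/

section Conjugation

theorem tendsto_const_mul_exp_neg (k : ℝ) {c : ℝ} (hc : 0 < c) :
    Tendsto (fun x => k * exp (-c * x)) atTop (𝓝 0) := by
  have h1 : Tendsto (fun x : ℝ => -c * x) atTop atBot :=
    tendsto_id.const_mul_atTop_of_neg (by linarith)
  simpa using (tendsto_exp_atBot.comp h1).const_mul k

theorem exists_pos_lt {f : ℝ → ℝ} {η : ℝ} (hf : Continuous f) (h : f 0 < η) :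
    ∃ d, 0 < d ∧ f d < η := by
  obtain ⟨d, h1, h2⟩ := (((hf.tendsto 0).eventually (eventually_lt_nhds h)).filter_mono
    (nhdsWithin_le_nhds (s := Ioi 0))).and self_mem_nhdsWithin |>.exists
  exact ⟨d, h2, h1⟩

local notation "BCF" => BoundedContinuousFunction ℝ

variable {𝓐 : Type*} [NormedRing 𝓐] [NormedAlgebra ℂ 𝓐]

/-- `P` conjugates `W' = A(x) W` to `Z' = L Z` and approaches the identity exponentially fast at
`+∞`. -/
structure IsExpConj (A : ℝ → 𝓐) (L : 𝓐) (P : ℝ → 𝓐) : Prop where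
  ode : ∀ x, HasDerivAt P (A x * P x - P x * L) x
  decay : ∃ C θ : ℝ, 0 < θ ∧ ∀ x, 0 ≤ x → ‖P x - 1‖ ≤ C * exp (-θ * x)

/-- The commutator with a fixed element. -/
def adCLM (L : 𝓐) : 𝓐 →L[ℂ] 𝓐 :=
  ContinuousLinearMap.mul ℂ 𝓐 L - (ContinuousLinearMap.mul ℂ 𝓐).flip L

theorem adCLM_apply (L X : 𝓐) : adCLM L X = L * X - X * L := rfl

theorem exists_weight [FiniteDimensional ℂ 𝓐] (L : 𝓐) {θ : ℝ} (hθ : 0 < θ) :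
    ∃ ρ : ℝ, 0 < ρ ∧ ρ < θ ∧ ∃ T : BCF 𝓐 →L[ℂ] BCF 𝓐,
        ∀ g x, HasDerivAt (T g) (adCLM L (T g x) + (ρ : ℂ) • T g x + g x) x := by
  let f : Module.End ℂ 𝓐 := (adCLM L : 𝓐 →ₗ[ℂ] 𝓐)
  have hfin : (((fun ν : ℂ => -ν.re) '' {ν | f.HasEigenvalue ν})).Finite :=
    (Module.End.finite_hasEigenvalue f).image _
  obtain ⟨ρ, hρ, hρ'⟩ := (Ioo_infinite hθ).exists_notMem_finite hfin
  refine ⟨ρ, hρ.1, hρ.2, ?_⟩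
  obtain ⟨T, hT⟩ := exists_bounded_solve_of_hyperbolic
    (adCLM L + (ρ : ℂ) • ContinuousLinearMap.id ℂ 𝓐) (fun ν hν v hv => by
      by_contra hv0
      refine hρ' ⟨ν - ρ, ?_, by simp [hν]⟩
      refine Module.End.hasEigenvalue_of_hasEigenvector (x := v) ⟨?_, hv0⟩
      rw [Module.End.mem_eigenspace_iff]
      have : adCLM L v + (ρ : ℂ) • v = ν • v := hv
      rw [sub_smul, ← this]
      simp [f])
  exact ⟨T, fun g x => hT g x⟩

theorem norm_mul_sub_mul_le (a b X : 𝓐) : ‖a * X - X * b‖ ≤ (‖a‖ + ‖b‖) * ‖X‖ := by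
  have h1 := norm_mul_le a X
  have h2 := norm_mul_le X b
  have h3 := norm_sub_le (a * X) (X * b)
  linarith

theorem norm_adCLM_sub_apply_le (L M X : 𝓐) : ‖adCLM L X - adCLM M X‖ ≤ 2 * ‖L - M‖ * ‖X‖ := by
  have : adCLM L X - adCLM M X = (L - M) * X - X * (L - M) := by
    simp only [adCLM_apply]; noncomm_ring
  rw [this, two_mul]
  exact norm_mul_sub_mul_le _ _ _

theorem lipschitz_conj_field {A : ℝ → 𝓐} {L : 𝓐} {K : NNReal} (hK : ∀ t, ‖A t‖ + ‖L‖ ≤ K) (t : ℝ) :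
    LipschitzWith K fun X => A t * X - X * L := by
  refine LipschitzWith.of_dist_le_mul fun X Y => ?_
  rw [dist_eq_norm, dist_eq_norm]
  have : A t * X - X * L - (A t * Y - Y * L) = A t * (X - Y) - (X - Y) * L := by noncomm_ring
  rw [this]
  exact (norm_mul_sub_mul_le _ _ _).trans (mul_le_mul_of_nonneg_right (hK t) (norm_nonneg _))

theorem exists_conj_of_tail [CompleteSpace 𝓐] {A : ℝ → 𝓐} {L : 𝓐} {K : ℝ} (hA : Continuous A)
    (hb : ∀ x, ‖A x‖ ≤ K) {M C ρ : ℝ} (hρ : 0 < ρ) {q : ℝ → 𝓐}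
    (hq : ∀ x, M ≤ x → HasDerivAt q (A x * q x - q x * L) x)
    (hdec : ∀ x, M ≤ x → ‖q x - 1‖ ≤ C * exp (-ρ * x)) :
    ∃ P, IsExpConj A L P ∧ P M = q M := by
  set K' : NNReal := (K + ‖L‖).toNNReal
  have hK' : ∀ t, ‖A t‖ + ‖L‖ ≤ K' := fun t => by
    exact (by linarith [hb t] : ‖A t‖ + ‖L‖ ≤ K + ‖L‖).trans (Real.le_coe_toNNReal _)
  obtain ⟨y, hy0, hy⟩ := exists_global_solution (f := fun t X => A (M + t) * X - X * L) (K := K')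
    (B := 0) (by fun_prop) (lipschitz_conj_field (A := fun t => A (M + t)) fun t => hK' _)
    (fun t => by simp) (q M)
  have hP : ∀ x, HasDerivAt (fun x => y (x - M)) (A x * y (x - M) - y (x - M) * L) x := fun x => by
    have := (hy (x - M)).comp_sub_const x M
    simpa using this
  have heq : ∀ x, M ≤ x → y (x - M) = q x := fun x hx => by
    have := ODE_solution_unique (v := fun t X => A t * X - X * L) (K := K') (a := M) (b := x)
      (f := fun x => y (x - M)) (g := q) (lipschitz_conj_field hK')
      (fun t _ => (hP t).continuousAt.continuousWithinAt) (fun t _ => (hP t).hasDerivWithinAt)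
      (fun t ht => (hq t ht.1).continuousAt.continuousWithinAt)
      (fun t ht => (hq t ht.1).hasDerivWithinAt) (by simp [hy0])
    exact this ⟨hx, le_rfl⟩
  refine ⟨fun x => y (x - M), ⟨hP, ?_⟩, heq M le_rfl⟩
  obtain ⟨D, hD⟩ := (isCompact_Icc (a := (0:ℝ)) (b := M)).exists_bound_of_continuousOn
    (f := fun x => y (x - M) - 1)
    (fun t _ => ((hP t).continuousAt.sub continuousAt_const).continuousWithinAt)
  refine ⟨max C (D * exp (ρ * M)), ρ, hρ, fun x hx => ?_⟩
  rcases le_total M x with h | h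
  · rw [heq x h]
    refine (hdec x h).trans ?_
    gcongr
    exact le_max_left _ _
  · have h1 := hD x ⟨hx, h⟩
    have hD0 : 0 ≤ D := (norm_nonneg _).trans h1
    have h2 : 1 ≤ exp (ρ * M) * exp (-ρ * x) := by
      rw [← exp_add]
      exact one_le_exp (by nlinarith)
    calc ‖y (x - M) - 1‖ ≤ D := h1
      _ ≤ D * (exp (ρ * M) * exp (-ρ * x)) := le_mul_of_one_le_right hD0 h2
      _ = D * exp (ρ * M) * exp (-ρ * x) := by ring
      _ ≤ _ := by gcongr; exact le_max_right _ _

/-- The equation for the weighted deviation of a conjugator from the identity. -/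
def IsTail (T : BCF 𝓐 →L[ℂ] BCF 𝓐) (L₀ : 𝓐) (ρ M : ℝ) (A : ℝ → 𝓐) (L : 𝓐) (p g : BCF 𝓐) : Prop :=
  (∀ x, g x = (adCLM L (p x) - adCLM L₀ (p x)) + (A (max x M) - L) * p x +
    ((exp (ρ * max x M) : ℝ) : ℂ) • (A (max x M) - L)) ∧ p = T g

theorem exists_tail [CompleteSpace 𝓐] (T : BCF 𝓐 →L[ℂ] BCF 𝓐) {L₀ L : 𝓐}
    {ρ M C θ : ℝ} {A : ℝ → 𝓐} (hM : 0 ≤ M) (hρθ : ρ < θ) (hθ : 0 < θ) (hA : Continuous A)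
    (hd : ∀ x, 0 ≤ x → ‖A x - L‖ ≤ C * exp (-θ * x))
    (hT : ‖T‖ * (2 * ‖L - L₀‖ + C * exp (-θ * M)) ≤ 1 / 2) :
    ∃ p g, IsTail T L₀ ρ M A L p g := by
  have hC : 0 ≤ C := by simpa using (norm_nonneg _).trans (hd 0 le_rfl)
  have hE : ∀ x, ‖A (max x M) - L‖ ≤ C * exp (-θ * M) := fun x => by
    refine (hd _ (hM.trans (le_max_right _ _))).trans ?_
    gcongr C * exp ?_
    nlinarith [le_max_right x M]
  have hk0 : 0 ≤ 2 * ‖L - L₀‖ + C * exp (-θ * M) := by positivity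
  obtain ⟨p, g, hg, hp⟩ := exists_lyapunov_perron T
    (N := fun x X => (adCLM L X - adCLM L₀ X) + (A (max x M) - L) * X +
      ((exp (ρ * max x M) : ℝ) : ℂ) • (A (max x M) - L))
    (k := ⟨_, hk0⟩) (B := C) (by
      have h1 : Continuous fun q : ℝ × 𝓐 => adCLM L q.2 := (adCLM L).continuous.comp continuous_snd
      have h2 : Continuous fun q : ℝ × 𝓐 => adCLM L₀ q.2 :=
        (adCLM L₀).continuous.comp continuous_snd
      simp only [Function.uncurry_def]
      fun_prop) (fun x => by
      refine LipschitzWith.of_dist_le_mul fun X Y => ?_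
      rw [dist_eq_norm, dist_eq_norm]
      have e : (adCLM L X - adCLM L₀ X) + (A (max x M) - L) * X +
            ((exp (ρ * max x M) : ℝ) : ℂ) • (A (max x M) - L) -
          ((adCLM L Y - adCLM L₀ Y) + (A (max x M) - L) * Y +
            ((exp (ρ * max x M) : ℝ) : ℂ) • (A (max x M) - L)) =
          (adCLM L (X - Y) - adCLM L₀ (X - Y)) + (A (max x M) - L) * (X - Y) := by
        rw [map_sub, map_sub]; noncomm_ring
      rw [e]
      refine (norm_add_le _ _).trans ?_
      have h1 := norm_adCLM_sub_apply_le L L₀ (X - Y)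
      have h2 := (norm_mul_le (A (max x M) - L) (X - Y)).trans
        (mul_le_mul_of_nonneg_right (hE x) (norm_nonneg _))
      change _ ≤ (2 * ‖L - L₀‖ + C * exp (-θ * M)) * ‖X - Y‖
      linarith) (fun x => by
      have h0 : 0 ≤ max x M := hM.trans (le_max_right _ _)
      simp only [map_zero, sub_zero, mul_zero, zero_add, norm_smul, norm_real, norm_eq_abs, abs_exp]
      calc exp (ρ * max x M) * ‖A (max x M) - L‖
          ≤ exp (ρ * max x M) * (C * exp (-θ * max x M)) := by gcongr; exact hd _ h0
        _ = C * exp ((ρ - θ) * max x M) := by rw [mul_left_comm, ← exp_add]; ring_nf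
        _ ≤ C := by
          refine mul_le_of_le_one_right hC (exp_le_one_iff.2 ?_)
          nlinarith) hT 0
  exact ⟨p, g, hg, hp.trans (zero_add _)⟩

theorem IsTail.exists_conj [CompleteSpace 𝓐] {T : BCF 𝓐 →L[ℂ] BCF 𝓐} {L₀ L : 𝓐}
    {ρ M K : ℝ} {A : ℝ → 𝓐} {p g : BCF 𝓐}
    (hp : IsTail T L₀ ρ M A L p g)
    (hT : ∀ g x, HasDerivAt (T g) (adCLM L₀ (T g x) + (ρ : ℂ) • T g x + g x) x)
    (hρ : 0 < ρ) (hA : Continuous A) (hb : ∀ x, ‖A x‖ ≤ K) :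
    ∃ P, IsExpConj A L P ∧ P M = 1 + ((exp (-ρ * M) : ℝ) : ℂ) • p M := by
  refine exists_conj_of_tail (q := fun x => 1 + ((exp (-ρ * x) : ℝ) : ℂ) • p x) (C := ‖p‖)
    hA hb hρ (fun x hx => ?_) fun x hx => ?_
  · have h1 := hT g x
    rw [← hp.2, hp.1 x, max_eq_left hx] at h1
    have h2 : HasDerivAt (fun x : ℝ => ((exp (-ρ * x) : ℝ) : ℂ))
        ((exp (-ρ * x) * -ρ : ℝ) : ℂ) x := by
      have h := ((hasDerivAt_id x).const_mul (-ρ)).exp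
      simp only [id, mul_one] at h
      exact h.ofReal_comp
    refine ((h2.smul h1).const_add 1).congr_deriv ?_
    have h3 : ((exp (-ρ * x) : ℝ) : ℂ) * ((exp (ρ * x) : ℝ) : ℂ) = 1 := by
      rw [← Complex.ofReal_mul, ← exp_add]; simp
    simp only [smul_add, smul_smul, h3, one_smul, adCLM_apply]
    rw [Complex.ofReal_mul]
    simp only [mul_add, add_mul, mul_one, one_mul, mul_smul_comm, smul_mul_assoc, sub_mul, smul_sub,
      Complex.ofReal_neg, mul_neg, neg_smul]
    abel
  · rw [add_sub_cancel_left, norm_smul, norm_real, norm_eq_abs, abs_exp, mul_comm]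
    gcongr
    exact p.norm_coe_le_norm x

theorem IsTail.norm_sub_le {T : BCF 𝓐 →L[ℂ] BCF 𝓐} {L₀ L : 𝓐}
    {ρ M D k : ℝ} {A A₀ : ℝ → 𝓐} {p g p₀ g₀ : BCF 𝓐}
    (hp : IsTail T L₀ ρ M A L p g) (hp₀ : IsTail T L₀ ρ M A₀ L₀ p₀ g₀)
    (hM : 0 ≤ M) (hρ : 0 < ρ) (hk : ∀ x, 2 * ‖L - L₀‖ + ‖A (max x M) - L‖ ≤ k)
    (hT : ‖T‖ * k ≤ 1 / 2)
    (hD : ∀ x, 0 ≤ x → exp (ρ * x) * ‖(A x - L) - (A₀ x - L₀)‖ ≤ D) :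
    ‖p - p₀‖ ≤ 2 * ‖T‖ * (2 * ‖L - L₀‖ * ‖p₀‖ + D * (‖p₀‖ + 1)) := by
  have hD0 : 0 ≤ D := le_trans (by positivity) (hD 0 le_rfl)
  have hk0 : 0 ≤ k := le_trans (by positivity) (hk 0)
  have hg : ‖g - g₀‖ ≤ k * ‖p - p₀‖ + (2 * ‖L - L₀‖ * ‖p₀‖ + D * (‖p₀‖ + 1)) := by
    refine (norm_le (by positivity)).2 fun x => ?_
    set y := max x M
    have hy : 0 ≤ y := hM.trans (le_max_right _ _)
    have e : (g - g₀) x = (adCLM L (p x - p₀ x) - adCLM L₀ (p x - p₀ x)) +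
        (A y - L) * (p x - p₀ x) + (adCLM L (p₀ x) - adCLM L₀ (p₀ x)) +
        ((A y - L) - (A₀ y - L₀)) * p₀ x +
        ((exp (ρ * y) : ℝ) : ℂ) • ((A y - L) - (A₀ y - L₀)) := by
      rw [BoundedContinuousFunction.coe_sub, Pi.sub_apply, hp.1 x, hp₀.1 x]
      simp only [map_sub, mul_sub, sub_mul, smul_sub, sub_self, zero_add]
      simp only [y]
      abel
    have h1 := norm_adCLM_sub_apply_le L L₀ (p x - p₀ x)
    have h2 := norm_mul_le (A y - L) (p x - p₀ x)
    have h3 := norm_adCLM_sub_apply_le L L₀ (p₀ x)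
    have h4 := norm_mul_le ((A y - L) - (A₀ y - L₀)) (p₀ x)
    have h5 := hD y hy
    have h6 : ‖(A y - L) - (A₀ y - L₀)‖ ≤ D :=
      (le_mul_of_one_le_left (norm_nonneg _) (one_le_exp (by positivity))).trans h5
    have h7 : ‖((exp (ρ * y) : ℝ) : ℂ) • ((A y - L) - (A₀ y - L₀))‖ ≤ D := by
      rwa [norm_smul, norm_real, norm_eq_abs, abs_exp]
    have h8 : ‖p x - p₀ x‖ ≤ ‖p - p₀‖ := (p - p₀).norm_coe_le_norm x
    have h9 : ‖p₀ x‖ ≤ ‖p₀‖ := p₀.norm_coe_le_norm x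
    rw [e]
    have a1 : ‖(adCLM L (p x - p₀ x) - adCLM L₀ (p x - p₀ x)) + (A y - L) * (p x - p₀ x)‖ ≤
        k * ‖p - p₀‖ := by
      refine (norm_add_le _ _).trans ?_
      calc _ ≤ (2 * ‖L - L₀‖ + ‖A y - L‖) * ‖p x - p₀ x‖ := by linarith
        _ ≤ k * ‖p - p₀‖ := mul_le_mul (hk x) h8 (norm_nonneg _) hk0
    have a2 : ‖adCLM L (p₀ x) - adCLM L₀ (p₀ x)‖ ≤ 2 * ‖L - L₀‖ * ‖p₀‖ := h3.trans (by gcongr)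
    have a3 : ‖((A y - L) - (A₀ y - L₀)) * p₀ x‖ ≤ D * ‖p₀‖ :=
      h4.trans (mul_le_mul h6 h9 (norm_nonneg _) hD0)
    refine (norm_add_le _ _).trans ?_
    have b1 := norm_add_le ((adCLM L (p x - p₀ x) - adCLM L₀ (p x - p₀ x)) +
        (A y - L) * (p x - p₀ x) + (adCLM L (p₀ x) - adCLM L₀ (p₀ x)))
        (((A y - L) - (A₀ y - L₀)) * p₀ x)
    have b2 := norm_add_le ((adCLM L (p x - p₀ x) - adCLM L₀ (p x - p₀ x)) +
        (A y - L) * (p x - p₀ x)) (adCLM L (p₀ x) - adCLM L₀ (p₀ x))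
    linarith
  have h1 : ‖p - p₀‖ ≤ ‖T‖ * ‖g - g₀‖ := by
    rw [hp.2, hp₀.2, ← map_sub]
    exact T.le_opNorm _
  have h2 := mul_le_mul_of_nonneg_left hg (norm_nonneg T)
  have h3 := mul_le_mul_of_nonneg_right hT (norm_nonneg (p - p₀))
  nlinarith

theorem exists_conj_tendsto [FiniteDimensional ℂ 𝓐] {ι : Type*} {l : Filter ι}
    {A : ι → ℝ → 𝓐} {L : ι → 𝓐} {A₀ : ℝ → 𝓐} {L₀ : 𝓐} {C θ : ℝ} {K : ℝ} (hθ : 0 < θ)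
    (hA : ∀ᶠ p in l, Continuous (A p)) (hA₀ : Continuous A₀)
    (hb : ∀ᶠ p in l, ∀ x, ‖A p x‖ ≤ K) (hb₀ : ∀ x, ‖A₀ x‖ ≤ K)
    (hd : ∀ᶠ p in l, ∀ x, 0 ≤ x → ‖A p x - L p‖ ≤ C * exp (-θ * x))
    (hd₀ : ∀ x, 0 ≤ x → ‖A₀ x - L₀‖ ≤ C * exp (-θ * x))
    (hL : Tendsto L l (𝓝 L₀))
    (hloc : ∀ X η : ℝ, 0 < η → ∀ᶠ p in l, ∀ x, |x| ≤ X → ‖A p x - A₀ x‖ ≤ η) :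
    ∃ (P : ι → ℝ → 𝓐) (P₀ : ℝ → 𝓐), (∀ᶠ p in l, IsExpConj (A p) (L p) (P p)) ∧ IsExpConj A₀ L₀ P₀ ∧
      Tendsto (fun p => P p 0) l (𝓝 (P₀ 0)) := by
  have hcomp : CompleteSpace 𝓐 := FiniteDimensional.complete ℂ 𝓐
  have hC : 0 ≤ C := by simpa using (norm_nonneg _).trans (hd₀ 0 le_rfl)
  obtain ⟨ρ, hρ, hρθ, T, hT⟩ := exists_weight L₀ hθ
  obtain ⟨M, hMk, hM⟩ := (((tendsto_const_mul_exp_neg (‖T‖ * C) hθ).eventually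
    (eventually_le_nhds (by norm_num : (0:ℝ) < 1 / 4))).and (eventually_ge_atTop 0)).exists
  rw [mul_assoc] at hMk
  have hLsub : Tendsto (fun p => ‖L p - L₀‖) l (𝓝 0) := tendsto_iff_norm_sub_tendsto_zero.1 hL
  have hsmall : ∀ᶠ p in l, ‖T‖ * (2 * ‖L p - L₀‖ + C * exp (-θ * M)) ≤ 1 / 2 := by
    have h1 := (hLsub.const_mul (‖T‖ * 2)).eventually
      (eventually_le_nhds (by simp : ‖T‖ * 2 * 0 < 1 / 4))
    filter_upwards [h1] with p hp
    linarith
  have hsmall₀ : ‖T‖ * (2 * ‖L₀ - L₀‖ + C * exp (-θ * M)) ≤ 1 / 2 := by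
    rw [sub_self, norm_zero]; linarith
  obtain ⟨p₀, g₀, hp₀⟩ := exists_tail T hM hρθ hθ hA₀ hd₀ hsmall₀
  obtain ⟨P₀, hP₀, hP₀M⟩ := hp₀.exists_conj hT hρ hA₀ hb₀
  have hex : ∀ᶠ i in l, ∃ (p g : BCF 𝓐) (P : ℝ → 𝓐), IsTail T L₀ ρ M (A i) (L i) p g ∧
      IsExpConj (A i) (L i) P ∧ P M = 1 + ((exp (-ρ * M) : ℝ) : ℂ) • p M := by
    filter_upwards [hA, hb, hd, hsmall] with i h1 h2 h3 h4
    obtain ⟨p, g, hp⟩ := exists_tail T hM hρθ hθ h1 h3 h4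
    obtain ⟨P, hP, hPM⟩ := hp.exists_conj hT hρ h1 h2
    exact ⟨p, g, P, hp, hP, hPM⟩
  obtain ⟨s, hs, hex⟩ := hex.exists_mem
  choose! p g P hpgP using hex
  refine ⟨P, P₀, mem_of_superset hs fun i h => (hpgP i h).2.1, hP₀, ?_⟩
  have hD : ∀ η : ℝ, 0 < η → ∀ᶠ i in l, ∀ x, 0 ≤ x →
      exp (ρ * x) * ‖(A i x - L i) - (A₀ x - L₀)‖ ≤ η := by
    intro η hη
    obtain ⟨X, hX⟩ := ((tendsto_const_mul_exp_neg (2 * C) (sub_pos.2 hρθ)).eventually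
      (eventually_le_nhds hη)).exists_forall_of_atTop
    have hη' : 0 < η / (2 * exp (ρ * X)) := by positivity
    filter_upwards [hd, hloc X _ hη', hLsub.eventually (eventually_le_nhds hη')] with i h1 h2 h3 x hx
    rcases le_total x X with hxX | hxX
    · have h4 := h2 x (by rwa [abs_of_nonneg hx])
      have h5 : ‖(A i x - L i) - (A₀ x - L₀)‖ ≤ η / exp (ρ * X) := by
        rw [show (A i x - L i) - (A₀ x - L₀) = (A i x - A₀ x) - (L i - L₀) by abel]
        refine (norm_sub_le _ _).trans ?_
        have : η / exp (ρ * X) = η / (2 * exp (ρ * X)) + η / (2 * exp (ρ * X)) := by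
          field_simp; norm_num
        linarith
      calc _ ≤ exp (ρ * X) * (η / exp (ρ * X)) := by gcongr
        _ = η := by field_simp
    · have h4 := h1 x hx
      have h5 := hd₀ x hx
      have h6 := norm_sub_le (A i x - L i) (A₀ x - L₀)
      calc _ ≤ exp (ρ * x) * (2 * C * exp (-θ * x)) := by gcongr; linarith
        _ = 2 * C * exp (-(θ - ρ) * x) := by rw [mul_left_comm, ← exp_add]; ring_nf
        _ ≤ η := hX x hxX
  have hkx : ∀ᶠ i in l, ∀ x, 2 * ‖L i - L₀‖ + ‖A i (max x M) - L i‖ ≤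
      2 * ‖L i - L₀‖ + C * exp (-θ * M) := by
    filter_upwards [hd] with i h1 x
    gcongr
    refine (h1 _ (hM.trans (le_max_right _ _))).trans ?_
    gcongr C * exp ?_
    nlinarith [le_max_right x M]
  have hpt : ∀ η : ℝ, 0 < η → ∀ᶠ i in l, ‖p i - p₀‖ ≤ η := by
    intro η hη
    obtain ⟨d, hd1, hd0⟩ := exists_pos_lt
      (f := fun d => 2 * ‖T‖ * (2 * d * ‖p₀‖ + d * (‖p₀‖ + 1))) (by fun_prop) (by simpa using hη)
    filter_upwards [hs, hsmall, hkx, hD d hd1, hLsub.eventually (eventually_le_nhds hd1)]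
      with i h1 h2 h3 h4 h5
    refine ((hpgP i h1).1.norm_sub_le hp₀ hM hρ h3 h2 h4).trans (le_trans ?_ hd0.le)
    gcongr
  obtain ⟨R, hR⟩ := (isCompact_Icc (a := (0:ℝ)) (b := 2 * M)).exists_bound_of_continuousOn
    (f := P₀) (fun t _ => (hP₀.ode t).continuousAt.continuousWithinAt)
  have hR0 : 0 ≤ R := (norm_nonneg _).trans (hR 0 ⟨le_rfl, by linarith⟩)
  set K' : NNReal := (K + ‖L₀‖ + 1).toNNReal
  rw [Metric.tendsto_nhds]
  intro η hη
  set b := exp (((K' : ℝ) + 1) * M) with hbdef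
  obtain ⟨d, hd0, hd1⟩ := exists_pos_lt (f := fun d => (d + 2 * d * R) * b) (by fun_prop)
    (by simpa using hη)
  filter_upwards [hs, hpt d hd0, hloc (2 * M) d hd0, hb,
    hLsub.eventually (eventually_le_nhds hd0), hLsub.eventually (eventually_le_nhds one_pos)]
    with i h1 h2 h3 h4 h5 h6
  obtain ⟨-, hconj, hPM⟩ := hpgP i h1
  have hK' : ∀ t, ‖A i t‖ + ‖L i‖ ≤ K' := fun t => by
    have := norm_le_norm_add_norm_sub' (L i) L₀
    exact (by linarith [h4 t] : ‖A i t‖ + ‖L i‖ ≤ K + ‖L₀‖ + 1).trans (Real.le_coe_toNNReal _)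
  have habs : ∀ t : ℝ, |t| ≤ M → M + t ∈ Icc 0 (2 * M) := fun t ht => by
    have := abs_le.1 ht
    exact ⟨by linarith, by linarith⟩
  have := dist_solution_le (F := fun t X => A i (M + t) * X - X * L i)
    (G := fun t => A₀ (M + t) * P₀ (M + t) - P₀ (M + t) * L₀) (K := K') (e := 2 * d * R) (d := d)
    (y := fun t => P i (M + t)) (z := fun t => P₀ (M + t)) (T := M) (t := -M)
    (lipschitz_conj_field (A := fun t => A i (M + t)) fun t => hK' _)
    (fun t ht => by
      rw [dist_eq_norm]
      have e : A₀ (M + t) * P₀ (M + t) - P₀ (M + t) * L₀ -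
          (A i (M + t) * P₀ (M + t) - P₀ (M + t) * L i) =
          P₀ (M + t) * (L i - L₀) - (A i (M + t) - A₀ (M + t)) * P₀ (M + t) := by noncomm_ring
      rw [e]
      have ht' := habs t ht
      have a1 := hR _ ht'
      have a2 := h3 (M + t) (by rw [abs_of_nonneg ht'.1]; exact ht'.2)
      have a3 := norm_mul_le (P₀ (M + t)) (L i - L₀)
      have a4 := norm_mul_le (A i (M + t) - A₀ (M + t)) (P₀ (M + t))
      have a5 := norm_sub_le (P₀ (M + t) * (L i - L₀)) ((A i (M + t) - A₀ (M + t)) * P₀ (M + t))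
      have a6 := mul_le_mul a1 h5 (norm_nonneg _) hR0
      have a7 := mul_le_mul a2 a1 (norm_nonneg _) hd0.le
      linarith)
    (fun t _ => by simpa using (hconj.ode (M + t)).comp_const_add M t)
    (fun t _ => by simpa using (hP₀.ode (M + t)).comp_const_add M t)
    (by
      simp only [add_zero]
      rw [hPM, hP₀M, dist_add_left, dist_eq_norm, ← smul_sub, norm_smul, norm_real,
        norm_eq_abs, abs_exp]
      have a1 : ‖p i M - p₀ M‖ ≤ ‖p i - p₀‖ := (p i - p₀).norm_coe_le_norm M
      have a2 : exp (-ρ * M) ≤ 1 := exp_le_one_iff.2 (by nlinarith)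
      calc _ ≤ 1 * ‖p i M - p₀ M‖ := by gcongr
        _ ≤ d := by linarith)
    (by rw [abs_neg, abs_of_nonneg hM])
  simp only [add_neg_cancel] at this
  exact this.trans_lt hd1

end Conjugation

/-! ### Riesz projections -/

section CircleParam

variable {F : Type*} [NormedAddCommGroup F] [NormedSpace ℂ F]

theorem continuousAt_circleIntegral {X : Type*} [TopologicalSpace X] [FirstCountableTopology X]
    {c : ℂ} {r : ℝ} (hr : 0 ≤ r) {f : X → ℂ → F} {x₀ : X}
    (h : ∀ᶠ x in 𝓝 x₀, ∀ z ∈ sphere c r, ContinuousAt (Function.uncurry f) (x, z)) :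
    ContinuousAt (fun x => ∮ z in C(c, r), f x z) x₀ := by
  refine TendstoUniformlyOn.tendsto_circleIntegral_of_continuousOn hr ?_ ?_
  · filter_upwards [h] with x hx z hz
    exact ((hx z hz).comp (f := fun z => (x, z))
      (continuousAt_const.prodMk continuousAt_id)).continuousWithinAt
  · rw [Metric.tendstoUniformlyOn_iff]
    intro ε hε
    refine (isCompact_sphere c r).eventually_forall_of_forall_eventually fun z hz => ?_
    have h0 := h.self_of_nhds z hz
    have h1 : ContinuousAt (fun q : X × ℂ => f x₀ q.2) (x₀, z) :=
      ContinuousAt.comp (f := fun q : X × ℂ => (x₀, q.2)) (g := Function.uncurry f) h0 (by fun_prop)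
    have h2 : ContinuousAt (fun q : X × ℂ => dist (f x₀ q.2) (f q.1 q.2)) (x₀, z) := h1.dist h0
    have h3 : Tendsto (fun q : X × ℂ => dist (f x₀ q.2) (f q.1 q.2)) (𝓝 (x₀, z)) (𝓝 0) := by
      simpa [ContinuousAt] using h2
    exact h3.eventually (eventually_lt_nhds hε)

theorem circleIntegral_comp_clm {G : Type*} [NormedAddCommGroup G] [NormedSpace ℂ G]
    [CompleteSpace F] [CompleteSpace G] (L : F →L[ℂ] G) {f : ℂ → F} {c : ℂ} {r : ℝ} (hr : 0 ≤ r)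
    (hf : ContinuousOn f (sphere c r)) :
    ∮ z in C(c, r), L (f z) = L (∮ z in C(c, r), f z) := by
  have h := (hf.circleIntegrable hr).out
  simp only [circleIntegral]
  rw [← L.intervalIntegral_comp_comm h]
  simp only [map_smul]

/-- Functions of a parameter and a complex variable that are jointly continuous at a point, with a
jointly continuous derivative in the complex variable. -/
def JC1 {X : Type*} [TopologicalSpace X] (W : X × ℂ → F) (p : X × ℂ) : Prop :=
  ContinuousAt W p ∧ ∃ W' : X × ℂ → F,
    (∀ᶠ q in 𝓝 p, HasDerivAt (fun l => W (q.1, l)) (W' q) q.2) ∧ ContinuousAt W' p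

theorem JC1.add {X : Type*} [TopologicalSpace X] {W Z : X × ℂ → F} {p : X × ℂ} (hW : JC1 W p)
    (hZ : JC1 Z p) : JC1 (fun q => W q + Z q) p := by
  obtain ⟨h1, W', h2, h3⟩ := hW
  obtain ⟨g1, Z', g2, g3⟩ := hZ
  exact ⟨h1.add g1, fun q => W' q + Z' q, by filter_upwards [h2, g2] with q a b using a.add b,
    h3.add g3⟩

end CircleParam

section Riesz

variable {𝓐 : Type*} [NormedRing 𝓐] [NormedAlgebra ℂ 𝓐]

def resolv (M : 𝓐) (z : ℂ) : 𝓐 := Ring.inverse (z • (1 : 𝓐) - M)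

def SphereFree (c : ℂ) (r : ℝ) (M : 𝓐) : Prop := ∀ z ∈ sphere c r, IsUnit (z • (1 : 𝓐) - M)

/-- The Riesz projection onto the spectral subspace for the spectrum inside a circle. -/
def rieszProj (c : ℂ) (r : ℝ) (M : 𝓐) : 𝓐 :=
  (2 * Real.pi * Complex.I : ℂ)⁻¹ • ∮ z in C(c, r), resolv M z

theorem resolv_sub {M N : 𝓐} {z : ℂ} (hM : IsUnit (z • (1 : 𝓐) - M))
    (hN : IsUnit (z • (1 : 𝓐) - N)) :
    resolv M z - resolv N z = resolv M z * (M - N) * resolv N z := by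
  have h1 : resolv M z * (z • (1 : 𝓐) - M) = 1 := Ring.inverse_mul_cancel _ hM
  have h2 : (z • (1 : 𝓐) - N) * resolv N z = 1 := Ring.mul_inverse_cancel _ hN
  calc resolv M z - resolv N z
      = resolv M z * ((z • (1 : 𝓐) - N) * resolv N z) -
        (resolv M z * (z • (1 : 𝓐) - M)) * resolv N z := by rw [h1, h2, one_mul, mul_one]
    _ = _ := by noncomm_ring

variable [CompleteSpace 𝓐]

theorem ContinuousAt.resolv {Y : Type*} [TopologicalSpace Y] {M : Y → 𝓐} {ζ : Y → ℂ} {y : Y}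
    (hM : ContinuousAt M y) (hζ : ContinuousAt ζ y) (h : IsUnit (ζ y • (1 : 𝓐) - M y)) :
    ContinuousAt (fun y => resolv (M y) (ζ y)) y := by
  obtain ⟨u, hu⟩ := h
  have := NormedRing.inverse_continuousAt u
  rw [hu] at this
  exact ContinuousAt.comp (g := Ring.inverse) (f := fun y => ζ y • (1 : 𝓐) - M y) this
    ((hζ.smul continuousAt_const).sub hM)

theorem continuousOn_resolv {c : ℂ} {r : ℝ} {M : 𝓐} (hM : SphereFree c r M) :
    ContinuousOn (resolv M) (sphere c r) := fun z hz =>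
  (ContinuousAt.resolv (M := fun _ => M) (ζ := id) continuousAt_const continuousAt_id
    (hM z hz)).continuousWithinAt

theorem eventually_isUnit_sub {Y : Type*} [TopologicalSpace Y] {M : Y → 𝓐} {y : Y} {K : Set ℂ}
    (hK : IsCompact K) (hM : ContinuousAt M y) (h : ∀ z ∈ K, IsUnit (z • (1 : 𝓐) - M y)) :
    ∀ᶠ x in 𝓝 y, ∀ z ∈ K, IsUnit (z • (1 : 𝓐) - M x) := by
  refine hK.eventually_forall_of_forall_eventually fun z hz => ?_
  have h1 : ContinuousAt (fun q : Y × ℂ => q.2 • (1 : 𝓐) - M q.1) (y, z) :=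
    (continuousAt_snd.smul continuousAt_const).sub
      (ContinuousAt.comp (f := Prod.fst) (g := M) hM continuousAt_fst)
  exact h1.eventually (Units.isOpen.mem_nhds (h z hz))

theorem SphereFree.eventually {Y : Type*} [TopologicalSpace Y] {M : Y → 𝓐} {y : Y} {c : ℂ} {r : ℝ}
    (hM : ContinuousAt M y) (h : SphereFree c r (M y)) : ∀ᶠ x in 𝓝 y, SphereFree c r (M x) :=
  eventually_isUnit_sub (isCompact_sphere c r) hM h

theorem continuousAt_riesz_kernel {c : ℂ} {r : ℝ} (hr : 0 ≤ r) {M N : 𝓐} (H : 𝓐)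
    (hM : SphereFree c r M) (hN : SphereFree c r N) :
    ContinuousAt (fun q : 𝓐 × 𝓐 × 𝓐 => ∮ z in C(c, r), resolv q.1 z * q.2.2 * resolv q.2.1 z)
      (M, N, H) := by
  refine continuousAt_circleIntegral hr ?_
  have h1 := SphereFree.eventually (M := fun q : 𝓐 × 𝓐 × 𝓐 => q.1) (y := (M, N, H)) (by fun_prop) hM
  have h2 := SphereFree.eventually (M := fun q : 𝓐 × 𝓐 × 𝓐 => q.2.1) (y := (M, N, H))
    (by fun_prop) hN
  filter_upwards [h1, h2] with q hq1 hq2 z hz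
  have a1 := ContinuousAt.resolv (M := fun p : (𝓐 × 𝓐 × 𝓐) × ℂ => p.1.1) (ζ := fun p => p.2)
    (y := (q, z)) (by fun_prop) (by fun_prop) (hq1 z hz)
  have a2 := ContinuousAt.resolv (M := fun p : (𝓐 × 𝓐 × 𝓐) × ℂ => p.1.2.1) (ζ := fun p => p.2)
    (y := (q, z)) (by fun_prop) (by fun_prop) (hq2 z hz)
  exact (a1.mul (by fun_prop)).mul a2

theorem continuousAt_rieszProj {c : ℂ} {r : ℝ} (hr : 0 ≤ r) {M : 𝓐} (hM : SphereFree c r M) :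
    ContinuousAt (rieszProj c r) M := by
  refine ContinuousAt.const_smul (g := fun M => ∮ z in C(c, r), resolv M z) ?_ _
  refine continuousAt_circleIntegral hr ?_
  filter_upwards [SphereFree.eventually (M := fun q : 𝓐 => q) continuousAt_id hM] with q hq z hz
  exact ContinuousAt.resolv (M := fun p : 𝓐 × ℂ => p.1) (ζ := fun p => p.2)
    (y := (q, z)) (by fun_prop) (by fun_prop) (hq z hz)

theorem hasDerivAt_rieszProj {c : ℂ} {r : ℝ} (hr : 0 ≤ r) {A : ℂ → 𝓐} {A' : 𝓐} {l : ℂ}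
    (hA : HasDerivAt A A' l) (h : SphereFree c r (A l)) :
    HasDerivAt (fun l => rieszProj c r (A l)) ((2 * Real.pi * Complex.I : ℂ)⁻¹ •
      ∮ z in C(c, r), resolv (A l) z * A' * resolv (A l) z) l := by
  have hev := SphereFree.eventually hA.continuousAt h
  refine HasDerivAt.fun_const_smul _ (f := fun l => ∮ z in C(c, r), resolv (A l) z) ?_
  rw [hasDerivAt_iff_tendsto_slope] at hA ⊢
  have hAc : Tendsto A (𝓝[≠] l) (𝓝 (A l)) := by
    have h1 : ContinuousAt A l := (hasDerivAt_iff_tendsto_slope.2 hA).continuousAt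
    exact h1.tendsto.mono_left nhdsWithin_le_nhds
  have h2 := (continuousAt_riesz_kernel hr A' h h).tendsto.comp
    (hAc.prodMk_nhds ((tendsto_const_nhds (x := A l)).prodMk_nhds hA))
  refine h2.congr' ?_
  filter_upwards [hev.filter_mono nhdsWithin_le_nhds, self_mem_nhdsWithin] with y hy hne
  have hne' : y - l ≠ 0 := sub_ne_zero.2 hne
  simp only [Function.comp_def, slope_def_module]
  rw [← circleIntegral.integral_sub ((continuousOn_resolv hy).circleIntegrable hr)
    ((continuousOn_resolv h).circleIntegrable hr), ← circleIntegral.integral_smul]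
  refine circleIntegral.integral_congr hr fun z hz => ?_
  rw [resolv_sub (hy z hz) (h z hz), mul_smul_comm, smul_mul_assoc]

theorem JC1.rieszProj {X : Type*} [TopologicalSpace X] {c : ℂ} {r : ℝ} (hr : 0 ≤ r)
    {W : X × ℂ → 𝓐} {p : X × ℂ} (hW : JC1 W p) (h : SphereFree c r (W p)) :
    JC1 (fun q => rieszProj c r (W q)) p := by
  obtain ⟨h1, W', h2, h3⟩ := hW
  refine ⟨(continuousAt_rieszProj hr h).comp h1, fun q => (2 * Real.pi * Complex.I : ℂ)⁻¹ •
      ∮ z in C(c, r), resolv (W q) z * W' q * resolv (W q) z, ?_, ?_⟩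
  · filter_upwards [h2, SphereFree.eventually h1 h] with q hq hq'
    exact hasDerivAt_rieszProj hr (A := fun l => W (q.1, l)) hq hq'
  · refine ContinuousAt.const_smul ?_ _
    exact ContinuousAt.comp (f := fun q => (W q, W q, W' q)) (continuousAt_riesz_kernel hr (W' p) h h)
      (h1.prodMk (h1.prodMk h3))

/-- The rescaled restriction of `A₀ + l A₁` to the spectral subspace near the kernel of `A₀`. -/
def slowPart (r : ℝ) (A₀ A₁ A : 𝓐) : 𝓐 :=
  (2 * Real.pi * Complex.I : ℂ)⁻¹ • ∮ z in C(0, r), z • (resolv A z * A₁ * resolv A₀ z)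

theorem continuousAt_slow_kernel {c : ℂ} {r : ℝ} (hr : 0 ≤ r) {A₀ A₁ A : 𝓐}
    (hA₀ : SphereFree c r A₀) (hA : SphereFree c r A) :
    ContinuousAt (fun q : 𝓐 × 𝓐 × 𝓐 => ∮ z in C(c, r), z • (resolv q.2.2 z * q.2.1 * resolv q.1 z))
      (A₀, A₁, A) := by
  refine continuousAt_circleIntegral hr ?_
  have h1 := SphereFree.eventually (M := fun q : 𝓐 × 𝓐 × 𝓐 => q.1) (y := (A₀, A₁, A))
    (by fun_prop) hA₀
  have h2 := SphereFree.eventually (M := fun q : 𝓐 × 𝓐 × 𝓐 => q.2.2) (y := (A₀, A₁, A))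
    (by fun_prop) hA
  filter_upwards [h1, h2] with q hq1 hq2 z hz
  have a1 := ContinuousAt.resolv (M := fun p : (𝓐 × 𝓐 × 𝓐) × ℂ => p.1.1) (ζ := fun p => p.2)
    (y := (q, z)) (by fun_prop) (by fun_prop) (hq1 z hz)
  have a2 := ContinuousAt.resolv (M := fun p : (𝓐 × 𝓐 × 𝓐) × ℂ => p.1.2.2) (ζ := fun p => p.2)
    (y := (q, z)) (by fun_prop) (by fun_prop) (hq2 z hz)
  exact continuousAt_snd.smul ((a2.mul (by fun_prop)).mul a1)

theorem continuousAt_slow_kernel' {c : ℂ} {r : ℝ} (hr : 0 ≤ r) {A₀ A₁ A B : 𝓐}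
    (hA₀ : SphereFree c r A₀) (hA : SphereFree c r A) (hB : SphereFree c r B) :
    ContinuousAt (fun q : 𝓐 × 𝓐 × 𝓐 × 𝓐 => ∮ z in C(c, r),
      z • (resolv q.2.2.2 z * q.2.1 * resolv q.2.2.1 z * q.2.1 * resolv q.1 z))
      (A₀, A₁, A, B) := by
  refine continuousAt_circleIntegral hr ?_
  have h1 := SphereFree.eventually (M := fun q : 𝓐 × 𝓐 × 𝓐 × 𝓐 => q.1) (y := (A₀, A₁, A, B))
    (by fun_prop) hA₀
  have h2 := SphereFree.eventually (M := fun q : 𝓐 × 𝓐 × 𝓐 × 𝓐 => q.2.2.1) (y := (A₀, A₁, A, B))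
    (by fun_prop) hA
  have h3 := SphereFree.eventually (M := fun q : 𝓐 × 𝓐 × 𝓐 × 𝓐 => q.2.2.2) (y := (A₀, A₁, A, B))
    (by fun_prop) hB
  filter_upwards [h1, h2, h3] with q hq1 hq2 hq3 z hz
  have a1 := ContinuousAt.resolv (M := fun p : (𝓐 × 𝓐 × 𝓐 × 𝓐) × ℂ => p.1.1) (ζ := fun p => p.2)
    (y := (q, z)) (by fun_prop) (by fun_prop) (hq1 z hz)
  have a2 := ContinuousAt.resolv (M := fun p : (𝓐 × 𝓐 × 𝓐 × 𝓐) × ℂ => p.1.2.2.1) (ζ := fun p => p.2)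
    (y := (q, z)) (by fun_prop) (by fun_prop) (hq2 z hz)
  have a3 := ContinuousAt.resolv (M := fun p : (𝓐 × 𝓐 × 𝓐 × 𝓐) × ℂ => p.1.2.2.2) (ζ := fun p => p.2)
    (y := (q, z)) (by fun_prop) (by fun_prop) (hq3 z hz)
  exact continuousAt_snd.smul ((((a3.mul (by fun_prop)).mul a2).mul (by fun_prop)).mul a1)

theorem continuousOn_slow_integrand {c : ℂ} {r : ℝ} {A₀ A₁ A : 𝓐}
    (hA₀ : SphereFree c r A₀) (hA : SphereFree c r A) :
    ContinuousOn (fun z : ℂ => z • (resolv A z * A₁ * resolv A₀ z)) (sphere c r) :=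
  continuousOn_id.smul (((continuousOn_resolv hA).mul continuousOn_const).mul
    (continuousOn_resolv hA₀))

theorem hasDerivAt_slowPart {r : ℝ} (hr : 0 ≤ r) {A₀ A₁ : 𝓐} {l : ℂ} (h₀ : SphereFree 0 r A₀)
    (h : SphereFree 0 r (A₀ + l • A₁)) :
    HasDerivAt (fun l : ℂ => slowPart r A₀ A₁ (A₀ + l • A₁)) ((2 * Real.pi * Complex.I : ℂ)⁻¹ •
      ∮ z in C(0, r), z • (resolv (A₀ + l • A₁) z * A₁ * resolv (A₀ + l • A₁) z * A₁ * resolv A₀ z))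
      l := by
  have hc : Continuous fun l : ℂ => A₀ + l • A₁ := by fun_prop
  have hev := SphereFree.eventually (M := fun l : ℂ => A₀ + l • A₁) hc.continuousAt h
  refine HasDerivAt.fun_const_smul _
    (f := fun l : ℂ => ∮ z in C(0, r), z • (resolv (A₀ + l • A₁) z * A₁ * resolv A₀ z)) ?_
  rw [hasDerivAt_iff_tendsto_slope]
  have h2 := (continuousAt_slow_kernel' hr (A₁ := A₁) h₀ h h).tendsto.comp
    ((tendsto_const_nhds (x := A₀) (f := 𝓝[≠] l)).prodMk_nhds ((tendsto_const_nhds (x := A₁)).prodMk_nhds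
      ((tendsto_const_nhds (x := A₀ + l • A₁)).prodMk_nhds
        ((hc.tendsto l).mono_left nhdsWithin_le_nhds))))
  refine h2.congr' ?_
  filter_upwards [hev.filter_mono nhdsWithin_le_nhds, self_mem_nhdsWithin] with y hy hne
  have hne' : y - l ≠ 0 := sub_ne_zero.2 hne
  simp only [Function.comp_def, slope_def_module]
  rw [← circleIntegral.integral_sub ((continuousOn_slow_integrand h₀ hy).circleIntegrable hr)
    ((continuousOn_slow_integrand h₀ h).circleIntegrable hr), ← circleIntegral.integral_smul]
  refine circleIntegral.integral_congr hr fun z hz => ?_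
  rw [← smul_sub, ← sub_mul, ← sub_mul, resolv_sub (hy z hz) (h z hz)]
  rw [show A₀ + y • A₁ - (A₀ + l • A₁) = (y - l) • A₁ by rw [sub_smul]; abel]
  rw [mul_smul_comm, smul_mul_assoc, smul_mul_assoc, smul_mul_assoc, smul_comm z, smul_smul,
    inv_mul_cancel₀ hne', one_smul]

theorem JC1.slowPart {X : Type*} [TopologicalSpace X] {r : ℝ} (hr : 0 ≤ r) {A₀ A₁ : X → 𝓐}
    {p : X × ℂ} (hA₀ : Continuous A₀) (hA₁ : Continuous A₁)
    (h₀ : SphereFree 0 r (A₀ p.1)) (h : SphereFree 0 r (A₀ p.1 + p.2 • A₁ p.1)) :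
    JC1 (fun q => slowPart r (A₀ q.1) (A₁ q.1) (A₀ q.1 + q.2 • A₁ q.1)) p := by
  have c0 : ContinuousAt (fun q : X × ℂ => A₀ q.1) p := by fun_prop
  have c1 : ContinuousAt (fun q : X × ℂ => A₁ q.1) p := by fun_prop
  have c2 : ContinuousAt (fun q : X × ℂ => A₀ q.1 + q.2 • A₁ q.1) p := by fun_prop
  refine ⟨?_, fun q => (2 * Real.pi * Complex.I : ℂ)⁻¹ • ∮ z in C(0, r),
      z • (resolv (A₀ q.1 + q.2 • A₁ q.1) z * A₁ q.1 * resolv (A₀ q.1 + q.2 • A₁ q.1) z *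
        A₁ q.1 * resolv (A₀ q.1) z), ?_, ?_⟩
  · refine ContinuousAt.const_smul (g := fun q : X × ℂ => ∮ z in C(0, r),
      z • (resolv (A₀ q.1 + q.2 • A₁ q.1) z * A₁ q.1 * resolv (A₀ q.1) z)) ?_ _
    exact ContinuousAt.comp (f := fun q : X × ℂ => (A₀ q.1, A₁ q.1, A₀ q.1 + q.2 • A₁ q.1))
      (continuousAt_slow_kernel hr h₀ h) (c0.prodMk (c1.prodMk c2))
  · filter_upwards [SphereFree.eventually c0 h₀, SphereFree.eventually c2 h] with q h1 h2
    exact hasDerivAt_slowPart hr h1 h2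
  · refine ContinuousAt.const_smul ?_ _
    exact ContinuousAt.comp
      (f := fun q : X × ℂ => (A₀ q.1, A₁ q.1, A₀ q.1 + q.2 • A₁ q.1, A₀ q.1 + q.2 • A₁ q.1))
      (continuousAt_slow_kernel' hr h₀ h h) (c0.prodMk (c1.prodMk (c2.prodMk c2)))

theorem continuousOn_smul_resolv {c : ℂ} {r : ℝ} {M : 𝓐} (hM : SphereFree c r M) :
    ContinuousOn (fun z : ℂ => z • resolv M z) (sphere c r) :=
  continuousOn_id.smul (continuousOn_resolv hM)

theorem mul_rieszProj {c : ℂ} {r : ℝ} (hr : 0 ≤ r) {M : 𝓐} (hM : SphereFree c r M) :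
    M * rieszProj c r M = (2 * Real.pi * Complex.I : ℂ)⁻¹ • ∮ z in C(c, r), z • resolv M z := by
  have h1 := circleIntegral_comp_clm (ContinuousLinearMap.mul ℂ 𝓐 M) hr (continuousOn_resolv hM)
  have h0 : ∮ _z in C(c, r), (1 : 𝓐) = 0 :=
    circleIntegral.integral_eq_zero_of_hasDerivWithinAt (f := fun z : ℂ => z • (1 : 𝓐)) hr
      fun z _ => by simpa using ((hasDerivAt_id z).smul_const (1 : 𝓐)).hasDerivWithinAt
  rw [rieszProj, mul_smul_comm]
  congr 1
  have h2 : M * (∮ z in C(c, r), resolv M z) = ∮ z in C(c, r), M * resolv M z := h1.symm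
  rw [h2]
  have h3 : ∮ z in C(c, r), M * resolv M z = ∮ z in C(c, r), (z • resolv M z - 1) := by
    refine circleIntegral.integral_congr hr fun z hz => ?_
    have : (z • (1 : 𝓐) - M) * resolv M z = 1 := Ring.mul_inverse_cancel _ (hM z hz)
    rw [sub_mul, smul_mul_assoc, one_mul] at this
    rw [← this]
    abel
  rw [h3, circleIntegral.integral_sub _ (circleIntegrable_const 1 c r), h0, sub_zero]
  exact (continuousOn_smul_resolv hM).circleIntegrable hr

/-- If the kernel of `A₀` carries the whole spectral subspace inside the circle, `slowPart` is the
restriction of `A₀ + l A₁` to its spectral subspace, divided by `l`. -/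
theorem smul_slowPart {r : ℝ} (hr : 0 ≤ r) {A₀ A₁ : 𝓐} {l : ℂ} (h₀ : SphereFree 0 r A₀)
    (h : SphereFree 0 r (A₀ + l • A₁)) (hker : A₀ * rieszProj 0 r A₀ = 0) :
    l • slowPart r A₀ A₁ (A₀ + l • A₁) = (A₀ + l • A₁) * rieszProj 0 r (A₀ + l • A₁) := by
  have h1 := mul_rieszProj hr h
  have h2 := mul_rieszProj hr h₀
  rw [hker] at h2
  rw [h1, ← sub_zero ((2 * Real.pi * Complex.I : ℂ)⁻¹ •
    ∮ z in C(0, r), z • resolv (A₀ + l • A₁) z), h2, ← smul_sub, slowPart, smul_comm]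
  congr 1
  rw [← circleIntegral.integral_sub ((continuousOn_smul_resolv h).circleIntegrable hr)
    ((continuousOn_smul_resolv h₀).circleIntegrable hr),
    ← circleIntegral.integral_smul]
  refine circleIntegral.integral_congr hr fun z hz => ?_
  rw [← smul_sub, resolv_sub (h z hz) (h₀ z hz), add_sub_cancel_left, mul_smul_comm, smul_mul_assoc,
    smul_comm]

end Riesz

section RieszGen

variable {V : Type*} [NormedAddCommGroup V] [NormedSpace ℂ V] [FiniteDimensional ℂ V]

theorem isUnit_sub_of_no_eigenvector {M : CL(V)} {z : ℂ} (h : ∀ v, M v = z • v → v = 0) :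
    IsUnit (z • (1 : CL(V)) - M) := by
  have : CompleteSpace V := FiniteDimensional.complete ℂ V
  rw [ContinuousLinearMap.isUnit_iff_bijective]
  have hinj : Function.Injective (z • (1 : CL(V)) - M) := by
    rw [injective_iff_map_eq_zero]
    intro v hv
    refine h v ?_
    have : z • v - M v = 0 := hv
    exact (sub_eq_zero.1 this).symm
  exact ⟨hinj, (LinearMap.injective_iff_surjective
    (f := ((z • (1 : CL(V)) - M : CL(V)) : V →ₗ[ℂ] V))).1 hinj⟩

theorem eq_zero_of_isUnit_sub {M : CL(V)} {z : ℂ} (h : IsUnit (z • (1 : CL(V)) - M)) {v : V}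
    (hv : M v = z • v) : v = 0 := by
  have : CompleteSpace V := FiniteDimensional.complete ℂ V
  refine (ContinuousLinearMap.isUnit_iff_bijective.1 h).1 ?_
  rw [map_zero]
  change z • v - M v = 0
  rw [hv, sub_self]

theorem resolv_apply_gen {M : CL(V)} {z ν : ℂ} (h : IsUnit (z • (1 : CL(V)) - M))
    (hz : z ≠ ν) (v : V) :
    resolv M z v = (z - ν)⁻¹ • (v + resolv M z (M v - ν • v)) := by
  have h1 : resolv M z * (z • (1 : CL(V)) - M) = 1 := Ring.inverse_mul_cancel _ h
  have h2 : resolv M z (z • v - M v) = v := by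
    have := DFunLike.congr_fun h1 v
    exact this
  have h3 : M v - ν • v = (z - ν) • v - (z • v - M v) := by rw [sub_smul]; abel
  rw [h3, map_sub, h2, map_smul, add_sub_cancel, smul_smul, inv_mul_cancel₀ (sub_ne_zero.2 hz),
    one_smul]

theorem circleIntegral_resolv_gen {M : CL(V)} {c ν : ℂ} {r : ℝ} (hr : 0 ≤ r)
    (hM : SphereFree c r M) (hν : ν ∉ sphere c r) :
    ∀ v ∈ maxGenEigenspace M.toLinearMap ν, ∀ j : ℕ,
      ∮ z in C(c, r), (z - ν) ^ (-(j : ℤ)) • resolv M z v =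
        (∮ z in C(c, r), (z - ν) ^ (-(j : ℤ) - 1)) • v := by
  have : CompleteSpace V := FiniteDimensional.complete ℂ V
  have hne : ∀ z ∈ sphere c r, z - ν ≠ 0 := fun z hz h => hν (by rwa [← sub_eq_zero.1 h])
  refine maxGenEigenspace_induction (by intro j; simp [circleIntegral]) fun v _ ih j => ?_
  have hpow : ∀ k : ℤ, ContinuousOn (fun z : ℂ => (z - ν) ^ k) (sphere c r) := fun k =>
    ContinuousOn.zpow₀ (by fun_prop) k fun z hz => Or.inl (hne z hz)
  have hres : ∀ w, ContinuousOn (fun z => resolv M z w) (sphere c r) := fun w =>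
    (continuousOn_resolv hM).clm_apply continuousOn_const
  have e : ∮ z in C(c, r), (z - ν) ^ (-(j : ℤ)) • resolv M z v =
      ∮ z in C(c, r), ((z - ν) ^ (-(j : ℤ) - 1) • v +
        (z - ν) ^ (-((j + 1 : ℕ) : ℤ)) • resolv M z (M v - ν • v)) := by
    refine circleIntegral.integral_congr hr fun z hz => ?_
    rw [resolv_apply_gen (hM z hz) (sub_ne_zero.1 (hne z hz)) v, smul_smul, smul_add,
      zpow_sub_one₀ (hne z hz), Nat.cast_add, Nat.cast_one, neg_add, ← sub_eq_add_neg,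
      zpow_sub_one₀ (hne z hz)]
  have ih' := ih (j + 1)
  have i1 : ContinuousOn (fun z : ℂ => (z - ν) ^ (-(j : ℤ) - 1) • v) (sphere c r) :=
    (hpow _).smul continuousOn_const
  have i2 : ContinuousOn (fun z : ℂ => (z - ν) ^ (-((j + 1 : ℕ) : ℤ)) • resolv M z (M v - ν • v))
    (sphere c r) := (hpow _).smul (hres _)
  rw [e, circleIntegral.integral_add (i1.circleIntegrable hr) (i2.circleIntegrable hr),
    circleIntegral.integral_smul_const]
  change _ + ∮ z in C(c, r), (z - ν) ^ (-((j + 1 : ℕ) : ℤ)) • resolv M z (M.toLinearMap v - ν • v) = _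
  rw [ih', circleIntegral.integral_sub_zpow_of_ne (n := -((j + 1 : ℕ) : ℤ) - 1) (by push_cast; omega),
    zero_smul, add_zero]

theorem rieszProj_apply {M : CL(V)} {c : ℂ} {r : ℝ} (hr : 0 ≤ r) (hM : SphereFree c r M) (v : V) :
    rieszProj c r M v = (2 * Real.pi * Complex.I : ℂ)⁻¹ • ∮ z in C(c, r), resolv M z v := by
  have : CompleteSpace V := FiniteDimensional.complete ℂ V
  have h := circleIntegral_comp_clm (ContinuousLinearMap.apply ℂ V v) hr (continuousOn_resolv hM)
  simp only [ContinuousLinearMap.apply_apply] at h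
  rw [h]
  rfl

theorem rieszProj_apply_of_mem_ball {M : CL(V)} {c ν : ℂ} {r : ℝ}
    (hM : SphereFree c r M) (hν : ν ∈ ball c r) {v : V}
    (hv : v ∈ maxGenEigenspace M.toLinearMap ν) : rieszProj c r M v = v := by
  have hr : 0 ≤ r := (Metric.pos_of_mem_ball hν).le
  have h := circleIntegral_resolv_gen hr hM (fun h => by
    rw [mem_ball] at hν; rw [mem_sphere] at h; linarith) v hv 0
  simp only [Nat.cast_zero, neg_zero, zpow_zero, one_smul, zero_sub, zpow_neg_one] at h
  rw [rieszProj_apply hr hM, h, circleIntegral.integral_sub_inv_of_mem_ball hν, smul_smul,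
    inv_mul_cancel₀ Complex.two_pi_I_ne_zero, one_smul]

theorem rieszProj_apply_of_notMem_closedBall {M : CL(V)} {c ν : ℂ} {r : ℝ} (hr : 0 ≤ r)
    (hM : SphereFree c r M) (hν : ν ∉ closedBall c r) {v : V}
    (hv : v ∈ maxGenEigenspace M.toLinearMap ν) : rieszProj c r M v = 0 := by
  have h := circleIntegral_resolv_gen hr hM (fun h => hν (sphere_subset_closedBall h)) v hv 0
  simp only [Nat.cast_zero, neg_zero, zpow_zero, one_smul, zero_sub, zpow_neg_one] at h
  have h0 : ∮ z in C(c, r), (z - ν)⁻¹ = 0 := by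
    refine Complex.circleIntegral_eq_zero_of_differentiable_on_off_countable hr countable_empty ?_ ?_
    · refine ContinuousOn.inv₀ (by fun_prop) fun z hz h => hν ?_
      rwa [← sub_eq_zero.1 h]
    · intro z hz
      refine DifferentiableAt.inv (by fun_prop) fun h => hν ?_
      rw [← sub_eq_zero.1 h]
      exact ball_subset_closedBall hz.1
  rw [rieszProj_apply hr hM, h, h0, zero_smul, smul_zero]

end RieszGen

/-! ### The unstable projection -/

theorem exists_circle_of_re_pos {s : Set ℂ} (hs : s.Finite) (h : ∀ z ∈ s, 0 < z.re) :
    ∃ (c : ℂ) (r δ : ℝ), 0 ≤ r ∧ 0 < δ ∧ (∀ z ∈ s, z ∈ ball c r) ∧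
      ∀ z ∈ closedBall c r, δ ≤ z.re := by
  have h1 : ∀ᶠ δ in 𝓝[>] (0 : ℝ), ∀ z ∈ s, δ < z.re :=
    (eventually_all_finite hs).2 fun z hz => nhdsWithin_le_nhds (eventually_lt_nhds (h z hz))
  obtain ⟨δ, hδs, hδ⟩ := (h1.and self_mem_nhdsWithin).exists
  have hδ : 0 < δ := hδ
  have h2 : ∀ᶠ C : ℝ in atTop, ∀ z ∈ s, ‖z‖ ^ 2 < 2 * C * (z.re - δ) := by
    refine (eventually_all_finite hs).2 fun z hz => ?_
    have : Tendsto (fun C : ℝ => 2 * C * (z.re - δ)) atTop atTop :=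
      (tendsto_id.const_mul_atTop (by norm_num)).atTop_mul_const (sub_pos.2 (hδs z hz))
    exact this.eventually_gt_atTop _
  obtain ⟨C, hC, hCδ⟩ := (h2.and (eventually_gt_atTop δ)).exists
  refine ⟨C, C - δ, δ, by linarith, hδ, fun z hz => ?_, fun z hz => ?_⟩
  · rw [mem_ball, dist_eq_norm]
    refine lt_of_pow_lt_pow_left₀ 2 (by linarith) ?_
    have e := hC z hz
    rw [Complex.sq_norm, normSq_apply] at e ⊢
    simp only [sub_re, sub_im, ofReal_re, ofReal_im, sub_zero]
    nlinarith
  · rw [mem_closedBall, dist_eq_norm] at hz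
    have := (abs_re_le_norm (z - C)).trans hz
    rw [sub_re, ofReal_re] at this
    have := neg_abs_le (z.re - C)
    linarith

section Uproj

variable {V : Type*} [NormedAddCommGroup V] [NormedSpace ℂ V]

theorem mem_maxGenEigenspace_of_map_sub {M : V →ₗ[ℂ] V} {ν : ℂ} {v : V}
    (hv : M v - ν • v ∈ maxGenEigenspace M ν) :
    v ∈ maxGenEigenspace M ν := by
  obtain ⟨k, hk⟩ := (mem_maxGenEigenspace _ _ _).1 hv
  refine (mem_maxGenEigenspace _ _ _).2 ⟨k + 1, ?_⟩
  rw [pow_succ, Module.End.mul_apply]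
  simpa using hk

variable [FiniteDimensional ℂ V]

theorem finite_eigenvalues (M : CL(V)) : {ν : ℂ | ∃ v, M v = ν • v ∧ v ≠ 0}.Finite := by
  refine (Module.End.finite_hasEigenvalue M.toLinearMap).subset ?_
  rintro ν ⟨v, hv, hv0⟩
  exact Module.End.hasEigenvalue_of_hasEigenvector (x := v)
    ⟨Module.End.mem_eigenspace_iff.2 hv, hv0⟩

theorem clm_ext_gen {M P Q : CL(V)} (h : ∀ ν x, M x = ν • x → x ≠ 0 →
    ∀ v ∈ maxGenEigenspace M.toLinearMap ν, P v = Q v) : P = Q :=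
  ContinuousLinearMap.ext <| genEigenvector_induction M.toLinearMap (by simp)
    (fun v w h1 h2 => by rw [map_add, map_add, h1, h2]) h

theorem exists_unstable_circle (M : CL(V)) : ∃ (c : ℂ) (r δ : ℝ), 0 ≤ r ∧ 0 < δ ∧ SphereFree c r M ∧
    (∀ ν v, M v = ν • v → v ≠ 0 → 0 < ν.re → ν ∈ ball c r) ∧ ∀ z ∈ closedBall c r, δ ≤ z.re := by
  obtain ⟨c, r, δ, hr, hδ, h1, h2⟩ := exists_circle_of_re_pos
    ((finite_eigenvalues M).subset (inter_subset_left (t := {ν : ℂ | 0 < ν.re}))) fun z hz => hz.2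
  refine ⟨c, r, δ, hr, hδ, fun z hz => isUnit_sub_of_no_eigenvector fun v hv => ?_,
    fun ν v hv hv0 hν => h1 ν ⟨⟨v, hv, hv0⟩, hν⟩, h2⟩
  by_contra hv0
  have := h1 z ⟨⟨v, hv, hv0⟩, hδ.trans_le (h2 z (sphere_subset_closedBall hz))⟩
  rw [mem_ball] at this
  rw [mem_sphere] at hz
  linarith

theorem exists_uproj (M : CL(V)) : ∃ P : CL(V), ∀ ν,
    ∀ v ∈ maxGenEigenspace M.toLinearMap ν, P v = if 0 < ν.re then v else 0 := by
  obtain ⟨c, r, δ, hr, hδ, hfree, h1, h2⟩ := exists_unstable_circle M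
  refine ⟨rieszProj c r M, fun ν v hv => ?_⟩
  rcases eq_zero_or_exists_eigenvector hv with rfl | ⟨x, hx, hx0⟩
  · simp
  split_ifs with hν
  · exact rieszProj_apply_of_mem_ball hfree (h1 ν x hx hx0 hν) hv
  · exact rieszProj_apply_of_notMem_closedBall hr hfree (fun h => hν (hδ.trans_le (h2 ν h))) hv

/-- The projection onto the generalized eigenspaces of eigenvalues with positive real part. -/
def uproj (M : CL(V)) : CL(V) := (exists_uproj M).choose

theorem uproj_apply {M : CL(V)} {ν : ℂ} {v : V}
    (hv : v ∈ maxGenEigenspace M.toLinearMap ν) :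
    uproj M v = if 0 < ν.re then v else 0 := (exists_uproj M).choose_spec ν v hv

theorem uproj_eq {M P : CL(V)} (h : ∀ ν x, M x = ν • x → x ≠ 0 →
    ∀ v ∈ maxGenEigenspace M.toLinearMap ν, P v = if 0 < ν.re then v else 0) : uproj M = P :=
  clm_ext_gen fun ν x hx hx0 v hv => by rw [uproj_apply hv, h ν x hx hx0 v hv]

theorem norm_le_of_eigenvector {M : CL(V)} {ν : ℂ} {v : V} (h : M v = ν • v) (hv : v ≠ 0) :
    ‖ν‖ ≤ ‖M‖ := by
  have h1 := M.le_opNorm v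
  rw [h, norm_smul] at h1
  exact le_of_mul_le_mul_right h1 (norm_pos_iff.2 hv)

theorem uproj_mul_self (M : CL(V)) : uproj M * uproj M = uproj M := by
  refine clm_ext_gen (M := M) fun ν _ _ _ v hv => ?_
  change uproj M (uproj M v) = uproj M v
  rw [uproj_apply hv]
  split_ifs with h
  · rw [uproj_apply hv, if_pos h]
  · exact map_zero _

theorem uproj_commute (M : CL(V)) : uproj M * M = M * uproj M := by
  refine clm_ext_gen (M := M) fun ν _ _ _ v hv => ?_
  change uproj M (M v) = M (uproj M v)
  have h1 : M v ∈ maxGenEigenspace M.toLinearMap ν := by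
    have := Submodule.add_mem _ (map_sub_smul_mem_maxGenEigenspace hv) (Submodule.smul_mem _ ν hv)
    rwa [sub_add_cancel] at this
  rw [uproj_apply hv, uproj_apply h1]
  split_ifs <;> simp

end Uproj

/-! ### Regularity of the unstable projection up to the imaginary axis -/

section Spectral

variable {V : Type*} [NormedAddCommGroup V] [NormedSpace ℂ V] [FiniteDimensional ℂ V]
variable {X : Type*} [TopologicalSpace X]

/-- Spectral relation between `l` and an eigenvalue `ν`. -/
def SpecRel (l ν : ℂ) : Prop := (ν = 0 → l = 0) ∧ (ν = 0 ∨ ν = -l ∨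
    ∃ T k : ℝ, 0 < T ∧ 0 < k ∧ ν.im * T = k * (l.im * ν.re - l.re * ν.im))

theorem SpecRel.eq_neg {l ν : ℂ} (h : SpecRel l ν) (hl : 0 ≤ l.re) (h0 : ν.re = 0) :
    ν = -l := by
  obtain ⟨h1, h2 | h2 | ⟨T, k, hT, hk, e⟩⟩ := h
  · rw [h1 h2, h2, neg_zero]
  · exact h2
  · rw [h0] at e
    have h3 : ν.im * (T + k * l.re) = 0 := by linarith
    have h4 : T + k * l.re ≠ 0 := by positivity
    have h5 : ν = 0 := Complex.ext h0 ((mul_eq_zero.1 h3).resolve_right h4)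
    rw [h1 h5, h5, neg_zero]

theorem SpecRel.re_ne_zero {l ν : ℂ} (h : SpecRel l ν) (hl : 0 < l.re) : ν.re ≠ 0 := by
  intro h0
  rw [h.eq_neg hl.le h0, neg_re] at h0
  linarith

theorem SpecRel.re_mul_pos {l ν : ℂ} (h : SpecRel l ν) (hl : 0 < l.re) (hi : l.im * ν.im ≠ 0) :
    0 < ν.re * (l.im * ν.im) := by
  have h0 : 0 < l.im * l.im := mul_self_pos.2 (left_ne_zero_of_mul hi)
  obtain ⟨-, rfl | rfl | ⟨T, k, hT, hk, e⟩⟩ := h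
  · simp at hi
  · simp only [Complex.neg_im, neg_re]; nlinarith [mul_pos hl h0]
  · have h1 : k * (l.im * l.im) * (ν.re * (l.im * ν.im)) = (l.im * ν.im) ^ 2 * (T + k * l.re) := by
      linear_combination (-l.im * (l.im * ν.im)) * e
    have h2 : 0 < (l.im * ν.im) ^ 2 * (T + k * l.re) := by positivity
    exact (mul_pos_iff_of_pos_left (by positivity)).1 (h1 ▸ h2)

theorem SpecRel.re_mul_pos_of_ratio {l κ : ℂ} (h : SpecRel l (κ * l)) (hl : 0 < l.re)
    (hκ : |κ.im| < |κ.re|) : 0 < κ.re * (κ * l).re := by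
  have key : ∀ x y : ℝ, 0 < x → |y| ≤ x → 0 < κ.re * (κ.re * x + κ.im * y) := fun x y hx hy => by
    have h1 := neg_abs_le (κ.re * κ.im * y)
    have h2 : |κ.re| * |κ.im| * |y| ≤ |κ.re| * |κ.im| * x := by gcongr
    have h3 : |κ.re| * |κ.im| * x < |κ.re| * |κ.re| * x := by
      gcongr; exact (abs_nonneg _).trans_lt hκ
    rw [abs_mul, abs_mul] at h1
    rw [abs_mul_abs_self] at h3
    linarith
  by_cases hc : |l.im| ≤ l.re
  · have := key l.re (-l.im) hl (by rwa [abs_neg])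
    rw [mul_re]
    linarith
  · have h0 : 0 < |l.im| := hl.trans (not_le.1 hc)
    have h1 := key (l.im * l.im) (l.re * l.im) (mul_self_pos.2 (abs_pos.1 h0)) (by
      rw [abs_mul, abs_of_pos hl, ← abs_mul_abs_self l.im]
      exact mul_le_mul_of_nonneg_right (not_le.1 hc).le h0.le)
    have e : l.im * (κ * l).im = κ.re * (l.im * l.im) + κ.im * (l.re * l.im) := by rw [mul_im]; ring
    rw [← e] at h1
    have h2 := mul_pos h1 (h.re_mul_pos hl (right_ne_zero_of_mul h1.ne'))
    refine pos_of_mul_pos_left (b := (l.im * (κ * l).im) ^ 2) (by linarith) (sq_nonneg _)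

theorem exists_re_neg_of_near {l₀ : ℂ} (h0 : l₀ ≠ 0) (hl₀ : 0 ≤ l₀.re) : ∃ ε > 0, ∀ l ν : ℂ,
    ‖ν + l₀‖ < ε → ‖l - l₀‖ < ε → 0 < l.re → SpecRel l ν → ν.re < 0 := by
  by_cases him : l₀.im = 0
  · have hre : 0 < l₀.re := hl₀.lt_of_ne fun h => h0 (Complex.ext h.symm him)
    refine ⟨l₀.re, hre, fun l ν h1 _ _ _ => ?_⟩
    have := (re_le_norm _).trans_lt h1
    rw [Complex.add_re] at this
    linarith
  · refine ⟨|l₀.im| / 2, by positivity, fun l ν h1 h2 hl h => ?_⟩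
    suffices hi : l.im * ν.im < 0 from
      neg_of_mul_pos_left (h.re_mul_pos hl hi.ne) hi.le
    have a1 := (Complex.abs_im_le_norm _).trans_lt h1
    have a2 := (Complex.abs_im_le_norm _).trans_lt h2
    rw [Complex.add_im, abs_lt] at a1
    rw [sub_im, abs_lt] at a2
    rcases lt_or_gt_of_ne him with h | h
    · rw [abs_of_neg h] at a1 a2
      exact mul_neg_of_neg_of_pos (by linarith) (by linarith)
    · rw [abs_of_pos h] at a1 a2
      exact mul_neg_of_pos_of_neg (by linarith) (by linarith)

/-- An affine pencil `A₀ + l A₁` whose eigenvalues satisfy the spectral relation, whose kernel at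
`l = 0` is semisimple, and whose small eigenvalues are, to leading order, real multiples of `l`. -/
structure SpectralPencil (A₀ A₁ : X → CL(V)) : Prop where
  cont₀ : Continuous A₀
  cont₁ : Continuous A₁
  rel : ∀ e l ν x, (A₀ e + l • A₁ e) x = ν • x → x ≠ 0 → SpecRel l ν
  semisimple : ∀ e x, A₀ e (A₀ e x) = 0 → A₀ e x = 0
  gap : ∀ e, ∃ ρ > 0, ∀ᶠ e' in 𝓝 e, ∀ (ν : ℂ) (x : V), ‖ν‖ < ρ → A₀ e' x = ν • x → x ≠ 0 → ν = 0
  slow : ∀ e, ∃ δ > 0, ∀ ε > 0, ∃ ρ > 0, ∀ᶠ q in 𝓝 (e, (0 : ℂ)), 0 < q.2.re →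
    ∀ (ν : ℂ) (x : V), ‖ν‖ < ρ → (A₀ q.1 + q.2 • A₁ q.1) x = ν • x → x ≠ 0 →
      δ ≤ ‖ν / q.2‖ ∧ |(ν / q.2).im| ≤ ε

namespace SpectralPencil

variable {A₀ A₁ : X → CL(V)}

theorem jc1 (h : SpectralPencil A₀ A₁) (p : X × ℂ) : JC1 (fun q => A₀ q.1 + q.2 • A₁ q.1) p := by
  have h0 := h.cont₀
  have h1 := h.cont₁
  refine ⟨by fun_prop, fun q => A₁ q.1, Eventually.of_forall fun q => ?_, by fun_prop⟩
  have := ((hasDerivAt_id q.2).smul_const (A₁ q.1)).const_add (A₀ q.1)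
  simpa using this

theorem exists_local_ne_zero (h : SpectralPencil A₀ A₁) {p : X × ℂ} (hp : 0 ≤ p.2.re)
    (hp0 : p.2 ≠ 0) : ∃ W, JC1 W p ∧
      ∀ᶠ q in 𝓝 p, 0 < q.2.re → uproj (A₀ q.1 + q.2 • A₁ q.1) = W q := by
  have : CompleteSpace V := FiniteDimensional.complete ℂ V
  set A : X × ℂ → CL(V) := fun q => A₀ q.1 + q.2 • A₁ q.1 with hA
  have hrel : ∀ q ν x, A q x = ν • x → x ≠ 0 → SpecRel q.2 ν := fun q => h.rel q.1 q.2
  have hc : ContinuousAt A p := (h.jc1 p).1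
  obtain ⟨c, r, δ, hr, hδ, hfree, h1, h2⟩ := exists_unstable_circle (A p)
  obtain ⟨ε, hε, hnear⟩ := exists_re_neg_of_near hp0 hp
  set K : Set ℂ := closedBall 0 (‖A p‖ + 1) ∩
    ({ν | 0 ≤ ν.re} ∩ ((ball c r)ᶜ ∩ {ν | ε ≤ ‖ν + p.2‖})) with hK
  have hKc : IsCompact K := (isCompact_closedBall _ _).inter_right
    ((isClosed_le continuous_const Complex.continuous_re).inter
      (isOpen_ball.isClosed_compl.inter (isClosed_le continuous_const (by fun_prop))))
  have hKu : ∀ ν ∈ K, IsUnit (ν • (1 : CL(V)) - A p) := by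
    rintro ν ⟨-, hν1, hν2, hν3⟩
    refine isUnit_sub_of_no_eigenvector fun v hv => ?_
    by_contra hv0
    rcases (show 0 ≤ ν.re from hν1).lt_or_eq with hpos | hz
    · exact hν2 (h1 ν v hv hv0 hpos)
    · have := (hrel p ν v hv hv0).eq_neg hp hz.symm
      simp only [this, mem_ofPred_eq, neg_add_cancel, norm_zero] at hν3
      linarith
  refine ⟨fun q => rieszProj c r (A q), (h.jc1 p).rieszProj hr hfree, ?_⟩
  have e1 : ∀ᶠ q in 𝓝 p, ‖A q‖ < ‖A p‖ + 1 := hc.norm.eventually (eventually_lt_nhds (by linarith))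
  have e2 : ∀ᶠ q : X × ℂ in 𝓝 p, ‖q.2 - p.2‖ < ε :=
    (by fun_prop : ContinuousAt (fun q : X × ℂ => ‖q.2 - p.2‖) p).eventually
      (eventually_lt_nhds (by simpa using hε))
  filter_upwards [e1, e2, eventually_isUnit_sub hKc hc hKu, SphereFree.eventually hc hfree] with
    q q1 q2 q3 q4 hq
  refine uproj_eq fun ν x hx hx0 v hv => ?_
  split_ifs with hν
  · refine rieszProj_apply_of_mem_ball q4 ?_ hv
    by_contra hb
    refine hx0 (eq_zero_of_isUnit_sub (q3 ν ⟨?_, hν.le, hb, ?_⟩) hx)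
    · rw [mem_closedBall_zero_iff]
      exact (norm_le_of_eigenvector hx hx0).trans q1.le
    · by_contra hlt
      have := hnear q.2 ν (not_le.1 hlt) q2 hq (hrel q ν x hx hx0)
      linarith
  · exact rieszProj_apply_of_notMem_closedBall hr q4 (fun h => hν (hδ.trans_le (h2 ν h))) hv

theorem mul_rieszProj_eq_zero {M : CL(V)} {r : ℝ} (hr : 0 ≤ r) (hM : SphereFree 0 r M)
    (hs : ∀ x, M (M x) = 0 → M x = 0)
    (he : ∀ (ν : ℂ) (x : V), ‖ν‖ ≤ r → M x = ν • x → x ≠ 0 → ν = 0) :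
    M * rieszProj 0 r M = 0 := by
  refine clm_ext_gen (M := M) fun ν x hx hx0 v hv => ?_
  change M (rieszProj 0 r M v) = 0
  by_cases hν : ‖ν‖ ≤ r
  · have h0 := he ν x hν hx hx0
    subst h0
    have hr' : r ≠ 0 := fun h0 => hx0 (eq_zero_of_isUnit_sub (hM 0 (by simp [h0])) hx)
    rw [rieszProj_apply_of_mem_ball hM (by simpa using hr.lt_of_ne' hr') hv]
    refine maxGenEigenspace_induction (M := M.toLinearMap) (ν := 0)
      (P := fun v => M v = 0) (map_zero _) (fun w _ hw => ?_) v hv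
    simp only [zero_smul, sub_zero] at hw
    exact hs w hw
  · rw [rieszProj_apply_of_notMem_closedBall hr hM (by simpa using hν) hv, map_zero]

theorem exists_radius {s : Set ℂ} (hs : s.Finite) {c d : ℝ} (hd : 0 < d) :
    ∃ t, 0 < t ∧ t < d ∧ ∀ z ∈ s, z ∉ sphere (c : ℂ) (c - t) := by
  have h1 : ((fun z : ℂ => c - dist z c) '' s).Finite := hs.image _
  obtain ⟨t, ht, ht'⟩ := ((Ioo_infinite hd).sdiff h1).nonempty
  refine ⟨t, ht.1, ht.2, fun z hz hzs => ht' ⟨z, hz, ?_⟩⟩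
  rw [mem_sphere] at hzs
  simp only [hzs]
  ring

theorem mem_ball_of_sector {κ : ℂ} {c t d ε : ℝ} (hκ : ‖κ‖ ≤ c) (hre : d ≤ κ.re)
    (him : |κ.im| ≤ ε) (hε : (c - d) ^ 2 + ε ^ 2 < (c - t) ^ 2) (hct : t < c) :
    κ ∈ ball (c : ℂ) (c - t) := by
  rw [mem_ball, dist_eq_norm]
  refine lt_of_pow_lt_pow_left₀ 2 (by linarith) ?_
  rw [Complex.sq_norm, normSq_apply]
  simp only [sub_re, sub_im, ofReal_re, ofReal_im, sub_zero]
  have h1 := re_le_norm κ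
  have h2 : κ.im * κ.im ≤ ε ^ 2 := by
    rw [← abs_mul_abs_self, sq]
    exact mul_self_le_mul_self (abs_nonneg _) him
  nlinarith

theorem exists_local_zero [FirstCountableTopology X] (h : SpectralPencil A₀ A₁) (e : X) :
    ∃ W, JC1 W (e, (0 : ℂ)) ∧
      ∀ᶠ q in 𝓝 (e, (0 : ℂ)), 0 < q.2.re → uproj (A₀ q.1 + q.2 • A₁ q.1) = W q := by
  have : CompleteSpace V := FiniteDimensional.complete ℂ V
  set A : X × ℂ → CL(V) := fun q => A₀ q.1 + q.2 • A₁ q.1 with hA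
  have hrel : ∀ q ν x, A q x = ν • x → x ≠ 0 → SpecRel q.2 ν := fun q => h.rel q.1 q.2
  set p : X × ℂ := (e, 0) with hp
  have hAp : A p = A₀ e := by simp [hA, hp]
  have hc : ContinuousAt A p := (h.jc1 p).1
  have hc₀ : ContinuousAt (fun q : X × ℂ => A₀ q.1) p := (h.cont₀.comp continuous_fst).continuousAt
  obtain ⟨c, r, δ, hr, hδ, hfree, h1, h2⟩ := exists_unstable_circle (A p)
  obtain ⟨ρ₁, hρ₁, hgap⟩ := h.gap e
  obtain ⟨d, hd, hslow⟩ := h.slow e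
  obtain ⟨r₀, hr₀, hr₀δ, hr₀1, hr₀e⟩ : ∃ r₀ : ℝ, 0 < r₀ ∧ r₀ < δ ∧ r₀ < ρ₁ ∧
      ∀ (ν : ℂ) (x : V), ‖ν‖ ≤ r₀ → A p x = ν • x → x ≠ 0 → ν = 0 := by
    have ev : ∀ᶠ t in 𝓝[>] (0 : ℝ), ∀ ν ∈ {ν : ℂ | ∃ v, A p v = ν • v ∧ v ≠ 0} ∩ {0}ᶜ, t < ‖ν‖ :=
      (eventually_all_finite ((finite_eigenvalues (A p)).subset inter_subset_left)).2 fun ν hν =>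
        nhdsWithin_le_nhds (eventually_lt_nhds (norm_pos_iff.2 hν.2))
    have ev1 : ∀ᶠ t in 𝓝[>] (0 : ℝ), t < δ := nhdsWithin_le_nhds (eventually_lt_nhds hδ)
    have ev2 : ∀ᶠ t in 𝓝[>] (0 : ℝ), t < ρ₁ := nhdsWithin_le_nhds (eventually_lt_nhds hρ₁)
    obtain ⟨t, t1, t2, t3, t4⟩ := (ev.and (ev1.and (ev2.and self_mem_nhdsWithin))).exists
    refine ⟨t, t4, t2, t3, fun ν x hν hx hx0 => ?_⟩
    by_contra h0
    have := t1 ν ⟨⟨x, hx, hx0⟩, h0⟩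
    linarith
  have hfree0 : SphereFree 0 r₀ (A p) := fun z hz => isUnit_sub_of_no_eigenvector fun v hv => by
    by_contra hv0
    rw [mem_sphere_zero_iff_norm] at hz
    have := hr₀e z v hz.le hv hv0
    rw [this, norm_zero] at hz
    linarith
  have hfree0' : SphereFree 0 r₀ (A₀ e) := hAp ▸ hfree0
  set M : X × ℂ → CL(V) := fun q => slowPart r₀ (A₀ q.1) (A₁ q.1) (A q) with hM
  have hMj : JC1 M p := JC1.slowPart hr₀.le h.cont₀ h.cont₁ hfree0' hfree0
  set R : ℝ := ‖M p‖ + 1 + d with hR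
  have hRd : d < R := by have := norm_nonneg (M p); linarith
  obtain ⟨t, ht0, htd, htfree⟩ := exists_radius (finite_eigenvalues (M p)) (half_pos hd) (c := R)
  have hfreeM : SphereFree (R : ℂ) (R - t) (M p) := fun z hz =>
    isUnit_sub_of_no_eigenvector fun v hv => by
      by_contra hv0
      exact htfree z ⟨v, hv, hv0⟩ hz
  obtain ⟨ε, hε0, hεd, hε⟩ : ∃ ε : ℝ, 0 < ε ∧ ε < d / 2 ∧
      (R - d / 2) ^ 2 + ε ^ 2 < (R - t) ^ 2 := by
    have ev1 : ∀ᶠ ε in 𝓝[>] (0 : ℝ), ε < d / 2 :=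
      nhdsWithin_le_nhds (eventually_lt_nhds (half_pos hd))
    have ev2 : ∀ᶠ ε in 𝓝[>] (0 : ℝ), (R - d / 2) ^ 2 + ε ^ 2 < (R - t) ^ 2 := by
      refine nhdsWithin_le_nhds (ContinuousAt.eventually_lt (by fun_prop) (by fun_prop) ?_)
      nlinarith
    obtain ⟨ε, a, b, cc⟩ := (ev1.and (ev2.and self_mem_nhdsWithin)).exists
    exact ⟨ε, cc, a, b⟩
  obtain ⟨ρ₂, hρ₂, hslow⟩ := hslow ε hε0
  set K : Set ℂ := (closedBall 0 (‖A p‖ + 1) ∩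
    ({ν | 0 ≤ ν.re} ∩ ((ball c r)ᶜ ∩ {ν | r₀ ≤ ‖ν‖}))) ∪
    (closedBall 0 r₀ ∩ {ν | ρ₂ ≤ ‖ν‖}) with hK
  have hKc : IsCompact K := ((isCompact_closedBall _ _).inter_right
    ((isClosed_le continuous_const Complex.continuous_re).inter
      (isOpen_ball.isClosed_compl.inter (isClosed_le continuous_const (by fun_prop))))).union
    ((isCompact_closedBall _ _).inter_right (isClosed_le continuous_const (by fun_prop)))
  have hKu : ∀ ν ∈ K, IsUnit (ν • (1 : CL(V)) - A p) := by
    intro ν hν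
    refine isUnit_sub_of_no_eigenvector fun v hv => ?_
    by_contra hv0
    rcases hν with ⟨-, hν1, hν2, hν3⟩ | ⟨hν1, hν2⟩
    · rcases (show 0 ≤ ν.re from hν1).lt_or_eq with hpos | hz
      · exact hν2 (h1 ν v hv hv0 hpos)
      · have := (hrel p ν v hv hv0).eq_neg le_rfl hz.symm
        simp only [this, mem_ofPred_eq, hp, norm_zero, neg_zero] at hν3
        linarith
    · have := hr₀e ν v (by simpa using hν1) hv hv0
      simp only [this, mem_ofPred_eq, norm_zero] at hν2
      linarith
  refine ⟨fun q => rieszProj c r (A q) + rieszProj (R : ℂ) (R - t) (M q),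
    ((h.jc1 p).rieszProj hr hfree).add (hMj.rieszProj (by linarith) hfreeM), ?_⟩
  have e1 : ∀ᶠ q in 𝓝 p, ‖A q‖ < ‖A p‖ + 1 := hc.norm.eventually (eventually_lt_nhds (by linarith))
  have e2 : ∀ᶠ q in 𝓝 p, ‖M q‖ < R :=
    hMj.1.norm.eventually (eventually_lt_nhds (by rw [hR]; linarith))
  have e3 : ∀ᶠ q : X × ℂ in 𝓝 p, ∀ (ν : ℂ) (x : V), ‖ν‖ < ρ₁ → A₀ q.1 x = ν • x → x ≠ 0 → ν = 0 :=
    (continuous_fst.tendsto (e, (0 : ℂ))).eventually hgap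
  filter_upwards [e1, e2, e3, eventually_isUnit_sub hKc hc hKu, SphereFree.eventually hc hfree,
    SphereFree.eventually hc hfree0, SphereFree.eventually hc₀ hfree0',
    SphereFree.eventually hMj.1 hfreeM, hslow] with q q1 q2 q3 q4 q5 q6 q7 q8 q9 hq
  have hl0 : q.2 ≠ 0 := fun h0 => by simp [h0] at hq
  have hsm : q.2 • M q = A q * rieszProj 0 r₀ (A q) := smul_slowPart hr₀.le q7 q6
    (mul_rieszProj_eq_zero hr₀.le q7 (h.semisimple q.1) fun ν x hν => q3 ν x (hν.trans_lt hr₀1))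
  have hMa : ∀ v, M q v = q.2⁻¹ • A q (rieszProj 0 r₀ (A q) v) := fun v => by
    have := congrArg (fun L : CL(V) => q.2⁻¹ • L v) hsm
    simpa [smul_smul, inv_mul_cancel₀ hl0] using this
  refine uproj_eq fun ν x hx hx0 v hv => ?_
  change rieszProj c r (A q) v + rieszProj (R : ℂ) (R - t) (M q) v = _
  by_cases hν0 : ‖ν‖ < r₀
  · have hmem : ν ∈ ball (0 : ℂ) r₀ := by simpa using hν0
    have hν2 : ‖ν‖ < ρ₂ := by
      by_contra hcon
      exact hx0 (eq_zero_of_isUnit_sub (q4 ν (Or.inr ⟨by simpa using hν0.le, not_lt.1 hcon⟩)) hx)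
    rw [rieszProj_apply_of_notMem_closedBall hr q5 (fun hb => by
      have := h2 ν hb
      have := re_le_norm ν
      linarith) hv, zero_add]
    set κ : ℂ := ν / q.2 with hκ
    have hκν : κ * q.2 = ν := div_mul_cancel₀ ν hl0
    have hMv : ∀ w ∈ maxGenEigenspace (A q).toLinearMap ν,
        M q w - κ • w = q.2⁻¹ • (A q w - ν • w) := fun w hw => by
      rw [hMa, rieszProj_apply_of_mem_ball q6 hmem hw, smul_sub, smul_smul, hκ, div_eq_inv_mul]
    have hgen : v ∈ maxGenEigenspace (M q).toLinearMap κ := by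
      refine maxGenEigenspace_induction (M := (A q).toLinearMap) (ν := ν)
        (P := fun v => v ∈ maxGenEigenspace (M q).toLinearMap κ)
        (Submodule.zero_mem _) (fun w hw ih => mem_maxGenEigenspace_of_map_sub ?_) v hv
      change M q w - κ • w ∈ _
      rw [hMv w hw]
      exact Submodule.smul_mem _ _ ih
    have hxM : M q x = κ • x := by
      have hxg : x ∈ maxGenEigenspace (A q).toLinearMap ν := by
        refine mem_maxGenEigenspace_of_map_sub ?_
        change A q x - ν • x ∈ _
        rw [hx, sub_self]
        exact Submodule.zero_mem _
      have := hMv x hxg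
      rwa [hx, sub_self, smul_zero, sub_eq_zero] at this
    have hκR : ‖κ‖ ≤ R := (norm_le_of_eigenvector hxM hx0).trans q2.le
    obtain ⟨s1, s2⟩ := q9 hq ν x hν2 hx hx0
    have hrel' : SpecRel q.2 (κ * q.2) := hκν ▸ hrel q ν x hx hx0
    have habs : d / 2 ≤ |κ.re| := by
      have := Complex.norm_le_abs_re_add_abs_im κ
      linarith
    have hsign := hrel'.re_mul_pos_of_ratio hq (by linarith)
    rw [hκν] at hsign
    rcases le_total 0 κ.re with hs | hs
    · rw [abs_of_nonneg hs] at habs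
      rw [if_pos (pos_of_mul_pos_right hsign hs), rieszProj_apply_of_mem_ball q8
        (mem_ball_of_sector hκR habs s2 hε (by linarith)) hgen]
    · rw [abs_of_nonpos hs] at habs
      rw [if_neg (neg_of_mul_pos_right hsign hs).not_gt, rieszProj_apply_of_notMem_closedBall (by linarith) q8 ?_ hgen]
      intro hb
      rw [mem_closedBall, dist_eq_norm] at hb
      have h3 := (abs_re_le_norm _).trans hb
      rw [sub_re, ofReal_re] at h3
      have := neg_abs_le (κ.re - R)
      linarith
  · have hout : ν ∉ closedBall (0 : ℂ) r₀ := by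
      intro hb
      have hn : ‖ν‖ = r₀ := le_antisymm (by simpa using hb) (not_lt.1 hν0)
      exact hx0 (eq_zero_of_isUnit_sub (q6 ν (by simpa using hn)) hx)
    have hgen : v ∈ maxGenEigenspace (M q).toLinearMap 0 := by
      refine mem_maxGenEigenspace_of_map_sub ?_
      change M q v - (0 : ℂ) • v ∈ _
      rw [hMa, rieszProj_apply_of_notMem_closedBall hr₀.le q6 hout hv, map_zero, smul_zero,
        zero_smul, sub_zero]
      exact Submodule.zero_mem _
    rw [rieszProj_apply_of_notMem_closedBall (by linarith) q8 (fun hb => by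
      rw [mem_closedBall, dist_eq_norm] at hb
      have h3 := (abs_re_le_norm _).trans hb
      rw [sub_re, ofReal_re, Complex.zero_re, zero_sub, abs_neg, abs_of_pos (by linarith)] at h3
      linarith) hgen, add_zero]
    split_ifs with hν
    · refine rieszProj_apply_of_mem_ball q5 ?_ hv
      by_contra hb
      refine hx0 (eq_zero_of_isUnit_sub (q4 ν (Or.inl ⟨?_, hν.le, hb, not_lt.1 hν0⟩)) hx)
      rw [mem_closedBall_zero_iff]
      exact (norm_le_of_eigenvector hx hx0).trans q1.le
    · exact rieszProj_apply_of_notMem_closedBall hr q5 (fun h => hν (hδ.trans_le (h2 ν h))) hv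

theorem exists_local [FirstCountableTopology X] (h : SpectralPencil A₀ A₁) {p : X × ℂ}
    (hp : 0 ≤ p.2.re) : ∃ W, JC1 W p ∧
      ∀ᶠ q in 𝓝 p, 0 < q.2.re → uproj (A₀ q.1 + q.2 • A₁ q.1) = W q := by
  by_cases h0 : p.2 = 0
  · have := h.exists_local_zero p.1
    rwa [← h0] at this
  · exact h.exists_local_ne_zero hp h0

/-- The unstable projection and its derivative extend continuously to the closed half-plane. -/
theorem exists_extension [FirstCountableTopology X] (h : SpectralPencil A₀ A₁) :
    ∃ P P' : X × ℂ → CL(V), (∀ e l, 0 < l.re → P (e, l) = uproj (A₀ e + l • A₁ e)) ∧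
      (∀ e l, 0 < l.re → HasDerivAt (fun l => P (e, l)) (P' (e, l)) l) ∧
      ContinuousOn P {q | 0 ≤ q.2.re} ∧ ContinuousOn P' {q | 0 ≤ q.2.re} := by
  set U : X × ℂ → CL(V) := fun q => uproj (A₀ q.1 + q.2 • A₁ q.1) with hU
  set U' : X × ℂ → CL(V) := fun q => deriv (fun l => U (q.1, l)) q.2 with hU'
  set S : Set (X × ℂ) := {q | 0 < q.2.re} with hS
  have hSo : IsOpen S := isOpen_lt continuous_const (by fun_prop)
  have hcl : {q : X × ℂ | 0 ≤ q.2.re} ⊆ closure S := by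
    rintro ⟨e, l⟩ hl
    have ht : Tendsto (fun t : ℝ => (e, l + t)) (𝓝[>] 0) (𝓝 (e, l)) := by
      have : ContinuousAt (fun t : ℝ => (e, l + (t : ℂ))) 0 := by fun_prop
      have h2 := this.tendsto.mono_left (nhdsWithin_le_nhds (s := Ioi 0))
      simpa using h2
    refine mem_closure_of_tendsto ht ?_
    filter_upwards [self_mem_nhdsWithin] with t htp
    have h1 : 0 < t := htp
    have h2 : 0 ≤ l.re := hl
    simp only [hS, mem_ofPred_eq, Complex.add_re, ofReal_re]
    linarith
  have key : ∀ q : X × ℂ, 0 ≤ q.2.re → ∃ W W', ContinuousAt W q ∧ ContinuousAt W' q ∧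
      (∀ᶠ q' in 𝓝 q, q' ∈ S → U q' = W q' ∧ U' q' = W' q' ∧
        HasDerivAt (fun l => U (q'.1, l)) (U' q') q'.2) := by
    intro q hq
    obtain ⟨W, ⟨w1, W', w2, w3⟩, w4⟩ := h.exists_local hq
    refine ⟨W, W', w1, w3, ?_⟩
    filter_upwards [w2, w4.eventually_nhds] with q' b1 b2 hq'
    have hev : ∀ᶠ l in 𝓝 q'.2, U (q'.1, l) = W (q'.1, l) := by
      have c1 : ContinuousAt (fun l : ℂ => (q'.1, l)) q'.2 := by fun_prop
      have c2 : ∀ᶠ l in 𝓝 q'.2, (q'.1, l) ∈ S :=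
        c1.eventually (p := fun x => x ∈ S) (hSo.mem_nhds hq')
      filter_upwards [c1.eventually b2, c2] with l d1 d2 using d1 d2
    have hd : HasDerivAt (fun l => U (q'.1, l)) (W' q') q'.2 := b1.congr_of_eventuallyEq hev
    have : U' q' = W' q' := hd.deriv
    exact ⟨b2.self_of_nhds hq', this, this ▸ hd⟩
  have ext : ∀ F : X × ℂ → CL(V), (∀ q : X × ℂ, 0 ≤ q.2.re → ∃ W, ContinuousAt W q ∧
      ∀ᶠ q' in 𝓝 q, q' ∈ S → F q' = W q') →
      (∀ q ∈ S, extendFrom S F q = F q) ∧ ContinuousOn (extendFrom S F) {q | 0 ≤ q.2.re} := by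
    intro F hF
    have hlim : ∀ q : X × ℂ, 0 ≤ q.2.re → ∃ y, Tendsto F (𝓝[S] q) (𝓝 y) ∧ (q ∈ S → F q = y) := by
      intro q hq
      obtain ⟨W, w1, w2⟩ := hF q hq
      refine ⟨W q, (w1.tendsto.mono_left nhdsWithin_le_nhds).congr' ?_, w2.self_of_nhds⟩
      filter_upwards [w2.filter_mono nhdsWithin_le_nhds, self_mem_nhdsWithin] with q' a b
      exact (a b).symm
    refine ⟨fun q hq => ?_, continuousOn_extendFrom hcl fun q hq => ?_⟩
    · obtain ⟨y, h1, h2⟩ := hlim q (le_of_lt hq)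
      rw [h2 hq]
      exact extendFrom_eq (subset_closure hq) h1
    · obtain ⟨y, h1, -⟩ := hlim q hq
      exact ⟨y, h1⟩
  obtain ⟨hP, hPc⟩ := ext U fun q hq => by
    obtain ⟨W, W', w1, w2, w3⟩ := key q hq
    exact ⟨W, w1, w3.mono fun q' a b => (a b).1⟩
  obtain ⟨hP', hPc'⟩ := ext U' fun q hq => by
    obtain ⟨W, W', w1, w2, w3⟩ := key q hq
    exact ⟨W', w2, w3.mono fun q' a b => (a b).2.1⟩
  refine ⟨extendFrom S U, extendFrom S U', fun e l hl => hP (e, l) hl, fun e l hl => ?_, hPc, hPc'⟩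
  obtain ⟨W, W', w1, w2, w3⟩ := key (e, l) (le_of_lt hl)
  rw [hP' (e, l) hl]
  refine (w3.self_of_nhds hl).2.2.congr_of_eventuallyEq ?_
  have c1 : ContinuousAt (fun l : ℂ => (e, l)) l := by fun_prop
  filter_upwards [c1.eventually (p := fun x => x ∈ S) (hSo.mem_nhds hl)] with l' hl'
  exact hP (e, l') hl'

end SpectralPencil

end Spectral

/-! ### The limiting coefficient matrices -/

def toCLM {n : ℕ} : Matrix (Fin n) (Fin n) ℂ →ₗ[ℂ] CL(Fin n → ℂ) :=
  (LinearMap.toContinuousLinearMap : _ ≃ₗ[ℂ] CL(Fin n → ℂ)).toLinearMap ∘ₗ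
    (Matrix.toLin' : _ ≃ₗ[ℂ] ((Fin n → ℂ) →ₗ[ℂ] (Fin n → ℂ))).toLinearMap

theorem toCLM_apply {n : ℕ} (M : Matrix (Fin n) (Fin n) ℂ) (x : Fin n → ℂ) :
    toCLM M x = M.mulVec x := rfl

theorem continuous_toCLM {n : ℕ} :
    Continuous (toCLM : Matrix (Fin n) (Fin n) ℂ → CL(Fin n → ℂ)) :=
  LinearMap.continuous_of_finiteDimensional _

theorem toCLM_mul {n : ℕ} (M N : Matrix (Fin n) (Fin n) ℂ) :
    toCLM (M * N) = toCLM M * toCLM N := by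
  ext x : 1
  change (M * N).mulVec x = M.mulVec (N.mulVec x)
  rw [Matrix.mulVec_mulVec]

theorem toCLM_one {n : ℕ} : toCLM (1 : Matrix (Fin n) (Fin n) ℂ) = 1 := by
  ext x : 1
  exact Matrix.one_mulVec x

theorem reduced_eigen {v s c B I μ₀ τ μ l ν u V V' w W α : ℂ} (hτ : τ ≠ 0) (hμ : μ ≠ 0)
    (hs : s = c + B ^ 2 / μ₀)
    (hν : ν ≠ 0) (hνl : ν ≠ -l)
    (e1 : l * V + V' = ν * u) (e2 : V' = ν * V)
    (e3 : l * (v / τ) * u + l * (v / τ) * V + ((v - c - B ^ 2 / μ₀) / τ - l) * V' +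
      I * B / (μ₀ * μ * τ) * W - l * (B / (μ₀ * τ)) * α = ν * V')
    (e4 : 1 / μ * W = ν * w)
    (e5 : I * B / μ₀ * V' + l * v * w + (v - I ^ 2 / μ₀) / μ * W + l * (I / μ₀) * α = ν * W)
    (e6 : I / μ * W - l * α = ν * α) :
    ∃ ζ ω : ℂ, l = ν * (ζ - 1) ∧ (V = 0 ∧ ω = 0 → u = 0 ∧ V' = 0 ∧ w = 0 ∧ W = 0 ∧ α = 0) ∧
      (v * ζ ^ 2 - s - τ * (ν * ζ)) * V = -(I * B / μ₀) * ω ∧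
      (v * ζ ^ 2 - I ^ 2 / μ₀ - μ * (ν * ζ)) * ω = -(I * B / μ₀) * V := by
  have hn : ν + l ≠ 0 := fun h => hνl (eq_neg_of_add_eq_zero_left h)
  obtain ⟨ζ, hζ⟩ : ∃ ζ, ζ = (ν + l) / ν := ⟨_, rfl⟩
  have hζ0 : ζ ≠ 0 := by rw [hζ]; exact div_ne_zero hn hν
  have hl : l = ν * (ζ - 1) := by rw [hζ]; field_simp; ring
  obtain ⟨ω, hω⟩ : ∃ ω, ω = w / ζ := ⟨_, rfl⟩
  have hw : w = ζ * ω := by rw [hω]; field_simp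
  have hW : W = μ * (ν * w) := by rw [← e4]; field_simp
  have hu : u = ζ * V := by
    apply mul_left_cancel₀ hν
    rw [← e1, e2, hl]; ring
  have hα : α = I * ω := by
    have h1 : (ν * ζ) * α = (ν * ζ) * (I * ω) := by
      have : I / μ * W = I * (ν * w) := by rw [hW]; field_simp
      rw [this, hl] at e6
      linear_combination (-1 : ℂ) * e6 + I * ν * hw
    exact mul_left_cancel₀ (mul_ne_zero hν hζ0) h1
  refine ⟨ζ, ω, hl, ?_, ?_, ?_⟩
  · rintro ⟨rfl, rfl⟩
    have hw0 : w = 0 := by rw [hw, mul_zero]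
    exact ⟨by rw [hu, mul_zero], by rw [e2, mul_zero], hw0, by rw [hW, hw0]; ring,
      by rw [hα, mul_zero]⟩
  · have e3' : ν * (l * v * u + l * v * V + ((v - c - B ^ 2 / μ₀) - l * τ) * V' +
      I * B / μ₀ * (ν * w) - l * (B / μ₀) * α) = ν * (ν * V' * τ) := by
      rw [← e3, hW]
      field_simp
    have e3'' := mul_left_cancel₀ hν e3'
    apply mul_left_cancel₀ hν
    rw [hu, e2, hw, hα, hl] at e3''
    rw [hs]
    linear_combination e3''
  · have e5' : I * B / μ₀ * V' + l * v * w + (v - I ^ 2 / μ₀) * (ν * w) + l * (I / μ₀) * α =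
        ν * (μ * (ν * w)) := by
      rw [← hW, ← e5, hW]
      field_simp
    apply mul_left_cancel₀ hν
    rw [e2, hw, hα, hl] at e5'
    linear_combination e5'

theorem specRel_of_reduced {v s11 s12 K τ μ : ℝ} {l ν ζ V ω : ℂ} (hv : 0 < v) (hτ : 0 < τ)
    (hμ : 0 < μ) (hs : 0 ≤ s11) (hK : 0 ≤ K) (hdet : s12 ^ 2 ≤ s11 * K)
    (hl : l = ν * (ζ - 1)) (hνl : ν ≠ -l) (hν : ν ≠ 0) (hne : ¬(V = 0 ∧ ω = 0))
    (h1 : (v * ζ ^ 2 - s11 - τ * (ν * ζ)) * V = s12 * ω)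
    (h2 : (v * ζ ^ 2 - K - μ * (ν * ζ)) * ω = s12 * V) : SpecRel l ν := by
  have hζ : ζ ≠ 0 := by
    rintro rfl
    exact hνl (by rw [hl]; ring)
  set nV := normSq V with hnV
  set nω := normSq ω with hnω
  set x := (V * (starRingEnd ℂ) ω).re with hx
  have p1 : 0 ≤ nV := normSq_nonneg _
  have p2 : 0 ≤ nω := normSq_nonneg _
  have p3 : 0 < nV + nω := by
    rcases p1.lt_or_eq with h | h
    · linarith
    · rcases p2.lt_or_eq with h' | h'
      · linarith
      · exact absurd ⟨Complex.normSq_eq_zero.1 h.symm, Complex.normSq_eq_zero.1 h'.symm⟩ hne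
  have p4 : x ^ 2 ≤ nV * nω := by
    have : x ^ 2 ≤ ‖V * (starRingEnd ℂ) ω‖ ^ 2 := by
      rw [← sq_abs]
      exact pow_le_pow_left₀ (abs_nonneg _) (abs_re_le_norm _) 2
    rwa [Complex.sq_norm, Complex.normSq_mul, Complex.normSq_conj] at this
  set S := s11 * nV + K * nω + 2 * s12 * x with hS
  have p5 : 0 ≤ S := by
    have q1 : (2 * s12 * x) ^ 2 ≤ (s11 * nV + K * nω) ^ 2 := by
      have a1 : (2 * s12 * x) ^ 2 = 4 * (s12 ^ 2 * x ^ 2) := by ring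
      have a2 : s12 ^ 2 * x ^ 2 ≤ (s11 * K) * (nV * nω) :=
        mul_le_mul hdet p4 (sq_nonneg _) (mul_nonneg hs hK)
      nlinarith [sq_nonneg (s11 * nV - K * nω)]
    have q2 := abs_le_of_sq_le_sq q1 (by positivity)
    linarith [neg_le_of_abs_le q2]
  have hsum : ζ * ν * ((τ * nV + μ * nω : ℝ) : ℂ) = v * ζ ^ 2 * ((nV + nω : ℝ) : ℂ) - (S : ℝ) := by
    have c1 : ((nV : ℝ) : ℂ) = V * (starRingEnd ℂ) V := (Complex.mul_conj V).symm
    have c2 : ((nω : ℝ) : ℂ) = ω * (starRingEnd ℂ) ω := (Complex.mul_conj ω).symm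
    have c3 : ((2 * x : ℝ) : ℂ) = V * (starRingEnd ℂ) ω + (starRingEnd ℂ) V * ω := by
      have := Complex.add_conj (V * (starRingEnd ℂ) ω)
      rw [map_mul, Complex.conj_conj] at this
      rw [this, hx]
    have c4 : ((S : ℝ) : ℂ) = s11 * (V * (starRingEnd ℂ) V) + K * (ω * (starRingEnd ℂ) ω) +
        s12 * (V * (starRingEnd ℂ) ω + (starRingEnd ℂ) V * ω) := by
      rw [← c1, ← c2, ← c3, hS]; push_cast; ring
    rw [c4]
    push_cast
    rw [c1, c2]
    linear_combination (-(starRingEnd ℂ) V) * h1 - (starRingEnd ℂ) ω * h2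
  refine ⟨fun h => absurd h hν, Or.inr (Or.inr ⟨normSq ζ * normSq ν * (τ * nV + μ * nω),
    normSq ζ * (v * (nV + nω)) + S, ?_, ?_, ?_⟩)⟩
  · have : 0 < τ * nV + μ * nω := by
      rcases p1.lt_or_eq with h | h
      · nlinarith [mul_pos hτ h, mul_nonneg hμ.le p2]
      · rw [← h] at p3 ⊢
        nlinarith [mul_pos hμ (by linarith : 0 < nω)]
    exact mul_pos (mul_pos (normSq_pos.2 hζ) (normSq_pos.2 hν)) this
  · have := mul_pos (normSq_pos.2 hζ) (mul_pos hv p3)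
    linarith
  · have i1 : normSq ν * ζ.im = l.im * ν.re - l.re * ν.im := by
      rw [hl, normSq_apply]
      simp only [mul_im, mul_re, sub_re, sub_im, Complex.one_re, Complex.one_im]
      ring
    have i2 : normSq ζ * ν.im * (τ * nV + μ * nω) = (normSq ζ * (v * (nV + nω)) + S) * ζ.im := by
      have h3 := congrArg (fun z => ((starRingEnd ℂ) ζ * z).im) hsum
      have h4 : (starRingEnd ℂ) ζ * (ζ * ν * ((τ * nV + μ * nω : ℝ) : ℂ)) =
          ((normSq ζ : ℝ) : ℂ) * (ν * ((τ * nV + μ * nω : ℝ) : ℂ)) := by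
        rw [← Complex.mul_conj]; ring
      have h5 : (starRingEnd ℂ) ζ * (v * ζ ^ 2 * ((nV + nω : ℝ) : ℂ) - (S : ℝ)) =
          ((normSq ζ : ℝ) : ℂ) * (((v * (nV + nω) : ℝ) : ℂ) * ζ) -
            ((S : ℝ) : ℂ) * (starRingEnd ℂ) ζ := by
        rw [← Complex.mul_conj]; push_cast; ring
      simp only [h4, h5, sub_im, Complex.im_ofReal_mul, Complex.im_mul_ofReal,
        Complex.conj_im] at h3
      linarith
    rw [← i1]
    linear_combination normSq ν * i2

theorem im_eq_zero_of_real_det {v s11 s12 K : ℝ} {ζ : ℂ} (hv : 0 < v) (hs : 0 ≤ s11) (hK : 0 ≤ K)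
    (hdet : s12 ^ 2 ≤ s11 * K) (h : ((v : ℂ) * ζ ^ 2 - s11) * (v * ζ ^ 2 - K) = (s12 : ℂ) ^ 2) :
    ζ.im = 0 := by
  obtain ⟨t, ht⟩ : ∃ t : ℂ, t = v * ζ ^ 2 := ⟨_, rfl⟩
  rw [← ht] at h
  have hre := congrArg Complex.re h
  have him := congrArg Complex.im h
  simp only [sq, mul_re, mul_im, sub_re, sub_im, ofReal_re,
    ofReal_im, sub_zero, mul_zero, zero_mul, add_zero] at hre him
  have hy : t.im = 0 := by
    by_contra hy
    have hx : 2 * t.re - s11 - K = 0 := by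
      apply mul_left_cancel₀ hy
      linear_combination him
    have hx' : t.re = (s11 + K) / 2 := by linarith
    rw [hx'] at hre
    have := mul_self_pos.2 hy
    nlinarith [sq_nonneg (s11 - K), mul_self_nonneg s12]
  have hx : 0 ≤ t.re := by
    rw [hy] at hre
    by_contra hx
    rw [not_le] at hx
    nlinarith [mul_pos_of_neg_of_neg hx hx]
  have r1 := congrArg Complex.re ht
  have r2 := congrArg Complex.im ht
  simp only [sq, mul_re, mul_im, ofReal_re, ofReal_im, zero_mul, sub_zero, add_zero] at r1 r2
  rw [hy] at r2
  by_contra hi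
  have a1 : ζ.re = 0 := by
    have : (2 * v * ζ.im) * ζ.re = 0 := by linear_combination -r2
    exact (mul_eq_zero.1 this).resolve_left (by positivity)
  rw [a1] at r1
  have := mul_pos hv (mul_self_pos.2 hi)
  linarith

namespace MHD

variable (m : MHD)

/-- The entry `c + B² / μ₀` of the symmetric matrix governing the characteristic speeds. -/
def s11 (c B : ℝ) : ℝ := c + B ^ 2 / m.μ₀

def s12 (B : ℝ) : ℝ := -(m.I * B / m.μ₀)

/-- Noncharacteristic end states, given by `v`, `c = a γ v ^ (-γ)` and `B`. -/
def endStates : Set (ℝ × ℝ²) :=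
  {e | 0 < e.1 ∧ 0 ≤ e.2.1 ∧ (e.1 - m.s11 e.2.1 e.2.2) * (e.1 - m.K) ≠ m.s12 e.2.2 ^ 2}

/-- The limiting coefficient matrix at `z = 0`. -/
def endMat₀ (e : ℝ × ℝ²) : Matrix (Fin 6) (Fin 6) ℂ := !![0, 0, 1, 0, 0, 0;
     0, 0, 1, 0, 0, 0;
     0, 0, ((e.1 - e.2.1 - e.2.2 ^ 2 / m.μ₀) / m.τ : ℝ), 0,
       (m.I * e.2.2 / (m.μ₀ * m.μ * m.τ) : ℝ), 0;
     0, 0, 0, 0, (1 / m.μ : ℝ), 0;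
     0, 0, (m.I * e.2.2 / m.μ₀ : ℝ), 0, ((e.1 - m.K) / m.μ : ℝ), 0;
     0, 0, 0, 0, (m.I / m.μ : ℝ), 0]

/-- The coefficient of `z` in the limiting coefficient matrix. -/
def endMat₁ (e : ℝ × ℝ²) : Matrix (Fin 6) (Fin 6) ℂ := !![0, 1, 0, 0, 0, 0;
     0, 0, 0, 0, 0, 0;
     (e.1 / m.τ : ℝ), (e.1 / m.τ : ℝ), -1, 0, 0, -(e.2.2 / (m.μ₀ * m.τ) : ℝ);
     0, 0, 0, 0, 0, 0;
     0, 0, 0, (e.1 : ℝ), 0, (m.I / m.μ₀ : ℝ);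
     0, 0, 0, 0, 0, -1]

notation "𝐋(" m ", " e ", " z ")" => toCLM (endMat₀ m e) + z • toCLM (endMat₁ m e)

theorem tau_pos : 0 < m.τ := m.τ_pos

theorem K_nonneg : 0 ≤ m.K := div_nonneg (sq_nonneg _) m.μ₀_pos.le

theorem s11_nonneg {c : ℝ} (hc : 0 ≤ c) (B : ℝ) : 0 ≤ m.s11 c B :=
  add_nonneg hc (div_nonneg (sq_nonneg _) m.μ₀_pos.le)

theorem s12_sq_le {c : ℝ} (hc : 0 ≤ c) (B : ℝ) : m.s12 B ^ 2 ≤ m.s11 c B * m.K := by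
  have h := mul_nonneg hc m.K_nonneg
  have e : m.s12 B ^ 2 = B ^ 2 / m.μ₀ * m.K := by rw [s12, K]; ring
  rw [e, s11, add_mul]
  linarith

theorem evansMatrix_eq_endMat {a v w : ℝ} (z : ℂ) (hv : 0 < v) (h1 : m.fieldV a v w = 0)
    (h2 : m.fieldW v w = 0) : m.evansMatrix a z v w =
      m.endMat₀ (v, a * m.γ * v ^ (-m.γ), m.magField v w) +
        z • m.endMat₁ (v, a * m.γ * v ^ (-m.γ), m.magField v w) := by
  have hf : m.fFun a v w - m.magField v w ^ 2 / (m.μ₀ * m.τ) =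
      (v - a * m.γ * v ^ (-m.γ) - m.magField v w ^ 2 / m.μ₀) / m.τ := by
    have hp : v ^ (m.γ + 1) * v ^ (-m.γ - 1) = 1 := by rw [← Real.rpow_add hv]; simp
    have hh : m.hFun a v w = a * m.γ := by
      rw [hFun, h1]
      linear_combination a * m.γ * hp
    rw [fFun, hh]
    have := m.μ₀_pos.ne'
    have := m.tau_pos.ne'
    field_simp
  have hW : m.μ * m.fieldW v w / v + m.I * m.magField v w / m.μ₀ =
      m.I * m.magField v w / m.μ₀ := by rw [h2]; simp
  simp only [evansMatrix]
  rw [hf, hW]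
  ext i j
  fin_cases i <;> fin_cases j <;> simp [endMat₀, endMat₁] <;> ring

theorem continuous_endMat₀ : Continuous m.endMat₀ := by
  refine continuous_matrix fun i j => ?_
  fin_cases i <;> fin_cases j <;> simp [endMat₀] <;> fun_prop

theorem continuous_endMat₁ : Continuous m.endMat₁ := by
  refine continuous_matrix fun i j => ?_
  fin_cases i <;> fin_cases j <;> simp [endMat₁] <;> fun_prop

variable {m}

theorem endMat_apply (e : ℝ × ℝ²) (l : ℂ) (x : Fin 6 → ℂ) :
    𝐋(m, e, l) x = ![l * x 1 + x 2, x 2,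
        l * (e.1 / m.τ) * x 0 + l * (e.1 / m.τ) * x 1 +
          ((e.1 - e.2.1 - (e.2.2 : ℂ) ^ 2 / m.μ₀) / m.τ - l) * x 2 +
          m.I * e.2.2 / (m.μ₀ * m.μ * m.τ) * x 4 - l * (e.2.2 / (m.μ₀ * m.τ)) * x 5,
        1 / m.μ * x 4,
        m.I * e.2.2 / m.μ₀ * x 2 + l * e.1 * x 3 + (e.1 - (m.I : ℂ) ^ 2 / m.μ₀) / m.μ * x 4 +
          l * (m.I / m.μ₀) * x 5,
        m.I / m.μ * x 4 - l * x 5] := by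
  have : 𝐋(m, e, l) x =
    (m.endMat₀ e).mulVec x + l • (m.endMat₁ e).mulVec x := rfl
  rw [this]
  ext i
  fin_cases i <;>
    simp [endMat₀, endMat₁, dotProduct, Fin.sum_univ_six, K] <;> ring

theorem exists_reduced {e : ℝ × ℝ²} {l ν : ℂ} {x : Fin 6 → ℂ}
    (hx : 𝐋(m, e, l) x = ν • x) (hx0 : x ≠ 0) (hν : ν ≠ 0)
    (hνl : ν ≠ -l) : ∃ ζ V ω : ℂ, l = ν * (ζ - 1) ∧ ¬ (V = 0 ∧ ω = 0) ∧
      ((e.1 : ℂ) * ζ ^ 2 - (m.s11 e.2.1 e.2.2 : ℝ) - m.τ * (ν * ζ)) * V = (m.s12 e.2.2 : ℝ) * ω ∧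
      ((e.1 : ℂ) * ζ ^ 2 - (m.K : ℝ) - m.μ * (ν * ζ)) * ω = (m.s12 e.2.2 : ℝ) * V := by
  rw [endMat_apply] at hx
  have hτ : (m.τ : ℂ) ≠ 0 := by exact_mod_cast m.tau_pos.ne'
  have hμ : (m.μ : ℂ) ≠ 0 := by exact_mod_cast m.μ_pos.ne'
  have e1 := congrFun hx 0
  have e2 := congrFun hx 1
  have e3 := congrFun hx 2
  have e4 := congrFun hx 3
  have e5 := congrFun hx 4
  have e6 := congrFun hx 5
  simp only [Matrix.cons_val, Pi.smul_apply, smul_eq_mul] at e1 e2 e3 e4 e5 e6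
  obtain ⟨ζ, ω, h1, h2, h3, h4⟩ := reduced_eigen hτ hμ rfl hν hνl e1 e2 e3 e4 e5 e6
  refine ⟨ζ, x 1, ω, h1, fun h => hx0 ?_, ?_, ?_⟩
  · obtain ⟨a1, a2, a3, a4, a5⟩ := h2 h
    ext i
    fin_cases i
    exacts [a1, h.1, a2, a3, a4, a5]
  · rw [s11, s12]; push_cast; exact h3
  · rw [K, s12]; push_cast; exact h4

theorem eq_zero_of_endMat_apply_eq_zero {e : ℝ × ℝ²} {l : ℂ} {x : Fin 6 → ℂ} (he : 0 < e.1)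
    (hl : l ≠ 0) (hx : 𝐋(m, e, l) x = 0) : x = 0 := by
  rw [endMat_apply] at hx
  have hτ : (m.τ : ℂ) ≠ 0 := by exact_mod_cast m.tau_pos.ne'
  have hμ : (m.μ : ℂ) ≠ 0 := by exact_mod_cast m.μ_pos.ne'
  have he' : (e.1 : ℂ) ≠ 0 := by exact_mod_cast he.ne'
  have e1 := congrFun hx 0
  have e2 := congrFun hx 1
  have e3 := congrFun hx 2
  have e4 := congrFun hx 3
  have e5 := congrFun hx 4
  have e6 := congrFun hx 5
  simp only [Matrix.cons_val, Pi.zero_apply] at e1 e2 e3 e4 e5 e6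
  have f4 : x 4 = 0 := by simpa [hμ] using e4
  have f1 : x 1 = 0 := by simpa [e2, hl] using e1
  have f5 : x 5 = 0 := by simpa [f4, hl] using e6
  have f0 : x 0 = 0 := by simpa [f1, f4, f5, e2, hl, he', hτ] using e3
  have f3 : x 3 = 0 := by simpa [e2, f4, f5, hl, he'] using e5
  ext i
  fin_cases i
  exacts [f0, f1, e2, f3, f4, f5]

theorem det_of_reduced {v s11 s12 K ε δ V ω ζ : ℂ} (hne : ¬ (V = 0 ∧ ω = 0))
    (h1 : (v * ζ ^ 2 - s11 - ε) * V = s12 * ω) (h2 : (v * ζ ^ 2 - K - δ) * ω = s12 * V) :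
    (v * ζ ^ 2 - s11 - ε) * (v * ζ ^ 2 - K - δ) = s12 ^ 2 := by
  by_cases hV : V = 0
  · have hω : ω ≠ 0 := fun h => hne ⟨hV, h⟩
    apply mul_right_cancel₀ hω
    linear_combination (v * ζ ^ 2 - s11 - ε) * h2 + s12 * h1
  · apply mul_right_cancel₀ hV
    linear_combination (v * ζ ^ 2 - K - δ) * h1 + s12 * h2

theorem norm_sq_le_of_reduced {v s11 s12 K : ℝ} {ε δ V ω ζ : ℂ} {C : ℝ} (hv : 0 < v)
    (hne : ¬ (V = 0 ∧ ω = 0))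
    (h1 : ((v : ℂ) * ζ ^ 2 - s11 - ε) * V = s12 * ω)
    (h2 : ((v : ℂ) * ζ ^ 2 - K - δ) * ω = s12 * V)
    (c1 : |s11| + |s12| + ‖ε‖ ≤ C) (c2 : |K| + |s12| + ‖δ‖ ≤ C) : v * ‖ζ‖ ^ 2 ≤ C := by
  have key : ∀ {s : ℝ} {ε V ω : ℂ}, ((v : ℂ) * ζ ^ 2 - s - ε) * V = s12 * ω → ‖ω‖ ≤ ‖V‖ →
      V ≠ 0 → |s| + |s12| + ‖ε‖ ≤ C → v * ‖ζ‖ ^ 2 ≤ C := by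
    intro s ε V ω h hle hV hC
    have e : (v : ℂ) * ζ ^ 2 * V = s * V + ε * V + s12 * ω := by linear_combination h
    have h3 := congrArg norm e
    rw [norm_mul, norm_mul, norm_pow, norm_real, norm_of_nonneg hv.le] at h3
    have h4 : ‖(s : ℂ) * V + ε * V + s12 * ω‖ ≤ |s| * ‖V‖ + ‖ε‖ * ‖V‖ + |s12| * ‖V‖ := by
      refine (norm_add₃_le).trans ?_
      rw [norm_mul, norm_mul, norm_mul, norm_real, norm_real, norm_eq_abs, norm_eq_abs]
      gcongr
    have h5 : 0 < ‖V‖ := norm_pos_iff.2 hV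
    have h6 : v * ‖ζ‖ ^ 2 * ‖V‖ ≤ C * ‖V‖ := by
      rw [h3]
      refine h4.trans ?_
      nlinarith
    exact le_of_mul_le_mul_right h6 h5
  rcases le_total ‖ω‖ ‖V‖ with h | h
  · by_cases hV : V = 0
    · rw [hV, norm_zero] at h
      exact absurd ⟨hV, norm_le_zero_iff.1 h⟩ hne
    · exact key h1 h hV c1
  · by_cases hω : ω = 0
    · rw [hω, norm_zero] at h
      exact absurd ⟨norm_le_zero_iff.1 h, hω⟩ hne
    · exact key h2 h hω c2

theorem endMat_zero (e : ℝ × ℝ²) (y : Fin 6 → ℂ) : toCLM (m.endMat₀ e) y =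
    𝐋(m, e, (0 : ℂ)) y := by
  change _ = toCLM (m.endMat₀ e) y + (0 : ℂ) • toCLM (m.endMat₁ e) y
  rw [zero_smul, add_zero]

theorem endMat_semisimple {e : ℝ × ℝ²} (he : e ∈ m.endStates) {x : Fin 6 → ℂ}
    (hx : toCLM (m.endMat₀ e) (toCLM (m.endMat₀ e) x) = 0) : toCLM (m.endMat₀ e) x = 0 := by
  have hτ : (m.τ : ℂ) ≠ 0 := by exact_mod_cast m.tau_pos.ne'
  have hμ : (m.μ : ℂ) ≠ 0 := by exact_mod_cast m.μ_pos.ne'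
  have hμ₀ : (m.μ₀ : ℂ) ≠ 0 := by exact_mod_cast m.μ₀_pos.ne'
  have hd : ((e.1 : ℂ) - e.2.1 - (e.2.2 : ℂ) ^ 2 / m.μ₀) * (e.1 - (m.I : ℂ) ^ 2 / m.μ₀) -
      (m.I * e.2.2 / m.μ₀) ^ 2 ≠ 0 := by
    intro h
    refine he.2.2 (sub_eq_zero.1 ?_)
    have : (((e.1 - m.s11 e.2.1 e.2.2) * (e.1 - m.K) - m.s12 e.2.2 ^ 2 : ℝ) : ℂ) = 0 := by
      rw [← h, s11, s12, K]
      push_cast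
      ring
    exact_mod_cast this
  rw [endMat_zero, endMat_apply] at hx
  have e1 := congrFun hx 0
  have e4 := congrFun hx 3
  have hy2 : toCLM (m.endMat₀ e) x 2 = 0 := by simpa using e1
  have hy4 : toCLM (m.endMat₀ e) x 4 = 0 := by simpa [hμ] using e4
  rw [endMat_zero, endMat_apply] at hy2 hy4 ⊢
  simp only [Matrix.cons_val, zero_mul, add_zero, sub_zero] at hy2 hy4
  have g2 : ((e.1 : ℂ) - e.2.1 - (e.2.2 : ℂ) ^ 2 / m.μ₀) * (m.μ * x 2) +
      m.I * e.2.2 / m.μ₀ * x 4 = 0 := by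
    have : ((e.1 : ℂ) - e.2.1 - (e.2.2 : ℂ) ^ 2 / m.μ₀) * (m.μ * x 2) +
      m.I * e.2.2 / m.μ₀ * x 4 = m.μ * m.τ * 0 := by
      rw [← hy2]; field_simp; ring
    rw [this, mul_zero]
  have g4 : m.I * e.2.2 / m.μ₀ * (m.μ * x 2) + (e.1 - (m.I : ℂ) ^ 2 / m.μ₀) * x 4 = 0 := by
    have : m.I * e.2.2 / m.μ₀ * (m.μ * x 2) + (e.1 - (m.I : ℂ) ^ 2 / m.μ₀) * x 4 = m.μ * 0 := by
      rw [← hy4]; field_simp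
    rw [this, mul_zero]
  have h4 : x 4 = 0 := by
    apply mul_left_cancel₀ hd
    linear_combination ((e.1 : ℂ) - e.2.1 - (e.2.2 : ℂ) ^ 2 / m.μ₀) * g4 - m.I * e.2.2 / m.μ₀ * g2
  have h2 : x 2 = 0 := by
    apply mul_left_cancel₀ hμ
    apply mul_left_cancel₀ hd
    linear_combination (e.1 - (m.I : ℂ) ^ 2 / m.μ₀) * g2 - m.I * e.2.2 / m.μ₀ * g4
  ext i
  fin_cases i <;> simp [h2, h4]

variable (m)

theorem continuous_s11 : Continuous fun e : ℝ × ℝ² => m.s11 e.2.1 e.2.2 := by unfold s11; fun_prop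

theorem continuous_s12 : Continuous fun e : ℝ × ℝ² => m.s12 e.2.2 := by unfold s12; fun_prop

/-- The characteristic function of the reduced eigenvalue problem, with `ε` standing for the sum
of the eigenvalue and the spectral parameter. -/
def reducedDet (e : ℝ × ℝ²) (ε ζ : ℂ) : ℂ :=
  ((e.1 : ℂ) * ζ ^ 2 - (m.s11 e.2.1 e.2.2 : ℝ) - m.τ * ε) *
    ((e.1 : ℂ) * ζ ^ 2 - (m.K : ℝ) - m.μ * ε) - ((m.s12 e.2.2 : ℝ) : ℂ) ^ 2

theorem continuous_reducedDet :
    Continuous fun q : ((ℝ × ℝ²) × ℂ) × ℂ => m.reducedDet q.1.1 q.1.2 q.2 := by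
  have h1 := m.continuous_s11
  have h2 := m.continuous_s12
  have h3 : Continuous fun q : ((ℝ × ℝ²) × ℂ) × ℂ => m.s11 q.1.1.2.1 q.1.1.2.2 :=
    h1.comp (continuous_fst.comp continuous_fst)
  have h4 : Continuous fun q : ((ℝ × ℝ²) × ℂ) × ℂ => m.s12 q.1.1.2.2 :=
    h2.comp (continuous_fst.comp continuous_fst)
  unfold reducedDet
  fun_prop

variable {m}

theorem reducedDet_ne_zero {e : ℝ × ℝ²} (he : e ∈ m.endStates) : m.reducedDet e 0 1 ≠ 0 := by
  intro h
  refine he.2.2 (sub_eq_zero.1 ?_)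
  have : (((e.1 - m.s11 e.2.1 e.2.2) * (e.1 - m.K) - m.s12 e.2.2 ^ 2 : ℝ) : ℂ) = 0 := by
    rw [← h, reducedDet]
    push_cast
    ring
  exact_mod_cast this

theorem im_eq_zero_of_reducedDet {e : ℝ × ℝ²} (he : e ∈ m.endStates) {ζ : ℂ}
    (h : m.reducedDet e 0 ζ = 0) : ζ.im = 0 := by
  refine im_eq_zero_of_real_det he.1 (m.s11_nonneg he.2.1 e.2.2) m.K_nonneg
    (m.s12_sq_le he.2.1 e.2.2) ?_
  rw [reducedDet] at h
  linear_combination h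

theorem specRel_endMat {e : ℝ × ℝ²} (he : e ∈ m.endStates) {l ν : ℂ} {x : Fin 6 → ℂ}
    (hx : 𝐋(m, e, l) x = ν • x) (hx0 : x ≠ 0) :
    SpecRel l ν := by
  by_cases hν : ν = 0
  · refine ⟨fun _ => ?_, Or.inl hν⟩
    by_contra hl
    exact hx0 (eq_zero_of_endMat_apply_eq_zero he.1 hl (by rw [hx, hν, zero_smul]))
  by_cases hνl : ν = -l
  · exact ⟨fun h => absurd h hν, Or.inr (Or.inl hνl)⟩
  obtain ⟨ζ, V, ω, h1, h2, h3, h4⟩ := exists_reduced hx hx0 hν hνl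
  exact specRel_of_reduced he.1 m.tau_pos m.μ_pos (m.s11_nonneg he.2.1 e.2.2) m.K_nonneg
    (m.s12_sq_le he.2.1 e.2.2) h1 hνl hν h2 h3 h4

theorem exists_reducedDet_eq_zero {e : ℝ × ℝ²} {l ν : ℂ} {x : Fin 6 → ℂ}
    (hx : 𝐋(m, e, l) x = ν • x) (hx0 : x ≠ 0) (hν : ν ≠ 0)
    (hνl : ν ≠ -l) {C : ℝ} (he : 0 < e.1)
    (c1 : |m.s11 e.2.1 e.2.2| + |m.s12 e.2.2| + m.τ * ‖ν + l‖ ≤ C)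
    (c2 : |m.K| + |m.s12 e.2.2| + m.μ * ‖ν + l‖ ≤ C) : ∃ ζ : ℂ, l = ν * (ζ - 1) ∧
      m.reducedDet e (ν + l) ζ = 0 ∧ e.1 * ‖ζ‖ ^ 2 ≤ C := by
  obtain ⟨ζ, V, ω, h1, h2, h3, h4⟩ := exists_reduced hx hx0 hν hνl
  have h5 : ν * ζ = ν + l := by rw [h1]; ring
  rw [h5] at h3 h4
  refine ⟨ζ, h1, sub_eq_zero.2 (det_of_reduced h2 h3 h4), ?_⟩
  refine norm_sq_le_of_reduced he h2 h3 h4 ?_ ?_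
  · rwa [norm_mul, norm_real, norm_of_nonneg m.tau_pos.le]
  · rwa [norm_mul, norm_real, norm_of_nonneg m.μ_pos.le]

theorem endMat_gap {e : ℝ × ℝ²} (he : e ∈ m.endStates) : ∃ ρ > 0, ∀ᶠ e' in 𝓝 e,
    ∀ (ν : ℂ) (x : Fin 6 → ℂ), ‖ν‖ < ρ → toCLM (m.endMat₀ e') x = ν • x → x ≠ 0 → ν = 0 := by
  have hc : ContinuousAt (fun q : (ℝ × ℝ²) × ℂ => m.reducedDet q.1 q.2 1) (e, 0) :=
    (m.continuous_reducedDet.comp (by fun_prop : Continuous fun q : (ℝ × ℝ²) × ℂ =>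
      (q, (1 : ℂ)))).continuousAt
  have hev := hc.eventually_ne (reducedDet_ne_zero he)
  rw [nhds_prod_eq] at hev
  obtain ⟨pa, ha, pb, hb, hab⟩ := eventually_prod_iff.1 hev
  obtain ⟨ρ, hρ, hball⟩ := Metric.eventually_nhds_iff.1 hb
  refine ⟨ρ, hρ, ?_⟩
  filter_upwards [ha] with e' he' ν x hν hx hx0
  by_contra hν0
  have hx' : 𝐋(m, e', (0 : ℂ)) x = ν • x := by
    rwa [← endMat_zero]
  obtain ⟨ζ, V, ω, h1, h2, h3, h4⟩ := exists_reduced hx' hx0 hν0 (by simpa using hν0)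
  have hζ : ζ = 1 := by
    have := (mul_eq_zero.1 h1.symm).resolve_left hν0
    exact sub_eq_zero.1 this
  rw [hζ, mul_one] at h3 h4
  exact hab he' (hball (by simpa using hν)) (sub_eq_zero.2 (det_of_reduced h2 h3 h4))

theorem endMat_slow {e : ℝ × ℝ²} (he : e ∈ m.endStates) : ∃ δ > 0, ∀ ε > 0, ∃ ρ > 0,
    ∀ᶠ q in 𝓝 (e, (0 : ℂ)), 0 < q.2.re → ∀ (ν : ℂ) (x : Fin 6 → ℂ), ‖ν‖ < ρ →
      𝐋(m, q.1, q.2) x = ν • x → x ≠ 0 →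
      δ ≤ ‖ν / q.2‖ ∧ |(ν / q.2).im| ≤ ε := by
  have hτ := m.tau_pos
  have hμ := m.μ_pos
  set C : ℝ := |m.s11 e.2.1 e.2.2| + |m.s12 e.2.2| + |m.K| + 2 + 2 * m.τ + 2 * m.μ with hC
  have hC0 : 0 ≤ C := by positivity
  set R : ℝ := Real.sqrt (C / (e.1 / 2)) with hR
  have hR0 : 0 ≤ R := sqrt_nonneg _
  have he1 : 0 < e.1 := he.1
  refine ⟨(R + 1)⁻¹, by positivity, fun ε hε => ?_⟩
  set S : Set ℂ := closedBall 0 R ∩ {ζ | ε * ‖ζ - 1‖ ^ 2 ≤ |ζ.im|} with hS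
  have hSc : IsCompact S := (isCompact_closedBall _ _).inter_right
    (isClosed_le (by fun_prop) (by fun_prop))
  have hev : ∀ᶠ q in 𝓝 (e, (0 : ℂ)), ∀ ζ ∈ S, m.reducedDet q.1 q.2 ζ ≠ 0 := by
    refine hSc.eventually_forall_of_forall_eventually fun ζ hζ => ?_
    refine m.continuous_reducedDet.continuousAt.eventually_ne (x := (((e, 0), ζ) : ((ℝ × ℝ²) × ℂ) × ℂ)) ?_
    intro h0
    have h1 : ζ.im = 0 := im_eq_zero_of_reducedDet he h0
    have h2 := hζ.2
    simp only [mem_ofPred_eq, h1, abs_zero] at h2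
    have h4 : ζ = 1 := by
      by_contra h4
      have := norm_pos_iff.2 (sub_ne_zero.2 h4)
      exact h2.not_gt (by positivity)
    rw [h4] at h0
    exact reducedDet_ne_zero he h0
  rw [nhds_prod_eq] at hev
  obtain ⟨pa, ha, pb, hb, hab⟩ := eventually_prod_iff.1 hev
  obtain ⟨ρ, hρ, hball⟩ := Metric.eventually_nhds_iff.1 hb
  have hρ1 : 0 < min (ρ / 2) 1 := lt_min (half_pos hρ) one_pos
  refine ⟨min (ρ / 2) 1, hρ1, ?_⟩
  have n1 : ∀ᶠ q : (ℝ × ℝ²) × ℂ in 𝓝 (e, (0 : ℂ)), pa q.1 :=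
    (continuous_fst.tendsto (e, (0 : ℂ))).eventually ha
  have n2 : ∀ᶠ q : (ℝ × ℝ²) × ℂ in 𝓝 (e, (0 : ℂ)), ‖q.2‖ < min (ρ / 2) 1 :=
    (by fun_prop : ContinuousAt (fun q : (ℝ × ℝ²) × ℂ => ‖q.2‖) (e, 0)).eventually
      (eventually_lt_nhds (by simpa using hρ1))
  have n3 : ∀ᶠ q : (ℝ × ℝ²) × ℂ in 𝓝 (e, (0 : ℂ)), e.1 / 2 < q.1.1 :=
    (by fun_prop : ContinuousAt (fun q : (ℝ × ℝ²) × ℂ => q.1.1) (e, 0)).eventually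
      (eventually_gt_nhds (by simpa using half_lt_self he1))
  have n4 : ∀ᶠ q : (ℝ × ℝ²) × ℂ in 𝓝 (e, (0 : ℂ)), |m.s11 q.1.2.1 q.1.2.2| <
      |m.s11 e.2.1 e.2.2| + 1 :=
    ((continuous_abs.comp (m.continuous_s11.comp continuous_fst)).tendsto
      ((e, 0) : (ℝ × ℝ²) × ℂ)).eventually (eventually_lt_nhds (by simp))
  have n5 : ∀ᶠ q : (ℝ × ℝ²) × ℂ in 𝓝 (e, (0 : ℂ)), |m.s12 q.1.2.2| < |m.s12 e.2.2| + 1 :=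
    ((continuous_abs.comp (m.continuous_s12.comp continuous_fst)).tendsto
      ((e, 0) : (ℝ × ℝ²) × ℂ)).eventually (eventually_lt_nhds (by simp))
  filter_upwards [n1, n2, n3, n4, n5] with q q1 q2 q3 q4 q5 hq ν x hν hx hx0
  have hl0 : q.2 ≠ 0 := fun h0 => by simp [h0] at hq
  have hν0 : ν ≠ 0 := fun h0 => hx0 (eq_zero_of_endMat_apply_eq_zero (by linarith) hl0
    (by rw [hx, h0, zero_smul]))
  by_cases hνl : ν = -q.2
  · have : ν / q.2 = -1 := by rw [hνl]; field_simp
    rw [this]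
    refine ⟨?_, by simpa using hε.le⟩
    rw [norm_neg, norm_one]
    exact inv_le_one_of_one_le₀ (by linarith)
  have hsum : ‖ν + q.2‖ < ρ ∧ ‖ν + q.2‖ ≤ 2 := by
    have := norm_add_le ν q.2
    have m1 := min_le_left (ρ / 2) 1
    have m2 := min_le_right (ρ / 2) 1
    constructor <;> linarith
  have t1 := mul_le_mul_of_nonneg_left hsum.2 hτ.le
  have t2 := mul_le_mul_of_nonneg_left hsum.2 hμ.le
  obtain ⟨ζ, hζ1, hζ2, hζ3⟩ := exists_reducedDet_eq_zero (C := C) hx hx0 hν0 hνl (by linarith)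
    (by have := abs_nonneg m.K; linarith) (by have := abs_nonneg (m.s11 e.2.1 e.2.2); linarith)
  have hζR : ‖ζ‖ ≤ R := by
    refine Real.le_sqrt_of_sq_le ?_
    rw [le_div_iff₀ (half_pos he1)]
    nlinarith [sq_nonneg ‖ζ‖]
  have hζ0 : ζ - 1 ≠ 0 := fun h0 => hl0 (by rw [hζ1, h0, mul_zero])
  have hκ : ν / q.2 = (ζ - 1)⁻¹ := by rw [hζ1]; field_simp
  rw [hκ]
  constructor
  · rw [norm_inv]
    refine inv_anti₀ (norm_pos_iff.2 hζ0) ((norm_sub_le _ _).trans ?_)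
    rw [norm_one]
    linarith
  · have hpb : pb (ν + q.2) := hball (by simpa using hsum.1)
    have hnS : ζ ∉ S := fun h => hab q1 hpb ζ h hζ2
    have : |ζ.im| < ε * ‖ζ - 1‖ ^ 2 := by
      by_contra h
      exact hnS ⟨by simpa using hζR, not_lt.1 h⟩
    rw [Complex.inv_im, abs_div, abs_neg, abs_of_nonneg (normSq_nonneg _), ← Complex.sq_norm,
      div_le_iff₀ (by have := norm_pos_iff.2 hζ0; positivity), sub_im, Complex.one_im,
      sub_zero]
    exact this.le

theorem spectralPencil_endMat : SpectralPencil (X := m.endStates) (V := Fin 6 → ℂ)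
    (fun e => toCLM (m.endMat₀ e)) (fun e => toCLM (m.endMat₁ e)) where
  cont₀ := continuous_toCLM.comp (m.continuous_endMat₀.comp continuous_subtype_val)
  cont₁ := continuous_toCLM.comp (m.continuous_endMat₁.comp continuous_subtype_val)
  rel e l ν x hx hx0 := specRel_endMat e.2 hx hx0
  semisimple e x hx := endMat_semisimple e.2 hx
  gap e := by
    obtain ⟨ρ, hρ, h⟩ := endMat_gap e.2
    exact ⟨ρ, hρ, (continuous_subtype_val.tendsto e).eventually h⟩
  slow e := by
    obtain ⟨δ, hδ, h⟩ := endMat_slow e.2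
    refine ⟨δ, hδ, fun ε hε => ?_⟩
    obtain ⟨ρ, hρ, h⟩ := h ε hε
    refine ⟨ρ, hρ, ?_⟩
    exact ((by fun_prop : Continuous fun q : m.endStates × ℂ => ((q.1 : ℝ × ℝ²), q.2)).tendsto
      (e, 0)).eventually h

end MHD

/-! ### Linear differential equations in a half-plane with a parameter -/

section HalfPlaneODE

theorem isOpen_re_pos : IsOpen {z : ℂ | 0 < z.re} := isOpen_lt continuous_const Complex.continuous_re

theorem convex_re_pos : Convex ℝ {z : ℂ | 0 < z.re} := convex_halfSpace_re_gt 0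

def clampRe (z : ℂ) : ℂ := z + (max 0 (-z.re) : ℝ)

theorem continuous_clampRe : Continuous clampRe := by
  unfold clampRe
  fun_prop

theorem clampRe_re_nonneg (z : ℂ) : 0 ≤ (clampRe z).re := by
  have := le_max_right 0 (-z.re)
  rw [clampRe, Complex.add_re, ofReal_re]
  linarith

theorem clampRe_of_nonneg {z : ℂ} (hz : 0 ≤ z.re) : clampRe z = z := by simp [clampRe, hz]

variable {E : Type*} [NormedAddCommGroup E] [NormedSpace ℂ E] [CompleteSpace E]

theorem hasDerivAt_segment_integral {g : ℂ → E} {z₀ z : ℂ} (hz₀ : 0 < z₀.re) (hz : 0 < z.re)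
    (hg : DifferentiableOn ℂ g {z | 0 < z.re}) :
    HasDerivAt (fun z => ∫ t in (0 : ℝ)..1, (z - z₀) • g (z₀ + t * (z - z₀))) (g z) z := by
  obtain ⟨c, r, δ, hr, hδ, h1, h2⟩ := exists_circle_of_re_pos (s := {z₀, z}) (by simp)
    (by rintro w (rfl | rfl); exacts [hz₀, hz])
  have hb0 : z₀ ∈ ball c r := h1 z₀ (by simp)
  have hbz : z ∈ ball c r := h1 z (by simp)
  have hsub : ball c r ⊆ {z : ℂ | 0 < z.re} := fun w hw =>
    hδ.trans_le (h2 w (ball_subset_closedBall hw))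
  obtain ⟨G, hG⟩ := (hg.mono hsub).isExactOn_ball
  have hgc : ContinuousOn g (ball c r) := (hg.mono hsub).continuousOn
  have key : ∀ w ∈ ball c r, ∫ t in (0 : ℝ)..1, (w - z₀) • g (z₀ + t * (w - z₀)) = G w - G z₀ := by
    intro w hw
    have hseg : ∀ t ∈ uIcc (0 : ℝ) 1, z₀ + t * (w - z₀) ∈ ball c r := by
      intro t ht
      rw [uIcc_of_le zero_le_one] at ht
      have := (convex_ball c r).add_smul_sub_mem hb0 hw ht
      simpa using this
    have hline : ∀ t : ℝ, HasDerivAt (fun t : ℝ => z₀ + t * (w - z₀)) (w - z₀) t := fun t => by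
      have := ((Complex.ofRealCLM.hasDerivAt (x := t)).mul_const (w - z₀)).const_add z₀
      simpa using this
    have := intervalIntegral.integral_eq_sub_of_hasDerivAt (a := (0 : ℝ)) (b := 1)
      (f := fun t : ℝ => G (z₀ + t * (w - z₀))) (f' := fun t => (w - z₀) • g (z₀ + t * (w - z₀)))
      (fun t ht => (hG _ (hseg t ht)).scomp t (hline t)) ?_
    · rw [this]; simp
    · refine ContinuousOn.intervalIntegrable ?_
      exact continuousOn_const.smul (hgc.comp (by fun_prop) hseg)
  refine ((hG z hbz).sub_const (G z₀)).congr_of_eventuallyEq ?_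
  filter_upwards [isOpen_ball.mem_nhds hbz] with w hw using key w hw

variable {X : Type*} [TopologicalSpace X]

/-- Terms of the Picard series of `T' = L T`, `T z₀ = y₀`. -/
def picardTerm (L : X × ℂ → E →L[ℂ] E) (z₀ : ℂ) (y₀ : E) : ℕ → X × ℂ → E
  | 0 => fun _ => y₀
  | n + 1 => fun q => ∫ t in (0 : ℝ)..1, (q.2 - z₀) •
      L (q.1, z₀ + t * (q.2 - z₀)) (picardTerm L z₀ y₀ n (q.1, z₀ + t * (q.2 - z₀)))

theorem continuous_picardTerm [FirstCountableTopology X] {L : X × ℂ → E →L[ℂ] E} (hL : Continuous L)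
    (z₀ : ℂ) (y₀ : E) (n : ℕ) : Continuous (picardTerm L z₀ y₀ n) := by
  induction n with
  | zero => exact continuous_const
  | succ n ih =>
    refine intervalIntegral.continuous_parametric_intervalIntegral_of_continuous' ?_ 0 1
    unfold Function.uncurry
    fun_prop

theorem norm_picardTerm_le [FirstCountableTopology X] {L : X × ℂ → E →L[ℂ] E} (hL : Continuous L)
    {z₀ : ℂ} {y₀ : E}
    {e : X} {ρ M : ℝ} (hM : ∀ z ∈ closedBall z₀ ρ, ‖L (e, z)‖ ≤ M) (n : ℕ) :
    ∀ z ∈ closedBall z₀ ρ,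
      ‖picardTerm L z₀ y₀ n (e, z)‖ ≤ ‖y₀‖ * ((M * ‖z - z₀‖) ^ n / n.factorial) := by
  induction n with
  | zero => intro z _; simp [picardTerm]
  | succ n ih =>
    intro z hz
    have hρ : ‖z - z₀‖ ≤ ρ := by simpa [dist_eq_norm] using hz
    have hM0 : 0 ≤ M := (norm_nonneg _).trans (hM z hz)
    set d := ‖z - z₀‖ with hd
    set c : ℝ := ‖y₀‖ * (M * d) ^ (n + 1) / n.factorial with hc
    have h1 : ‖picardTerm L z₀ y₀ (n + 1) (e, z)‖ ≤ ∫ t in (0 : ℝ)..1, c * t ^ n := by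
      refine intervalIntegral.norm_integral_le_of_norm_le zero_le_one ?_
        ((by fun_prop : Continuous fun t : ℝ => c * t ^ n).intervalIntegrable _ _)
      refine Eventually.of_forall fun t ht => ?_
      have ht0 : 0 ≤ t := ht.1.le
      have hnorm : ‖z₀ + t * (z - z₀) - z₀‖ = t * d := by
        rw [add_sub_cancel_left, norm_mul, norm_real, norm_of_nonneg ht0]
      have hmem : z₀ + t * (z - z₀) ∈ closedBall z₀ ρ := by
        rw [mem_closedBall, dist_eq_norm, hnorm]
        nlinarith [norm_nonneg (z - z₀), ht.2]
      have h2 := ih _ hmem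
      rw [hnorm] at h2
      have h3 := (L (e, z₀ + t * (z - z₀))).le_of_opNorm_le_of_le (hM _ hmem) h2
      change ‖(z - z₀) • L (e, z₀ + t * (z - z₀)) (picardTerm L z₀ y₀ n (e, z₀ + t * (z - z₀)))‖ ≤ _
      rw [norm_smul, ← hd]
      refine (mul_le_mul_of_nonneg_left h3 (norm_nonneg _)).trans (le_of_eq ?_)
      rw [hc]
      ring
    refine h1.trans (le_of_eq ?_)
    rw [intervalIntegral.integral_const_mul, integral_pow, hc, Nat.factorial_succ]
    push_cast
    have : (n : ℝ) + 1 ≠ 0 := by positivity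
    field_simp
    simp

theorem hasDerivAt_picardTerm [FirstCountableTopology X] {L : X × ℂ → E →L[ℂ] E} {z₀ : ℂ} {y₀ : E}
    (hz₀ : 0 < z₀.re) {e : X} (hd : DifferentiableOn ℂ (fun z => L (e, z)) {z | 0 < z.re}) (n : ℕ) :
    DifferentiableOn ℂ (fun z => picardTerm L z₀ y₀ n (e, z)) {z | 0 < z.re} ∧
    ∀ z : ℂ, 0 < z.re → HasDerivAt (fun z => picardTerm L z₀ y₀ (n + 1) (e, z))
      (L (e, z) (picardTerm L z₀ y₀ n (e, z))) z := by
  have step : ∀ n, DifferentiableOn ℂ (fun z => picardTerm L z₀ y₀ n (e, z)) {z | 0 < z.re} →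
      ∀ z : ℂ, 0 < z.re → HasDerivAt (fun z => picardTerm L z₀ y₀ (n + 1) (e, z))
      (L (e, z) (picardTerm L z₀ y₀ n (e, z))) z := fun n hn z hz =>
    hasDerivAt_segment_integral (g := fun z => L (e, z) (picardTerm L z₀ y₀ n (e, z))) hz₀ hz
      (hd.clm_apply hn)
  induction n with
  | zero => exact ⟨differentiableOn_const _, step 0 (differentiableOn_const _)⟩
  | succ n ih =>
    have : DifferentiableOn ℂ (fun z => picardTerm L z₀ y₀ (n + 1) (e, z)) {z | 0 < z.re} :=
      fun z hz => (ih.2 z hz).differentiableAt.differentiableWithinAt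
    exact ⟨this, step _ this⟩

theorem exists_halfPlane_solution [FirstCountableTopology X] {L : X × ℂ → E →L[ℂ] E}
    (hL : ContinuousOn L {q | 0 ≤ q.2.re})
    (hd : ∀ e, DifferentiableOn ℂ (fun z => L (e, z)) {z | 0 < z.re}) {z₀ : ℂ} (hz₀ : 0 < z₀.re)
    (y₀ : E) : ∃ T : X × ℂ → E, ContinuousOn T {q | 0 ≤ q.2.re} ∧ (∀ e, T (e, z₀) = y₀) ∧
      ∀ e (z : ℂ), 0 < z.re → HasDerivAt (fun z => T (e, z)) (L (e, z) (T (e, z))) z := by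
  set L' : X × ℂ → E →L[ℂ] E := fun q => L (q.1, clampRe q.2) with hL'
  have hc : Continuous L' := hL.comp_continuous
    (continuous_fst.prodMk (continuous_clampRe.comp continuous_snd)) fun q => clampRe_re_nonneg _
  have hLL : ∀ e (z : ℂ), 0 ≤ z.re → L' (e, z) = L (e, z) := fun e z hz => by
    simp only [hL', clampRe_of_nonneg hz]
  have hd' : ∀ e, DifferentiableOn ℂ (fun z => L' (e, z)) {z | 0 < z.re} := fun e =>
    (hd e).congr fun z hz => hLL e z (le_of_lt hz)
  have hsum : ∀ M ρ : ℝ, Summable fun n : ℕ => ‖y₀‖ * ((M * ρ) ^ n / n.factorial) := fun M ρ =>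
    (Real.summable_pow_div_factorial (M * ρ)).mul_left _
  have hbound : ∀ {e : X} {ρ M : ℝ}, (∀ z ∈ closedBall z₀ ρ, ‖L' (e, z)‖ ≤ M) → ∀ n,
      ∀ z ∈ closedBall z₀ ρ,
        ‖picardTerm L' z₀ y₀ n (e, z)‖ ≤ ‖y₀‖ * ((M * ρ) ^ n / n.factorial) := by
    intro e ρ M hM n z hz
    refine (norm_picardTerm_le hc hM n z hz).trans ?_
    have hρ : ‖z - z₀‖ ≤ ρ := by simpa [dist_eq_norm] using hz
    have hM0 : 0 ≤ M := (norm_nonneg _).trans (hM z hz)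
    gcongr
  have hM : ∀ (e : X) (ρ : ℝ), ∃ M, ∀ᶠ e' in 𝓝 e, ∀ z ∈ closedBall z₀ ρ, ‖L' (e', z)‖ ≤ M := by
    intro e ρ
    obtain ⟨M, hM⟩ := (isCompact_closedBall z₀ ρ).exists_bound_of_continuousOn
      (f := fun z => L' (e, z)) (by fun_prop)
    exact ⟨M + 1, (isCompact_closedBall z₀ ρ).eventually_forall_of_forall_eventually fun z hz =>
      hc.norm.continuousAt.eventually (eventually_le_nhds (by linarith [hM z hz]))⟩
  refine ⟨fun q => ∑' n, picardTerm L' z₀ y₀ n q, ?_, fun e => ?_, fun e z hz => ?_⟩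
  · refine Continuous.continuousOn (continuous_iff_continuousAt.2 fun q₀ => ?_)
    obtain ⟨M, hM⟩ := hM q₀.1 (‖q₀.2 - z₀‖ + 1)
    set s : Set (X × ℂ) := {q | (∀ z ∈ closedBall z₀ (‖q₀.2 - z₀‖ + 1), ‖L' (q.1, z)‖ ≤ M) ∧
      q.2 ∈ closedBall z₀ (‖q₀.2 - z₀‖ + 1)} with hs
    have hsn : s ∈ 𝓝 q₀ := by
      refine Filter.inter_mem ((continuous_fst.tendsto q₀).eventually hM) ?_
      refine (continuous_snd.tendsto q₀).eventually (Metric.closedBall_mem_nhds_of_mem ?_)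
      rw [mem_ball, dist_eq_norm]
      linarith
    exact (continuousOn_tsum (fun n => (continuous_picardTerm hc z₀ y₀ n).continuousOn) (hsum M _)
      fun n q hq => hbound hq.1 n q.2 hq.2).continuousAt hsn
  · change ∑' n, picardTerm L' z₀ y₀ n (e, z₀) = y₀
    exact tsum_eq_single 0 fun n hn => by
      obtain ⟨k, rfl⟩ := Nat.exists_eq_succ_of_ne_zero hn
      simp [picardTerm]
  · obtain ⟨M, hM⟩ := hM e (‖z - z₀‖ + 1)
    have hM := hM.self_of_nhds
    set ρ := ‖z - z₀‖ + 1 with hρ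
    have hρ0 : 0 < ρ := by positivity
    set t : Set ℂ := ball z₀ ρ ∩ {z | 0 < z.re} with ht
    have hzt : z ∈ t := ⟨by rw [mem_ball, dist_eq_norm]; linarith, hz⟩
    set g' : ℕ → ℂ → E := fun n z => Nat.casesOn n 0 fun n => L' (e, z) (picardTerm L' z₀ y₀ n (e, z))
    set u : ℕ → ℝ := fun n => Nat.casesOn n 0 fun n => M * (‖y₀‖ * ((M * ρ) ^ n / n.factorial))
    have hu : Summable u := (summable_nat_add_iff 1).1 ((hsum M ρ).mul_left M)
    have hsm : Summable fun n => picardTerm L' z₀ y₀ n (e, z) :=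
      Summable.of_norm_bounded (hsum M ρ) fun n => hbound hM n z (ball_subset_closedBall hzt.1)
    have hder := hasDerivAt_tsum_of_isPreconnected (g := fun n z => picardTerm L' z₀ y₀ n (e, z))
      (g' := g') hu (isOpen_ball.inter isOpen_re_pos)
      ((convex_ball z₀ ρ).inter convex_re_pos).isPreconnected (t := t) ?_ ?_ hzt hsm hzt
    · have hsm' : Summable fun n => g' n z := (summable_nat_add_iff 1).1 ((L' (e, z)).summable hsm)
      have e1 : ∑' n, g' n z = L (e, z) (∑' n, picardTerm L' z₀ y₀ n (e, z)) := by
        rw [hsm'.tsum_eq_zero_add, ← hLL e z hz.le, (L' (e, z)).map_tsum hsm]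
        exact zero_add _
      rwa [e1] at hder
    · rintro (_ | n) w hw
      · exact hasDerivAt_const _ _
      · exact (hasDerivAt_picardTerm hz₀ (hd' e) n).2 w hw.2
    · rintro (_ | n) w hw
      · simp [g', u]
      · have hw' := ball_subset_closedBall hw.1
        exact (L' (e, w)).le_of_opNorm_le_of_le (hM w hw') (hbound hM n w hw')

theorem eq_of_hasDerivAt_zero {F : Type*} [NormedAddCommGroup F] [NormedSpace ℂ F] {f : ℂ → F}
    (hf : ∀ z : ℂ, 0 < z.re → HasDerivAt f 0 z) {z w : ℂ} (hz : 0 < z.re) (hw : 0 < w.re) :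
    f z = f w :=
  isOpen_re_pos.is_const_of_deriv_eq_zero convex_re_pos.isPreconnected
    (fun z hz => (hf z hz).differentiableAt.differentiableWithinAt) (fun z hz => (hf z hz).deriv) hz hw

theorem eq_of_eq_re_pos {F : Type*} [TopologicalSpace F] [T2Space F] {f g : ℂ → F}
    (hf : ContinuousOn f {z | 0 ≤ z.re}) (hg : ContinuousOn g {z | 0 ≤ z.re})
    (h : ∀ z : ℂ, 0 < z.re → f z = g z) : ∀ z : ℂ, 0 ≤ z.re → f z = g z := by
  have : EqOn f g {z | 0 ≤ z.re} := EqOn.of_subset_closure (s := {z : ℂ | 0 < z.re}) h hf hg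
    (fun z hz => show 0 ≤ z.re from le_of_lt hz) (by rw [Complex.closure_setOfPred_lt_re])
  exact this

end HalfPlaneODE

/-! ### Kato transport -/

section Kato

variable {V : Type*} [NormedAddCommGroup V] [NormedSpace ℂ V] [FiniteDimensional ℂ V]

theorem uproj_mul_rieszProj {M : CL(V)} {c σ : ℂ} {r : ℝ} (hr : 0 ≤ r) (hM : SphereFree c r M)
    (h : ∀ z ∈ ball c r, (if 0 < z.re then 1 else 0) = σ) :
    uproj M * rieszProj c r M = σ • rieszProj c r M := by
  refine clm_ext_gen (M := M) fun ν x hx hx0 v hv => ?_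
  change uproj M (rieszProj c r M v) = σ • rieszProj c r M v
  by_cases hν : ν ∈ ball c r
  · rw [rieszProj_apply_of_mem_ball hM hν hv, uproj_apply hv, ← h ν hν, ite_smul, one_smul, zero_smul]
  · rw [rieszProj_apply_of_notMem_closedBall hr hM (fun hb => hx0 ?_) hv, map_zero, smul_zero]
    exact eq_zero_of_isUnit_sub (hM ν (le_antisymm hb (not_lt.1 hν))) hx

variable {X : Type*} [TopologicalSpace X]

/-- `P` is the unstable projection of `A₀ + z A₁`, extended to the closed half-plane, and `T` is
Kato's transformation function, normalized at `z₀`. -/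
structure IsKatoTransport (A₀ A₁ : X → CL(V)) (z₀ : ℂ) (P T : X × ℂ → CL(V)) : Prop where
  contP : ContinuousOn P {q | 0 ≤ q.2.re}
  contT : ContinuousOn T {q | 0 ≤ q.2.re}
  base : ∀ e, T (e, z₀) = 1
  eq_uproj : ∀ e (z : ℂ), 0 < z.re → P (e, z) = uproj (A₀ e + z • A₁ e)
  isUnit : ∀ e (z : ℂ), 0 ≤ z.re → IsUnit (T (e, z))
  intertwine : ∀ e (z : ℂ), 0 ≤ z.re → P (e, z) * T (e, z) = T (e, z) * P (e, z₀)
  deriv : ∀ e (z : ℂ), 0 < z.re → ∃ T', HasDerivAt (fun z => T (e, z)) T' z ∧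
    P (e, z) * T' * P (e, z₀) = 0 ∧ P (e, z) * T' * (1 - P (e, z₀)) = T' * (1 - P (e, z₀))
  idem : ∀ e (z : ℂ), 0 ≤ z.re → P (e, z) * P (e, z) = P (e, z)
  comm : ∀ e (z : ℂ), 0 ≤ z.re → P (e, z) * (A₀ e + z • A₁ e) = (A₀ e + z • A₁ e) * P (e, z)
  apply_gen : ∀ e (z : ℂ), 0 ≤ z.re → ∀ ν : ℂ, ν.re ≠ 0 →
    ∀ v ∈ maxGenEigenspace (A₀ e + z • A₁ e).toLinearMap ν, P (e, z) v = if 0 < ν.re then v else 0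
  unique : ∀ e (R : ℂ → V), ContinuousOn R {z | 0 ≤ z.re} →
    (∀ z : ℂ, 0 < z.re → DifferentiableAt ℂ R z) →
    ((∀ z : ℂ, 0 < z.re → P (e, z) (R z) = R z ∧ P (e, z) (_root_.deriv R z) = 0) ∨
      (∀ z : ℂ, 0 < z.re → P (e, z) (R z) = 0 ∧ P (e, z) (_root_.deriv R z) = _root_.deriv R z)) →
    ∀ z : ℂ, 0 ≤ z.re → R z = T (e, z) (R z₀)

theorem continuousOn_slice {F : Type*} [TopologicalSpace F] {T : X × ℂ → F}
    (h : ContinuousOn T {q | 0 ≤ q.2.re}) (e : X) :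
    ContinuousOn (fun z => T (e, z)) {z | 0 ≤ z.re} :=
  h.comp (f := fun z : ℂ => (e, z)) (by fun_prop) fun z hz => hz

theorem neBot_nhdsWithin_re_pos {z : ℂ} (hz : 0 ≤ z.re) : (𝓝[{z | 0 < z.re}] z).NeBot := by
  rw [← mem_closure_iff_nhdsWithin_neBot, Complex.closure_setOfPred_lt_re]
  exact hz

namespace SpectralPencil

variable {A₀ A₁ : X → CL(V)}

theorem extension_of_pos (h : SpectralPencil A₀ A₁) {P : X × ℂ → CL(V)}
    (hc : ContinuousOn P {q | 0 ≤ q.2.re})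
    (hP : ∀ e (z : ℂ), 0 < z.re → P (e, z) = uproj (A₀ e + z • A₁ e)) {e : X} {z : ℂ}
    (hz : 0 ≤ z.re) {ν : ℂ} (hν : ν.re ≠ 0) {v : V}
    (hv : v ∈ maxGenEigenspace (A₀ e + z • A₁ e).toLinearMap ν) :
    P (e, z) v = if 0 < ν.re then v else 0 := by
  set A : ℂ → CL(V) := fun z => A₀ e + z • A₁ e with hA
  have hAc : ContinuousAt A z := by fun_prop
  change v ∈ maxGenEigenspace (A z).toLinearMap ν at hv
  rcases eq_zero_or_exists_eigenvector hv with rfl | ⟨x, hx, hx0⟩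
  · simp
  have := neBot_nhdsWithin_re_pos hz
  obtain ⟨r, ⟨hr0, hr⟩, hrS⟩ := (Ioo_infinite (abs_pos.2 hν)).exists_notMem_finite
    ((finite_eigenvalues (A z)).image (dist · ν))
  have hf : SphereFree ν r (A z) := fun w hw => isUnit_sub_of_no_eigenvector fun v hv => by
    by_contra hv0
    exact hrS ⟨w, ⟨v, hv, hv0⟩, hw⟩
  have hσ : ∀ w ∈ ball ν r, (if 0 < w.re then (1 : ℂ) else 0) = if 0 < ν.re then 1 else 0 := by
    intro w hw
    have h1 := abs_lt.1 (((abs_re_le_norm (w - ν)).trans_lt (mem_ball_iff_norm.1 hw)).trans hr)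
    rw [sub_re] at h1
    have : 0 < w.re ↔ 0 < ν.re := by
      rcases hν.lt_or_gt with h | h
      · rw [abs_of_neg h] at h1; constructor <;> intro <;> linarith
      · rw [abs_of_pos h] at h1; constructor <;> intro <;> linarith
    simp only [this]
  have h1 : Tendsto (fun z => rieszProj ν r (A z)) (𝓝[{z | 0 < z.re}] z)
      (𝓝 (rieszProj ν r (A z))) :=
    ((continuousAt_rieszProj hr0.le hf).comp (f := A) hAc).tendsto.mono_left nhdsWithin_le_nhds
  have h2 : Tendsto (fun z => P (e, z)) (𝓝[{z | 0 < z.re}] z) (𝓝 (P (e, z))) :=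
    ((continuousOn_slice hc e) z hz).tendsto.mono_left
      (nhdsWithin_mono _ fun w hw => show 0 ≤ w.re from le_of_lt hw)
  have h3 := tendsto_nhds_unique (h2.mul h1) ((h1.const_smul (if 0 < ν.re then (1 : ℂ) else 0)).congr' (by
    filter_upwards [self_mem_nhdsWithin, (SphereFree.eventually hAc hf).filter_mono
      nhdsWithin_le_nhds] with w hw hw'
    rw [hP e w hw, uproj_mul_rieszProj hr0.le hw' hσ]))
  have h4 := DFunLike.congr_fun h3 v
  change P (e, z) (rieszProj ν r (A z) v) = (if 0 < ν.re then (1 : ℂ) else 0) • rieszProj ν r (A z) v at h4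
  rwa [rieszProj_apply_of_mem_ball hf (Metric.mem_ball_self hr0) hv, ite_smul, one_smul, zero_smul] at h4

theorem exists_katoTransport [FirstCountableTopology X] (h : SpectralPencil A₀ A₁) {z₀ : ℂ}
    (hz₀ : 0 < z₀.re) : ∃ P T, IsKatoTransport A₀ A₁ z₀ P T := by
  have : CompleteSpace V := FiniteDimensional.complete ℂ V
  obtain ⟨P, P', hP, hPd, hPc, hP'c⟩ := h.exists_extension
  have hidem : ∀ e (z : ℂ), 0 < z.re → P (e, z) * P (e, z) = P (e, z) := fun e z hz => by
    rw [hP e z hz, uproj_mul_self]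
  have hP' : ∀ e (z : ℂ), 0 < z.re →
      P' (e, z) * P (e, z) + P (e, z) * P' (e, z) = P' (e, z) := fun e z hz => by
    refine (((hPd e z hz).mul (hPd e z hz)).congr_of_eventuallyEq ?_).unique (hPd e z hz)
    filter_upwards [isOpen_re_pos.mem_nhds hz] with w hw
    exact (hidem e w hw).symm
  have hPPP : ∀ e (z : ℂ), 0 < z.re → P (e, z) * P' (e, z) * P (e, z) = 0 := fun e z hz => by
    have h1 := congrArg (fun L => P (e, z) * L) (hP' e z hz)
    simp only [mul_add, ← mul_assoc, hidem e z hz] at h1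
    exact add_eq_right.1 h1
  set Q : X × ℂ → CL(V) := fun q => P' q * P q - P q * P' q with hQ
  have hPdiff : ∀ e, DifferentiableOn ℂ (fun z => P (e, z)) {z | 0 < z.re} := fun e z hz =>
    (hPd e z hz).differentiableAt.differentiableWithinAt
  have hP'diff : ∀ e, DifferentiableOn ℂ (fun z => P' (e, z)) {z | 0 < z.re} := fun e =>
    ((hPdiff e).deriv isOpen_re_pos).congr fun z hz => (hPd e z hz).deriv.symm
  have hQc : ContinuousOn Q {q | 0 ≤ q.2.re} := (hP'c.mul hPc).sub (hPc.mul hP'c)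
  have hQd : ∀ e, DifferentiableOn ℂ (fun z => Q (e, z)) {z | 0 < z.re} := fun e =>
    ((hP'diff e).mul (hPdiff e)).sub ((hPdiff e).mul (hP'diff e))
  have hQP : ∀ e (z : ℂ), 0 < z.re → Q (e, z) * P (e, z) = P' (e, z) * P (e, z) := fun e z hz => by
    simp only [hQ, sub_mul]
    rw [hPPP e z hz, sub_zero, mul_assoc, hidem e z hz]
  have hPQ : ∀ e (z : ℂ), 0 < z.re → P (e, z) * Q (e, z) = -(P (e, z) * P' (e, z)) := fun e z hz => by
    simp only [hQ, mul_sub, ← mul_assoc]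
    rw [hPPP e z hz, zero_sub, hidem e z hz]
  obtain ⟨T, hTc, hT0, hTd⟩ := exists_halfPlane_solution
    (L := fun q => ContinuousLinearMap.mul ℂ CL(V) (Q q))
    ((ContinuousLinearMap.mul ℂ CL(V)).continuous.comp_continuousOn hQc)
    (fun e => (ContinuousLinearMap.mul ℂ CL(V)).differentiable.comp_differentiableOn (hQd e))
    hz₀ 1
  obtain ⟨S, hSc, hS0, hSd⟩ := exists_halfPlane_solution
    (L := fun q => -(ContinuousLinearMap.mul ℂ CL(V)).flip (Q q))
    ((ContinuousLinearMap.mul ℂ CL(V)).flip.continuous.comp_continuousOn hQc).neg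
    (fun e => ((ContinuousLinearMap.mul ℂ CL(V)).flip.differentiable.comp_differentiableOn
      (hQd e)).neg)
    hz₀ 1
  have hTd : ∀ e (z : ℂ), 0 < z.re → HasDerivAt (fun z => T (e, z)) (Q (e, z) * T (e, z)) z := hTd
  have hSd : ∀ e (z : ℂ), 0 < z.re →
    HasDerivAt (fun z => S (e, z)) (-(S (e, z) * Q (e, z))) z := hSd
  have hST : ∀ e (z : ℂ), 0 ≤ z.re → S (e, z) * T (e, z) = 1 := by
    intro e
    refine eq_of_eq_re_pos ((continuousOn_slice hSc e).mul (continuousOn_slice hTc e))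
      continuousOn_const fun z hz => ?_
    have h1 := eq_of_hasDerivAt_zero (f := fun z => S (e, z) * T (e, z)) (fun z hz => by
      refine ((hSd e z hz).mul (hTd e z hz)).congr_deriv ?_
      noncomm_ring) hz hz₀
    simpa [hS0, hT0] using h1
  have hTS : ∀ e (z : ℂ), 0 ≤ z.re → T (e, z) * S (e, z) = 1 :=fun e z hz =>
    ContinuousLinearMap.coe_injective (mul_eq_one_comm.1 (congrArg ContinuousLinearMap.toLinearMap
      (hST e z hz) : (S (e, z)).toLinearMap * (T (e, z)).toLinearMap = 1))
  have hint : ∀ e (z : ℂ), 0 ≤ z.re → P (e, z) * T (e, z) = T (e, z) * P (e, z₀) := by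
    intro e
    refine eq_of_eq_re_pos ((continuousOn_slice hPc e).mul (continuousOn_slice hTc e))
      ((continuousOn_slice hTc e).mul continuousOn_const) fun z hz => ?_
    have h1 := eq_of_hasDerivAt_zero (f := fun z => S (e, z) * P (e, z) * T (e, z)) (fun z hz => by
      refine (((hSd e z hz).mul (hPd e z hz)).mul (hTd e z hz)).congr_deriv ?_
      have h2 : P' (e, z) + P (e, z) * Q (e, z) - Q (e, z) * P (e, z) = 0 := by
        rw [hQP e z hz, hPQ e z hz]
        nth_rewrite 1 [← hP' e z hz]
        abel
      have h3 : S (e, z) * (P' (e, z) + P (e, z) * Q (e, z) - Q (e, z) * P (e, z)) *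
        T (e, z) = 0 := by rw [h2, mul_zero, zero_mul]
      rw [← h3]
      noncomm_ring) hz hz₀
    simp only [hS0, hT0, one_mul, mul_one] at h1
    rw [← h1, ← mul_assoc, ← mul_assoc, hTS e z hz.le, one_mul]
  refine ⟨P, T, hPc, hTc, hT0, hP, fun e z hz => ?_, hint, fun e z hz => ?_, fun e => ?_, fun e => ?_,
    fun e z hz ν hν v hv => h.extension_of_pos hPc hP hz hν hv, fun e R hRc hRd hR => ?_⟩
  · exact ⟨⟨T (e, z), S (e, z), hTS e z hz, hST e z hz⟩, rfl⟩
  · refine ⟨_, hTd e z hz, ?_, ?_⟩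
    · rw [← mul_assoc, hPQ e z hz, mul_assoc, ← hint e z hz.le, ← mul_assoc, neg_mul, hPPP e z hz,
        neg_zero, zero_mul]
    · have h1 : T (e, z) * (1 - P (e, z₀)) = (1 - P (e, z)) * T (e, z) := by
        rw [mul_sub, sub_mul, hint e z hz.le, one_mul, mul_one]
      rw [mul_assoc, mul_assoc, h1, ← mul_assoc, ← mul_assoc, ← mul_assoc, hPQ e z hz]
      congr 1
      rw [mul_sub, mul_sub, mul_one, mul_one, hQP e z hz, neg_mul, hPPP e z hz]
      simp only [hQ]
      abel
  · refine eq_of_eq_re_pos ((continuousOn_slice hPc e).mul (continuousOn_slice hPc e))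
      (continuousOn_slice hPc e) fun z hz => hidem e z hz
  · refine eq_of_eq_re_pos ((continuousOn_slice hPc e).mul (by fun_prop))
      (ContinuousOn.mul (by fun_prop) (continuousOn_slice hPc e)) fun z hz => ?_
    rw [hP e z hz, uproj_commute]
  · have hRQ : ∀ z : ℂ, 0 < z.re → deriv R z = Q (e, z) (R z) := by
      intro z hz
      have h1 : HasDerivAt (fun z => P (e, z) (R z)) (P' (e, z) (R z) + P (e, z) (deriv R z)) z :=
        (hPd e z hz).clm_apply (hRd z hz).hasDerivAt
      change _ = P' (e, z) (P (e, z) (R z)) - P (e, z) (P' (e, z) (R z))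
      rcases hR with hR | hR
      · have h2 := (h1.congr_of_eventuallyEq (f₁ := R) (by
          filter_upwards [isOpen_re_pos.mem_nhds hz] with w hw
          exact (hR w hw).1.symm)).unique (hRd z hz).hasDerivAt
        rw [(hR z hz).2, add_zero] at h2
        rw [(hR z hz).1, h2, (hR z hz).2, sub_zero]
      · have h2 := (h1.congr_of_eventuallyEq (f₁ := fun _ => (0 : V)) (by
          filter_upwards [isOpen_re_pos.mem_nhds hz] with w hw
          exact (hR w hw).1.symm)).unique (hasDerivAt_const z (0 : V))
        rw [(hR z hz).2] at h2
        rw [(hR z hz).1, map_zero, zero_sub, eq_neg_of_add_eq_zero_left h2, map_neg, neg_neg,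
          (hR z hz).2]
    refine eq_of_eq_re_pos hRc ((continuousOn_slice hTc e).clm_apply continuousOn_const) fun z hz => ?_
    have h1 := eq_of_hasDerivAt_zero (f := fun z => S (e, z) (R z)) (fun z hz => by
      refine ((hSd e z hz).clm_apply (hRd z hz).hasDerivAt).congr_deriv ?_
      rw [hRQ z hz]
      change -(S (e, z) (Q (e, z) (R z))) + S (e, z) (Q (e, z) (R z)) = 0
      rw [neg_add_cancel]) hz hz₀
    simp only [hS0] at h1
    have h2 : T (e, z) (S (e, z) (R z)) = R z := DFunLike.congr_fun (hTS e z hz.le) (R z)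
    rw [← h2, h1]
    rfl

end SpectralPencil

end Kato

/-! ### Uniqueness of conjugators up to unimodular transformations -/

section Flow

variable {V : Type*} [NormedAddCommGroup V] [NormedSpace ℂ V] [FiniteDimensional ℂ V]

def expFlow (L : CL(V)) (x : ℝ) : CL(V) := NormedSpace.exp (x • L)

theorem hasDerivAt_expFlow (L : CL(V)) (x : ℝ) : HasDerivAt (expFlow L) (L * expFlow L x) x :=
  have : CompleteSpace V := FiniteDimensional.complete ℂ V
  hasDerivAt_exp_smul_const' L x

theorem hasDerivAt_expFlow' (L : CL(V)) (x : ℝ) : HasDerivAt (expFlow L) (expFlow L x * L) x :=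
  have : CompleteSpace V := FiniteDimensional.complete ℂ V
  hasDerivAt_exp_smul_const L x

theorem expFlow_zero (L : CL(V)) : expFlow L 0 = 1 := by
  rw [expFlow, zero_smul, NormedSpace.exp_zero]

theorem expFlow_neg (L : CL(V)) (x : ℝ) : expFlow (-L) x = expFlow L (-x) := by
  rw [expFlow, expFlow, smul_neg, neg_smul]

theorem hasDerivAt_expFlow_neg (L : CL(V)) (x : ℝ) :
    HasDerivAt (fun x => expFlow L (-x)) (-(expFlow L (-x) * L)) x := by
  have := hasDerivAt_expFlow' (-L) x
  rw [show expFlow (-L) = fun x => expFlow L (-x) from funext (expFlow_neg L)] at this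
  exact this.congr_deriv (mul_neg _ _)

theorem expFlow_mul_neg (L : CL(V)) (x : ℝ) : expFlow L x * expFlow L (-x) = 1 := by
  have h : ∀ x, HasDerivAt (fun x => expFlow L x * expFlow L (-x)) 0 x := fun x => by
    refine ((hasDerivAt_expFlow L x).mul (hasDerivAt_expFlow_neg L x)).congr_deriv ?_
    have : L * expFlow L x = expFlow L x * L :=
      (hasDerivAt_expFlow L x).unique (hasDerivAt_expFlow' L x)
    have h2 : L * expFlow L (-x) = expFlow L (-x) * L :=
      (hasDerivAt_expFlow L (-x)).unique (hasDerivAt_expFlow' L (-x))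
    rw [this, ← h2]
    noncomm_ring
  have := is_const_of_deriv_eq_zero (fun x => (h x).differentiableAt) (fun x => (h x).deriv) x 0
  simpa [expFlow_zero] using this

theorem expFlow_neg_mul (L : CL(V)) (x : ℝ) : expFlow L (-x) * expFlow L x = 1 := by
  simpa using expFlow_mul_neg L (-x)

theorem expFlow_comm {L Q : CL(V)} (h : Q * L = L * Q) (x : ℝ) :
    Q * expFlow L x = expFlow L x * Q := by
  have : Commute Q (x • L) := by
    change Q * (x • L) = (x • L) * Q
    rw [mul_smul_comm, smul_mul_assoc, h]
  exact this.exp_right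

theorem norm_expFlow_gen_le {L : CL(V)} {ν : ℂ} (hν : ν.re ≤ 0) {ε : ℝ} (hε : 0 < ε) :
    ∀ v ∈ maxGenEigenspace L.toLinearMap ν,
      ∃ C, ∀ x, 0 ≤ x → ‖expFlow L x v‖ ≤ C * exp (ε * x) := by
  refine maxGenEigenspace_induction ⟨0, fun x _ => by simp⟩ fun w _ ⟨C, hC⟩ => ?_
  have hC0 : 0 ≤ C := by simpa using (norm_nonneg _).trans (hC 0 le_rfl)
  have ha : 0 < ε - ν.re := by linarith
  have hexp : ∀ x : ℝ, ‖Complex.exp (-ν * x)‖ = exp (-ν.re * x) := fun x => by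
    rw [Complex.norm_exp]; simp
  refine ⟨‖w‖ + C / (ε - ν.re), fun X hX => ?_⟩
  set f : ℝ → V := fun x => Complex.exp (-ν * x) • expFlow L x w with hf
  have hfd : ∀ x : ℝ, HasDerivAt f (Complex.exp (-ν * x) • expFlow L x (L w - ν • w)) x := fun x => by
    have h1 : HasDerivAt (fun x : ℝ => Complex.exp (-ν * x)) (Complex.exp (-ν * x) * (-ν)) x := by
      have := ((Complex.ofRealCLM.hasDerivAt (x := x)).const_mul (-ν)).cexp
      simpa using this
    have h2 : HasDerivAt (fun x => expFlow L x w) (expFlow L x (L w)) x :=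
      ((ContinuousLinearMap.apply ℂ V w).restrictScalars ℝ).hasFDerivAt.comp_hasDerivAt x
        (hasDerivAt_expFlow' L x)
    refine (h1.smul h2).congr_deriv ?_
    rw [map_sub, map_smul, smul_sub, smul_smul, mul_neg, neg_smul]
    abel
  have hB : ∀ x, HasDerivAt (fun x => ‖w‖ + C / (ε - ν.re) * exp ((ε - ν.re) * x))
      (C * exp ((ε - ν.re) * x)) x := fun x => by
    have := ((((hasDerivAt_id x).const_mul (ε - ν.re)).exp).const_mul (C / (ε - ν.re))).const_add ‖w‖
    refine this.congr_deriv ?_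
    simp only [id, mul_one]
    field_simp
  have key := image_norm_le_of_norm_deriv_right_le_deriv_boundary (a := 0) (b := X) (f := f)
    (HasDerivAt.continuousOn fun x _ => hfd x) (fun x _ => (hfd x).hasDerivWithinAt)
    (B := fun x => ‖w‖ + C / (ε - ν.re) * exp ((ε - ν.re) * x))
    (by simp only [hf, expFlow_zero, Complex.ofReal_zero, mul_zero, Complex.exp_zero, one_smul]
        have : 0 ≤ C / (ε - ν.re) := by positivity
        simpa using this) hB
    (fun x hx => by
      rw [norm_smul, hexp]
      have := hC x hx.1
      calc _ ≤ exp (-ν.re * x) * (C * exp (ε * x)) :=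
            mul_le_mul_of_nonneg_left this (exp_pos _).le
        _ = _ := by rw [mul_left_comm, ← exp_add]; ring_nf) (right_mem_Icc.2 hX)
  have h3 : ‖expFlow L X w‖ = exp (ν.re * X) * ‖f X‖ := by
    rw [hf, norm_smul, hexp, ← mul_assoc, ← exp_add]
    simp
  rw [h3]
  calc _ ≤ exp (ν.re * X) * (‖w‖ + C / (ε - ν.re) * exp ((ε - ν.re) * X)) :=
        mul_le_mul_of_nonneg_left key (exp_pos _).le
    _ = exp (ν.re * X) * ‖w‖ + C / (ε - ν.re) * exp (ε * X) := by
        rw [mul_add, mul_left_comm, ← exp_add]; ring_nf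
    _ ≤ exp (ε * X) * ‖w‖ + C / (ε - ν.re) * exp (ε * X) := by
        gcongr
        linarith
    _ = _ := by ring

theorem exists_expFlow_mul_le {L Q : CL(V)} (hcomm : Q * L = L * Q)
    (hQ : ∀ ν : ℂ, 0 < ν.re → ∀ v ∈ maxGenEigenspace L.toLinearMap ν, Q v = 0)
    {ε : ℝ} (hε : 0 < ε) : ∃ C, ∀ x, 0 ≤ x → ‖expFlow L x * Q‖ ≤ C * exp (ε * x) := by
  have : CompleteSpace V := FiniteDimensional.complete ℂ V
  obtain ⟨C, hC⟩ := banach_steinhaus (ι := {x : ℝ // 0 ≤ x})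
    (g := fun x => (exp (-(ε * x)) : ℂ) • (expFlow L x * Q)) fun v => by
      obtain ⟨C, hC⟩ := by
        refine genEigenvector_induction L.toLinearMap
          (p := fun v => ∃ C, ∀ x, 0 ≤ x → ‖expFlow L x (Q v)‖ ≤ C * exp (ε * x))
          ⟨0, fun x _ => by simp⟩ ?_ (fun ν _ _ _ v hv => ?_) v
        · rintro v w ⟨C, hC⟩ ⟨D, hD⟩
          refine ⟨C + D, fun x hx => ?_⟩
          rw [map_add, map_add, add_mul]
          exact (norm_add_le _ _).trans (add_le_add (hC x hx) (hD x hx))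
        by_cases hν : 0 < ν.re
        · rw [hQ ν hν v hv]
          exact ⟨0, fun x _ => by simp⟩
        refine norm_expFlow_gen_le (not_lt.1 hν) hε _ (maxGenEigenspace_induction
          (M := L.toLinearMap) (ν := ν) (P := fun v => Q v ∈ maxGenEigenspace L.toLinearMap ν)
          (by simp) (fun w _ hw => mem_maxGenEigenspace_of_map_sub ?_) v hv)
        have h1 : Q (L w) = L (Q w) := DFunLike.congr_fun hcomm w
        change L (Q w) - ν • Q w ∈ _
        rw [← h1, ← map_smul, ← map_sub]
        exact hw
      refine ⟨C, fun x => ?_⟩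
      change ‖(exp (-(ε * x)) : ℂ) • expFlow L x (Q v)‖ ≤ C
      rw [norm_smul, norm_real, norm_of_nonneg (exp_pos _).le, Real.exp_neg,
        inv_mul_le_iff₀ (exp_pos _), mul_comm]
      exact hC x x.2
  refine ⟨C, fun x hx => ?_⟩
  have := hC ⟨x, hx⟩
  rwa [norm_smul, norm_real, norm_of_nonneg (exp_pos _).le, Real.exp_neg,
    inv_mul_le_iff₀ (exp_pos _), mul_comm] at this

theorem mem_maxGenEigenspace_neg {L : CL(V)} {ν : ℂ} {v : V}
    (hv : v ∈ maxGenEigenspace (-L).toLinearMap ν) :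
    v ∈ maxGenEigenspace L.toLinearMap (-ν) := by
  refine maxGenEigenspace_induction (M := (-L).toLinearMap) (ν := ν)
    (P := fun v => v ∈ maxGenEigenspace L.toLinearMap (-ν))
    (Submodule.zero_mem _) (fun w _ hw => mem_maxGenEigenspace_of_map_sub ?_) v hv
  have h : L w - (-ν) • w = -((-L) w - ν • w) := by
    rw [neg_apply, neg_smul]
    abel
  exact h ▸ Submodule.neg_mem _ hw

theorem IsExpConj.exists_factor {A : ℝ → CL(V)} {L Q : CL(V)} {P P' : ℝ → CL(V)}
    {K : ℝ} (hK : ∀ x, ‖A x‖ ≤ K) (hP : IsExpConj A L P) (hP' : IsExpConj A L P')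
    (hQ : Q * Q = Q) (hcomm : Q * L = L * Q)
    (hpos : ∀ ν : ℂ, 0 < ν.re → ∀ v ∈ maxGenEigenspace L.toLinearMap ν, Q v = 0)
    (hneg : ∀ ν : ℂ, ν.re < 0 → ∀ v ∈ maxGenEigenspace L.toLinearMap ν, Q v = v) :
    ∃ G : CL(V), P' 0 = P 0 * G ∧ (1 - Q) * G * Q = 0 ∧ (G * Q + (1 - Q)).det = 1 := by
  have : CompleteSpace V := FiniteDimensional.complete ℂ V
  obtain ⟨C, θ, hθ, hC⟩ := hP.decay
  obtain ⟨C', θ', hθ', hC'⟩ := hP'.decay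
  obtain ⟨D, κ, hκ, hD, hD'⟩ : ∃ D κ : ℝ, 0 < κ ∧ (∀ x, 0 ≤ x → ‖P x - 1‖ ≤ D * exp (-κ * x)) ∧
      ∀ x, 0 ≤ x → ‖P' x - 1‖ ≤ D * exp (-κ * x) := by
    have hC0 : 0 ≤ C := by simpa using (norm_nonneg _).trans (hC 0 le_rfl)
    have hC0' : 0 ≤ C' := by simpa using (norm_nonneg _).trans (hC' 0 le_rfl)
    refine ⟨max C C', min θ θ', lt_min hθ hθ', fun x hx => (hC x hx).trans ?_,
      fun x hx => (hC' x hx).trans ?_⟩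
    · refine mul_le_mul (le_max_left _ _) (exp_le_exp.2 ?_) (exp_pos _).le
        (hC0.trans (le_max_left _ _))
      nlinarith [min_le_left θ θ']
    · refine mul_le_mul (le_max_right _ _) (exp_le_exp.2 ?_) (exp_pos _).le
        (hC0.trans (le_max_left _ _))
      nlinarith [min_le_right θ θ']
  have hlim := tendsto_const_mul_exp_neg D hκ
  obtain ⟨x₀, hx₀⟩ := eventually_atTop.1 ((hlim.eventually (eventually_lt_nhds
    (show (0 : ℝ) < 1 / 2 by norm_num))).and (eventually_ge_atTop 0))
  have hhalf : ∀ x, x₀ ≤ x → ‖P x - 1‖ ≤ 1 / 2 := fun x hx =>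
    (hD x (hx₀ x hx).2).trans (hx₀ x hx).1.le
  obtain ⟨u, hu⟩ : IsUnit (P x₀) := by
    have := isUnit_one_sub_of_norm_lt_one (x := 1 - P x₀) (by
      rw [norm_sub_rev]
      exact (hhalf x₀ le_rfl).trans_lt (by norm_num))
    rwa [sub_sub_cancel] at this
  set U := expFlow L with hU
  set G : CL(V) := U (-x₀) * (↑u⁻¹ * P' x₀) * U x₀ with hG
  set F : ℝ → CL(V) := fun x => U x * G * U (-x) with hF
  have hF0 : F 0 = G := by simp [hF, hU, expFlow_zero]
  have hFx₀ : P x₀ * F x₀ = P' x₀ := by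
    have h1 : F x₀ = (U x₀ * U (-x₀)) * (↑u⁻¹ * P' x₀) * (U x₀ * U (-x₀)) := by
      simp only [hF, hG]; noncomm_ring
    rw [h1, hU, expFlow_mul_neg, one_mul, mul_one, ← hu, ← mul_assoc, Units.mul_inv, one_mul]
  have hFd : ∀ x, HasDerivAt F (L * F x - F x * L) x := fun x => by
    refine (((hasDerivAt_expFlow L x).mul (hasDerivAt_const x G)).mul
      (hasDerivAt_expFlow_neg L x)).congr_deriv ?_
    simp only [hF, hU]
    noncomm_ring
  have hPF : ∀ x, P x * F x = P' x := by
    intro x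
    have hK' : ∀ t, ‖A (t + x₀)‖ + ‖L‖ ≤ (⟨‖A 0‖ + |K| + ‖L‖, by positivity⟩ : NNReal) := fun t => by
      change _ ≤ ‖A 0‖ + |K| + ‖L‖
      linarith [hK (t + x₀), le_abs_self K, norm_nonneg (A 0)]
    have h1 := solution_unique (lipschitz_conj_field (A := fun t => A (t + x₀)) (L := L) hK')
      (y := fun t => P (t + x₀) * F (t + x₀)) (z := fun t => P' (t + x₀)) (fun t => by
        refine (((hP.ode (t + x₀)).mul (hFd (t + x₀))).comp_add_const t x₀).congr_deriv ?_
        noncomm_ring) (fun t => (hP'.ode (t + x₀)).comp_add_const t x₀) (by simpa using hFx₀)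
      (x - x₀)
    simpa using h1
  have hFlim : ∀ x, x₀ ≤ x → ‖F x - 1‖ ≤ 4 * D * exp (-κ * x) := fun x hx => by
    have h1 : F x - 1 = (P' x - 1) - (P x - 1) - (P x - 1) * (F x - 1) := by
      rw [← hPF x]; noncomm_ring
    have h2 : ‖F x - 1‖ ≤ ‖P' x - 1‖ + ‖P x - 1‖ + ‖P x - 1‖ * ‖F x - 1‖ := by
      conv_lhs => rw [h1]
      exact (norm_sub_le _ _).trans (add_le_add (norm_sub_le _ _) (norm_mul_le _ _))
    have h3 := mul_le_mul_of_nonneg_right (hhalf x hx) (norm_nonneg (F x - 1))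
    linarith [hD x (hx₀ x hx).2, hD' x (hx₀ x hx).2]
  have hQU : ∀ x, Q * U x = U x * Q := expFlow_comm hcomm
  refine ⟨G, ?_, ?_, ?_⟩
  · rw [← hPF 0, hF0]
  · obtain ⟨C₁, hC₁⟩ := exists_expFlow_mul_le hcomm hpos (ε := κ / 4) (by positivity)
    obtain ⟨C₂, hC₂⟩ := exists_expFlow_mul_le (L := -L) (Q := 1 - Q)
      (by rw [sub_mul, mul_sub, one_mul, mul_one, mul_neg, neg_mul, hcomm])
      (fun ν hν v hv => by
        have := hneg (-ν) (by simpa using hν) v (mem_maxGenEigenspace_neg hv)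
        change v - Q v = 0
        rw [this, sub_self]) (ε := κ / 4) (by positivity)
    have h1 : ∀ x, (1 - Q) * G * Q = expFlow (-L) x * (1 - Q) * (F x - 1) * (U x * Q) := fun x => by
      have h2 : (1 - Q) * U (-x) = U (-x) * (1 - Q) := by
        rw [sub_mul, mul_sub, one_mul, mul_one, hQU]
      have h3 : G = U (-x) * F x * U x := by
        have : U (-x) * F x * U x = (U (-x) * U x) * G * (U (-x) * U x) := by
          simp only [hF]; noncomm_ring
        rw [this, hU, expFlow_neg_mul, one_mul, mul_one]
      have h4 : (1 - Q) * 1 * Q = 0 := by rw [mul_one, sub_mul, one_mul, hQ, sub_self]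
      rw [expFlow_neg, ← hU, ← h2]
      calc (1 - Q) * G * Q = (1 - Q) * (U (-x) * F x * U x) * Q - (1 - Q) * 1 * Q := by
            rw [h4, sub_zero, ← h3]
        _ = (1 - Q) * (U (-x) * F x * U x) * Q - (1 - Q) * (U (-x) * U x) * Q := by
            rw [hU, expFlow_neg_mul]
        _ = _ := by noncomm_ring
    have h5 : ∀ᶠ x in atTop, ‖(1 - Q) * G * Q‖ ≤ (C₂ * (4 * D) * C₁) * exp (-(κ / 2) * x) := by
      filter_upwards [eventually_ge_atTop x₀] with x hx
      have hx0 : 0 ≤ x := (hx₀ x hx).2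
      rw [h1 x]
      have e1 := hC₂ x hx0
      have e2 := hFlim x hx
      have e3 := hC₁ x hx0
      calc _ ≤ ‖expFlow (-L) x * (1 - Q)‖ * ‖F x - 1‖ * ‖U x * Q‖ :=
            (norm_mul_le _ _).trans (mul_le_mul_of_nonneg_right (norm_mul_le _ _) (norm_nonneg _))
        _ ≤ (C₂ * exp (κ / 4 * x)) * (4 * D * exp (-κ * x)) * (C₁ * exp (κ / 4 * x)) := by
              have n1 := (norm_nonneg _).trans e1
              have n2 := (norm_nonneg _).trans e2
              exact mul_le_mul (mul_le_mul e1 e2 (norm_nonneg _) n1) e3 (norm_nonneg _)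
                (mul_nonneg n1 n2)
        _ = (C₂ * (4 * D) * C₁) * (exp (κ / 4 * x) * exp (-κ * x) * exp (κ / 4 * x)) := by ring
        _ = _ := by rw [← exp_add, ← exp_add]; ring_nf
    exact norm_le_zero_iff.1 (ge_of_tendsto (tendsto_const_mul_exp_neg _ (half_pos hκ)) h5)
  · have hconj : ∀ x, F x * Q + (1 - Q) = U x * (G * Q + (1 - Q)) * U (-x) := fun x => by
      have h2 : Q * U (-x) = U (-x) * Q := hQU (-x)
      have h3 : U x * U (-x) = 1 := expFlow_mul_neg L x
      calc F x * Q + (1 - Q) = U x * G * (U (-x) * Q) + (1 - Q) * (U x * U (-x)) := by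
            rw [h3]; simp only [hF]; noncomm_ring
        _ = U x * G * (Q * U (-x)) + (U x - Q * U x) * U (-x) := by rw [h2]; noncomm_ring
        _ = _ := by rw [hQU x]; noncomm_ring
    have hdet : ∀ x, (F x * Q + (1 - Q)).det = (G * Q + (1 - Q)).det := fun x => by
      rw [hconj x]
      have hm : ∀ M N : CL(V), (M * N).det = M.det * N.det := fun M N =>
        LinearMap.det_comp M.toLinearMap N.toLinearMap
      rw [hm, hm, mul_right_comm, ← hm, hU, expFlow_mul_neg]
      have h1 : (1 : CL(V)).det = 1 := LinearMap.det_id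
      rw [h1, one_mul]
    have hFt : Tendsto F atTop (𝓝 1) := by
      rw [tendsto_iff_norm_sub_tendsto_zero]
      refine squeeze_zero' (Eventually.of_forall fun _ => norm_nonneg _)
        (g := fun x => 4 * (D * exp (-κ * x))) ?_ (by simpa using hlim.const_mul 4)
      filter_upwards [eventually_ge_atTop x₀] with x hx
      rw [← mul_assoc]
      exact hFlim x hx
    have h1 : Tendsto (fun x => (F x * Q + (1 - Q)).det) atTop (𝓝 ((1 * Q + (1 - Q)).det)) :=
      (ContinuousLinearMap.continuous_det.tendsto _).comp ((hFt.mul_const Q).add_const (1 - Q))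
    simp only [hdet] at h1
    have h2 := tendsto_nhds_unique tendsto_const_nhds h1
    rw [h2, one_mul, add_sub_cancel]
    exact LinearMap.det_id

theorem exists_unimodular_transition {k : ℕ} {Q G : CL(V)} {R : Fin k → V}
    (hR : LinearIndependent ℂ R) (hQR : ∀ i, Q (R i) = R i)
    (hran : ∀ v, Q v ∈ Submodule.span ℂ (range R)) (hG : (1 - Q) * G * Q = 0)
    (hdet : (G * Q + (1 - Q)).det = 1) :
    ∃ q : Matrix (Fin k) (Fin k) ℂ, q.det = 1 ∧ ∀ i, G (R i) = ∑ j, q i j • R j := by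
  set W := Submodule.span ℂ (range R) with hW
  have hQW : ∀ w ∈ W, Q w = w := by
    intro w hw
    have : W ≤ LinearMap.eqLocus Q.toLinearMap LinearMap.id := by
      rw [hW, Submodule.span_le]
      rintro _ ⟨i, rfl⟩
      exact hQR i
    exact this hw
  set N : CL(V) := G * Q + (1 - Q) with hN
  have hNW : ∀ w ∈ W, N w = G w := fun w hw => by
    change G (Q w) + (w - Q w) = G w
    rw [hQW w hw, sub_self, add_zero]
  have hGW : ∀ w ∈ W, G w ∈ W := fun w hw => by
    have h1 : G (Q w) - Q (G (Q w)) = 0 := DFunLike.congr_fun hG w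
    rw [hQW w hw, sub_eq_zero] at h1
    rw [h1]
    exact hran _
  have he : W ≤ Submodule.comap N.toLinearMap W := fun w hw => by
    change N w ∈ W
    rw [hNW w hw]
    exact hGW w hw
  have h1 := LinearMap.det_eq_det_mul_det W N.toLinearMap he
  have h2 : W.mapQ W N.toLinearMap he = LinearMap.id := by
    refine Submodule.linearMap_qext _ (LinearMap.ext fun v => ?_)
    change Submodule.Quotient.mk (N v) = Submodule.Quotient.mk v
    rw [Submodule.Quotient.eq]
    have : N v - v = N (Q v) - Q v := by
      change G (Q v) + (v - Q v) - v = G (Q (Q v)) + (Q v - Q (Q v)) - Q v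
      rw [hQW _ (hran v)]
      abel
    rw [this]
    exact W.sub_mem (he (hran v)) (hran v)
  have hdet' : LinearMap.det N.toLinearMap = 1 := hdet
  rw [hdet', h2, LinearMap.det_id, mul_one] at h1
  let b : Module.Basis (Fin k) ℂ W := Module.Basis.span hR
  have hb : ∀ i, ((b i : W) : V) = R i := fun i =>
    congrArg Subtype.val (Module.Basis.span_apply hR i)
  set M := LinearMap.toMatrix b b (N.toLinearMap.restrict he) with hM
  refine ⟨M.transpose, ?_, fun i => ?_⟩
  · rw [Matrix.det_transpose, hM, LinearMap.det_toMatrix, ← h1]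
  · have h3 := b.sum_repr ((N.toLinearMap.restrict he) (b i))
    have h4 := congrArg (fun w : W => (w : V)) h3
    simp only [Submodule.coe_sum, Submodule.coe_smul, hb] at h4
    have h5 : (((N.toLinearMap.restrict he) (b i) : W) : V) = G (R i) := by
      rw [LinearMap.restrict_apply]
      change N (b i : V) = _
      rw [hNW _ (b i).2, hb]
    rw [← h5, ← h4]
    refine Finset.sum_congr rfl fun j _ => ?_
    rw [Matrix.transpose_apply, hM, LinearMap.toMatrix_apply]

end Flow

theorem det_append_transition {k l : ℕ} {u : Fin k → Fin (k + l) → ℂ} {w : Fin l → Fin (k + l) → ℂ}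
    {q : Matrix (Fin k) (Fin k) ℂ} {q' : Matrix (Fin l) (Fin l) ℂ} (hq : q.det = 1)
    (hq' : q'.det = 1) :
    Matrix.det (fun i j => (Fin.append (fun i => ∑ s, q i s • u s) (fun i => ∑ s, q' i s • w s) :
      Fin (k + l) → Fin (k + l) → ℂ) j i) =
    Matrix.det (fun i j => (Fin.append u w : Fin (k + l) → Fin (k + l) → ℂ) j i) := by
  set M : Matrix (Fin (k + l)) (Fin (k + l)) ℂ := Matrix.of (Fin.append u w) with hM
  set M' : Matrix (Fin (k + l)) (Fin (k + l)) ℂ :=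
    Matrix.of (Fin.append (fun i => ∑ s, q i s • u s) (fun i => ∑ s, q' i s • w s)) with hM'
  change M'.transpose.det = M.transpose.det
  rw [Matrix.det_transpose, Matrix.det_transpose]
  have h : M'.submatrix finSumFinEquiv finSumFinEquiv =
      Matrix.fromBlocks q 0 0 q' * M.submatrix finSumFinEquiv finSumFinEquiv := by
    ext i j
    rw [Matrix.mul_apply, Fintype.sum_sum_type]
    rcases i with i | i <;> simp [hM, hM', Fin.append_left, Fin.append_right]
  rw [← Matrix.det_submatrix_equiv_self finSumFinEquiv M', h, Matrix.det_mul,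
    Matrix.det_fromBlocks_zero₂₁, hq, hq', one_mul, one_mul, Matrix.det_submatrix_equiv_self]

/-! ### Conjugators along families of curves -/

/-- Matrices and continuous linear maps, as normed spaces. -/
def matCLM (n : ℕ) : (Fin n → Fin n → ℂ) ≃L[ℂ] CL(Fin n → ℂ) := LinearEquiv.toContinuousLinearEquiv
    ((Matrix.toLin' : Matrix (Fin n) (Fin n) ℂ ≃ₗ[ℂ] ((Fin n → ℂ) →ₗ[ℂ] (Fin n → ℂ))).trans
      LinearMap.toContinuousLinearMap)

theorem matCLM_symm_toCLM {n : ℕ} (M : Matrix (Fin n) (Fin n) ℂ) : (matCLM n).symm (toCLM M) = M :=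
  (matCLM n).symm_apply_apply M

theorem toCLM_matCLM_symm {n : ℕ} (L : CL(Fin n → ℂ)) :
    toCLM (Matrix.of ((matCLM n).symm L)) = L := (matCLM n).apply_symm_apply L

theorem norm_toCLM_le {n : ℕ} : ∃ c : ℝ, 0 ≤ c ∧ ∀ (M : Matrix (Fin n) (Fin n) ℂ) (r : ℝ), 0 ≤ r →
    (∀ i j, ‖M i j‖ ≤ r) → ‖toCLM M‖ ≤ c * r := by
  refine ⟨‖(matCLM n).toContinuousLinearMap‖,
    ContinuousLinearMap.opNorm_nonneg _, fun M r hr h => ?_⟩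
  refine ((matCLM n).toContinuousLinearMap.le_opNorm M).trans (mul_le_mul_of_nonneg_left ?_
    (ContinuousLinearMap.opNorm_nonneg _))
  exact (pi_norm_le_iff_of_nonneg hr).2 fun i => (pi_norm_le_iff_of_nonneg hr).2 fun j => h i j

theorem norm_entry_le {n : ℕ} : ∃ c : ℝ, 0 ≤ c ∧ ∀ (M : Matrix (Fin n) (Fin n) ℂ) (i j : Fin n),
    ‖M i j‖ ≤ c * ‖toCLM M‖ := by
  refine ⟨‖(matCLM n).symm.toContinuousLinearMap‖, ContinuousLinearMap.opNorm_nonneg _, fun M i j => ?_⟩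
  have h := ContinuousLinearMap.le_opNorm (matCLM n).symm.toContinuousLinearMap (toCLM M)
  have h1 : (matCLM n).symm.toContinuousLinearMap (toCLM M) = M := matCLM_symm_toCLM M
  rw [h1] at h
  exact ((norm_le_pi_norm (M i) j).trans (norm_le_pi_norm (M : Fin n → Fin n → ℂ) i)).trans h

theorem hasDerivAt_toCLM {n : ℕ} {P : ℝ → Matrix (Fin n) (Fin n) ℂ} {P' : Matrix (Fin n) (Fin n) ℂ}
    {x : ℝ} : HasDerivAt (fun y => toCLM (P y)) (toCLM P') x ↔
      ∀ i j, HasDerivAt (fun y => P y i j) (P' i j) x := by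
  constructor
  · intro h
    have h1 := ((matCLM n).symm.toContinuousLinearMap.restrictScalars ℝ).hasFDerivAt.comp_hasDerivAt x h
    have h2 : HasDerivAt (fun y => (P y : Fin n → Fin n → ℂ)) P' x := by
      refine (h1.congr_of_eventuallyEq (Eventually.of_forall fun y => ?_)).congr_deriv ?_
      · exact (matCLM_symm_toCLM (P y)).symm
      · exact matCLM_symm_toCLM P'
    exact fun i j => hasDerivAt_pi.1 (hasDerivAt_pi.1 h2 i) j
  · intro h
    have h2 : HasDerivAt (fun y => (P y : Fin n → Fin n → ℂ)) P' x :=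
      hasDerivAt_pi.2 fun i => hasDerivAt_pi.2 fun j => h i j
    exact ((matCLM n).toContinuousLinearMap.restrictScalars ℝ).hasFDerivAt.comp_hasDerivAt x h2

theorem IsConjugator.isExpConj {n : ℕ} {A P : ℝ → Matrix (Fin n) (Fin n) ℂ}
    {L : Matrix (Fin n) (Fin n) ℂ} (h : IsConjugator A L (Ici 0) P) :
    IsExpConj (fun x => toCLM (A x)) (toCLM L) (fun x => toCLM (P x)) where
  ode x := by
    rw [← toCLM_mul, ← toCLM_mul, ← map_sub]
    exact hasDerivAt_toCLM.2 (h.ode x)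
  decay := by
    obtain ⟨C, θ, hθ, hC⟩ := h.decay
    obtain ⟨c, hc, hM⟩ := norm_toCLM_le (n := n)
    refine ⟨c * |C|, θ, hθ, fun x hx => ?_⟩
    rw [← toCLM_one, ← map_sub, mul_assoc]
    refine hM _ _ (by positivity) fun i j => (hC x hx i j).trans ?_
    rw [abs_of_nonneg hx]
    exact mul_le_mul_of_nonneg_right (le_abs_self C) (exp_pos _).le

theorem IsExpConj.isConjugator {n : ℕ} {A P : ℝ → Matrix (Fin n) (Fin n) ℂ}
    {L : Matrix (Fin n) (Fin n) ℂ}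
    (h : IsExpConj (fun x => toCLM (A x)) (toCLM L) (fun x => toCLM (P x))) :
    IsConjugator A L (Ici 0) P where
  ode x := by
    have := h.ode x
    rw [← toCLM_mul, ← toCLM_mul, ← map_sub] at this
    exact hasDerivAt_toCLM.1 this
  decay := by
    obtain ⟨C, θ, hθ, hC⟩ := h.decay
    obtain ⟨c, hc, hM⟩ := norm_entry_le (n := n)
    refine ⟨c * C, θ, hθ, fun x hx i j => ?_⟩
    rw [abs_of_nonneg (show (0 : ℝ) ≤ x from hx), mul_assoc]
    refine (hM (P x - 1) i j).trans (mul_le_mul_of_nonneg_left ?_ hc)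
    rw [map_sub, toCLM_one]
    exact hC x hx

theorem isConjugator_reflect {n : ℕ} {A P : ℝ → Matrix (Fin n) (Fin n) ℂ}
    {L : Matrix (Fin n) (Fin n) ℂ} {s t : Set ℝ} (hst : ∀ x ∈ t, -x ∈ s)
    (h : IsConjugator A L s P) :
    IsConjugator (fun x => -A (-x)) (-L) t (fun x => P (-x)) where
  ode x i j := by
    refine (HasDerivAt.scomp x (h.ode (-x) i j) (hasDerivAt_neg x)).congr_deriv ?_
    simp only [neg_smul, one_smul, Matrix.sub_apply, Matrix.neg_mul, Matrix.mul_neg, Matrix.neg_apply]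
    ring
  decay := by
    obtain ⟨C, θ, hθ, hC⟩ := h.decay
    exact ⟨C, θ, hθ, fun x hx i j => by simpa using hC (-x) (hst x hx) i j⟩

namespace MHD

variable (m : MHD)

/-- The coefficient matrix as a function of `(a, z)` and of the point of the profile. -/
def coeff (p : (ℝ × ℂ) × ℝ²) : CL(Fin 6 → ℂ) := toCLM (m.evansMatrix p.1.1 p.1.2 p.2.1 p.2.2)

theorem contDiffAt_coeff {p : (ℝ × ℂ) × ℝ²} (hp : 0 < p.2.1) : ContDiffAt ℝ 1 m.coeff p := by
  have hτ := m.tau_pos.ne'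
  have hμ := m.μ_pos.ne'
  have hμ₀ := m.μ₀_pos.ne'
  have hv : p.2.1 ≠ 0 := hp.ne'
  have key : ContDiffAt ℝ 1 (F := Fin 6 → Fin 6 → ℂ)
      (fun p : (ℝ × ℂ) × ℝ² => m.evansMatrix p.1.1 p.1.2 p.2.1 p.2.2) p := by
    have hB : ContDiffAt ℝ 1 (fun p : (ℝ × ℂ) × ℝ² => m.magField p.2.1 p.2.2) p := by
      unfold magField; fun_prop (disch := assumption)
    have hr : ∀ r : ℝ, ContDiffAt ℝ 1 (fun p : (ℝ × ℂ) × ℝ² => p.2.1 ^ r) p := fun r =>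
      ContDiffAt.rpow_const_of_ne (by fun_prop) hv
    have hV : ContDiffAt ℝ 1 (fun p : (ℝ × ℂ) × ℝ² => m.fieldV p.1.1 p.2.1 p.2.2) p := by
      have h1 := hr (-m.γ)
      have h2 : 2 * m.μ₀ * p.2.1 ≠ 0 := by positivity
      unfold fieldV pressure
      fun_prop (disch := assumption)
    have hW : ContDiffAt ℝ 1 (fun p : (ℝ × ℂ) × ℝ² => m.fieldW p.2.1 p.2.2) p := by
      unfold fieldW
      fun_prop (disch := assumption)
    have hf : ContDiffAt ℝ 1 (fun p : (ℝ × ℂ) × ℝ² => m.fFun p.1.1 p.2.1 p.2.2) p := by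
      have h1 := hr (-m.γ)
      have h2 := hr (m.γ + 1)
      have h3 := hr (-m.γ - 1)
      have h4 : p.2.1 ^ 2 ≠ 0 := by positivity
      unfold fFun hFun
      fun_prop (disch := assumption)
    have hc : ∀ {f : (ℝ × ℂ) × ℝ² → ℝ}, ContDiffAt ℝ 1 f p →
        ContDiffAt ℝ 1 (fun p => ((f p : ℝ) : ℂ)) p := fun h =>
      Complex.ofRealCLM.contDiff.contDiffAt.comp p h
    have hz : ContDiffAt ℝ 1 (fun p : (ℝ × ℂ) × ℝ² => p.1.2) p := by fun_prop
    have hv1 : ContDiffAt ℝ 1 (fun p : (ℝ × ℂ) × ℝ² => p.2.1) p := by fun_prop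
    have e1 := hc (hv1.div_const m.τ)
    have e2 := hc (hf.sub ((hB.pow 2).div_const (m.μ₀ * m.τ)))
    have e3 := hc ((contDiffAt_const (c := m.I)).mul hB |>.div_const (m.μ₀ * m.μ * m.τ))
    have e4 := hc (hB.div_const (m.μ₀ * m.τ))
    have e5 := hc ((((contDiffAt_const (c := m.μ)).mul hW).div hv1 hv).add
      ((contDiffAt_const (c := m.I)).mul hB |>.div_const m.μ₀))
    have e6 := hc hv1
    have e7 := hc ((hv1.sub (contDiffAt_const (c := m.K))).div_const m.μ)
    refine contDiffAt_pi.2 fun i => contDiffAt_pi.2 fun j => ?_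
    fin_cases i <;> fin_cases j <;> first
      | exact contDiffAt_const
      | exact hz
      | exact hz.neg
      | exact hz.mul e1
      | exact e2.sub hz
      | exact e3
      | exact hz.neg.mul e4
      | exact e5
      | exact hz.mul e6
      | exact e7
      | exact hz.mul contDiffAt_const
  exact ((matCLM 6).toContinuousLinearMap.restrictScalars ℝ).contDiff.contDiffAt.comp p key

def box (δ M : ℝ) : Set ℝ² := {y | δ ≤ y.1 ∧ ‖y‖ ≤ M}

theorem isCompact_box {δ M : ℝ} : IsCompact (box δ M) :=
  (isCompact_closedBall (0 : ℝ²) M).of_isClosed_subset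
    ((isClosed_le continuous_const continuous_fst).inter (isClosed_le continuous_norm continuous_const))
    fun y hy => by simpa using hy.2

theorem convex_box {δ M : ℝ} : Convex ℝ (box δ M) := by
  have e : box δ M = {y | δ ≤ y.1} ∩ closedBall 0 M := by ext y; simp [box]
  rw [e]
  exact (convex_halfSpace_ge (LinearMap.fst ℝ ℝ ℝ).isLinear δ).inter (convex_closedBall _ _)

/-- A curve in the half-plane `v > 0` with quantitative bounds that converges to `e` exponentially
fast. -/
structure IsTameCurve (c : ℝ → ℝ²) (e : ℝ²) (C θ δ M : ℝ) : Prop where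
  cont : Continuous c
  mem : ∀ x, c x ∈ box δ M
  mem_end : e ∈ box δ M
  decay : ∀ x, 0 ≤ x → ‖c x - e‖ ≤ C * exp (-θ * x)

theorem exists_conj_family {ι : Type*} {l : Filter ι} (s : ℝ) {q : ι → ℝ × ℂ} {q₀ : ℝ × ℂ}
    {c : ι → ℝ → ℝ²} {e : ι → ℝ²} {c₀ : ℝ → ℝ²} {e₀ : ℝ²} {C θ δ M : ℝ} (hθ : 0 < θ)
    (hδ : 0 < δ) (hq : Tendsto q l (𝓝 q₀)) (hc : ∀ᶠ p in l, IsTameCurve (c p) (e p) C θ δ M)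
    (hc₀ : IsTameCurve c₀ e₀ C θ δ M) (he : Tendsto e l (𝓝 e₀))
    (hloc : ∀ X η : ℝ, 0 < η → ∀ᶠ p in l, ∀ x, |x| ≤ X → ‖c p x - c₀ x‖ ≤ η) :
    ∃ (P : ι → ℝ → CL(Fin 6 → ℂ)) (P₀ : ℝ → CL(Fin 6 → ℂ)),
      (∀ᶠ p in l, IsExpConj (fun x => s • m.coeff (q p, c p x)) (s • m.coeff (q p, e p)) (P p)) ∧
      IsExpConj (fun x => s • m.coeff (q₀, c₀ x)) (s • m.coeff (q₀, e₀)) P₀ ∧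
      Tendsto (fun p => P p 0) l (𝓝 (P₀ 0)) := by
  set U : Set ((ℝ × ℂ) × ℝ²) := closedBall q₀ 1 ×ˢ box δ M with hU
  have hUcompact : IsCompact U := (isCompact_closedBall q₀ 1).prod isCompact_box
  have hcd : ContDiffOn ℝ 1 m.coeff U := fun p hp =>
    (m.contDiffAt_coeff (hδ.trans_le hp.2.1)).contDiffWithinAt
  obtain ⟨κ, hκ⟩ := (hcd.locallyLipschitzOn ((convex_closedBall q₀ 1).prod convex_box)).exists_lipschitzOnWith_of_compact hUcompact
  obtain ⟨N, hN⟩ := hUcompact.exists_bound_of_continuousOn hcd.continuousOn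
  have hq0 : q₀ ∈ closedBall q₀ (1 : ℝ) := Metric.mem_closedBall_self zero_le_one
  have hq1 : ∀ᶠ p in l, q p ∈ closedBall q₀ (1 : ℝ) :=
    hq.eventually (Metric.closedBall_mem_nhds q₀ one_pos)
  have hlip : ∀ p ∈ U, ∀ p' ∈ U, ‖s • m.coeff p - s • m.coeff p'‖ ≤ |s| * κ * dist p p' :=
    fun p hp p' hp' => by
      have h1 : s • m.coeff p - s • m.coeff p' = s • (m.coeff p - m.coeff p') := (smul_sub s _ _).symm
      rw [h1, norm_smul, norm_eq_abs, mul_assoc, ← dist_eq_norm]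
      exact mul_le_mul_of_nonneg_left (hκ.dist_le_mul p hp p' hp') (abs_nonneg s)
  have hcont : ∀ q ∈ closedBall q₀ (1 : ℝ), ∀ {c : ℝ → ℝ²} {e : ℝ²},
      IsTameCurve c e C θ δ M → Continuous fun x => s • m.coeff (q, c x) := fun q hq c e h => by
    refine Continuous.const_smul ?_ s
    refine hcd.continuousOn.comp_continuous (f := fun x => (q, c x)) ?_ fun x => ⟨hq, h.mem x⟩
    have := h.cont
    fun_prop
  have hbd : ∀ q ∈ closedBall q₀ (1 : ℝ), ∀ {c : ℝ → ℝ²} {e : ℝ²},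
      IsTameCurve c e C θ δ M → ∀ x, ‖s • m.coeff (q, c x)‖ ≤ |s| * N := fun q hq c e h x => by
    rw [norm_smul, norm_eq_abs]
    exact mul_le_mul_of_nonneg_left (hN _ ⟨hq, h.mem x⟩) (abs_nonneg s)
  have hdec : ∀ q ∈ closedBall q₀ (1 : ℝ), ∀ {c : ℝ → ℝ²} {e : ℝ²},
      IsTameCurve c e C θ δ M → ∀ x, 0 ≤ x → ‖s • m.coeff (q, c x) - s • m.coeff (q, e)‖ ≤
        |s| * κ * C * exp (-θ * x) := fun q hq c e h x hx => by
    refine (hlip _ ⟨hq, h.mem x⟩ _ ⟨hq, h.mem_end⟩).trans ?_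
    rw [mul_assoc (|s| * (κ : ℝ))]
    refine mul_le_mul_of_nonneg_left ?_ (by positivity)
    have : dist (q, c x) (q, e) = ‖c x - e‖ := by simp [dist_eq_norm]
    rw [this]
    exact h.decay x hx
  refine exists_conj_tendsto (C := |s| * κ * C) (θ := θ) (K := |s| * N) hθ ?_ (hcont q₀ hq0 hc₀) ?_
    (hbd q₀ hq0 hc₀) ?_ (hdec q₀ hq0 hc₀) ?_ fun X η hη => ?_
  · filter_upwards [hc, hq1] with p h1 h2 using hcont _ h2 h1
  · filter_upwards [hc, hq1] with p h1 h2 using hbd _ h2 h1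
  · filter_upwards [hc, hq1] with p h1 h2 using hdec _ h2 h1
  · have h1 : ContinuousAt m.coeff (q₀, e₀) :=
      (m.contDiffAt_coeff (p := (q₀, e₀)) (hδ.trans_le hc₀.mem_end.1)).continuousAt
    exact (h1.tendsto.comp (hq.prodMk_nhds he)).const_smul s
  · obtain ⟨r, hr, hrη⟩ : ∃ r > 0, |s| * κ * r ≤ η := by
      refine ⟨η / (|s| * κ + 1), by positivity, ?_⟩
      rw [mul_div_assoc', div_le_iff₀ (by positivity)]
      nlinarith
    filter_upwards [hc, hq1, hloc X r hr, hq.eventually (Metric.closedBall_mem_nhds q₀ hr)]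
      with p h1 h2 h3 h4 x hx
    refine (hlip _ ⟨h2, h1.mem x⟩ _ ⟨hq0, hc₀.mem x⟩).trans
      ((mul_le_mul_of_nonneg_left ?_ (by positivity)).trans hrη)
    rw [Prod.dist_eq]
    exact max_le h4 (by rw [dist_eq_norm]; exact h3 x hx)

end MHD

/-! ### Kato bases and the Evans function -/

theorem mem_unstableSubspace {n : ℕ} {M : Matrix (Fin n) (Fin n) ℂ} {v : Fin n → ℂ} :
    v ∈ unstableSubspace M ↔ uproj (toCLM M) v = v := by
  constructor
  · intro hv
    have : unstableSubspace M ≤ LinearMap.eqLocus (uproj (toCLM M)).toLinearMap LinearMap.id :=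
      iSup₂_le fun ν hν v hv => by
        have := uproj_apply (M := toCLM M) hv
        rwa [if_pos hν] at this
    exact this hv
  · intro hv
    rw [← hv]
    refine genEigenvector_induction (toCLM M).toLinearMap
      (p := fun v => uproj (toCLM M) v ∈ unstableSubspace M) (by simp) (fun v w h1 h2 => by
        rw [map_add]; exact Submodule.add_mem _ h1 h2) (fun ν _ _ _ v hv => ?_) v
    rw [uproj_apply hv]
    split_ifs with h
    · exact Submodule.mem_iSup_of_mem ν (Submodule.mem_iSup_of_mem h hv)
    · exact Submodule.zero_mem _

theorem mem_stableSubspace {n : ℕ} {M : Matrix (Fin n) (Fin n) ℂ} {v : Fin n → ℂ}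
    (hM : ∀ (ν : ℂ) (x : Fin n → ℂ), toCLM M x = ν • x → x ≠ 0 → ν.re ≠ 0) :
    v ∈ stableSubspace M ↔ uproj (toCLM M) v = 0 := by
  constructor
  · intro hv
    have : stableSubspace M ≤ LinearMap.ker (uproj (toCLM M)).toLinearMap :=
      iSup₂_le fun ν hν v hv => by
        have := uproj_apply (M := toCLM M) hv
        rwa [if_neg (not_lt.2 hν.le)] at this
    exact this hv
  · intro hv
    rw [← sub_zero v, ← hv]
    refine genEigenvector_induction (toCLM M).toLinearMap
      (p := fun v => v - uproj (toCLM M) v ∈ stableSubspace M) (by simp) (fun v w h1 h2 => by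
        rw [map_add, add_sub_add_comm]; exact Submodule.add_mem _ h1 h2)
      (fun ν x hx hx0 v hv => ?_) v
    rw [uproj_apply hv]
    split_ifs with h
    · rw [sub_self]; exact Submodule.zero_mem _
    · rw [sub_zero]
      exact Submodule.mem_iSup_of_mem ν (Submodule.mem_iSup_of_mem
        ((not_lt.1 h).lt_of_ne (hM ν x hx hx0)) hv)

theorem IsFrame.transport {n k : ℕ} {T Q Q₀ : CL(Fin n → ℂ)} {E : Submodule ℂ (Fin n → ℂ)}
    {b : Fin k → Fin n → ℂ} (hb : IsFrame E b) (hU : IsUnit T) (hint : Q * T = T * Q₀)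
    (hE : ∀ v, v ∈ E ↔ Q₀ v = v) : (∀ i, Q (T (b i)) = T (b i)) ∧
      LinearIndependent ℂ (fun i => T (b i)) ∧
        ∀ v, Q v = v → v ∈ Submodule.span ℂ (range fun i => T (b i)) := by
  have hl : ∀ w, Q (T w) = T (Q₀ w) := fun w => DFunLike.congr_fun hint w
  have hT := ContinuousLinearMap.isUnit_iff_bijective.1 hU
  refine ⟨fun i => ?_, hb.1.map' T.toLinearMap (LinearMap.ker_eq_bot.2 hT.1), fun v hv => ?_⟩
  · rw [hl, (hE _).1 (hb.2 ▸ Submodule.subset_span (mem_range_self i))]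
  · obtain ⟨w, rfl⟩ := hT.2 v
    rw [hl] at hv
    have h1 : w ∈ Submodule.span ℂ (range b) := by rw [hb.2, hE]; exact hT.1 hv
    have h2 := Submodule.mem_map_of_mem (f := T.toLinearMap) h1
    rwa [Submodule.map_span, ← range_comp] at h2

theorem isKatoBasis_of_transport {n k : ℕ} {E F : ℂ → Submodule ℂ (Fin n → ℂ)}
    {T Q : ℂ → CL(Fin n → ℂ)} {b : Fin k → Fin n → ℂ} {z₀ : ℂ} (hz₀ : 0 < z₀.re)
    (hcont : ContinuousOn T {z | 0 ≤ z.re}) (hU : ∀ z : ℂ, 0 ≤ z.re → IsUnit (T z))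
    (hint : ∀ z : ℂ, 0 ≤ z.re → Q z * T z = T z * Q z₀)
    (hderiv : ∀ z : ℂ, 0 < z.re → ∃ T', HasDerivAt T T' z ∧ Q z * T' * Q z₀ = 0)
    (hE : ∀ z : ℂ, 0 < z.re → ∀ v, v ∈ E z ↔ Q z v = v)
    (hF : ∀ z : ℂ, 0 < z.re → ∀ v, v ∈ F z ↔ Q z v = 0) (hb : IsFrame (E z₀) b) :
    IsKatoBasis E F (fun j z => T z (b j)) := by
  have hQb : ∀ j, Q z₀ (b j) = b j := fun j =>
    (hE z₀ hz₀ _).1 (hb.2 ▸ Submodule.subset_span (mem_range_self j))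
  have htr := fun (z : ℂ) (hz : 0 ≤ z.re) => hb.transport (hU z hz) (hint z hz) (hE z₀ hz₀)
  refine ⟨fun j => hcont.clm_apply continuousOn_const, fun z hz => (htr z hz).2.1, fun z hz =>
    ⟨(htr z hz.le).2.1, le_antisymm ?_ fun v hv => (htr z hz.le).2.2 v ((hE z hz v).1 hv)⟩,
    fun z hz j => ?_, fun z hz j => ?_⟩
  · rw [Submodule.span_le]
    rintro _ ⟨j, rfl⟩
    exact (hE z hz _).2 ((htr z hz.le).1 j)
  · obtain ⟨T', hT', -⟩ := hderiv z hz
    exact (hT'.clm_apply (hasDerivAt_const z (b j))).differentiableAt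
  · obtain ⟨T', hT', h0⟩ := hderiv z hz
    have h1 : HasDerivAt (fun z => T z (b j)) (T' (b j)) z :=
      (hT'.clm_apply (hasDerivAt_const z (b j))).congr_deriv (by simp)
    rw [h1.deriv]
    refine (hF z hz _).2 ?_
    have := DFunLike.congr_fun h0 (b j)
    change Q z (T' (Q z₀ (b j))) = 0 at this
    rwa [hQb] at this

namespace MHD

variable (m : MHD)

/-- Kato's transport for the limiting coefficient matrices. -/
def IsTransport (z₀ : ℂ) (P T : m.endStates × ℂ → CL(Fin 6 → ℂ)) : Prop :=
  IsKatoTransport (X := m.endStates) (V := Fin 6 → ℂ)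
    (fun e => toCLM (m.endMat₀ e)) (fun e => toCLM (m.endMat₁ e)) z₀ P T

/-- `N` is the pencil of limiting coefficient matrices at the end state `e`. -/
def IsPencil (e : m.endStates) (N : ℂ → Matrix (Fin 6) (Fin 6) ℂ) : Prop :=
  ∀ z, toCLM (N z) = 𝐋(m, e, z)

variable {m} {z₀ : ℂ} {P T : m.endStates × ℂ → CL(Fin 6 → ℂ)} {e : m.endStates}
  {N : ℂ → Matrix (Fin 6) (Fin 6) ℂ} {k : ℕ} {b : Fin k → Fin 6 → ℂ}

theorem mem_unstable_iff (hT : m.IsTransport z₀ P T)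
    (hN : m.IsPencil e N) {z : ℂ} (hz : 0 < z.re)
    (v : Fin 6 → ℂ) : v ∈ unstableSubspace (N z) ↔ P (e, z) v = v := by
  rw [mem_unstableSubspace, hN, hT.eq_uproj e z hz]

theorem mem_stable_iff (hT : m.IsTransport z₀ P T)
    (hN : m.IsPencil e N) {z : ℂ} (hz : 0 < z.re)
    (v : Fin 6 → ℂ) : v ∈ stableSubspace (N z) ↔ P (e, z) v = 0 := by
  rw [mem_stableSubspace, hN, hT.eq_uproj e z hz]
  intro ν x hx hx0
  rw [hN] at hx
  exact (specRel_endMat e.2 hx hx0).re_ne_zero hz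

theorem isKatoBasis_unstable (hz₀ : 0 < z₀.re) (hT : m.IsTransport z₀ P T)
    (hN : m.IsPencil e N)
    (hb : IsFrame (unstableSubspace (N z₀)) b) :
    IsKatoBasis (fun z => unstableSubspace (N z)) (fun z => stableSubspace (N z))
      (fun j z => T (e, z) (b j)) :=
  isKatoBasis_of_transport (T := fun z => T (e, z)) (Q := fun z => P (e, z)) hz₀
    (continuousOn_slice hT.contT e) (hT.isUnit e) (hT.intertwine e)
    (fun z hz => by
      obtain ⟨T', h1, h2, -⟩ := hT.deriv e z hz
      exact ⟨T', h1, h2⟩)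
    (fun z hz v => mem_unstable_iff hT hN hz v) (fun z hz v => mem_stable_iff hT hN hz v) hb

theorem isKatoBasis_stable (hz₀ : 0 < z₀.re) (hT : m.IsTransport z₀ P T)
    (hN : m.IsPencil e N)
    (hb : IsFrame (stableSubspace (N z₀)) b) :
    IsKatoBasis (fun z => stableSubspace (N z)) (fun z => unstableSubspace (N z))
      (fun j z => T (e, z) (b j)) :=
  isKatoBasis_of_transport (T := fun z => T (e, z)) (Q := fun z => 1 - P (e, z)) hz₀
    (continuousOn_slice hT.contT e) (hT.isUnit e)
    (fun z hz => by rw [sub_mul, mul_sub, one_mul, mul_one, hT.intertwine e z hz])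
    (fun z hz => by
      obtain ⟨T', h1, -, h2⟩ := hT.deriv e z hz
      exact ⟨T', h1, by rw [sub_mul, one_mul, sub_mul, h2, sub_self]⟩)
    (fun z hz v => by
      rw [mem_stable_iff hT hN hz v]
      change _ ↔ v - P (e, z) v = v
      rw [sub_eq_self])
    (fun z hz v => by
      rw [mem_unstable_iff hT hN hz v]
      change _ ↔ v - P (e, z) v = 0
      rw [sub_eq_zero, eq_comm]) hb

theorem kato_unique_unstable (hT : m.IsTransport z₀ P T)
    (hN : m.IsPencil e N)
    {R : Fin k → ℂ → Fin 6 → ℂ} (hR : IsKatoBasis (fun z => unstableSubspace (N z))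
      (fun z => stableSubspace (N z)) R) (j : Fin k) {z : ℂ} (hz : 0 ≤ z.re) :
    R j z = T (e, z) (R j z₀) := by
  refine hT.unique e (R j) (hR.continuousOn j) (fun z hz => hR.differentiable z hz j)
    (Or.inl fun z hz => ⟨?_, (mem_stable_iff hT hN hz _).1 (hR.kato z hz j)⟩) z hz
  exact (mem_unstable_iff hT hN hz _).1
    ((hR.frame z hz).2 ▸ Submodule.subset_span (mem_range_self j))

theorem kato_unique_stable (hT : m.IsTransport z₀ P T)
    (hN : m.IsPencil e N)
    {R : Fin k → ℂ → Fin 6 → ℂ} (hR : IsKatoBasis (fun z => stableSubspace (N z))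
      (fun z => unstableSubspace (N z)) R) (j : Fin k) {z : ℂ} (hz : 0 ≤ z.re) :
    R j z = T (e, z) (R j z₀) := by
  refine hT.unique e (R j) (hR.continuousOn j) (fun z hz => hR.differentiable z hz j)
    (Or.inr fun z hz => ⟨?_, (mem_unstable_iff hT hN hz _).1 (hR.kato z hz j)⟩) z hz
  exact (mem_stable_iff hT hN hz _).1 ((hR.frame z hz).2 ▸ Submodule.subset_span (mem_range_self j))

theorem exists_transition {Q T : ℂ → CL(Fin 6 → ℂ)} {E : Submodule ℂ (Fin 6 → ℂ)}
    {z : ℂ} (hU : IsUnit (T z)) (hint : Q z * T z = T z * Q z₀)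
    (hE : ∀ v, v ∈ E ↔ Q z₀ v = v) (hidem : Q z * Q z = Q z)
    (hb : IsFrame E b) {A : ℝ → CL(Fin 6 → ℂ)} {L : CL(Fin 6 → ℂ)}
    {S S' : ℝ → CL(Fin 6 → ℂ)} {K : ℝ} (hK : ∀ x, ‖A x‖ ≤ K)
    (hS : IsExpConj A L S) (hS' : IsExpConj A L S') (hcomm : Q z * L = L * Q z)
    (hpos : ∀ ν : ℂ, 0 < ν.re → ∀ v ∈ maxGenEigenspace L.toLinearMap ν, Q z v = 0)
    (hneg : ∀ ν : ℂ, ν.re < 0 → ∀ v ∈ maxGenEigenspace L.toLinearMap ν, Q z v = v) :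
    ∃ q : Matrix (Fin k) (Fin k) ℂ, q.det = 1 ∧
      ∀ i, S' 0 (T z (b i)) = ∑ j, q i j • S 0 (T z (b j)) := by
  obtain ⟨G, hG, h1, h2⟩ := IsExpConj.exists_factor hK hS hS' hidem hcomm hpos hneg
  obtain ⟨hQT, hind, hran⟩ := hb.transport hU hint hE
  obtain ⟨q, hq, hqG⟩ := exists_unimodular_transition (R := fun i => T z (b i)) hind hQT
    (fun v => hran _ (DFunLike.congr_fun hidem v)) h1 h2
  refine ⟨q, hq, fun i => ?_⟩
  rw [hG]
  change S 0 (G (T z (b i))) = _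
  rw [hqG, map_sum]
  simp only [map_smul]

/-- The point of a profile as a curve in the plane. -/
def Profile.curve (φ : Profile) (x : ℝ) : ℝ² := (φ.v x, φ.w x)

variable (m) in
/-- The data `(v, a γ v ^ (-γ), B)` of an end state. -/
def endData (a : ℝ) (p : ℝ²) : ℝ × ℝ² := (p.1, a * m.γ * p.1 ^ (-m.γ), m.magField p.1 p.2)

variable (m) in
theorem continuousAt_endData {a₀ : ℝ} {y₀ : ℝ²} (hy : 0 < y₀.1) :
    ContinuousAt (fun q : ℝ × ℝ² => m.endData q.1 q.2) (a₀, y₀) := by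
  have h1 : y₀.1 ≠ 0 := hy.ne'
  have h2 : ContinuousAt (fun q : ℝ × ℝ² => q.2.1 ^ (-m.γ)) (a₀, y₀) :=
    ContinuousAt.rpow_const (by fun_prop) (Or.inl h1)
  have h3 : ContinuousAt (fun q : ℝ × ℝ² => (m.Bm + m.I * q.2.2) / q.2.1) (a₀, y₀) :=
    ContinuousAt.div (by fun_prop) (by fun_prop) h1
  have h4 : ContinuousAt (fun q : ℝ × ℝ² => q.1 * m.γ) (a₀, y₀) := by fun_prop
  have h5 : ContinuousAt (fun q : ℝ × ℝ² => q.2.1) (a₀, y₀) := by fun_prop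
  exact h5.prodMk ((h4.mul h2).prodMk h3)

variable (m) in
/-- Quantitative hypotheses on a profile under which its Evans function exists and depends
continuously on the profile. -/
structure IsTameProfile (a : ℝ) (φ : Profile) (C θ δ M : ℝ) : Prop where
  right : IsTameCurve φ.curve (φ.vR, φ.wR) C θ δ M
  left : IsTameCurve (fun x => φ.curve (-x)) (1, 0) C θ δ M
  rest_v : m.fieldV a φ.vR φ.wR = 0
  rest_w : m.fieldW φ.vR φ.wR = 0
  mem_right : m.endData a (φ.vR, φ.wR) ∈ m.endStates
  mem_left : m.endData a (1, 0) ∈ m.endStates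

variable (m) in
theorem limLeft_eq (a : ℝ) (z : ℂ) : toCLM (m.limLeft a z) =
    toCLM (m.endMat₀ (m.endData a (1, 0))) + z • toCLM (m.endMat₁ (m.endData a (1, 0))) := by
  have h1 : m.fieldV a 1 0 = 0 := by simp [fieldV]
  have h2 : m.fieldW 1 0 = 0 := by simp [fieldW]
  rw [limLeft, m.evansMatrix_eq_endMat z one_pos h1 h2, map_add, map_smul]
  rfl

theorem IsTameProfile.limRight_eq {a : ℝ} {φ : Profile} {C θ δ M : ℝ}
    (h : m.IsTameProfile a φ C θ δ M) (z : ℂ) : toCLM (m.limRight a φ z) =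
    toCLM (m.endMat₀ (m.endData a (φ.vR, φ.wR))) +
      z • toCLM (m.endMat₁ (m.endData a (φ.vR, φ.wR))) := by
  rw [limRight, m.evansMatrix_eq_endMat z (show 0 < φ.vR from h.mem_right.1) h.rest_v h.rest_w, map_add, map_smul]
  rfl

theorem toCLM_det_append {u : Fin 2 → Fin 6 → ℂ} {w : Fin 4 → Fin 6 → ℂ}
    {A B : CL(Fin 6 → ℂ)} {q : Matrix (Fin 2) (Fin 2) ℂ}
    {q' : Matrix (Fin 4) (Fin 4) ℂ} (hq : q.det = 1) (hq' : q'.det = 1)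
    {u' : Fin 2 → Fin 6 → ℂ} {w' : Fin 4 → Fin 6 → ℂ} (hu : ∀ i, u' i = ∑ j, q i j • A (u j))
    (hw : ∀ i, w' i = ∑ j, q' i j • B (w j)) :
    Matrix.det (fun i j : Fin 6 => (Fin.append (m := 2) (n := 4) u' w' : Fin 6 → Fin 6 → ℂ) j i) =
    Matrix.det (fun i j : Fin 6 => (Fin.append (m := 2) (n := 4) (fun l => A (u l))
      (fun l => B (w l)) : Fin 6 → Fin 6 → ℂ) j i) := by
  obtain rfl : u' = fun i => ∑ j, q i j • A (u j) := funext hu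
  obtain rfl : w' = fun i => ∑ j, q' i j • B (w j) := funext hw
  exact det_append_transition (k := 2) (l := 4) (u := fun l => A (u l)) (w := fun l => B (w l)) hq hq'

/-- The determinant formed with transported vectors and arbitrary conjugators. -/
def evansDet (T : m.endStates × ℂ → CL(Fin 6 → ℂ)) (eL eR : m.endStates) (z : ℂ)
    (bm : Fin 2 → Fin 6 → ℂ) (bp : Fin 4 → Fin 6 → ℂ) (A B : CL(Fin 6 → ℂ)) : ℂ :=
  Matrix.det (fun i j : Fin 6 => (Fin.append (m := 2) (n := 4) (fun l => A (T (eL, z) (bm l)))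
    (fun l => B (T (eR, z) (bp l))) : Fin 6 → Fin 6 → ℂ) j i)

theorem tendsto_det_append {ι : Type*} {l : Filter ι} {k n : ℕ} {u : ι → Fin k → Fin (k + n) → ℂ}
    {w : ι → Fin n → Fin (k + n) → ℂ} {u₀ : Fin k → Fin (k + n) → ℂ} {w₀ : Fin n → Fin (k + n) → ℂ}
    (hu : ∀ i, Tendsto (fun p => u p i) l (𝓝 (u₀ i)))
    (hw : ∀ i, Tendsto (fun p => w p i) l (𝓝 (w₀ i))) :
    Tendsto (fun p => Matrix.det (fun i j => (Fin.append (u p) (w p) :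
        Fin (k + n) → Fin (k + n) → ℂ) j i)) l
      (𝓝 (Matrix.det (fun i j => (Fin.append u₀ w₀ : Fin (k + n) → Fin (k + n) → ℂ) j i))) := by
  have hdc : Continuous (fun M : Matrix (Fin (k + n)) (Fin (k + n)) ℂ => M.det) :=
    continuous_id.matrix_det
  have h1 : ∀ j, Tendsto (fun p => Fin.append (u p) (w p) j) l (𝓝 (Fin.append u₀ w₀ j)) := by
    intro j
    refine Fin.addCases (fun i => ?_) (fun i => ?_) j
    · simp only [Fin.append_left]
      exact hu i
    · simp only [Fin.append_right]
      exact hw i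
  have h2 : Tendsto (fun p => (Matrix.of fun i j => Fin.append (u p) (w p) j i)) l
      (𝓝 (Matrix.of fun i j => Fin.append u₀ w₀ j i)) :=
    tendsto_pi_nhds.2 fun i => tendsto_pi_nhds.2 fun j => tendsto_pi_nhds.1 (h1 j) i
  exact (hdc.tendsto _).comp h2

theorem tendsto_clm_apply {ι : Type*} {l : Filter ι} {A : ι → CL(Fin 6 → ℂ)}
    {A₀ : CL(Fin 6 → ℂ)} {x : ι → Fin 6 → ℂ} {x₀ : Fin 6 → ℂ}
    (hA : Tendsto A l (𝓝 A₀)) (hx : Tendsto x l (𝓝 x₀)) :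
    Tendsto (fun p => A p (x p)) l (𝓝 (A₀ x₀)) :=
  (isBoundedBilinearMap_apply.continuous.tendsto (A₀, x₀)).comp (hA.prodMk_nhds hx)

variable {a : ℝ} {φ : Profile} {C θ δ M : ℝ} {bm : Fin 2 → Fin 6 → ℂ} {bp : Fin 4 → Fin 6 → ℂ}

/-- The equation conjugated on the right half-line, and, reflected, on the left one. -/
def IsRightConj (m : MHD) (a : ℝ) (φ : Profile) (z : ℂ) (S : ℝ → CL(Fin 6 → ℂ)) : Prop :=
  IsExpConj (fun x => m.coeff ((a, z), φ.curve x)) (m.coeff ((a, z), (φ.vR, φ.wR))) S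

def IsLeftConj (m : MHD) (a : ℝ) (φ : Profile) (z : ℂ) (S : ℝ → CL(Fin 6 → ℂ)) : Prop :=
  IsExpConj (fun x => -m.coeff ((a, z), φ.curve (-x))) (-m.coeff ((a, z), (1, 0))) S

theorem clm_neg_one_smul (X : CL(Fin 6 → ℂ)) : (-1 : ℝ) • X = -X := neg_one_smul ℝ X

theorem clm_one_smul (X : CL(Fin 6 → ℂ)) : (1 : ℝ) • X = X := one_smul ℝ X

theorem IsTameCurve.coeff_bounded {c : ℝ → ℝ²} {e : ℝ²} (h : IsTameCurve c e C θ δ M)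
    (hδ : 0 < δ) (q : ℝ × ℂ) : ∃ K, ∀ x, ‖m.coeff (q, c x)‖ ≤ K := by
  obtain ⟨N, hN⟩ := isCompact_box.exists_bound_of_continuousOn (f := fun y => m.coeff (q, y))
    fun y hy => ((m.contDiffAt_coeff (p := (q, y)) (hδ.trans_le hy.1)).continuousAt.comp
      (f := fun y : ℝ² => (q, y)) (by fun_prop)).continuousWithinAt
  exact ⟨N, fun x => hN _ (h.mem x)⟩

theorem left_transition (hz₀ : 0 < z₀.re) (hδ : 0 < δ) (hT : m.IsTransport z₀ P T)
    (h : m.IsTameProfile a φ C θ δ M) (he : (e : ℝ × ℝ²) = m.endData a (1, 0))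
    (hbm : IsFrame (unstableSubspace (m.limLeft a z₀)) b) {z : ℂ} (hz : 0 ≤ z.re)
    {S S' : ℝ → CL(Fin 6 → ℂ)} (hS : m.IsLeftConj a φ z S)
    (hS' : m.IsLeftConj a φ z S') : ∃ q : Matrix (Fin k) (Fin k) ℂ, q.det = 1 ∧
      ∀ i, S' 0 (T (e, z) (b i)) = ∑ j, q i j • S 0 (T (e, z) (b j)) := by
  have hN : ∀ z, toCLM (m.limLeft a z) = 𝐋(m, e, z) := by
    rw [he]; exact m.limLeft_eq a
  obtain ⟨K, hK⟩ := h.left.coeff_bounded (m := m) hδ (a, z)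
  have hL : m.coeff ((a, z), (1, 0)) = 𝐋(m, e, z) := hN z
  unfold IsLeftConj at hS hS'
  rw [hL] at hS hS'
  exact exists_transition (z₀ := z₀) (z := z) (Q := fun z => P (e, z))
    (T := fun z => T (e, z)) (hT.isUnit e z hz) (hT.intertwine e z hz)
    (mem_unstable_iff hT hN hz₀) (hT.idem e z hz) hbm
    (K := K) (fun x => by rw [norm_neg]; exact hK x) hS hS'
    ((mul_neg _ _).trans ((congrArg Neg.neg (hT.comm e z hz)).trans (neg_mul _ _).symm))
    (fun ν hν v hv => by
      rw [hT.apply_gen e z hz (-ν) (by simpa using hν.ne') v (mem_maxGenEigenspace_neg hv),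
        if_neg (by simpa using hν.le)])
    (fun ν hν v hv => by
      rw [hT.apply_gen e z hz (-ν) (by simpa using hν.ne) v (mem_maxGenEigenspace_neg hv),
        if_pos (by simpa using hν)])

theorem right_transition (hz₀ : 0 < z₀.re) (hδ : 0 < δ) (hT : m.IsTransport z₀ P T)
    (h : m.IsTameProfile a φ C θ δ M) (he : (e : ℝ × ℝ²) = m.endData a (φ.vR, φ.wR))
    (hbp : IsFrame (stableSubspace (m.limRight a φ z₀)) b) {z : ℂ} (hz : 0 ≤ z.re)
    {S S' : ℝ → CL(Fin 6 → ℂ)} (hS : m.IsRightConj a φ z S)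
    (hS' : m.IsRightConj a φ z S') : ∃ q : Matrix (Fin k) (Fin k) ℂ, q.det = 1 ∧
      ∀ i, S' 0 (T (e, z) (b i)) = ∑ j, q i j • S 0 (T (e, z) (b j)) := by
  have hN : ∀ z, toCLM (m.limRight a φ z) = 𝐋(m, e, z) := by
    rw [he]; exact h.limRight_eq
  obtain ⟨K, hK⟩ := h.right.coeff_bounded (m := m) hδ (a, z)
  have hL : m.coeff ((a, z), (φ.vR, φ.wR)) = 𝐋(m, e, z) := hN z
  unfold IsRightConj at hS hS'
  rw [hL] at hS hS'
  exact exists_transition (z₀ := z₀) (z := z) (Q := fun z => 1 - P (e, z))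
    (T := fun z => T (e, z)) (hT.isUnit e z hz)
    (by rw [sub_mul, mul_sub, one_mul, mul_one, hT.intertwine e z hz])
    (fun v => by
      rw [mem_stable_iff hT hN hz₀ v]
      change _ ↔ v - P (e, z₀) v = v
      rw [sub_eq_self])
    (by rw [mul_sub, sub_mul, sub_mul, hT.idem e z hz, one_mul, mul_one, one_mul, sub_self, sub_zero])
    hbp hK hS hS'
    (by rw [sub_mul, mul_sub, hT.comm e z hz, one_mul, mul_one])
    (fun ν hν v hv => by
      change v - P (e, z) v = 0
      rw [hT.apply_gen e z hz ν hν.ne' v hv, if_pos hν, sub_self])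
    (fun ν hν v hv => by
      change v - P (e, z) v = v
      rw [hT.apply_gen e z hz ν hν.ne v hv, if_neg hν.not_gt, sub_zero])

theorem IsEvansFunction.eq_evansDet {D : ℂ → ℂ} (hz₀ : 0 < z₀.re) (hδ : 0 < δ)
    (hT : m.IsTransport z₀ P T) (h : m.IsTameProfile a φ C θ δ M)
    (hD : m.IsEvansFunction a φ z₀ bm bp D) {z : ℂ} (hz : 0 ≤ z.re) {eL eR : m.endStates}
    (heL : (eL : ℝ × ℝ²) = m.endData a (1, 0))
    (heR : (eR : ℝ × ℝ²) = m.endData a (φ.vR, φ.wR))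
    {S S' : ℝ → CL(Fin 6 → ℂ)} (hS : m.IsLeftConj a φ z S)
    (hS' : m.IsRightConj a φ z S') : D z = evansDet T eL eR z bm bp (S 0) (S' 0) := by
  obtain ⟨Rm, Rp, hRm, hRp, hbm, hbp, hDz⟩ := hD
  obtain ⟨Pm, Pp, hPm, hPp, hdet⟩ := hDz z hz
  have hNm : ∀ z, toCLM (m.limLeft a z) = 𝐋(m, eL, z) := by
    rw [heL]; exact m.limLeft_eq a
  have hNp : ∀ z, toCLM (m.limRight a φ z) = 𝐋(m, eR, z) := by
    rw [heR]; exact h.limRight_eq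
  have hfm : IsFrame (unstableSubspace (m.limLeft a z₀)) bm := by
    rw [← funext hbm]; exact hRm.frame z₀ hz₀
  have hfp : IsFrame (stableSubspace (m.limRight a φ z₀)) bp := by
    rw [← funext hbp]; exact hRp.frame z₀ hz₀
  have hPm' : m.IsLeftConj a φ z (fun x => toCLM (Pm (-x))) := by
    have h1 := (isConjugator_reflect (t := Ici 0) (by intro x hx; simpa using hx) hPm).isExpConj
    simp only [map_neg] at h1
    exact h1
  have hPp' : m.IsRightConj a φ z (fun x => toCLM (Pp x)) := hPp.isExpConj
  obtain ⟨q, hq, hq1⟩ := left_transition hz₀ hδ hT h heL hfm hz hS hPm'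
  obtain ⟨q', hq', hq1'⟩ := right_transition hz₀ hδ hT h heR hfp hz hS' hPp'
  rw [hdet]
  refine toCLM_det_append (u := fun l => T (eL, z) (bm l)) (w := fun l => T (eR, z) (bp l)) hq hq'
    (fun i => ?_) (fun i => ?_)
  · rw [← hq1 i, kato_unique_unstable hT hNm hRm i hz, hbm]
    simp only [neg_zero, toCLM_apply]
  · rw [← hq1' i, kato_unique_stable hT hNp hRp i hz, hbp]
    simp only [toCLM_apply]

theorem IsTameProfile.exists_leftConj (hθ : 0 < θ) (hδ : 0 < δ) (h : m.IsTameProfile a φ C θ δ M)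
    (z : ℂ) : ∃ S, m.IsLeftConj a φ z S := by
  obtain ⟨-, S, -, hS, -⟩ := m.exists_conj_family (ι := Unit) (l := ⊥) (-1) (q := fun _ => 0)
    (q₀ := (a, z)) (c := fun _ _ => 0) (e := fun _ => 0) hθ hδ tendsto_bot (by simp) h.left
    tendsto_bot (by simp)
  simp only [clm_neg_one_smul] at hS
  exact ⟨S, hS⟩

theorem IsTameProfile.exists_rightConj (hθ : 0 < θ) (hδ : 0 < δ) (h : m.IsTameProfile a φ C θ δ M)
    (z : ℂ) : ∃ S, m.IsRightConj a φ z S := by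
  obtain ⟨-, S, -, hS, -⟩ := m.exists_conj_family (ι := Unit) (l := ⊥) 1 (q := fun _ => 0)
    (q₀ := (a, z)) (c := fun _ _ => 0) (e := fun _ => 0) hθ hδ tendsto_bot (by simp) h.right
    tendsto_bot (by simp)
  simp only [clm_one_smul] at hS
  exact ⟨S, hS⟩

theorem IsTameProfile.exists_evansFunction (hz₀ : 0 < z₀.re) (hθ : 0 < θ) (hδ : 0 < δ)
    (h : m.IsTameProfile a φ C θ δ M) (hbm : IsFrame (unstableSubspace (m.limLeft a z₀)) bm)
    (hbp : IsFrame (stableSubspace (m.limRight a φ z₀)) bp) :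
    ∃ D, m.IsEvansFunction a φ z₀ bm bp D := by
  obtain ⟨P, T, hT⟩ := m.spectralPencil_endMat.exists_katoTransport hz₀
  choose S hS using h.exists_leftConj hθ hδ
  choose S' hS' using h.exists_rightConj hθ hδ
  refine ⟨fun z => Matrix.det (fun i j : Fin 6 => (Fin.append (m := 2) (n := 4)
    (fun l => S z 0 (T (⟨_, h.mem_left⟩, z) (bm l))) (fun l => S' z 0 (T (⟨_, h.mem_right⟩, z) (bp l))) :
    Fin 6 → Fin 6 → ℂ) j i), _, _,
    isKatoBasis_unstable (m := m) (e := ⟨_, h.mem_left⟩) hz₀ hT (m.limLeft_eq a) hbm,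
    isKatoBasis_stable (m := m) (e := ⟨_, h.mem_right⟩) hz₀ hT h.limRight_eq hbp,
    fun j => by rw [hT.base]; rfl, fun j => by rw [hT.base]; rfl, fun z hz => ?_⟩
  refine ⟨fun x => Matrix.of ((matCLM 6).symm (S z (-x))),
    fun x => Matrix.of ((matCLM 6).symm (S' z x)), ?_, ?_, ?_⟩
  · have h1 := hS z
    have h2 : IsConjugator (fun x => -m.evansMatrix a z (φ.v (-x)) (φ.w (-x))) (-m.limLeft a z) (Ici 0)
        (fun x => Matrix.of ((matCLM 6).symm (S z x))) := by
      apply IsExpConj.isConjugator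
      simp only [toCLM_matCLM_symm, map_neg]
      exact h1
    have h3 := isConjugator_reflect (t := Iic 0) (by intro x hx; simpa using hx) h2
    simpa only [neg_neg] using h3
  · have h1 := hS' z
    apply IsExpConj.isConjugator
    simp only [toCLM_matCLM_symm]
    exact h1
  · simp only [neg_zero, ← toCLM_apply, toCLM_matCLM_symm]

theorem tendsto_evansFunction {ι : Type*} {l : Filter ι} {a : ι → ℝ} {z : ι → ℂ} {φ : ι → Profile}
    {a₀ : ℝ} {z₁ : ℂ} {φ₀ : Profile} {bm : ι → Fin 2 → Fin 6 → ℂ} {bp : ι → Fin 4 → Fin 6 → ℂ}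
    {bm₀ : Fin 2 → Fin 6 → ℂ} {bp₀ : Fin 4 → Fin 6 → ℂ} {D : ι → ℂ → ℂ} {D₀ : ℂ → ℂ}
    (hz₀ : 0 < z₀.re) (hθ : 0 < θ) (hδ : 0 < δ) (h₀ : m.IsTameProfile a₀ φ₀ C θ δ M)
    (h : ∀ᶠ p in l, m.IsTameProfile (a p) (φ p) C θ δ M) (ha : Tendsto a l (𝓝 a₀))
    (hz : Tendsto z l (𝓝 z₁)) (hzre : ∀ᶠ p in l, 0 ≤ (z p).re) (hz₁ : 0 ≤ z₁.re)
    (hend : Tendsto (fun p => ((φ p).vR, (φ p).wR)) l (𝓝 (φ₀.vR, φ₀.wR)))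
    (hloc : ∀ X η : ℝ, 0 < η → ∀ᶠ p in l, ∀ x, |x| ≤ X → ‖(φ p).curve x - φ₀.curve x‖ ≤ η)
    (hbm : Tendsto bm l (𝓝 bm₀)) (hbp : Tendsto bp l (𝓝 bp₀))
    (hD₀ : m.IsEvansFunction a₀ φ₀ z₀ bm₀ bp₀ D₀)
    (hD : ∀ᶠ p in l, m.IsEvansFunction (a p) (φ p) z₀ (bm p) (bp p) (D p)) :
    Tendsto (fun p => D p (z p)) l (𝓝 (D₀ z₁)) := by
  classical
  obtain ⟨P, T, hT⟩ := m.spectralPencil_endMat.exists_katoTransport hz₀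
  have hq : Tendsto (fun p => (a p, z p)) l (𝓝 (a₀, z₁)) := ha.prodMk_nhds hz
  obtain ⟨S, S₀, hS, hS₀, hSl⟩ := m.exists_conj_family (-1) hθ hδ hq (h.mono fun p hp => hp.left)
    h₀.left tendsto_const_nhds fun X η hη => (hloc X η hη).mono fun p hp x hx =>
      hp (-x) (by rwa [abs_neg])
  obtain ⟨S', S₀', hS', hS₀', hSl'⟩ := m.exists_conj_family 1 hθ hδ hq
    (h.mono fun p hp => hp.right) h₀.right hend hloc
  simp only [clm_neg_one_smul] at hS hS₀
  simp only [clm_one_smul] at hS' hS₀'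
  set eL₀ : m.endStates := ⟨_, h₀.mem_left⟩ with heL₀
  set eR₀ : m.endStates := ⟨_, h₀.mem_right⟩ with heR₀
  have hcE : ∀ {y : ι → ℝ²} {y₀ : ℝ²}, 0 < y₀.1 → Tendsto y l (𝓝 y₀) →
      Tendsto (fun p => m.endData (a p) (y p)) l (𝓝 (m.endData a₀ y₀)) := fun {y y₀} hy₀ hy => by
    exact (m.continuousAt_endData hy₀).tendsto.comp (ha.prodMk_nhds hy)
  have hR0 : (0 : ℝ) < φ₀.vR := h₀.mem_right.1
  obtain ⟨eL, heL, heL'⟩ : ∃ eL : ι → m.endStates, (∀ᶠ p in l, (eL p : ℝ × ℝ²) =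
      m.endData (a p) (1, 0)) ∧ Tendsto eL l (𝓝 eL₀) := by
    have h1 : ∀ᶠ p in l, ((if hp : m.endData (a p) (1, 0) ∈ m.endStates then ⟨_, hp⟩ else eL₀ :
        m.endStates) : ℝ × ℝ²) = m.endData (a p) (1, 0) :=
      h.mono fun p hp => by rw [dif_pos hp.mem_left]
    exact ⟨_, h1, tendsto_subtype_rng.2 (((hcE one_pos tendsto_const_nhds)).congr'
      (h1.mono fun p hp => hp.symm))⟩
  obtain ⟨eR, heR, heR'⟩ : ∃ eR : ι → m.endStates, (∀ᶠ p in l, (eR p : ℝ × ℝ²) =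
      m.endData (a p) ((φ p).vR, (φ p).wR)) ∧ Tendsto eR l (𝓝 eR₀) := by
    have h1 : ∀ᶠ p in l, ((if hp : m.endData (a p) ((φ p).vR, (φ p).wR) ∈ m.endStates then ⟨_, hp⟩
        else eR₀ : m.endStates) : ℝ × ℝ²) = m.endData (a p) ((φ p).vR, (φ p).wR) :=
      h.mono fun p hp => by rw [dif_pos hp.mem_right]
    exact ⟨_, h1, tendsto_subtype_rng.2 ((hcE hR0 hend).congr' (h1.mono fun p hp => hp.symm))⟩
  have hTc : ∀ {e : ι → m.endStates} {e₀ : m.endStates}, Tendsto e l (𝓝 e₀) →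
      Tendsto (fun p => T (e p, z p)) l (𝓝 (T (e₀, z₁))) := fun {e e₀} he =>
    (hT.contT (e₀, z₁) hz₁).tendsto.comp (tendsto_nhdsWithin_iff.2 ⟨he.prodMk_nhds hz, hzre⟩)
  have hval : ∀ᶠ p in l, evansDet T (eL p) (eR p) (z p) (bm p) (bp p) (S p 0) (S' p 0) =
      D p (z p) := by
    filter_upwards [h, hD, hzre, hS, hS', heL, heR] with p h1 h2 h3 h4 h5 h6 h7
    exact (h2.eq_evansDet hz₀ hδ hT h1 h3 h6 h7 h4 h5).symm
  rw [hD₀.eq_evansDet (eL := eL₀) (eR := eR₀) hz₀ hδ hT h₀ hz₁ rfl rfl hS₀ hS₀']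
  refine Tendsto.congr' hval ?_
  exact tendsto_det_append (k := 2) (n := 4)
    (fun i => tendsto_clm_apply hSl (tendsto_clm_apply (hTc heL') (tendsto_pi_nhds.1 hbm i)))
    (fun i => tendsto_clm_apply hSl' (tendsto_clm_apply (hTc heR') (tendsto_pi_nhds.1 hbp i)))

/-- Uniform convergence of the Evans functions on compact sets, from convergence of the profiles. -/
theorem tendstoUniformlyOn_evansFunction {φ : ℝ → Profile} {φ₀ : Profile}
    {bm : ℝ → Fin 2 → Fin 6 → ℂ} {bp : ℝ → Fin 4 → Fin 6 → ℂ} {l : Filter ℝ}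
    {bm₀ : Fin 2 → Fin 6 → ℂ} {bp₀ : Fin 4 → Fin 6 → ℂ} {D : ℝ → ℂ → ℂ} {D₀ : ℂ → ℂ} {a₀ : ℝ}
    (hz₀ : 0 < z₀.re) (hθ : 0 < θ) (hδ : 0 < δ) (hl : l ≤ 𝓝 a₀)
    (h₀ : m.IsTameProfile a₀ φ₀ C θ δ M) (h : ∀ᶠ a in l, m.IsTameProfile a (φ a) C θ δ M)
    (hend : Tendsto (fun p => ((φ p).vR, (φ p).wR)) l (𝓝 (φ₀.vR, φ₀.wR)))
    (hloc : ∀ X η : ℝ, 0 < η → ∀ᶠ p in l, ∀ x, |x| ≤ X → ‖(φ p).curve x - φ₀.curve x‖ ≤ η)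
    (hbm : Tendsto bm l (𝓝 bm₀)) (hbp : Tendsto bp l (𝓝 bp₀))
    (hD₀ : m.IsEvansFunction a₀ φ₀ z₀ bm₀ bp₀ D₀)
    (hD : ∀ᶠ a in l, m.IsEvansFunction a (φ a) z₀ (bm a) (bp a) (D a)) {S : Set ℂ}
    (hS : IsCompact S) (hSre : S ⊆ {z : ℂ | 0 ≤ z.re}) : TendstoUniformlyOn D D₀ l S := by
  rw [← tendstoLocallyUniformlyOn_iff_tendstoUniformlyOn_of_compact hS,
    tendstoLocallyUniformlyOn_iff_forall_tendsto]
  intro z₁ hz₁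
  have hsnd : Tendsto (fun p : ℝ × ℂ => p.2) (l ×ˢ 𝓝[S] z₁) (𝓝[S] z₁) := tendsto_snd
  have hfst : Tendsto (fun p : ℝ × ℂ => p.1) (l ×ˢ 𝓝[S] z₁) l := tendsto_fst
  have hz := hsnd.mono_right nhdsWithin_le_nhds
  have hre : ∀ᶠ p : ℝ × ℂ in l ×ˢ 𝓝[S] z₁, 0 ≤ p.2.re :=
    (hsnd.eventually self_mem_nhdsWithin).mono fun p hp => hSre hp
  have c1 := tendsto_evansFunction (l := l ×ˢ 𝓝[S] z₁) (a := fun p : ℝ × ℂ => p.1)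
    (z := fun p => p.2) (φ := fun p => φ p.1) (D := fun p => D p.1) hz₀ hθ hδ h₀ (hfst.eventually h)
    (hfst.mono_right hl) hz hre (hSre hz₁) (hend.comp hfst)
    (fun X η hη => hfst.eventually (hloc X η hη)) (hbm.comp hfst) (hbp.comp hfst) hD₀
    (hfst.eventually hD)
  have c2 := tendsto_evansFunction (l := l ×ˢ 𝓝[S] z₁) (a := fun _ => a₀)
    (z := fun p => p.2) (φ := fun _ => φ₀) (D := fun _ => D₀) hz₀ hθ hδ h₀
    (Eventually.of_forall fun _ => h₀) tendsto_const_nhds hz hre (hSre hz₁) tendsto_const_nhds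
    (fun X η hη => Eventually.of_forall fun _ x _ => by simpa using hη.le) tendsto_const_nhds
    tendsto_const_nhds hD₀ (Eventually.of_forall fun _ => hD₀)
  exact (c2.prodMk_nhds c1).mono_right (nhds_le_uniformity (D₀ z₁))

end MHD

/-! ### Characteristic speeds and end states -/

namespace MHD

variable (m : MHD)

theorem charSpeeds_eq {a v w : ℝ} (ha : 0 ≤ a) (hv : 0 < v) : ∃ c₁ c₂ : ℝ, 0 ≤ c₁ ∧ 0 ≤ c₂ ∧
    v * (c₁ ^ 2 + c₂ ^ 2) = m.s11 (a * m.γ * v ^ (-m.γ)) (m.magField v w) + m.K ∧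
    v ^ 2 * (c₁ ^ 2 * c₂ ^ 2) = a * m.γ * v ^ (-m.γ) * m.K ∧
    m.charSpeeds a v w = {1 + c₁, 1 - c₁, 1 + c₂, 1 - c₂} := by
  set B := m.magField v w with hB
  set α := a * m.γ * v ^ (-m.γ - 1) with hα
  have hα0 : 0 ≤ α := mul_nonneg (mul_nonneg ha (by linarith [m.one_le_γ])) (rpow_nonneg hv.le _)
  have hc : a * m.γ * v ^ (-m.γ) = v * α := by rw [hα, Real.rpow_sub_one hv.ne']; field_simp
  have hμ₀ := m.μ₀_pos
  rw [hc]
  set t := α + B ^ 2 / (m.μ₀ * v) + m.I ^ 2 / (m.μ₀ * v) with ht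
  set d := α * (m.I ^ 2 / (m.μ₀ * v)) with hd
  have hk : 0 ≤ m.I ^ 2 / (m.μ₀ * v) := by positivity
  have hb : 0 ≤ B ^ 2 / (m.μ₀ * v) := by positivity
  have hdisc : 0 ≤ t ^ 2 - 4 * d := by
    have : t ^ 2 - 4 * d = (α - m.I ^ 2 / (m.μ₀ * v)) ^ 2 +
        B ^ 2 / (m.μ₀ * v) * (2 * α + 2 * (m.I ^ 2 / (m.μ₀ * v)) + B ^ 2 / (m.μ₀ * v)) := by
      rw [ht, hd]; ring
    rw [this]; positivity
  have ht0 : 0 ≤ t := by positivity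
  have hd0 : 0 ≤ d := by positivity
  set R := √(t ^ 2 - 4 * d) with hR
  have hR2 : R ^ 2 = t ^ 2 - 4 * d := sq_sqrt hdisc
  have hR0 : 0 ≤ R := sqrt_nonneg _
  have hRt : R ≤ t := by nlinarith
  have e1 : √((t + R) / 2) ^ 2 = (t + R) / 2 := sq_sqrt (by linarith)
  have e2 : √((t - R) / 2) ^ 2 = (t - R) / 2 := sq_sqrt (by linarith)
  set c₁ := √((t + R) / 2) with hc₁
  set c₂ := √((t - R) / 2) with hc₂
  have hs : c₁ ^ 2 + c₂ ^ 2 = t := by rw [e1, e2]; ring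
  have hp : c₁ ^ 2 * c₂ ^ 2 = d := by rw [e1, e2]; linear_combination (-1 / 4 : ℝ) * hR2
  refine ⟨c₁, c₂, sqrt_nonneg _, sqrt_nonneg _, ?_, ?_, ?_⟩
  · rw [hs, ht, s11, K]; field_simp
  · rw [hp, hd, K]; field_simp
  · have hpoly : (m.charMatrix a v B).charpoly =
        (({1 + c₁, 1 - c₁, 1 + c₂, 1 - c₂} : Multiset ℝ).map
          fun r => Polynomial.X - Polynomial.C r).prod := by
      refine Polynomial.funext fun x => ?_
      rw [Matrix.eval_charpoly]
      have hdet : (Matrix.scalar (Fin 4) x - m.charMatrix a v B).det =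
          (x - 1) ^ 4 - t * (x - 1) ^ 2 + d := by
        have hM : Matrix.scalar (Fin 4) x - m.charMatrix a v B =
            !![x - 1, 0, 1, 0; 0, x - 1, -(B / v), m.I / v; α, -(B / m.μ₀), x - 1, 0;
              0, m.I / m.μ₀, 0, x - 1] := by
          rw [charMatrix, ← hα]
          ext i j
          fin_cases i <;> fin_cases j <;> simp [Matrix.one_apply, neg_div]
        rw [hM, ht, hd]
        simp [Matrix.det_succ_row_zero, Fin.sum_univ_succ, Fin.succAbove]
        field_simp
        ring
      rw [hdet]
      simp only [Multiset.insert_eq_cons, Multiset.map_cons, Multiset.prod_cons,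
        Multiset.map_singleton, Multiset.prod_singleton, Polynomial.eval_mul, Polynomial.eval_sub,
        Polynomial.eval_X, Polynomial.eval_C]
      linear_combination (x - 1) ^ 2 * hs - hp
    rw [charSpeeds, ← hB, hpoly, Polynomial.roots_multiset_prod_X_sub_C]

theorem left_lax_zero (h : ∀ s ∈ m.charSpeeds 0 1 0, 0 < s) : 2 * m.J + m.K < 1 := by
  obtain ⟨c₁, c₂, h1, h2, h3, h4, h5⟩ := m.charSpeeds_eq (w := 0) le_rfl one_pos
  rw [h5] at h
  have k1 : 0 < 1 - c₁ := h _ (by simp)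
  have k2 : 0 < 1 - c₂ := h _ (by simp)
  have : m.s11 (0 * m.γ * 1 ^ (-m.γ)) (m.magField 1 0) = 2 * m.J := by
    have := m.μ₀_pos.ne'
    simp only [s11, magField, J]; field_simp; ring
  rw [this] at h3
  nlinarith [mul_pos (mul_pos k1 (by linarith : 0 < 1 + c₁)) (mul_pos k2 (by linarith : 0 < 1 + c₂))]

theorem left_lax_of_lt (h : 2 * m.J + m.K < 1) (hJ : 0 ≤ m.J) :
    ∀ᶠ a in 𝓝 (0 : ℝ), 0 ≤ a → ∀ s ∈ m.charSpeeds a 1 0, 0 < s := by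
  have h1 : ∀ᶠ a in 𝓝 (0 : ℝ), a * m.γ < 1 - 2 * m.J - m.K :=
    ContinuousAt.eventually_lt (f := fun a : ℝ => a * m.γ) (by fun_prop) (by fun_prop)
      (by simp; linarith)
  filter_upwards [h1] with a ha ha0
  obtain ⟨c₁, c₂, k1, k2, h3, h4, h5⟩ := m.charSpeeds_eq (w := 0) ha0 one_pos
  have e : m.s11 (a * m.γ * 1 ^ (-m.γ)) (m.magField 1 0) = a * m.γ + 2 * m.J := by
    have := m.μ₀_pos.ne'
    simp only [s11, magField, J, one_rpow]; field_simp; ring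
  have hK := m.K_nonneg
  have hγ : 0 ≤ a * m.γ := mul_nonneg ha0 (by linarith [m.one_le_γ])
  rw [e] at h3
  have c1 : c₁ < 1 := by nlinarith [sq_nonneg c₂]
  have c2 : c₂ < 1 := by nlinarith [sq_nonneg c₁]
  rw [h5]
  intro s hs
  simp only [Multiset.insert_eq_cons, Multiset.mem_cons, Multiset.mem_singleton] at hs
  rcases hs with rfl | rfl | rfl | rfl <;> linarith

theorem right_lax_iff {a v w : ℝ} (ha : 0 ≤ a) (hv : 0 < v) :
    ((∀ s ∈ m.charSpeeds a v w, s ≠ 0) ∧ ((m.charSpeeds a v w).filter (fun s => s < 0)).card = 1) ↔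
    (v - m.s11 (a * m.γ * v ^ (-m.γ)) (m.magField v w)) * (v - m.K) <
      m.s12 (m.magField v w) ^ 2 := by
  obtain ⟨c₁, c₂, h1, h2, h3, h4, h5⟩ := m.charSpeeds_eq (w := w) ha hv
  set c := a * m.γ * v ^ (-m.γ)
  set B := m.magField v w
  have hdet : m.s11 c B * m.K - m.s12 B ^ 2 = c * m.K := by
    have := m.μ₀_pos.ne'
    simp only [s11, s12, K]; field_simp; ring
  have key : (v - m.s11 c B) * (v - m.K) - m.s12 B ^ 2 =
      v ^ 2 * ((1 - c₁) * (1 - c₂)) * ((1 + c₁) * (1 + c₂)) := by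
    linear_combination hdet + v * h3 - h4
  have hpos : 0 < v ^ 2 * ((1 + c₁) * (1 + c₂)) := by positivity
  have key2 : (v - m.s11 c B) * (v - m.K) < m.s12 B ^ 2 ↔ (1 - c₁) * (1 - c₂) < 0 := by
    rw [← sub_neg, key]
    constructor
    · intro h
      by_contra h'
      push Not at h'
      nlinarith [mul_nonneg hpos.le h']
    · intro h
      nlinarith [mul_pos hpos (neg_pos.2 h)]
  have n1 : ¬ 1 + c₁ < 0 := by linarith
  have n2 : ¬ 1 + c₂ < 0 := by linarith
  rw [key2, h5]
  simp only [Multiset.insert_eq_cons, Multiset.mem_cons, Multiset.mem_singleton, forall_eq_or_imp,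
    forall_eq, Multiset.filter_cons, Multiset.filter_singleton, n1, n2]
  rcases lt_trichotomy (1 - c₁) 0 with k1 | k1 | k1 <;> rcases lt_trichotomy (1 - c₂) 0 with k2 | k2 | k2
  · simp only [k1, k2, if_true, if_false]
    have := mul_pos_of_neg_of_neg k1 k2
    simp [this.le]
  · simp [k2]
  · simp only [k1, not_lt.2 k2.le, if_true, if_false]
    have := mul_neg_of_neg_of_pos k1 k2
    simp [this, k1.ne, k2.ne']
    constructor <;> linarith
  · simp [k1]
  · simp [k1]
  · simp [k1]
  · simp only [k2, not_lt.2 k1.le, if_true, if_false]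
    have := mul_neg_of_pos_of_neg k1 k2
    simp [this, k1.ne', k2.ne]
    constructor <;> linarith
  · simp [k2]
  · simp only [not_lt.2 k1.le, not_lt.2 k2.le, if_false]
    have := mul_pos k1 k2
    simp [this.le]

/-! ### Rest points of the profile equations -/

/-- The `v`-component of the profile field on the curve of zeros of the `w`-component. -/
def restFun (a v : ℝ) : ℝ :=
  (v - 1) + a * (v ^ (-m.γ) - 1) + m.J * ((1 - m.K) ^ 2 / (v - m.K) ^ 2 - 1)

def restFunDeriv (a v : ℝ) : ℝ :=
  1 - a * m.γ * v ^ (-m.γ - 1) - 2 * m.J * (1 - m.K) ^ 2 / (v - m.K) ^ 3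

def wRest (v : ℝ) : ℝ := m.I * m.Bm / m.μ₀ * (1 - v) / (v - m.K)

/-- Rest points of saddle type. -/
structure IsEndState (a v : ℝ) : Prop where
  pos : 0 < v
  ne : v ≠ m.K
  zero : m.restFun a v = 0
  neg : (v - m.K) * m.restFunDeriv a v < 0

variable {m}

theorem magField_wRest {v : ℝ} (hv : 0 < v) (hK : v ≠ m.K) :
    m.magField v (m.wRest v) = m.Bm * (1 - m.K) / (v - m.K) := by
  have h1 := sub_ne_zero.2 hK
  have h2 := m.μ₀_pos.ne'
  have h3 : m.I ^ 2 = m.K * m.μ₀ := by rw [K]; field_simp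
  have h4 : m.I * m.wRest v * (v - m.K) = m.K * m.Bm * (1 - v) := by
    rw [wRest]; field_simp; linear_combination (1 - v) * m.Bm * h3
  rw [magField, div_eq_div_iff hv.ne' h1]
  linear_combination h4

theorem fieldW_eq {v w : ℝ} (hK : v ≠ m.K) :
    m.fieldW v w = (v - m.K) * (w - m.wRest v) / m.μ := by
  have h1 := sub_ne_zero.2 hK
  have h2 := m.μ₀_pos.ne'
  have h4 : (v - m.K) * m.wRest v = m.I * m.Bm / m.μ₀ * (1 - v) := by rw [wRest]; field_simp
  have e : (v - m.K) * (w - m.wRest v) = v * w - m.I / m.μ₀ * (m.Bm * (1 - v) + m.I * w) := by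
    rw [mul_sub, h4, K]; field_simp; ring
  rw [fieldW, e]

theorem fieldV_wRest {a v : ℝ} (hv : 0 < v) (hK : v ≠ m.K) :
    m.fieldV a v (m.wRest v) = v * m.restFun a v / m.τ := by
  have h1 := sub_ne_zero.2 hK
  have h2 := m.μ₀_pos.ne'
  have h := magField_wRest hv hK
  rw [magField, div_eq_iff hv.ne'] at h
  rw [fieldV, h, restFun, J]
  simp only [pressure, one_rpow]
  congr 1
  field_simp

theorem det_wRest {a v : ℝ} (hv : 0 < v) (hK : v ≠ m.K) :
    (v - m.s11 (a * m.γ * v ^ (-m.γ)) (m.magField v (m.wRest v))) * (v - m.K) -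
      m.s12 (m.magField v (m.wRest v)) ^ 2 = v * ((v - m.K) * m.restFunDeriv a v) := by
  have h1 := sub_ne_zero.2 hK
  have h2 := m.μ₀_pos.ne'
  rw [magField_wRest hv hK, s11, s12, restFunDeriv, Real.rpow_sub_one hv.ne', J]
  have h3 : m.I ^ 2 = m.K * m.μ₀ := by rw [K]; field_simp
  field_simp
  linear_combination (-(1 - m.K) ^ 2 * m.Bm ^ 2) * h3

theorem ne_K_of_rest (hJ : 0 < m.J) (hK : m.K < 1) {v w : ℝ} (hv : 0 < v) (h : m.fieldW v w = 0) :
    v ≠ m.K := by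
  intro hvK
  have h2 := m.μ₀_pos.ne'
  have hμ := m.μ_pos.ne'
  rw [fieldW, div_eq_zero_iff, or_iff_left hμ, hvK, K] at h
  have h3 : m.I * (m.Bm * (1 - m.I ^ 2 / m.μ₀)) = 0 := by
    field_simp at h ⊢; linear_combination (-1 : ℝ) * h
  rcases mul_eq_zero.1 h3 with h4 | h4
  · rw [hvK, K, h4] at hv; simp at hv
  · rcases mul_eq_zero.1 h4 with h5 | h5
    · rw [J, h5] at hJ; simp at hJ
    · have : 1 - m.K = 0 := h5
      linarith

theorem rest_iff {a v w : ℝ} (hv : 0 < v) (hK : v ≠ m.K) :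
    m.fieldV a v w = 0 ∧ m.fieldW v w = 0 ↔ w = m.wRest v ∧ m.restFun a v = 0 := by
  have h1 := sub_ne_zero.2 hK
  have hw : m.fieldW v w = 0 ↔ w = m.wRest v := by
    rw [fieldW_eq hK, div_eq_zero_iff, or_iff_left m.μ_pos.ne', mul_eq_zero, or_iff_right h1,
      sub_eq_zero]
  rw [hw]
  constructor
  · rintro ⟨h, rfl⟩
    rw [fieldV_wRest hv hK, div_eq_zero_iff, or_iff_left m.tau_pos.ne', mul_eq_zero,
      or_iff_right hv.ne'] at h
    exact ⟨rfl, h⟩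
  · rintro ⟨rfl, h⟩
    exact ⟨by rw [fieldV_wRest hv hK, h]; simp, rfl⟩

theorem restFun_one (hK : m.K < 1) (a : ℝ) : m.restFun a 1 = 0 := by
  have : (1 - m.K) ≠ 0 := by linarith
  rw [restFun, one_rpow, div_self (pow_ne_zero 2 this)]; ring

theorem restFun_tangent (hJ : 0 ≤ m.J) {a x y : ℝ} (ha : 0 ≤ a) (hx : 0 < x) (hy : 0 < y)
    (hxy : 0 < (x - m.K) * (y - m.K)) :
    m.restFun a x + m.restFunDeriv a x * (y - x) ≤ m.restFun a y := by
  have h1 : x ^ (-m.γ) - m.γ * x ^ (-m.γ - 1) * (y - x) ≤ y ^ (-m.γ) := by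
    have hγ := m.one_le_γ
    have e1 : y ^ (-m.γ) = x ^ (-m.γ) * (y / x) ^ (-m.γ) := by
      rw [← Real.mul_rpow hx.le (div_pos hy hx).le]; congr 1; field_simp
    have e2 : 1 - m.γ * (y / x - 1) ≤ (y / x) ^ (-m.γ) := by
      have h3 := Real.log_le_sub_one_of_pos (div_pos hy hx)
      have h4 := Real.add_one_le_exp (Real.log (y / x) * -m.γ)
      rw [Real.rpow_def_of_pos (div_pos hy hx)]
      nlinarith
    have e3 : x ^ (-m.γ) - m.γ * x ^ (-m.γ - 1) * (y - x) =
        x ^ (-m.γ) * (1 - m.γ * (y / x - 1)) := by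
      rw [Real.rpow_sub_one hx.ne']; field_simp
    rw [e1, e3]
    exact mul_le_mul_of_nonneg_left e2 (rpow_nonneg hx.le _)
  have h2 : 1 / (x - m.K) ^ 2 - 2 / (x - m.K) ^ 3 * (y - x) ≤ 1 / (y - m.K) ^ 2 := by
    obtain ⟨s, hs⟩ : ∃ s, s = x - m.K := ⟨_, rfl⟩
    obtain ⟨t, ht⟩ : ∃ t, t = y - m.K := ⟨_, rfl⟩
    have hyx : y - x = t - s := by rw [hs, ht]; ring
    rw [← hs, ← ht] at hxy
    rw [← hs, ← ht, hyx]
    have hs0 : s ≠ 0 := fun h => by simp [h] at hxy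
    have ht0 : t ≠ 0 := fun h => by simp [h] at hxy
    have : 1 / t ^ 2 - (1 / s ^ 2 - 2 / s ^ 3 * (t - s)) =
        (t - s) ^ 2 * (2 * (s * t) + s ^ 2) / (s ^ 4 * t ^ 2) := by
      field_simp; ring
    have h0 : 0 ≤ (t - s) ^ 2 * (2 * (s * t) + s ^ 2) / (s ^ 4 * t ^ 2) := by positivity
    linarith
  have h3 := mul_le_mul_of_nonneg_left h1 ha
  have h4 := mul_le_mul_of_nonneg_left h2 (mul_nonneg hJ (sq_nonneg (1 - m.K)))
  have e1 : m.restFun a x + m.restFunDeriv a x * (y - x) = (y - 1) - a - m.J +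
      a * (x ^ (-m.γ) - m.γ * x ^ (-m.γ - 1) * (y - x)) +
      m.J * (1 - m.K) ^ 2 * (1 / (x - m.K) ^ 2 - 2 / (x - m.K) ^ 3 * (y - x)) := by
    rw [restFun, restFunDeriv]; ring
  have e2 : m.restFun a y = (y - 1) - a - m.J + a * y ^ (-m.γ) +
      m.J * (1 - m.K) ^ 2 * (1 / (y - m.K) ^ 2) := by
    rw [restFun]; ring
  rw [e1, e2]
  linarith

theorem IsEndState.restFun_pos (hJ : 0 ≤ m.J) {a v y : ℝ} (ha : 0 ≤ a) (h : m.IsEndState a v)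
    (hy : 0 < y) (hvy : 0 < (v - m.K) * (y - m.K)) (h' : (v - m.K) * (y - v) < 0) :
    0 < m.restFun a y := by
  refine lt_of_lt_of_le ?_ (restFun_tangent hJ ha h.pos hy hvy)
  rw [h.zero, zero_add]
  have h1 : 0 < (v - m.K) ^ 2 := by have := sub_ne_zero.2 h.ne; positivity
  have h2 := mul_pos_of_neg_of_neg h.neg h'
  by_contra h3
  push Not at h3
  nlinarith

theorem IsEndState.unique (hJ : 0 ≤ m.J) {a v y : ℝ} (ha : 0 ≤ a) (h : m.IsEndState a v)
    (h' : m.IsEndState a y) (hvy : m.K < v ↔ m.K < y) : v = y := by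
  have hs : 0 < (v - m.K) * (y - m.K) := by
    rcases lt_or_gt_of_ne h.ne with h1 | h1
    · have h2 : y < m.K := lt_of_le_of_ne (not_lt.1 (mt hvy.2 (not_lt.2 h1.le))) h'.ne
      exact mul_pos_of_neg_of_neg (sub_neg.2 h1) (sub_neg.2 h2)
    · exact mul_pos (sub_pos.2 h1) (sub_pos.2 (hvy.1 h1))
  by_contra hne
  have hv := sub_ne_zero.2 h.ne
  rcases lt_or_gt_of_ne (mul_ne_zero hv (sub_ne_zero.2 (Ne.symm hne))) with h1 | h1
  · exact (h.restFun_pos hJ ha h'.pos hs h1).ne' h'.zero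
  · refine (h'.restFun_pos hJ ha h.pos (by rwa [mul_comm]) ?_).ne' h.zero
    by_contra h2
    push Not at h2
    have h4 := mul_nonneg h2 h1.le
    have h5 : (y - m.K) * (v - y) * ((v - m.K) * (y - v)) =
      -((v - m.K) * (y - m.K) * (v - y) ^ 2) := by ring
    have h6 : 0 < (v - y) ^ 2 := by have := sub_ne_zero.2 hne; positivity
    nlinarith [mul_pos hs h6]

theorem continuousAt_restFun {a v : ℝ} (hv : 0 < v) (hK : v ≠ m.K) :
    ContinuousAt (fun p : ℝ² => m.restFun p.1 p.2) (a, v) := by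
  have h1 : ContinuousAt (fun p : ℝ² => p.2 ^ (-m.γ)) (a, v) :=
    ContinuousAt.rpow_const (by fun_prop) (Or.inl hv.ne')
  have h2 : ((a, v) : ℝ²).2 - m.K ≠ 0 := sub_ne_zero.2 hK
  have h3 : (((a, v) : ℝ²).2 - m.K) ^ 2 ≠ 0 := pow_ne_zero 2 h2
  unfold restFun
  fun_prop (disch := assumption)

theorem continuousAt_restFunDeriv {a v : ℝ} (hv : 0 < v) (hK : v ≠ m.K) :
    ContinuousAt (fun p : ℝ² => m.restFunDeriv p.1 p.2) (a, v) := by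
  have h1 : ContinuousAt (fun p : ℝ² => p.2 ^ (-m.γ - 1)) (a, v) :=
    ContinuousAt.rpow_const (by fun_prop) (Or.inl hv.ne')
  have h2 : ((a, v) : ℝ²).2 - m.K ≠ 0 := sub_ne_zero.2 hK
  have h3 : (((a, v) : ℝ²).2 - m.K) ^ 3 ≠ 0 := pow_ne_zero 3 h2
  unfold restFunDeriv
  fun_prop (disch := assumption)

theorem IsEndState.exists_near (hJ : 0 ≤ m.J) {v₀ : ℝ} (h : m.IsEndState 0 v₀) {ε : ℝ}
    (hε : 0 < ε) : ∀ᶠ a in 𝓝 (0 : ℝ), ∃ v, |v - v₀| < ε ∧ m.IsEndState a v ∧ (m.K < v ↔ m.K < v₀) := by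
  have hopen : ∀ᶠ p : ℝ² in 𝓝 (0, v₀), 0 < p.2 ∧ 0 < (v₀ - m.K) * (p.2 - m.K) ∧
      (p.2 - m.K) * m.restFunDeriv p.1 p.2 < 0 := by
    have c1 : ContinuousAt (fun p : ℝ² => p.2) ((0 : ℝ), v₀) := continuousAt_snd
    have c2 := continuousAt_restFunDeriv (a := 0) h.pos h.ne
    have c3 : ContinuousAt (fun p : ℝ² => (v₀ - m.K) * (p.2 - m.K)) ((0 : ℝ), v₀) := by fun_prop
    have h0 : 0 < (v₀ - m.K) * (v₀ - m.K) := mul_self_pos.2 (sub_ne_zero.2 h.ne)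
    exact (c1.eventually_const_lt h.pos).and ((c3.eventually_const_lt h0).and
      (((c1.sub continuousAt_const).mul c2).eventually_lt_const h.neg))
  rw [nhds_prod_eq] at hopen
  obtain ⟨U, hU, V, hV, hUV⟩ := eventually_prod_iff.1 hopen
  obtain ⟨ρ, hρ, hρV⟩ := Metric.eventually_nhds_iff.1 hV
  set δ := min ρ ε / 2 with hδ
  have hδ0 : 0 < δ := by positivity
  have hδρ : δ < ρ := by have := min_le_left ρ ε; have := lt_min hρ hε; linarith
  have hδε : δ < ε := by have := min_le_right ρ ε; have := lt_min hρ hε; linarith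
  have hin : ∀ y ∈ Icc (v₀ - δ) (v₀ + δ), V y := fun y hy =>
    hρV (by rw [Real.dist_eq, abs_lt]; constructor <;> linarith [hy.1, hy.2])
  have hne : ∀ {y}, 0 < (v₀ - m.K) * (y - m.K) → y ≠ m.K := fun hy h0 => by simp [h0] at hy
  have m1 : v₀ - δ ∈ Icc (v₀ - δ) (v₀ + δ) := ⟨le_rfl, by linarith⟩
  have m2 : v₀ + δ ∈ Icc (v₀ - δ) (v₀ + δ) := ⟨by linarith, le_rfl⟩
  have hpos : ∀ y, V y → (v₀ - m.K) * (y - v₀) < 0 → 0 < m.restFun 0 y := fun y hy hs =>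
    h.restFun_pos hJ le_rfl (hUV hU.self_of_nhds hy).1 (hUV hU.self_of_nhds hy).2.1 hs
  have hneg : ∀ y, V y → 0 < (v₀ - m.K) * (y - v₀) → m.restFun 0 y < 0 := fun y hy hs => by
    obtain ⟨a1, a2, a3⟩ := hUV hU.self_of_nhds hy
    have h1 := restFun_tangent hJ le_rfl a1 h.pos (by rwa [mul_comm])
    rw [h.zero] at h1
    have h2 : m.restFunDeriv 0 y * (y - v₀) < 0 := by
      by_contra h3
      push Not at h3
      have h4 := mul_pos a2 hs
      have h5 := mul_nonneg (mul_self_nonneg (v₀ - m.K)) h3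
      have h6 := mul_neg_of_pos_of_neg hs a3
      have h7 : 0 < (v₀ - m.K) * (v₀ - m.K) := mul_self_pos.2 (sub_ne_zero.2 h.ne)
      have h8 : 0 ≤ ((v₀ - m.K) * (y - m.K)) * (m.restFunDeriv 0 y * (y - v₀)) :=
        mul_nonneg a2.le h3
      nlinarith
    linarith
  have hc : ∀ y, V y → ContinuousAt (fun a => m.restFun a y) 0 := fun y hy => by
    obtain ⟨a1, a2, -⟩ := hUV hU.self_of_nhds hy
    exact (continuousAt_restFun a1 (hne a2)).comp (f := fun a : ℝ => (a, y)) (by fun_prop)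
  have hcon : ∀ a, U a → ContinuousOn (m.restFun a) (Icc (v₀ - δ) (v₀ + δ)) := fun a ha y hy => by
    obtain ⟨a1, a2, -⟩ := hUV ha (hin y hy)
    exact ((continuousAt_restFun a1 (hne a2)).comp (f := fun y : ℝ => (a, y))
      (by fun_prop)).continuousWithinAt
  have hfin : ∀ a, U a → 0 ∈ m.restFun a '' Icc (v₀ - δ) (v₀ + δ) →
      ∃ v, |v - v₀| < ε ∧ m.IsEndState a v ∧ (m.K < v ↔ m.K < v₀) := by
    rintro a ha ⟨v, hv, hv0⟩
    obtain ⟨a1, a2, a3⟩ := hUV ha (hin v hv)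
    refine ⟨v, by rw [abs_lt]; constructor <;> linarith [hv.1, hv.2], ⟨a1, hne a2, hv0, a3⟩, ?_⟩
    rw [← sub_pos, ← sub_pos (b := m.K) (a := v₀)]
    exact ⟨fun h1 => pos_of_mul_pos_left a2 h1.le, fun h1 => pos_of_mul_pos_right a2 h1.le⟩
  rcases lt_or_gt_of_ne (sub_ne_zero.2 h.ne) with hs | hs
  · have k1 := hneg _ (hin _ m1) (by nlinarith)
    have k2 := hpos _ (hin _ m2) (by nlinarith)
    filter_upwards [hU, (hc _ (hin _ m1)).eventually_lt_const k1,
      (hc _ (hin _ m2)).eventually_const_lt k2] with a ha e1 e2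
    exact hfin a ha (intermediate_value_Icc (by linarith) (hcon a ha) ⟨e1.le, e2.le⟩)
  · have k1 := hpos _ (hin _ m1) (by nlinarith)
    have k2 := hneg _ (hin _ m2) (by nlinarith)
    filter_upwards [hU, (hc _ (hin _ m1)).eventually_const_lt k1,
      (hc _ (hin _ m2)).eventually_lt_const k2] with a ha e1 e2
    exact hfin a ha (intermediate_value_Icc' (by linarith) (hcon a ha) ⟨e2.le, e1.le⟩)

theorem IsEndState.exists_family (hJ : 0 ≤ m.J) {v₀ : ℝ} (h : m.IsEndState 0 v₀) : ∃ vE : ℝ → ℝ,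
    vE 0 = v₀ ∧ Tendsto vE (𝓝[≥] 0) (𝓝 v₀) ∧
    ∀ᶠ a in 𝓝[≥] (0 : ℝ), m.IsEndState a (vE a) ∧ (m.K < vE a ↔ m.K < v₀) := by
  classical
  set vE : ℝ → ℝ := fun a =>
    if h : ∃ v, m.IsEndState a v ∧ (m.K < v ↔ m.K < v₀) then h.choose else v₀ with hvE
  have hspec : ∀ a, (∃ v, m.IsEndState a v ∧ (m.K < v ↔ m.K < v₀)) →
      m.IsEndState a (vE a) ∧ (m.K < vE a ↔ m.K < v₀) := fun a ha => by
    rw [hvE]; simp only [dif_pos ha]; exact ha.choose_spec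
  refine ⟨vE, ?_, ?_, ?_⟩
  · obtain ⟨h1, h2⟩ := hspec 0 ⟨v₀, h, Iff.rfl⟩
    exact h1.unique hJ le_rfl h h2
  · rw [Metric.tendsto_nhds]
    intro ε hε
    filter_upwards [nhdsWithin_le_nhds (h.exists_near hJ hε), self_mem_nhdsWithin]
      with a ⟨v, h1, h2, h3⟩ (ha : (0 : ℝ) ≤ a)
    obtain ⟨h4, h5⟩ := hspec a ⟨v, h2, h3⟩
    rw [h4.unique hJ ha h2 (h5.trans h3.symm)]
    exact h1
  · filter_upwards [nhdsWithin_le_nhds (h.exists_near hJ one_pos)] with a ⟨v, h1, h2, h3⟩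
    exact hspec a ⟨v, h2, h3⟩

theorem eq_zero_of_tendsto_deriv {f f' : ℝ → ℝ} {l c : ℝ} (hf : ∀ x, HasDerivAt f (f' x) x)
    (hl : Tendsto f atTop (𝓝 l)) (hc : Tendsto f' atTop (𝓝 c)) : c = 0 := by
  have h1 : ∀ x, ∃ ξ, x ≤ ξ ∧ f' ξ = f (x + 1) - f x := fun x => by
    obtain ⟨ξ, hξ, h⟩ := exists_hasDerivAt_eq_slope f f' (lt_add_one x)
      (fun y _ => (hf y).continuousAt.continuousWithinAt) fun y _ => hf y
    exact ⟨ξ, hξ.1.le, by rw [h]; simp⟩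
  choose ξ hξ hξ' using h1
  have h2 : Tendsto (fun x => f' (ξ x)) atTop (𝓝 c) := hc.comp (tendsto_atTop_mono hξ tendsto_id)
  simp only [hξ'] at h2
  have h3 := (hl.comp (tendsto_atTop_add_const_right atTop 1 tendsto_id)).sub hl
  rw [sub_self] at h3
  exact tendsto_nhds_unique h2 h3

/-- The vector field of the profile equations. -/
def fld (m : MHD) (a : ℝ) (y : ℝ²) : ℝ² := (m.fieldV a y.1 y.2, m.fieldW y.1 y.2)

theorem contDiffAt_fld (m : MHD) {p : ℝ × ℝ²} (hp : 0 < p.2.1) :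
    ContDiffAt ℝ 1 (fun p : ℝ × ℝ² => m.fld p.1 p.2) p := by
  have h1 : ContDiffAt ℝ 1 (fun p : ℝ × ℝ² => p.2.1 ^ (-m.γ)) p :=
    ContDiffAt.rpow_const_of_ne (by fun_prop) hp.ne'
  have h2 : 2 * m.μ₀ * p.2.1 ≠ 0 := mul_ne_zero (by simp [m.μ₀_pos.ne']) hp.ne'
  have h3 := m.tau_pos.ne'
  have h4 := m.μ_pos.ne'
  unfold fld fieldV fieldW pressure
  fun_prop (disch := assumption)

theorem continuousAt_fld {a : ℝ} {y : ℝ²} (hy : 0 < y.1) : ContinuousAt (m.fld a) y :=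
  (m.contDiffAt_fld (p := (a, y)) hy).continuousAt.comp (f := fun y : ℝ² => (a, y)) (by fun_prop)

theorem IsProfile.rest {a : ℝ} {φ : Profile} (h : m.IsProfile a φ) :
    m.fieldV a φ.vR φ.wR = 0 ∧ m.fieldW φ.vR φ.wR = 0 := by
  have h1 := (continuousAt_fld (m := m) (a := a) (y := (φ.vR, φ.wR)) h.vR_pos).tendsto.comp
    (h.v_right.prodMk_nhds h.w_right)
  exact ⟨eq_zero_of_tendsto_deriv h.ode_v h.v_right h1.fst_nhds,
    eq_zero_of_tendsto_deriv h.ode_w h.w_right h1.snd_nhds⟩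

theorem IsLaxOneProfile.isEndState (hJ : 0 < m.J) (hK : m.K < 1) {a : ℝ} (ha : 0 ≤ a) {φ : Profile}
    (h : m.IsLaxOneProfile a φ) : m.IsEndState a φ.vR ∧ φ.wR = m.wRest φ.vR := by
  have hne := ne_K_of_rest hJ hK h.1.vR_pos h.1.rest.2
  obtain ⟨h1, h2⟩ := (rest_iff h.1.vR_pos hne).1 h.1.rest
  refine ⟨⟨h.1.vR_pos, hne, h2, ?_⟩, h1⟩
  have h3 := (m.right_lax_iff ha h.1.vR_pos).1 h.2.2
  rw [h1, ← sub_neg, det_wRest h.1.vR_pos hne] at h3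
  by_contra h4
  push Not at h4
  exact absurd h3 (not_lt.2 (mul_nonneg h.1.vR_pos.le h4))

theorem IsEndState.right_lax {a v : ℝ} (ha : 0 ≤ a) (h : m.IsEndState a v) :
    (∀ s ∈ m.charSpeeds a v (m.wRest v), s ≠ 0) ∧
      ((m.charSpeeds a v (m.wRest v)).filter (fun s => s < 0)).card = 1 := by
  rw [m.right_lax_iff ha h.pos, ← sub_neg, det_wRest h.pos h.ne]
  exact mul_neg_of_pos_of_neg h.pos h.neg

theorem IsEndState.mem_endStates {a v : ℝ} (ha : 0 ≤ a) (h : m.IsEndState a v) :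
    m.endData a (v, m.wRest v) ∈ m.endStates := by
  refine ⟨h.pos, mul_nonneg (mul_nonneg ha (by linarith [m.one_le_γ])) (rpow_nonneg h.pos.le _),
    fun h1 => ?_⟩
  have h2 := det_wRest (a := a) h.pos h.ne
  exact (mul_neg_of_pos_of_neg h.pos h.neg).ne (h2.symm.trans (sub_eq_zero.2 h1))

theorem left_mem_endStates (h : 2 * m.J + m.K < 1) : ∀ᶠ a in 𝓝[≥] (0 : ℝ),
    m.endData a (1, 0) ∈ m.endStates := by
  have h1 : ∀ᶠ a in 𝓝 (0 : ℝ), 0 < (1 - a * m.γ) * (1 - m.K) - 2 * m.J := by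
    refine ContinuousAt.eventually_lt (f := fun _ : ℝ => (0 : ℝ)) (by fun_prop) (by fun_prop) ?_
    simp; linarith
  filter_upwards [nhdsWithin_le_nhds h1, self_mem_nhdsWithin] with a h2 (ha : (0 : ℝ) ≤ a)
  refine ⟨one_pos, mul_nonneg (mul_nonneg ha (by linarith [m.one_le_γ])) (rpow_nonneg zero_le_one _),
    fun h3 => ?_⟩
  have e : (1 - m.s11 (a * m.γ * 1 ^ (-m.γ)) (m.magField 1 0)) * (1 - m.K) -
      m.s12 (m.magField 1 0) ^ 2 = (1 - a * m.γ) * (1 - m.K) - 2 * m.J := by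
    have := m.μ₀_pos.ne'
    simp only [s11, s12, magField, J, K, one_rpow]; field_simp; ring
  rw [← e] at h2
  exact h2.ne' (sub_eq_zero.2 h3)

end MHD

/-! ### Planar saddles and repellers -/

theorem forall_mem_of_step {E : Type*} [TopologicalSpace E] {y : ℝ → E} {U : Set E}
    (hU : IsOpen U) (hy : Continuous y)
    (h : ∀ t, 0 ≤ t → (∀ s, 0 ≤ s → s < t → y s ∈ U) → y t ∈ U) : ∀ t, 0 ≤ t → y t ∈ U := by
  by_contra hcon
  push Not at hcon
  obtain ⟨t, ht, htU⟩ := hcon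
  set B := Ici (0 : ℝ) ∩ y ⁻¹' Uᶜ with hB
  have hBc : IsClosed B := isClosed_Ici.inter (hU.isClosed_compl.preimage hy)
  have hBb : BddBelow B := ⟨0, fun s hs => hs.1⟩
  have hmem := hBc.csInf_mem ⟨t, ht, htU⟩ hBb
  exact hmem.2 (h _ hmem.1 fun s hs hs' => by
    by_contra hsU
    exact absurd (csInf_le hBb ⟨hs, hsU⟩) (not_le.2 hs'))

theorem antitoneOn_of_hasDerivAt {w w' : ℝ → ℝ} {s : Set ℝ} (hs : Convex ℝ s)
    (hw : ∀ t ∈ s, HasDerivAt w (w' t) t) (h : ∀ t ∈ interior s, w' t ≤ 0) : AntitoneOn w s :=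
  antitoneOn_of_deriv_nonpos hs (fun t ht => (hw t ht).continuousAt.continuousWithinAt)
    (fun t ht => (hw t (interior_subset ht)).differentiableAt.differentiableWithinAt) fun t ht =>
      (hw t (interior_subset ht)).deriv.trans_le (h t ht)

theorem monotoneOn_of_hasDerivAt {w w' : ℝ → ℝ} {s : Set ℝ} (hs : Convex ℝ s)
    (hw : ∀ t ∈ s, HasDerivAt w (w' t) t) (h : ∀ t ∈ interior s, 0 ≤ w' t) : MonotoneOn w s := by
  simpa using (antitoneOn_of_hasDerivAt hs (fun t ht => (hw t ht).neg)
    fun t ht => neg_nonpos.2 (h t ht)).neg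

theorem le_exp_of_deriv_le {w w' : ℝ → ℝ} {k T : ℝ} (hw : ∀ t, T ≤ t → HasDerivAt w (w' t) t)
    (h : ∀ t, T ≤ t → w' t ≤ -k * w t) {t : ℝ} (ht : T ≤ t) :
    w t ≤ w T * exp (-k * (t - T)) := by
  have hd : ∀ t, T ≤ t → HasDerivAt (fun t => w t * exp (k * (t - T)))
      (w' t * exp (k * (t - T)) + w t * (exp (k * (t - T)) * k)) t := fun t ht =>
    (hw t ht).mul ((((hasDerivAt_id t).sub_const T).const_mul k).exp.congr_deriv (by simp))
  have hanti : AntitoneOn (fun t => w t * exp (k * (t - T))) (Ici T) := by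
    refine antitoneOn_of_hasDerivAt (convex_Ici T) hd fun t ht => ?_
    nlinarith [h t (interior_subset ht), exp_pos (k * (t - T))]
  have h1 := hanti self_mem_Ici ht ht
  simp only [sub_self, mul_zero, Real.exp_zero, mul_one] at h1
  have h2 := mul_le_mul_of_nonneg_right h1 (exp_pos (-k * (t - T))).le
  rwa [mul_assoc, ← exp_add, show k * (t - T) + -k * (t - T) = 0 by ring, Real.exp_zero,
    mul_one] at h2

theorem le_of_deriv_ge {w w' : ℝ → ℝ} {k c M T : ℝ} (hk : 0 < k)
    (hw : ∀ t, T ≤ t → HasDerivAt w (w' t) t) (h : ∀ t, T ≤ t → k * (w t - c) ≤ w' t)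
    (hM : ∀ t, T ≤ t → w t ≤ M) {t : ℝ} (ht : T ≤ t) : w t ≤ c := by
  by_contra hc
  push Not at hc
  have h1 : ∀ s, t ≤ s → w t - c ≤ (M - c) * exp (-k * (s - t)) := fun s hs => by
    have := le_exp_of_deriv_le (w := fun x => c - w x) (w' := fun x => -w' x) (k := -k) (T := t)
      (fun x hx => (hw x (ht.trans hx)).const_sub c)
      (fun x hx => by linarith [h x (ht.trans hx)]) hs
    have h2 := mul_le_mul_of_nonneg_right this (exp_pos (-k * (s - t))).le
    rw [mul_assoc, ← exp_add, show - -k * (s - t) + -k * (s - t) = 0 by ring, Real.exp_zero,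
      mul_one] at h2
    have h3 := mul_le_mul_of_nonneg_right (hM s (ht.trans hs)) (exp_pos (-k * (s - t))).le
    linarith
  have h2 : Tendsto (fun s => (M - c) * exp (-k * (s - t))) atTop (𝓝 ((M - c) * 0)) := by
    refine (tendsto_exp_atBot.comp ?_).const_mul _
    exact (tendsto_atTop_add_const_right atTop (-t) tendsto_id).const_mul_atTop_of_neg (by linarith)
  have h3 := ge_of_tendsto h2 (eventually_atTop.2 ⟨t, fun s hs => h1 s hs⟩)
  linarith

theorem exp_decay_of_trapped {w w' : ℝ → ℝ} {k r : ℝ} (hk : 0 ≤ k) (hw : ∀ t, HasDerivAt w (w' t) t)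
    (hpos : ∀ t, 0 ≤ w t) (h : ∀ t, 0 ≤ t → w t < r → w' t ≤ -k * w t) (h0 : w 0 < r) :
    ∀ t, 0 ≤ t → w t < r ∧ w t ≤ w 0 * exp (-k * t) := by
  have hc : Continuous w := continuous_of_hasDerivAt hw
  have h1 : ∀ t, 0 ≤ t → w t ∈ Iio r := by
    refine forall_mem_of_step isOpen_Iio hc fun t ht hs => ?_
    have hanti : AntitoneOn w (Icc 0 t) := by
      refine antitoneOn_of_hasDerivAt (convex_Icc 0 t) (fun s _ => hw s) fun s hs' => ?_
      rw [interior_Icc] at hs'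
      nlinarith [h s hs'.1.le (hs s hs'.1.le hs'.2), hpos s]
    exact (hanti ⟨le_rfl, ht⟩ ⟨ht, le_rfl⟩ ht).trans_lt h0
  intro t ht
  have h2 := le_exp_of_deriv_le (T := 0) (fun t _ => hw t) (fun t ht => h t ht (h1 t ht)) ht
  rw [sub_zero] at h2
  exact ⟨h1 t ht, h2⟩

theorem continuous_flow {E : Type*} [NormedAddCommGroup E] [NormedSpace ℝ E] {F : E → E} {K : NNReal}
    (hF : LipschitzWith K F) {Y : ℝ → ℝ → E} (hY : ∀ s t, HasDerivAt (Y s) (F (Y s t)) t)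
    (h0 : Continuous fun s => Y s 0) : Continuous (Function.uncurry Y) := by
  refine continuous_iff_continuousAt.2 fun ⟨s₀, t₀⟩ => ?_
  have hc : Continuous (Y s₀) := continuous_of_hasDerivAt (hY s₀)
  set T := |t₀| + 1 with hT
  refine tendsto_iff_dist_tendsto_zero.2 ?_
  have h1 : Tendsto (fun p : ℝ² => dist (Y p.1 0) (Y s₀ 0) * exp ((K + 1) * T) +
      dist (Y s₀ p.2) (Y s₀ t₀)) (𝓝 (s₀, t₀)) (𝓝 (dist (Y s₀ 0) (Y s₀ 0) * exp ((K + 1) * T) +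
      dist (Y s₀ t₀) (Y s₀ t₀))) := by
    have c1 : Continuous fun p : ℝ² => Y p.1 0 := h0.comp continuous_fst
    have c2 : Continuous fun p : ℝ² => Y s₀ p.2 := hc.comp continuous_snd
    exact Continuous.tendsto (by fun_prop) _
  rw [dist_self, dist_self, zero_mul, add_zero] at h1
  refine squeeze_zero' (Eventually.of_forall fun _ => dist_nonneg) ?_ h1
  have h2 : ∀ᶠ p : ℝ² in 𝓝 (s₀, t₀), |p.2| < T :=
    ContinuousAt.eventually_lt (f := fun p : ℝ² => |p.2|) (by fun_prop) (by fun_prop) (by simp [hT])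
  filter_upwards [h2] with p hp
  refine (dist_triangle _ (Y s₀ p.2) _).trans (add_le_add_left ?_ _)
  change dist (Y p.1 p.2) (Y s₀ p.2) ≤ _
  have := dist_solution_le (F := fun _ => F) (e := 0) (d := dist (Y p.1 0) (Y s₀ 0))
    (G := fun t => F (Y s₀ t)) (T := T) (fun _ => hF) (fun t _ => by simp) (fun t _ => hY p.1 t)
    (fun t _ => hY s₀ t) le_rfl hp.le
  simpa using this

variable {P Q : ℝ² →L[ℝ] ℝ} {κ : ℝ} {F : ℝ² → ℝ²} {U : Set ℝ²}

/-- In the coordinates `P`, `Q` differences of solutions contract in the direction of `P` and expand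
in that of `Q`. -/
structure IsSaddleField (P Q : ℝ² →L[ℝ] ℝ) (κ : ℝ) (F : ℝ² → ℝ²) (U : Set ℝ²) :
    Prop where
  contract : ∀ y ∈ U, ∀ z ∈ U, P (y - z) * P (F y - F z) ≤
    -3 * κ * P (y - z) ^ 2 + κ * (P (y - z) ^ 2 + Q (y - z) ^ 2)
  expand : ∀ y ∈ U, ∀ z ∈ U, 3 * κ * Q (y - z) ^ 2 - κ * (P (y - z) ^ 2 + Q (y - z) ^ 2) ≤
    Q (y - z) * Q (F y - F z)

namespace IsSaddleField

theorem compare (h : IsSaddleField P Q κ F U) (hκ : 0 < κ) {G : ℝ² → ℝ²} {y z : ℝ → ℝ²}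
    {T M ω : ℝ} (hy : ∀ t, T ≤ t → HasDerivAt y (F (y t)) t)
    (hz : ∀ t, T ≤ t → HasDerivAt z (G (z t)) t) (hyU : ∀ t, T ≤ t → y t ∈ U)
    (hzU : ∀ t, T ≤ t → z t ∈ U) (hM : ∀ t, T ≤ t → Q (y t - z t) ^ 2 - P (y t - z t) ^ 2 ≤ M)
    (hω : ∀ t, T ≤ t →
      P (F (z t) - G (z t)) ^ 2 + Q (F (z t) - G (z t)) ^ 2 ≤ κ ^ 2 * ω) {t : ℝ} (ht : T ≤ t) :
    Q (y t - z t) ^ 2 - P (y t - z t) ^ 2 ≤ ω := by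
  have hd : ∀ (L : ℝ² →L[ℝ] ℝ) t, T ≤ t →
      HasDerivAt (fun t => L (y t - z t)) (L (F (y t) - G (z t))) t := fun L t ht =>
    L.hasFDerivAt.comp_hasDerivAt t ((hy t ht).sub (hz t ht))
  refine le_of_deriv_ge (w := fun t => Q (y t - z t) ^ 2 - P (y t - z t) ^ 2) hκ
    (fun t ht => ((hd Q t ht).pow 2).sub ((hd P t ht).pow 2)) (fun t ht => ?_) hM ht
  have h1 := h.contract _ (hyU t ht) _ (hzU t ht)
  have h2 := h.expand _ (hyU t ht) _ (hzU t ht)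
  have e : ∀ L : ℝ² →L[ℝ] ℝ, L (F (y t) - G (z t)) =
      L (F (y t) - F (z t)) + L (F (z t) - G (z t)) := fun L => by rw [← map_add]; congr 1; abel
  have h3 := hω t ht
  simp only [Nat.cast_ofNat, Nat.add_one_sub_one, pow_one, e]
  set p := P (y t - z t)
  set q := Q (y t - z t)
  set r := P (F (z t) - G (z t))
  set s := Q (F (z t) - G (z t))
  have h4 : 0 ≤ κ⁻¹ * ((κ * q + s) ^ 2 + (κ * p - r) ^ 2) := by positivity
  have h5 : κ⁻¹ * ((κ * q + s) ^ 2 + (κ * p - r) ^ 2) =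
      κ * (q ^ 2 + p ^ 2) + 2 * q * s - 2 * p * r + κ⁻¹ * (r ^ 2 + s ^ 2) := by
    field_simp; ring
  have h6 : κ⁻¹ * (r ^ 2 + s ^ 2) ≤ κ * ω := by
    refine (mul_le_mul_of_nonneg_left h3 (inv_nonneg.2 hκ.le)).trans_eq ?_
    field_simp
  nlinarith [sq_nonneg p, sq_nonneg q]

theorem cone (h : IsSaddleField P Q κ F U) (hκ : 0 < κ) {y : ℝ → ℝ²} {S : ℝ²} {T M : ℝ}
    (hS : S ∈ U) (hFS : F S = 0) (hy : ∀ t, T ≤ t → HasDerivAt y (F (y t)) t)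
    (hyU : ∀ t, T ≤ t → y t ∈ U) (hM : ∀ t, T ≤ t → Q (y t - S) ^ 2 - P (y t - S) ^ 2 ≤ M) {t : ℝ}
    (ht : T ≤ t) : Q (y t - S) ^ 2 ≤ P (y t - S) ^ 2 := by
  have := h.compare hκ (G := F) (z := fun _ => S) (ω := 0) hy
    (fun t _ => by rw [hFS]; exact hasDerivAt_const t S) hyU (fun _ _ => hS) hM
    (fun t _ => by simp) ht
  linarith

theorem decay (h : IsSaddleField P Q κ F U) (hκ : 0 < κ) {y : ℝ → ℝ²} {S : ℝ²} {T : ℝ}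
    (hS : S ∈ U) (hFS : F S = 0) (hy : ∀ t, T ≤ t → HasDerivAt y (F (y t)) t)
    (hyU : ∀ t, T ≤ t → y t ∈ U) (hcone : ∀ t, T ≤ t → Q (y t - S) ^ 2 ≤ P (y t - S) ^ 2) {t : ℝ}
    (ht : T ≤ t) : P (y t - S) ^ 2 ≤ P (y T - S) ^ 2 * exp (-(2 * κ) * (t - T)) := by
  have hd : ∀ t, T ≤ t → HasDerivAt (fun t => P (y t - S)) (P (F (y t))) t := fun t ht =>
    P.hasFDerivAt.comp_hasDerivAt t ((hy t ht).sub_const S)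
  refine le_exp_of_deriv_le (w := fun t => P (y t - S) ^ 2) (fun t ht => (hd t ht).pow 2)
    (fun t ht => ?_) ht
  have h1 := h.contract _ (hyU t ht) _ hS
  rw [hFS, sub_zero] at h1
  simp only [Nat.cast_ofNat, Nat.add_one_sub_one, pow_one]
  nlinarith [hcone t ht]

/-- Existence of an orbit on the local stable manifold. -/
theorem exists_stable (h : IsSaddleField P Q κ F U) (hκ : 0 < κ) {K : NNReal} {B : ℝ}
    (hF : LipschitzWith K F) (hU : IsOpen U) {S e f : ℝ²} {p₀ : ℝ} (hFS : F S = 0)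
    (hp₀ : 0 < p₀) (hUS : ∀ y, P (y - S) ^ 2 + Q (y - S) ^ 2 ≤ 5 * p₀ ^ 2 → y ∈ U)
    (hPe : P e = 1) (hQe : Q e = 0) (hPf : P f = 0) (hQf : Q f = 1) (hB : ‖F 0‖ ≤ B) :
    ∃ y : ℝ → ℝ², (∀ t, HasDerivAt y (F (y t)) t) ∧ P (y 0 - S) = p₀ ∧
      ∀ t, 0 ≤ t → y t ∈ U ∧ Q (y t - S) ^ 2 ≤ P (y t - S) ^ 2 := by
  have hS : S ∈ U := hUS S (by simp; positivity)
  have hex : ∀ s : ℝ, ∃ y : ℝ → ℝ², y 0 = S + (p₀ • e + (s * p₀) • f) ∧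
      ∀ t, HasDerivAt y (F (y t)) t := fun s =>
    exists_global_solution (f := fun _ => F) (hF.continuous.comp continuous_snd) (fun _ => hF)
      (fun _ => hB) _
  choose Y hY0 hY using hex
  have hYc : Continuous (Function.uncurry Y) := continuous_flow hF hY (by simp only [hY0]; fun_prop)
  have hYt : ∀ s, Continuous (Y s) := fun s => hYc.comp (by fun_prop : Continuous fun t => (s, t))
  have hP0 : ∀ s, P (Y s 0 - S) = p₀ := fun s => by simp [hY0, hPe, hPf]
  have hQ0 : ∀ s, Q (Y s 0 - S) = s * p₀ := fun s => by simp [hY0, hQe, hQf]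
  set E : ℝ → ℝ → ℝ := fun s t => Q (Y s t - S) ^ 2 - P (Y s t - S) ^ 2 with hE
  have hEc : ∀ s, Continuous (E s) := fun s => by have := hYt s; fun_prop
  have hd : ∀ (L : ℝ² →L[ℝ] ℝ) s t,
      HasDerivAt (fun t => L (Y s t - S)) (L (F (Y s t))) t := fun L s t =>
    L.hasFDerivAt.comp_hasDerivAt t ((hY s t).sub_const S)
  have hmono : ∀ s t₁ t₂, t₁ ≤ t₂ → (∀ t ∈ Icc t₁ t₂, Y s t ∈ U) → E s t₁ ≤ E s t₂ := by
    intro s t₁ t₂ h12 hin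
    refine monotoneOn_of_hasDerivAt (convex_Icc t₁ t₂)
      (fun t _ => ((hd Q s t).pow 2).sub ((hd P s t).pow 2)) (fun t ht => ?_) ⟨le_rfl, h12⟩
      ⟨h12, le_rfl⟩ h12
    have h1 := h.contract _ (hin t (interior_subset ht)) _ hS
    have h2 := h.expand _ (hin t (interior_subset ht)) _ hS
    rw [hFS, sub_zero] at h1 h2
    simp only [Nat.cast_ofNat, Nat.add_one_sub_one, pow_one]
    nlinarith [mul_nonneg hκ.le (sq_nonneg (P (Y s t - S))),
      mul_nonneg hκ.le (sq_nonneg (Q (Y s t - S)))]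
  set A : ℝ → Set ℝ := fun σ => {s | ∃ t, 0 ≤ t ∧ (∀ τ ∈ Icc 0 t, Y s τ ∈ U) ∧ 0 < E s t ∧
    0 < σ * Q (Y s t - S)} with hA
  have hAopen : ∀ σ, IsOpen (A σ) := by
    intro σ
    refine isOpen_iff_mem_nhds.2 ?_
    rintro s ⟨t, ht, h1, h2, h3⟩
    have e1 : ∀ᶠ s' in 𝓝 s, ∀ τ ∈ Icc 0 t, Y s' τ ∈ U := by
      refine isCompact_Icc.eventually_forall_of_forall_eventually fun τ hτ => ?_
      exact hYc.continuousAt.eventually_mem (hU.mem_nhds (h1 τ hτ))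
    have hYs : Continuous fun s => Y s t := hYc.comp (by fun_prop : Continuous fun s => (s, t))
    have e2 : ∀ f : ℝ → ℝ, Continuous f → 0 < f s → ∀ᶠ s' in 𝓝 s, 0 < f s' := fun f hf h =>
      hf.continuousAt.eventually_const_lt h
    filter_upwards [e1, e2 (E · t) (by fun_prop) h2, e2 (fun s => σ * Q (Y s t - S)) (by fun_prop) h3]
      with s' k1 k2 k3 using ⟨t, ht, k1, k2, k3⟩
  have hpersist : ∀ σ s t t', 0 ≤ t → t ≤ t' → (∀ τ ∈ Icc 0 t', Y s τ ∈ U) → 0 < E s t →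
      0 < σ * Q (Y s t - S) → 0 < σ * Q (Y s t' - S) := by
    intro σ s t t' ht htt' hin hEt hσ
    by_contra hcon
    push Not at hcon
    have hYs := hYt s
    obtain ⟨τ, hτ, h0⟩ := intermediate_value_Icc' (f := fun τ => σ * Q (Y s τ - S)) htt'
      (by fun_prop) ⟨hcon, hσ.le⟩
    have h1 := hmono s t τ hτ.1 fun r hr => hin r ⟨ht.trans hr.1, hr.2.trans hτ.2⟩
    have hσ0 : σ ≠ 0 := fun h => by simp [h] at hσ
    have h2 : Q (Y s τ - S) = 0 := (mul_eq_zero.1 h0).resolve_left hσ0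
    have h3 : 0 < E s τ := hEt.trans_le h1
    simp only [hE, h2] at h3
    nlinarith [sq_nonneg (P (Y s τ - S))]
  have hdisj : ∀ s, s ∈ A 1 → s ∈ A (-1) → False := by
    rintro s ⟨t₁, h1, h2, h3, h4⟩ ⟨t₂, k1, k2, k3, k4⟩
    rcases le_total t₁ t₂ with hle | hle
    · have := hpersist 1 s t₁ t₂ h1 hle k2 h3 h4; linarith
    · have := hpersist (-1) s t₂ t₁ k1 hle h2 k3 k4; linarith
  have hY0U : ∀ s ∈ Icc (-2 : ℝ) 2, Y s 0 ∈ U := fun s hs => by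
    refine hUS _ ?_
    rw [hP0, hQ0]
    have : s ^ 2 ≤ 4 := by nlinarith [hs.1, hs.2]
    nlinarith [sq_nonneg p₀]
  have hstart : ∀ σ : ℝ, σ ^ 2 = 1 → 2 * σ ∈ A σ := fun σ hσ => by
    refine ⟨0, le_rfl, fun τ hτ => ?_, ?_, ?_⟩
    · rw [Icc_self, mem_singleton_iff] at hτ
      rw [hτ]
      exact hY0U _ ⟨by nlinarith, by nlinarith⟩
    · simp only [hE, hP0, hQ0]; nlinarith [sq_pos_of_pos hp₀]
    · rw [hQ0]; nlinarith
  obtain ⟨s, hs, hs1, hs2⟩ : ∃ s ∈ Icc (-2 : ℝ) 2, s ∉ A 1 ∧ s ∉ A (-1) := by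
    by_contra hcon
    push Not at hcon
    obtain ⟨s, -, h1, h2⟩ := isPreconnected_Icc (a := (-2 : ℝ)) (b := 2) (A 1) (A (-1)) (hAopen 1)
      (hAopen (-1)) (fun s hs => or_iff_not_imp_left.2 (hcon s hs))
      ⟨2, by norm_num, by have := hstart 1 (by norm_num); rwa [mul_one] at this⟩
      ⟨-2, by norm_num, by have := hstart (-1) (by norm_num); rwa [mul_neg, mul_one] at this⟩
    exact hdisj s h1 h2
  have hcone : ∀ t, 0 ≤ t → (∀ τ ∈ Icc 0 t, Y s τ ∈ U) → Q (Y s t - S) ^ 2 ≤ P (Y s t - S) ^ 2 := by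
    intro t ht hin
    by_contra hcon
    push Not at hcon
    have hE0 : 0 < E s t := sub_pos.2 hcon
    rcases lt_trichotomy (Q (Y s t - S)) 0 with h1 | h1 | h1
    · exact hs2 ⟨t, ht, hin, hE0, by linarith⟩
    · rw [h1] at hcon; nlinarith [sq_nonneg (P (Y s t - S))]
    · exact hs1 ⟨t, ht, hin, hE0, by linarith⟩
  have hall : ∀ t, 0 ≤ t → Y s t ∈ U := by
    refine forall_mem_of_step hU (hYt s) fun t ht hbefore => ?_
    rcases ht.eq_or_lt with rfl | ht
    · exact hY0U s hs
    have hYs := hYt s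
    have hP : AntitoneOn (fun t => P (Y s t - S) ^ 2) (Icc 0 t) := by
      refine antitoneOn_of_hasDerivAt (convex_Icc 0 t) (fun τ _ => (hd P s τ).pow 2) fun τ hτ => ?_
      rw [interior_Icc] at hτ
      have h1 := h.contract _ (hbefore τ hτ.1.le hτ.2) _ hS
      have h2 := hcone τ hτ.1.le fun r hr => hbefore r hr.1 (hr.2.trans_lt hτ.2)
      rw [hFS, sub_zero] at h1
      simp only [Nat.cast_ofNat, Nat.add_one_sub_one, pow_one]
      nlinarith [mul_nonneg hκ.le (sq_nonneg (P (Y s τ - S)))]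
    have h1 := hP ⟨le_rfl, ht.le⟩ ⟨ht.le, le_rfl⟩ ht.le
    simp only [hP0] at h1
    have h2 : Q (Y s t - S) ^ 2 ≤ P (Y s t - S) ^ 2 := by
      have c : ∀ L : ℝ² →L[ℝ] ℝ, Tendsto (fun τ => L (Y s τ - S) ^ 2) (𝓝[<] t)
          (𝓝 (L (Y s t - S) ^ 2)) := fun L =>
        (Continuous.tendsto (by fun_prop) t).mono_left nhdsWithin_le_nhds
      refine le_of_tendsto_of_tendsto (c Q) (c P) ?_
      filter_upwards [Ioo_mem_nhdsLT ht] with τ hτ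
      exact hcone τ hτ.1.le fun r hr => hbefore r hr.1 (hr.2.trans_lt hτ.2)
    exact hUS _ (by nlinarith [sq_nonneg p₀])
  exact ⟨Y s, hY s, hP0 s, fun t ht => ⟨hall t ht, hcone t ht fun τ hτ => hall τ hτ.1⟩⟩

end IsSaddleField

/-! ### Linearization of the profile equations -/

theorem exists_saddle_coords {α β γ δ l₁ l₂ : ℝ} (hdet : α * δ - β * γ < 0)
    (hl : ∀ k > 0, ¬(l₁ * α + l₂ * γ = k * l₁ ∧ l₁ * β + l₂ * δ = k * l₂)) :
    ∃ k k' p₁ p₂ q₁ q₂ c c' : ℝ, k < 0 ∧ 0 < k' ∧ 0 < c ∧ p₁ * q₂ - p₂ * q₁ ≠ 0 ∧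
      p₁ * α + p₂ * γ = k * p₁ ∧ p₁ * β + p₂ * δ = k * p₂ ∧
      q₁ * α + q₂ * γ = k' * q₁ ∧ q₁ * β + q₂ * δ = k' * q₂ ∧
      l₁ = c * p₁ + c' * q₁ ∧ l₂ = c * p₂ + c' * q₂ := by
  set R := √((α + δ) ^ 2 - 4 * (α * δ - β * γ)) with hR
  have hR2 : R ^ 2 = (α + δ) ^ 2 - 4 * (α * δ - β * γ) := sq_sqrt (by nlinarith [sq_nonneg (α + δ)])
  have hR0 : 0 ≤ R := sqrt_nonneg _
  have hRt : |α + δ| < R := abs_lt_of_sq_lt_sq (by linarith) hR0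
  obtain ⟨hRt1, hRt2⟩ := abs_lt.1 hRt
  have hev : ∀ k, k ^ 2 - (α + δ) * k + (α * δ - β * γ) = 0 → ∃ x y : ℝ, ¬(x = 0 ∧ y = 0) ∧
      x * α + y * γ = k * x ∧ x * β + y * δ = k * y := by
    intro k hk
    by_cases h : γ = 0 ∧ k = α
    · obtain ⟨rfl, rfl⟩ := h
      by_cases h' : β = 0 ∧ k = δ
      · obtain ⟨rfl, rfl⟩ := h'
        exact ⟨1, 0, by simp, by ring, by ring⟩
      · exact ⟨k - δ, β, fun h2 => h' ⟨h2.2, by linarith [h2.1]⟩, by ring, by ring⟩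
    · exact ⟨γ, k - α, fun h2 => h ⟨h2.1, by linarith [h2.2]⟩, by ring, by linear_combination -hk⟩
  obtain ⟨p₁, p₂, hp, hp1, hp2⟩ := hev ((α + δ - R) / 2) (by linear_combination hR2 / 4)
  obtain ⟨q₁, q₂, hq, hq1, hq2⟩ := hev ((α + δ + R) / 2) (by linear_combination hR2 / 4)
  set k := (α + δ - R) / 2 with hk
  set k' := (α + δ + R) / 2 with hk'
  have hk0 : k < 0 := by rw [hk]; linarith
  have hk0' : 0 < k' := by rw [hk']; linarith
  have hΔ : p₁ * q₂ - p₂ * q₁ ≠ 0 := by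
    intro h0
    have e1 : (k' - k) * (q₁ * p₁) = 0 := by linear_combination q₁ * hp1 - p₁ * hq1 + γ * h0
    have e2 : (k' - k) * (q₁ * p₂) = 0 := by linear_combination q₁ * hp2 - p₁ * hq2 + (δ - k') * h0
    have e3 : (k' - k) * (q₂ * p₁) = 0 := by linear_combination e2 + (k' - k) * h0
    have e4 : (k' - k) * (q₂ * p₂) = 0 := by linear_combination q₂ * hp2 - p₂ * hq2 - β * h0
    have hkk : k' - k ≠ 0 := by linarith
    simp only [mul_eq_zero, hkk, false_or] at e1 e2 e3 e4
    tauto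
  set c := (l₁ * q₂ - l₂ * q₁) / (p₁ * q₂ - p₂ * q₁) with hc
  set c' := (p₁ * l₂ - p₂ * l₁) / (p₁ * q₂ - p₂ * q₁) with hc'
  have el1 : l₁ = c * p₁ + c' * q₁ := by
    rw [hc, hc', div_mul_eq_mul_div, div_mul_eq_mul_div, ← add_div, eq_div_iff hΔ]; ring
  have el2 : l₂ = c * p₂ + c' * q₂ := by
    rw [hc, hc', div_mul_eq_mul_div, div_mul_eq_mul_div, ← add_div, eq_div_iff hΔ]; ring
  have hc0 : c ≠ 0 := by
    intro h0
    rw [h0, zero_mul, zero_add] at el1 el2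
    exact hl k' hk0' ⟨by rw [el1, el2]; linear_combination c' * hq1,
      by rw [el1, el2]; linear_combination c' * hq2⟩
  rcases lt_or_gt_of_ne hc0 with h | h
  · exact ⟨k, k', -p₁, -p₂, q₁, q₂, -c, c', hk0, hk0', by linarith, fun h => hΔ (by linarith),
      by linear_combination -hp1, by linear_combination -hp2, hq1, hq2, by rw [neg_mul_neg]; exact el1,
      by rw [neg_mul_neg]; exact el2⟩
  · exact ⟨k, k', p₁, p₂, q₁, q₂, c, c', hk0, hk0', h, hΔ, hp1, hp2, hq1, hq2, el1, el2⟩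

/-- The linear map of the plane with the given matrix. -/
def planarCLM (α β γ δ : ℝ) : ℝ² →L[ℝ] ℝ² :=
  (α • ContinuousLinearMap.fst ℝ ℝ ℝ + β • ContinuousLinearMap.snd ℝ ℝ ℝ).prod
    (γ • ContinuousLinearMap.fst ℝ ℝ ℝ + δ • ContinuousLinearMap.snd ℝ ℝ ℝ)

theorem planarCLM_apply (α β γ δ : ℝ) (d : ℝ²) :
    planarCLM α β γ δ d = (α * d.1 + β * d.2, γ * d.1 + δ * d.2) := rfl

theorem norm_le_of_decomp {P Q : ℝ² →L[ℝ] ℝ} {e f d : ℝ²} {n : ℝ} (hd : d = P d • e + Q d • f)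
    (hP : |P d| ≤ n) (hQ : |Q d| ≤ n) : ‖d‖ ≤ (‖e‖ + ‖f‖) * n := by
  calc ‖d‖ ≤ |P d| * ‖e‖ + |Q d| * ‖f‖ := by
        conv_lhs => rw [hd]
        refine (norm_add_le _ _).trans_eq ?_
        rw [norm_smul, norm_smul, norm_eq_abs, norm_eq_abs]
    _ ≤ n * ‖e‖ + n * ‖f‖ := by gcongr
    _ = _ := by ring

/-- Coordinates adapted to a planar saddle. The last field says that on the cone
`|Q| ≤ |P|` the functional `l` has the sign of `P`. -/
structure IsSaddleCoords (P Q : ℝ² →L[ℝ] ℝ) (e f : ℝ²) (l : ℝ² → ℝ) (c : ℝ) : Prop where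
  Pe : P e = 1
  Qe : Q e = 0
  Pf : P f = 0
  Qf : Q f = 1
  decomp : ∀ d, d = P d • e + Q d • f
  c_pos : 0 < c
  side : ∀ d, Q d ^ 2 ≤ P d ^ 2 → c * P d ^ 2 ≤ l d * P d

theorem IsSaddleCoords.isSaddleField {P Q : ℝ² →L[ℝ] ℝ} {e f : ℝ²} {l : ℝ² → ℝ} {c κ k k' : ℝ}
    (hc : IsSaddleCoords P Q e f l c) {A : ℝ² →L[ℝ] ℝ²} (hPA : ∀ d, P (A d) = k * P d)
    (hQA : ∀ d, Q (A d) = k' * Q d) (hκ : 0 < κ) (hk : 3 * κ ≤ -k) (hk' : 3 * κ ≤ k')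
    {F : ℝ² → ℝ²} {U : Set ℝ²}
    (hF : ∀ y ∈ U, ∀ z ∈ U, ‖F y - F z - A (y - z)‖ ≤
      κ / (2 * ((‖P‖ + ‖Q‖) * (‖e‖ + ‖f‖)) + 1) * ‖y - z‖) : IsSaddleField P Q κ F U := by
  have herr : ∀ y ∈ U, ∀ z ∈ U, ∀ (L : ℝ² →L[ℝ] ℝ) (x : ℝ),
      ‖L‖ ≤ ‖P‖ + ‖Q‖ → x ^ 2 ≤ P (y - z) ^ 2 + Q (y - z) ^ 2 →
      |x * (L (F y - F z) - L (A (y - z)))| ≤ κ * (P (y - z) ^ 2 + Q (y - z) ^ 2) := by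
    intro y hy z hz L x hL hx
    obtain ⟨n, hn⟩ : ∃ n, n = P (y - z) ^ 2 + Q (y - z) ^ 2 := ⟨_, rfl⟩
    have hn0 : 0 ≤ n := by rw [hn]; positivity
    have hE0 : 0 ≤ ‖e‖ + ‖f‖ := by positivity
    have hN0 : 0 ≤ ‖P‖ + ‖Q‖ := by positivity
    have hF' := hF y hy z hz
    rw [← hn] at hx ⊢
    have hd : ‖y - z‖ ≤ (‖e‖ + ‖f‖) * √n := norm_le_of_decomp (hc.decomp _)
      (abs_le_sqrt (by rw [hn]; nlinarith only [sq_nonneg (Q (y - z))]))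
      (abs_le_sqrt (by rw [hn]; nlinarith only [sq_nonneg (P (y - z))]))
    have hx' : |x| ≤ √n := abs_le_sqrt hx
    generalize ‖P‖ + ‖Q‖ = p at *
    generalize ‖e‖ + ‖f‖ = q at *
    have hpq : 0 ≤ p * q := mul_nonneg hN0 hE0
    have hR : |L (F y - F z) - L (A (y - z))| ≤ p * (κ / (2 * (p * q) + 1) * (q * √n)) := by
      rw [← map_sub, ← norm_eq_abs]
      refine (L.le_opNorm _).trans (mul_le_mul hL (hF'.trans ?_) (norm_nonneg _) hN0)
      exact mul_le_mul_of_nonneg_left hd (by positivity)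
    rw [abs_mul]
    calc _ ≤ √n * (p * (κ / (2 * (p * q) + 1) * (q * √n))) :=
          mul_le_mul hx' hR (abs_nonneg _) (sqrt_nonneg _)
      _ = ((p * q) / (2 * (p * q) + 1)) * (κ * (√n * √n)) := by ring
      _ ≤ 1 * (κ * n) := by
        rw [Real.mul_self_sqrt hn0]
        refine mul_le_mul_of_nonneg_right ?_ (by positivity)
        rw [div_le_one (by positivity)]; linarith
      _ = κ * n := one_mul _
  refine ⟨fun y hy z hz => ?_, fun y hy z hz => ?_⟩
  · have h1 := herr y hy z hz P (P (y - z)) (by linarith [norm_nonneg Q])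
      (by nlinarith only [sq_nonneg (Q (y - z))])
    rw [hPA] at h1
    nlinarith only [le_of_abs_le h1, mul_nonneg (sub_nonneg.2 hk) (sq_nonneg (P (y - z)))]
  · have h1 := herr y hy z hz Q (Q (y - z)) (by linarith [norm_nonneg P])
      (by nlinarith only [sq_nonneg (P (y - z))])
    rw [hQA] at h1
    nlinarith only [neg_le_of_abs_le h1, mul_nonneg (sub_nonneg.2 hk') (sq_nonneg (Q (y - z)))]

theorem exists_saddleField {F : ℝ → ℝ² → ℝ²} {S : ℝ²} {α β γ δ l₁ l₂ : ℝ}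
    (hdet : α * δ - β * γ < 0)
    (hl : ∀ k > 0, ¬(l₁ * α + l₂ * γ = k * l₁ ∧ l₁ * β + l₂ * δ = k * l₂))
    (hF : ∀ ε > 0, ∃ ρ > 0, ∀ a, |a| < ρ → ∀ y ∈ ball S ρ, ∀ z ∈ ball S ρ,
      ‖F a y - F a z - planarCLM α β γ δ (y - z)‖ ≤ ε * ‖y - z‖) :
    ∃ (P Q : ℝ² →L[ℝ] ℝ) (e f : ℝ²) (c κ ρ : ℝ), 0 < κ ∧ 0 < ρ ∧
      IsSaddleCoords P Q e f (fun d => l₁ * d.1 + l₂ * d.2) c ∧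
      ∀ a, |a| < ρ → IsSaddleField P Q κ (F a) (ball S ρ) := by
  obtain ⟨k, k', p₁, p₂, q₁, q₂, c, c', hk, hk', hc, hΔ, hp1, hp2, hq1, hq2, e1, e2⟩ :=
    exists_saddle_coords hdet hl
  set s := 2 * |c'| / c + 1 with hs
  have hs0 : 0 < s := by positivity
  have hsc : 2 * |c'| ≤ c * s := by rw [hs, mul_add, mul_div_cancel₀ _ hc.ne']; linarith
  set P : ℝ² →L[ℝ] ℝ := p₁ • ContinuousLinearMap.fst ℝ ℝ ℝ + p₂ • ContinuousLinearMap.snd ℝ ℝ ℝ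
  set Q : ℝ² →L[ℝ] ℝ := s • (q₁ • ContinuousLinearMap.fst ℝ ℝ ℝ +
    q₂ • ContinuousLinearMap.snd ℝ ℝ ℝ)
  have hP : ∀ d, P d = p₁ * d.1 + p₂ * d.2 := fun d => rfl
  have hQ : ∀ d, Q d = s * (q₁ * d.1 + q₂ * d.2) := fun d => rfl
  set Δ := p₁ * q₂ - p₂ * q₁ with hΔd
  set e : ℝ² := (q₂ / Δ, -q₁ / Δ) with he
  set f : ℝ² := (-p₂ / (s * Δ), p₁ / (s * Δ)) with hf
  have hcoord : IsSaddleCoords P Q e f (fun d => l₁ * d.1 + l₂ * d.2) (c / 2) := by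
    refine ⟨?_, ?_, ?_, ?_, fun d => ?_, by positivity, fun d hd => ?_⟩
    · rw [hP, he]; simp only; field_simp; rw [hΔd]; ring
    · rw [hQ, he]; simp only; field_simp; ring
    · rw [hP, hf]; simp only; field_simp; ring
    · rw [hQ, hf]; simp only; field_simp; rw [hΔd]; ring
    · rw [hP, hQ, he, hf]
      ext
      · simp only [Prod.fst_add, Prod.smul_fst, smul_eq_mul]; field_simp; rw [hΔd]; ring
      · simp only [Prod.snd_add, Prod.smul_snd, smul_eq_mul]; field_simp; rw [hΔd]; ring
    · have h1 : l₁ * d.1 + l₂ * d.2 = c * P d + c' / s * Q d := by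
        rw [hP, hQ, e1, e2]; field_simp; ring
      simp only [h1]
      have h2 : |c' / s| ≤ c / 2 := by rw [abs_div, abs_of_pos hs0, div_le_iff₀ hs0]; linarith
      have h3 : |Q d * P d| ≤ P d ^ 2 := by
        rw [abs_mul, ← sq_abs (P d), sq]
        exact mul_le_mul_of_nonneg_right (sq_le_sq.1 hd) (abs_nonneg _)
      have h4 : |c' / s * (Q d * P d)| ≤ c / 2 * P d ^ 2 := by
        rw [abs_mul]; exact mul_le_mul h2 h3 (abs_nonneg _) (by positivity)
      nlinarith [neg_le_of_abs_le h4]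
  have hPA : ∀ d, P (planarCLM α β γ δ d) = k * P d := fun d => by
    rw [hP, hP, planarCLM_apply]; linear_combination d.1 * hp1 + d.2 * hp2
  have hQA : ∀ d, Q (planarCLM α β γ δ d) = k' * Q d := fun d => by
    rw [hQ, hQ, planarCLM_apply]; linear_combination s * d.1 * hq1 + s * d.2 * hq2
  set κ := min (-k) k' / 3 with hκ
  have hmin : 0 < min (-k) k' := lt_min (by linarith) hk'
  have hκ0 : 0 < κ := by positivity
  have hκk : 3 * κ ≤ -k := by rw [hκ]; linarith [min_le_left (-k) k']
  have hκk' : 3 * κ ≤ k' := by rw [hκ]; linarith [min_le_right (-k) k']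
  obtain ⟨ρ, hρ, hρF⟩ := hF (κ / (2 * ((‖P‖ + ‖Q‖) * (‖e‖ + ‖f‖)) + 1)) (by positivity)
  exact ⟨P, Q, e, f, c / 2, κ, ρ, hκ0, hρ, hcoord, fun a ha =>
    hcoord.isSaddleField hPA hQA hκ0 hκk hκk' (hρF a ha)⟩

namespace MHD

variable {m : MHD}

/-- Linearization at a rest point, uniformly for small `a`. -/
theorem fld_linearization {v w : ℝ} (hv : 0 < v) (h1 : m.fieldV 0 v w = 0) (h2 : m.fieldW v w = 0)
    {ε : ℝ} (hε : 0 < ε) : ∃ ρ > 0, ∀ a, |a| < ρ → ∀ y ∈ ball (v, w) ρ,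
      ∀ z ∈ ball (v, w) ρ, ‖m.fld a y - m.fld a z -
        planarCLM ((v - m.magField v w ^ 2 / m.μ₀) / m.τ) (m.I * m.magField v w / (m.μ₀ * m.τ))
          (m.I * m.magField v w / (m.μ₀ * m.μ)) ((v - m.K) / m.μ) (y - z)‖ ≤ ε * ‖y - z‖ := by
  have hτ := m.tau_pos.ne'
  have hμ := m.μ_pos.ne'
  have hμ₀ := m.μ₀_pos.ne'
  have hv' := hv.ne'
  have hB : m.magField v w * v = m.Bm + m.I * w := by rw [magField]; field_simp
  set B := m.magField v w with hBd
  have hst := (m.contDiffAt_fld (p := (0, (v, w))) hv).hasStrictFDerivAt one_ne_zero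
  set L := fderiv ℝ (fun p : ℝ × ℝ² => m.fld p.1 p.2) (0, (v, w)) with hL
  have hfV : ∀ t s, m.fieldV 0 t s =
      (t * (t - 1) + ((m.Bm + m.I * s) ^ 2 - t ^ 2 * m.Bm ^ 2) / (2 * m.μ₀ * t)) / m.τ :=
    fun t s => by simp [fieldV, pressure]
  have hr1 : v - 1 + B ^ 2 / (2 * m.μ₀) - m.Bm ^ 2 / (2 * m.μ₀) = 0 := by
    rw [hfV, ← hB, div_eq_zero_iff, or_iff_left hτ] at h1
    have : v * (v - 1 + B ^ 2 / (2 * m.μ₀) - m.Bm ^ 2 / (2 * m.μ₀)) = 0 := by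
      rw [← h1]; field_simp; ring
    exact (mul_eq_zero.1 this).resolve_left hv'
  have hr2 : w + m.I * m.Bm / m.μ₀ = m.I * B / m.μ₀ := by
    rw [fieldW, div_eq_zero_iff, or_iff_left hμ] at h2
    have : v * (w + m.I * m.Bm / m.μ₀ - m.I * B / m.μ₀) = 0 := by
      rw [← h2]; field_simp; linear_combination (-m.I) * hB
    linarith [(mul_eq_zero.1 this).resolve_left hv']
  have hLv : L (0, (1, 0)) = ((v - B ^ 2 / m.μ₀) / m.τ, m.I * B / (m.μ₀ * m.μ)) := by
    have c1 : HasDerivAt (fun t : ℝ => ((0 : ℝ), (t, w))) (0, (1, 0)) v :=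
      (hasDerivAt_const v 0).prodMk ((hasDerivAt_id v).prodMk (hasDerivAt_const v w))
    have c2 := hst.hasFDerivAt.comp_hasDerivAt v c1
    refine c2.unique (HasDerivAt.prodMk ?_ ?_)
    · change HasDerivAt (fun t => m.fieldV 0 t w) _ v
      simp only [hfV]
      have d1 := ((hasDerivAt_id v).mul ((hasDerivAt_id v).sub_const 1)).add
        ((((hasDerivAt_pow 2 v).mul_const (m.Bm ^ 2)).const_sub ((m.Bm + m.I * w) ^ 2)).div
          ((hasDerivAt_id v).const_mul (2 * m.μ₀)) (by simp [hμ₀, hv']))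
      refine (d1.div_const m.τ).congr_deriv ?_
      simp only [id, ← hB]
      have hX : m.Bm ^ 2 = 2 * m.μ₀ * (v - 1) + B ^ 2 := by
        field_simp at hr1; linear_combination -hr1
      rw [hX]
      field_simp
      ring
    · change HasDerivAt (fun t => m.fieldW t w) _ v
      unfold fieldW
      have d1 := ((hasDerivAt_id v).mul_const w).sub
        (((((hasDerivAt_id v).const_sub 1).const_mul m.Bm).add_const (m.I * w)).const_mul (m.I / m.μ₀))
      refine (d1.div_const m.μ).congr_deriv ?_
      field_simp
      field_simp at hr2
      linear_combination hr2
  have hLw : L (0, (0, 1)) = (m.I * B / (m.μ₀ * m.τ), (v - m.K) / m.μ) := by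
    have c1 : HasDerivAt (fun t : ℝ => ((0 : ℝ), (v, t))) (0, (0, 1)) w :=
      (hasDerivAt_const w 0).prodMk ((hasDerivAt_const w v).prodMk (hasDerivAt_id w))
    have c2 := hst.hasFDerivAt.comp_hasDerivAt w c1
    refine c2.unique (HasDerivAt.prodMk ?_ ?_)
    · change HasDerivAt (fun t => m.fieldV 0 v t) _ w
      simp only [hfV]
      have d1 := ((((((hasDerivAt_id w).const_mul m.I).const_add m.Bm).pow 2).sub_const
        (v ^ 2 * m.Bm ^ 2)).div_const (2 * m.μ₀ * v)).const_add (v * (v - 1))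
      refine (d1.div_const m.τ).congr_deriv ?_
      simp only [id, ← hB]
      field_simp
      ring
    · change HasDerivAt (fun t => m.fieldW v t) _ w
      unfold fieldW
      have d1 := ((hasDerivAt_id w).const_mul v).sub
        ((((hasDerivAt_id w).const_mul m.I).const_add (m.Bm * (1 - v))).const_mul (m.I / m.μ₀))
      refine (d1.div_const m.μ).congr_deriv ?_
      rw [K]
      field_simp
  have hLd : ∀ d : ℝ², L (0, d) = planarCLM ((v - B ^ 2 / m.μ₀) / m.τ)
      (m.I * B / (m.μ₀ * m.τ)) (m.I * B / (m.μ₀ * m.μ)) ((v - m.K) / m.μ) d := fun d => by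
    have e : ((0 : ℝ), d) = d.1 • ((0 : ℝ), ((1 : ℝ), (0 : ℝ))) + d.2 • ((0 : ℝ), ((0 : ℝ), (1 : ℝ))) := by
      ext <;> simp
    rw [e, map_add, map_smul, map_smul, hLv, hLw, planarCLM_apply]
    ext <;> simp <;> ring
  have hev := hst.isLittleO.def hε
  obtain ⟨ρ, hρ, hρU⟩ := Metric.eventually_nhds_iff.1 hev
  have hmem : ∀ a, |a| < ρ → ∀ y ∈ ball (v, w) ρ, dist (a, y) ((0 : ℝ), (v, w)) < ρ :=
    fun a ha y hy => by rw [Prod.dist_eq]; exact max_lt (by simpa using ha) hy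
  refine ⟨ρ, hρ, fun a ha y hy z hz => ?_⟩
  have := hρU (y := ((a, y), (a, z))) (by
    rw [Prod.dist_eq]; exact max_lt (hmem a ha y hy) (hmem a ha z hz))
  simp only [Prod.mk_sub_mk, sub_self, hLd] at this
  refine this.trans_eq ?_
  rw [Prod.norm_mk, norm_zero, max_eq_right (norm_nonneg _)]

theorem IsEndState.exists_saddleField (hJ : 0 < m.J) (hK : m.K < 1) {v₀ : ℝ}
    (h : m.IsEndState 0 v₀) {l : ℝ² → ℝ} (hl : l = if m.K < v₀ then fun d => 1 * d.1 + 0 * d.2 else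
      fun d => 0 * d.1 + m.I * m.Bm * d.2) :
    ∃ (P Q : ℝ² →L[ℝ] ℝ) (e f : ℝ²) (c κ ρ : ℝ), 0 < κ ∧ 0 < ρ ∧ IsSaddleCoords P Q e f l c ∧
      ∀ a, |a| < ρ → IsSaddleField P Q κ (m.fld a) (ball (v₀, m.wRest v₀) ρ) := by
  obtain ⟨h1, h2⟩ := (rest_iff h.pos h.ne).2 ⟨rfl, h.zero⟩
  have hτ := m.tau_pos
  have hμ := m.μ_pos
  have hμ₀ := m.μ₀_pos
  have hlin := fun ε (hε : 0 < ε) => fld_linearization h.pos h1 h2 hε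
  have hd := det_wRest (a := 0) h.pos h.ne
  rw [s11, s12, zero_mul, zero_mul, zero_add] at hd
  set B := m.magField v₀ (m.wRest v₀) with hB
  have hdet : (v₀ - B ^ 2 / m.μ₀) / m.τ * ((v₀ - m.K) / m.μ) -
      m.I * B / (m.μ₀ * m.τ) * (m.I * B / (m.μ₀ * m.μ)) < 0 := by
    have e : (v₀ - B ^ 2 / m.μ₀) / m.τ * ((v₀ - m.K) / m.μ) -
      m.I * B / (m.μ₀ * m.τ) * (m.I * B / (m.μ₀ * m.μ)) =
      ((v₀ - B ^ 2 / m.μ₀) * (v₀ - m.K) - (-(m.I * B / m.μ₀)) ^ 2) / (m.τ * m.μ) := by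
      field_simp
    rw [e, hd]
    exact div_neg_of_neg_of_pos (mul_neg_of_pos_of_neg h.pos h.neg) (by positivity)
  by_cases hv : m.K < v₀
  · rw [if_pos hv] at hl
    rw [hl]
    refine _root_.exists_saddleField hdet (fun k hk hcon => ?_) hlin
    have e1 : m.I * B / (m.μ₀ * m.τ) = 0 := by linarith [hcon.2]
    rw [e1] at hdet
    have e2 : (v₀ - B ^ 2 / m.μ₀) / m.τ = k := by linarith [hcon.1]
    rw [e2] at hdet
    have := mul_pos hk (div_pos (sub_pos.2 hv) hμ)
    linarith
  · rw [if_neg hv] at hl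
    rw [hl]
    have hv2 : v₀ < m.K := lt_of_le_of_ne (not_lt.1 hv) h.ne
    have hI : m.I ≠ 0 := fun h0 => by rw [K, h0] at hv2; simp at hv2; linarith [h.pos]
    have hBm : m.Bm ≠ 0 := fun h0 => by rw [J, h0] at hJ; simp at hJ
    refine _root_.exists_saddleField hdet (fun k hk hcon => ?_) hlin
    have e1 : m.I * m.Bm * (m.I * B / (m.μ₀ * m.μ)) = 0 := by linarith [hcon.1]
    have hB0 : B ≠ 0 := by
      rw [hB, magField_wRest h.pos h.ne]
      exact div_ne_zero (mul_ne_zero hBm (by linarith)) (sub_ne_zero.2 h.ne)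
    simp [hI, hBm, hB0, hμ.ne', hμ₀.ne'] at e1

/-- The energy controlling the repelling end state `(1, 0)`. -/
def repEnergy (m : MHD) (y : ℝ²) : ℝ := m.τ * (y.1 - 1) ^ 2 + m.μ * y.2 ^ 2

theorem le_quadratic_form {A C b : ℝ} (hA : 0 < A) (hC : 0 < C) (hA1 : A ≤ 1) (hC1 : C ≤ 1)
    (h : b ^ 2 < A * C) (x y : ℝ) :
    (A * C - b ^ 2) / 2 * (x ^ 2 + y ^ 2) ≤ A * x ^ 2 + 2 * b * x * y + C * y ^ 2 := by
  obtain ⟨k, hk⟩ : ∃ k, k = (A * C - b ^ 2) / 2 := ⟨_, rfl⟩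
  have hk0 : 0 < k := by rw [hk]; linarith
  have hAC : A * C ≤ A := mul_le_of_le_one_right hA.le hC1
  have hAk : 0 < A - k := by rw [hk]; nlinarith only [sq_nonneg b, hAC, hA]
  have hdet : b ^ 2 ≤ (A - k) * (C - k) := by
    nlinarith only [hk, hk0, sq_nonneg k, mul_nonneg hk0.le (sub_nonneg.2 hA1),
      mul_nonneg hk0.le (sub_nonneg.2 hC1)]
  rw [← hk]
  have h0 : 0 ≤ (A - k) * ((A - k) * x ^ 2 + 2 * b * x * y + (C - k) * y ^ 2) := by
    nlinarith only [sq_nonneg ((A - k) * x + b * y), mul_nonneg (sub_nonneg.2 hdet) (sq_nonneg y)]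
  linarith only [nonneg_of_mul_nonneg_right h0 hAk]

theorem exists_repeller (h : 2 * m.J + m.K < 1) (hJ : 0 < m.J) : ∃ k > 0, ∃ ρ > 0, ∀ a, |a| < ρ → ∀ y,
    m.repEnergy y < ρ → k * m.repEnergy y ≤
      2 * (m.τ * (y.1 - 1) * (m.fld a y).1 + m.μ * y.2 * (m.fld a y).2) := by
  have hτ := m.tau_pos
  have hμ := m.μ_pos
  have hμ₀ := m.μ₀_pos
  have hK := m.K_nonneg
  set b := m.I * m.Bm / m.μ₀ with hb
  have hb2 : b ^ 2 = 2 * m.J * m.K := by rw [hb, J, K]; field_simp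
  have hg0 : b ^ 2 < (1 - 2 * m.J) * (1 - m.K) := by rw [hb2]; nlinarith only [h]
  have hform := le_quadratic_form (by linarith : 0 < 1 - 2 * m.J) (by linarith : 0 < 1 - m.K)
    (by linarith) (by linarith) hg0
  obtain ⟨k₀, hk₀⟩ : ∃ k, k = ((1 - 2 * m.J) * (1 - m.K) - b ^ 2) / 2 := ⟨_, rfl⟩
  have hk₀0 : 0 < k₀ := by rw [hk₀]; linarith
  rw [← hk₀] at hform
  have r1 : m.fieldV 0 1 0 = 0 := by simp [fieldV]
  have r2 : ∀ a, m.fld a (1, 0) = 0 := fun a => by simp [fld, fieldV, fieldW]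
  set ε := k₀ / (2 * (m.τ + m.μ)) with hε
  have hε0 : 0 < ε := by positivity
  obtain ⟨ρ, hρ, hρF⟩ := fld_linearization one_pos r1 (congrArg Prod.snd (r2 0)) hε0
  have hB : m.magField 1 0 = m.Bm := by simp [magField]
  rw [hB] at hρF
  refine ⟨k₀ / (m.τ + m.μ), by positivity, min ρ (min (m.τ * ρ ^ 2) (m.μ * ρ ^ 2)), by positivity,
    fun a ha y hy => ?_⟩
  set x₁ := y.1 - 1 with hx₁
  have hyρ : y ∈ ball ((1 : ℝ), (0 : ℝ)) ρ := by
    have h1 : m.τ * x₁ ^ 2 < m.τ * ρ ^ 2 :=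
      lt_of_le_of_lt (by rw [repEnergy]; nlinarith [mul_nonneg hμ.le (sq_nonneg y.2)])
        (hy.trans_le ((min_le_right _ _).trans (min_le_left _ _)))
    have h2 : m.μ * y.2 ^ 2 < m.μ * ρ ^ 2 :=
      lt_of_le_of_lt (by rw [repEnergy]; nlinarith [mul_nonneg hτ.le (sq_nonneg (y.1 - 1))])
        (hy.trans_le ((min_le_right _ _).trans (min_le_right _ _)))
    rw [mem_ball, Prod.dist_eq, Real.dist_eq, Real.dist_eq, sub_zero]
    exact max_lt (abs_lt_of_sq_lt_sq (lt_of_mul_lt_mul_left h1 hτ.le) hρ.le)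
      (abs_lt_of_sq_lt_sq (lt_of_mul_lt_mul_left h2 hμ.le) hρ.le)
  have h1 := hρF a (ha.trans_le (min_le_left _ _)) y hyρ (1, 0) (Metric.mem_ball_self hρ)
  rw [r2, sub_zero, planarCLM_apply] at h1
  have hsub : y - (1, 0) = (x₁, y.2) := by ext <;> simp [hx₁]
  rw [hsub] at h1
  set d := ‖((x₁, y.2) : ℝ²)‖ with hd
  have hd1 : |x₁| ≤ d := norm_fst_le (x₁, y.2)
  have hd2 : |y.2| ≤ d := norm_snd_le (x₁, y.2)
  have hdd : d ^ 2 ≤ x₁ ^ 2 + y.2 ^ 2 := by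
    rcases max_choice ‖x₁‖ ‖y.2‖ with h | h
    · rw [hd, Prod.norm_mk, h, norm_eq_abs, sq_abs]; nlinarith [sq_nonneg y.2]
    · rw [hd, Prod.norm_mk, h, norm_eq_abs, sq_abs]; nlinarith [sq_nonneg x₁]
  obtain ⟨R, hR⟩ : ∃ R : ℝ², R = m.fld a y - ((1 - m.Bm ^ 2 / m.μ₀) / m.τ * x₁ +
    m.I * m.Bm / (m.μ₀ * m.τ) * y.2, m.I * m.Bm / (m.μ₀ * m.μ) * x₁ + (1 - m.K) / m.μ * y.2) := ⟨_, rfl⟩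
  simp only at h1
  rw [← hR] at h1
  have hR1 : |R.1| ≤ ε * d := (norm_fst_le R).trans h1
  have hR2 : |R.2| ≤ ε * d := (norm_snd_le R).trans h1
  have e1 : (m.fld a y).1 = R.1 + ((1 - m.Bm ^ 2 / m.μ₀) / m.τ * x₁ +
    m.I * m.Bm / (m.μ₀ * m.τ) * y.2) := by rw [hR]; simp
  have e2 : (m.fld a y).2 = R.2 + (m.I * m.Bm / (m.μ₀ * m.μ) * x₁ + (1 - m.K) / m.μ * y.2) := by
    rw [hR]; simp
  have e3 : m.τ * x₁ * (m.fld a y).1 + m.μ * y.2 * (m.fld a y).2 =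
      ((1 - 2 * m.J) * x₁ ^ 2 + 2 * b * x₁ * y.2 + (1 - m.K) * y.2 ^ 2) +
        (m.τ * (x₁ * R.1) + m.μ * (y.2 * R.2)) := by
    rw [e1, e2, hb, J]; field_simp; ring
  have h3 : |x₁ * R.1| ≤ ε * d ^ 2 := by
    rw [abs_mul]; calc _ ≤ d * (ε * d) := mul_le_mul hd1 hR1 (abs_nonneg _) (norm_nonneg _)
      _ = _ := by ring
  have h4 : |y.2 * R.2| ≤ ε * d ^ 2 := by
    rw [abs_mul]; calc _ ≤ d * (ε * d) := mul_le_mul hd2 hR2 (abs_nonneg _) (norm_nonneg _)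
      _ = _ := by ring
  have h5 : (m.τ + m.μ) * (ε * d ^ 2) ≤ k₀ / 2 * (x₁ ^ 2 + y.2 ^ 2) := by
    have : (m.τ + m.μ) * (ε * d ^ 2) = k₀ / 2 * d ^ 2 := by rw [hε]; field_simp
    rw [this]; exact mul_le_mul_of_nonneg_left hdd (by positivity)
  have h6 : k₀ / (m.τ + m.μ) * m.repEnergy y ≤ k₀ * (x₁ ^ 2 + y.2 ^ 2) := by
    rw [div_mul_eq_mul_div, div_le_iff₀ (by positivity), repEnergy, ← hx₁]
    nlinarith only [mul_nonneg (mul_nonneg hk₀0.le hμ.le) (sq_nonneg x₁),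
      mul_nonneg (mul_nonneg hk₀0.le hτ.le) (sq_nonneg y.2)]
  rw [e3]
  linarith only [hform x₁ y.2, mul_le_mul_of_nonneg_left (neg_le_of_abs_le h3) hτ.le,
    mul_le_mul_of_nonneg_left (neg_le_of_abs_le h4) hμ.le, h5, h6]

end MHD

/-! ### Truncated profile equations -/

namespace MHD

variable (m : MHD) {δ M : ℝ}

def clamp (δ M : ℝ) (y : ℝ²) : ℝ² := (max δ (min M y.1), max (-M) (min M y.2))

/-- The field of the profile equations, made globally Lipschitz outside a box. -/
def cfld (δ M a : ℝ) (y : ℝ²) : ℝ² := m.fld a (clamp δ M y)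

theorem clamp_eq {y : ℝ²} (hy : y ∈ box δ M) : clamp δ M y = y := by
  have a1 := abs_le.1 ((norm_fst_le y).trans hy.2)
  have a2 := abs_le.1 ((norm_snd_le y).trans hy.2)
  rw [clamp, min_eq_right a1.2, min_eq_right a2.2, max_eq_right hy.1, max_eq_right a2.1]

theorem clamp_mem (hδ : 0 < δ) (h : δ ≤ M) (y : ℝ²) : clamp δ M y ∈ box δ M := by
  refine ⟨le_max_left _ _, ?_⟩
  rw [Prod.norm_def]
  refine max_le (abs_le.2 ⟨?_, max_le h (min_le_left _ _)⟩)
    (abs_le.2 ⟨le_max_left _ _, max_le (by linarith) (min_le_left _ _)⟩)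
  exact (by linarith : -M ≤ δ).trans (le_max_left _ _)

theorem lipschitz_clamp : LipschitzWith 1 (clamp δ M) := by
  have h := (((LipschitzWith.prod_fst (α := ℝ) (β := ℝ)).const_min M).const_max δ).prodMk
    (((LipschitzWith.prod_snd (α := ℝ) (β := ℝ)).const_min M).const_max (-M))
  rw [max_self] at h
  exact h

theorem box_mono {δ' M' : ℝ} (h : δ' ≤ δ) (h' : M ≤ M') : box δ M ⊆ box δ' M' :=
  fun _ hy => ⟨h.trans hy.1, hy.2.trans h'⟩

theorem exists_lipschitz_fld (hδ : 0 < δ) : ∃ K : NNReal, ∀ a ∈ Icc (-1 : ℝ) 1, ∀ a' ∈ Icc (-1 : ℝ) 1,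
    ∀ y ∈ box δ M, ∀ y' ∈ box δ M, dist (m.fld a y) (m.fld a' y') ≤ K * max |a - a'| (dist y y') := by
  set G : ℝ × ℝ² → ℝ² := fun p => m.fld p.1 p.2 with hG
  set D := Icc (-1 : ℝ) 1 ×ˢ box δ M with hD
  have hDc : IsCompact D := isCompact_Icc.prod isCompact_box
  have hconv : Convex ℝ D := (convex_Icc _ _).prod convex_box
  have hd : ∀ p ∈ D, ContDiffAt ℝ 1 G p := fun p hp => m.contDiffAt_fld (hδ.trans_le hp.2.1)
  obtain ⟨C, hC⟩ := hDc.exists_bound_of_continuousOn (f := fderiv ℝ G) fun p hp =>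
    ((hd p hp).fderiv_right (m := 0) (by simp)).continuousAt.continuousWithinAt
  refine ⟨C.toNNReal, fun a ha a' ha' y hy y' hy' => ?_⟩
  rw [dist_eq_norm]
  refine (hconv.norm_image_sub_le_of_norm_fderiv_le (f := G)
    (fun p hp => (hd p hp).differentiableAt one_ne_zero) hC (x := (a', y')) ⟨ha', hy'⟩
    (y := (a, y)) ⟨ha, hy⟩).trans ?_
  rw [Prod.mk_sub_mk, Prod.norm_mk, dist_eq_norm, norm_eq_abs]
  exact mul_le_mul_of_nonneg_right (Real.le_coe_toNNReal C) (le_max_of_le_left (abs_nonneg _))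

theorem exists_lipschitz_cfld (hδ : 0 < δ) (h : δ ≤ M) : ∃ K : NNReal,
    (∀ a ∈ Icc (-1 : ℝ) 1, LipschitzWith K (m.cfld δ M a)) ∧
    ∀ a ∈ Icc (-1 : ℝ) 1, ∀ y ∈ box δ M, dist (m.fld 0 y) (m.fld a y) ≤ K * |a| := by
  obtain ⟨K, hK⟩ := m.exists_lipschitz_fld (M := M) hδ
  refine ⟨K, fun a ha => LipschitzWith.of_dist_le_mul fun y z => ?_, fun a ha y hy => ?_⟩
  · refine (hK a ha a ha _ (clamp_mem hδ h y) _ (clamp_mem hδ h z)).trans ?_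
    rw [sub_self, abs_zero, max_eq_right dist_nonneg]
    have := (lipschitz_clamp (δ := δ) (M := M)).dist_le_mul y z
    rw [NNReal.coe_one, one_mul] at this
    gcongr
  · refine (hK 0 (by simp) a ha y hy y hy).trans ?_
    rw [dist_self, zero_sub, abs_neg, max_eq_left (abs_nonneg a)]

theorem cfld_eq {a : ℝ} {y : ℝ²} (hy : y ∈ box δ M) : m.cfld δ M a y = m.fld a y := by
  rw [cfld, clamp_eq hy]

theorem exists_cfld_solution (hδ : 0 < δ) (h : δ ≤ M) {a : ℝ} (ha : a ∈ Icc (-1 : ℝ) 1) (y₀ : ℝ²) :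
    ∃ y : ℝ → ℝ², y 0 = y₀ ∧ ∀ t, HasDerivAt y (m.cfld δ M a (y t)) t := by
  obtain ⟨K, hK, -⟩ := m.exists_lipschitz_cfld hδ h
  exact exists_global_solution (f := fun _ => m.cfld δ M a) ((hK a ha).continuous.comp continuous_snd)
    (fun _ => hK a ha) (fun _ => le_rfl) y₀

variable {m}

theorem exists_shadow_cfld (hδ : 0 < δ) (h : δ ≤ M) {z : ℝ → ℝ²}
    (hz : ∀ t, HasDerivAt z (m.fld 0 (z t)) t) (hzb : ∀ t, z t ∈ box δ M) (T : ℝ) {η : ℝ} (hη : 0 < η) :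
    ∃ d > 0, ∀ a, |a| < d → ∀ y : ℝ → ℝ², (∀ t, HasDerivAt y (m.cfld δ M a (y t)) t) →
      dist (y 0) (z 0) < d → ∀ t, |t| ≤ T → dist (y t) (z t) ≤ η := by
  obtain ⟨K, hK, hKa⟩ := m.exists_lipschitz_cfld hδ h
  set X := (1 + K) * exp ((K + 1) * T) with hX
  have hX0 : 0 < X := by positivity
  refine ⟨min 1 (η / X), by positivity, fun a ha y hy h0 t ht => ?_⟩
  obtain ⟨ha1, ha2⟩ := lt_min_iff.1 ha
  have hamem : a ∈ Icc (-1 : ℝ) 1 := abs_le.1 ha1.le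
  refine (dist_solution_le (F := fun _ => m.cfld δ M a) (G := fun t => m.fld 0 (z t))
    (e := K * (η / X)) (fun _ => hK a hamem) (fun t _ => ?_) (fun t _ => hy t) (fun t _ => hz t)
    (h0.le.trans (min_le_right _ _)) ht).trans_eq ?_
  · rw [m.cfld_eq (hzb t)]
    exact (hKa a hamem _ (hzb t)).trans (by gcongr)
  · rw [show η / X + K * (η / X) = η / X * (1 + K) by ring, mul_assoc, ← hX, div_mul_cancel₀ _ hX0.ne']

theorem mem_box_of_dist_le {y z : ℝ²} {η : ℝ} (hz : z ∈ box δ M) (h : dist y z ≤ η) :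
    y ∈ box (δ - η) (M + η) := by
  have h1 := abs_le.1 (((norm_fst_le (y - z)).trans_eq (dist_eq_norm y z).symm).trans h)
  refine ⟨?_, ?_⟩
  · have := hz.1; have := h1.1; simp only [Prod.fst_sub] at this; linarith
  · have := norm_le_norm_add_norm_sub z y
    rw [norm_sub_rev, ← dist_eq_norm] at this
    linarith [hz.2]

theorem fld_unique {a : ℝ} {I : Set ℝ} (hI : IsOpen I) (hI' : IsPreconnected I) {y z : ℝ → ℝ²}
    (hy : ∀ t ∈ I, HasDerivAt y (m.fld a (y t)) t) (hz : ∀ t ∈ I, HasDerivAt z (m.fld a (z t)) t)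
    (hpos : ∀ t ∈ I, 0 < (y t).1) {t₀ : ℝ} (ht₀ : t₀ ∈ I) (h : y t₀ = z t₀) : ∀ t ∈ I, y t = z t :=
  ode_unique_of_contDiff (U := {y : ℝ² | 0 < y.1})
    (fun p hp => (m.contDiffAt_fld (p := (a, p)) hp).comp p (contDiffAt_const.prodMk contDiffAt_id))
    hI hI' hy hz hpos ht₀ h

theorem exists_shadow (hδ : 0 < δ) (h : δ ≤ M) {z : ℝ → ℝ²}
    (hz : ∀ t, HasDerivAt z (m.fld 0 (z t)) t) (hzb : ∀ t, z t ∈ box δ M) (T : ℝ) {η : ℝ} (hη : 0 < η) :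
    ∃ d > 0, ∀ a, |a| < d → ∀ y : ℝ → ℝ², (∀ t, HasDerivAt y (m.fld a (y t)) t) →
      (∀ t, 0 < (y t).1) → dist (y 0) (z 0) < d → ∀ t, |t| ≤ T → dist (y t) (z t) ≤ η := by
  have hη' : 0 < min η (δ / 2) := by positivity
  have hsub : box δ M ⊆ box (δ / 2) (M + δ) := box_mono (by linarith) (by linarith)
  obtain ⟨d, hd, H⟩ := exists_shadow_cfld (m := m) (by linarith : 0 < δ / 2) (by linarith) hz
    (fun t => hsub (hzb t)) (|T| + 1) hη'
  refine ⟨min d 1, by positivity, fun a ha y hy hpos h0 t ht => ?_⟩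
  obtain ⟨ha1, ha2⟩ := lt_min_iff.1 ha
  obtain ⟨x, hx0, hx⟩ := m.exists_cfld_solution (by linarith : 0 < δ / 2) (by linarith : δ / 2 ≤ M + δ)
    (abs_le.1 ha2.le) (y 0)
  have hxz := H a ha1 x hx (by rw [hx0]; exact h0.trans_le (min_le_left _ _))
  have hxb : ∀ t, |t| ≤ |T| + 1 → x t ∈ box (δ / 2) (M + δ) := fun t ht =>
    box_mono (by linarith [min_le_right η (δ / 2)]) (by linarith [min_le_right η (δ / 2)])
      (mem_box_of_dist_le (hzb t) (hxz t ht))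
  have hT1 : ∀ t ∈ Ioo (-(|T| + 1)) (|T| + 1), |t| ≤ |T| + 1 := fun t ht => abs_le.2 ⟨ht.1.le, ht.2.le⟩
  have htT : |t| < |T| + 1 := by linarith [le_abs_self T]
  have e := fld_unique isOpen_Ioo isPreconnected_Ioo (y := y) (z := x) (fun t _ => hy t)
    (fun t ht => (hx t).congr_deriv (m.cfld_eq (hxb t (hT1 t ht)))) (fun t _ => hpos t)
    (t₀ := 0) ⟨by linarith [abs_nonneg T], by linarith [abs_nonneg T]⟩ hx0.symm t (abs_lt.1 htT)
  rw [e]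
  exact (hxz t htT.le).trans (min_le_left _ _)

theorem repEnergy_decay {k ρ : ℝ} {F : ℝ² → ℝ²} (hk : 0 ≤ k) (hF : ∀ y, m.repEnergy y < ρ →
      k * m.repEnergy y ≤ 2 * (m.τ * (y.1 - 1) * (F y).1 + m.μ * y.2 * (F y).2))
    {y : ℝ → ℝ²} (hy : ∀ t, HasDerivAt y (F (y t)) t) {T t : ℝ} (hT : m.repEnergy (y T) < ρ)
    (ht : t ≤ T) : m.repEnergy (y t) < ρ ∧ m.repEnergy (y t) ≤ m.repEnergy (y T) * exp (-k * (T - t)) := by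
  have hτ := m.tau_pos
  have hμ := m.μ_pos
  have hw : ∀ s, HasDerivAt (fun s => m.repEnergy (y (T - s))) (-(2 * (m.τ * ((y (T - s)).1 - 1) *
      (F (y (T - s))).1 + m.μ * (y (T - s)).2 * (F (y (T - s))).2))) s := fun s => by
    have h0 := (hy (T - s)).scomp s ((hasDerivAt_id s).const_sub T)
    obtain ⟨h1, h2⟩ := hasDerivAt_fst_snd h0
    refine (((h1.sub_const 1).pow 2 |>.const_mul m.τ).add ((h2.pow 2).const_mul m.μ)).congr_deriv ?_
    simp; ring
  have := exp_decay_of_trapped hk hw (fun s => by rw [repEnergy]; positivity)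
    (fun s _ hs => by linarith [hF _ hs]) (by simpa using hT) (T - t) (by linarith)
  simpa using this

end MHD

/-! ### Entry of a solution into a neighbourhood of a saddle -/

/-- From the time `x` on, the solution `y` stays in `U` and in the cone at `S`, where it starts at
height `p`. -/
structure IsEntry (P Q : ℝ² →L[ℝ] ℝ) (U : Set ℝ²) (S : ℝ²) (p : ℝ) (y : ℝ → ℝ²) (x : ℝ) : Prop where
  mem : ∀ t, x ≤ t → y t ∈ U
  P_eq : P (y x - S) = p
  cone : ∀ t, x ≤ t → Q (y t - S) ^ 2 ≤ P (y t - S) ^ 2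

namespace IsSaddleField

theorem exists_entry (h : IsSaddleField P Q κ F U) (hκ : 0 < κ) (hU : IsOpen U) {M : ℝ}
    (hM : ∀ y ∈ U, ∀ z ∈ U, Q (y - z) ^ 2 - P (y - z) ^ 2 ≤ M) {S : ℝ²} (hS : S ∈ U) (hFS : F S = 0)
    {y : ℝ → ℝ²} (hy : ∀ t, HasDerivAt y (F (y t)) t) (hlim : Tendsto y atTop (𝓝 S)) {p : ℝ}
    (hp : 0 < p) (hUS : ∀ y, P (y - S) ^ 2 + Q (y - S) ^ 2 ≤ 5 * p ^ 2 → y ∈ U) {t₁ : ℝ}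
    (ht₁ : y t₁ ∉ U) (hside : ∀ T, ∃ t, T ≤ t ∧ (Q (y t - S) ^ 2 ≤ P (y t - S) ^ 2 → 0 < P (y t - S))) :
    ∃ x, IsEntry P Q U S p y x := by
  have hyc : Continuous y := continuous_of_hasDerivAt hy
  have hPc : Continuous fun t => P (y t - S) := by fun_prop
  obtain ⟨T, hT⟩ := eventually_atTop.1 (hlim.eventually (hU.mem_nhds hS))
  have hcone : ∀ x, (∀ t, x ≤ t → y t ∈ U) → ∀ t, x ≤ t → Q (y t - S) ^ 2 ≤ P (y t - S) ^ 2 :=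
    fun x hx t ht => h.cone hκ hS hFS (fun t _ => hy t) hx (fun t ht => hM _ (hx t ht) _ hS) ht
  set E : Set ℝ := {t | y t ∉ U} with hE
  have hEb : BddAbove E := ⟨T, fun t ht => le_of_not_gt fun h => ht (hT t h.le)⟩
  have hEc : IsClosed E := (hU.preimage hyc).isClosed_compl
  have hsE : sSup E ∈ E := hEc.csSup_mem ⟨t₁, ht₁⟩ hEb
  obtain ⟨s, hs⟩ : ∃ s, s = sSup E := ⟨_, rfl⟩
  have hafter : ∀ t, s < t → y t ∈ U := fun t ht => by
    by_contra hcon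
    exact absurd (le_csSup hEb hcon) (not_le.2 (hs ▸ ht))
  have hsQ : Q (y s - S) ^ 2 ≤ P (y s - S) ^ 2 := by
    have hc : ContinuousWithinAt (fun t => P (y t - S) ^ 2 - Q (y t - S) ^ 2) (Ioi s) s := by fun_prop
    refine sub_nonneg.1 (ge_of_tendsto hc (eventually_mem_nhdsWithin.mono fun t ht => ?_))
    exact sub_nonneg.2 (hcone t (fun t' ht' => hafter t' (lt_of_lt_of_le ht ht')) t le_rfl)
  have hsP : p < |P (y s - S)| := by
    by_contra hcon
    have h1 : P (y s - S) ^ 2 ≤ p ^ 2 := sq_le_sq.2 ((not_lt.1 hcon).trans (le_abs_self p))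
    rw [← hs] at hsE
    exact hsE (hUS _ (by nlinarith [sq_nonneg p]))
  have hev : ∀ᶠ t in atTop, |P (y t - S)| < p := by
    have : Tendsto (fun t => |P (y t - S)|) atTop (𝓝 |P (S - S)|) :=
      ((P.continuous.tendsto _).comp (hlim.sub_const S)).abs
    rw [sub_self, map_zero, abs_zero] at this
    exact this.eventually_lt_const hp
  obtain ⟨t₂, ht₂, hst⟩ := (hev.and (eventually_gt_atTop s)).exists
  obtain ⟨x, hx, hxp⟩ := intermediate_value_Icc' hst.le hPc.abs.continuousOn ⟨ht₂.le, hsP.le⟩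
  simp only at hxp
  have hsx : s < x := lt_of_le_of_ne hx.1 fun h => by rw [← h] at hxp; exact hsP.ne' hxp
  have hmem : ∀ t, x ≤ t → y t ∈ U := fun t ht => hafter t (hsx.trans_le ht)
  refine ⟨x, hmem, ?_, hcone x hmem⟩
  rcases abs_eq hp.le |>.1 hxp with h1 | h1
  · exact h1
  · exfalso
    obtain ⟨t, hxt, hPt⟩ := hside x
    have hPt := hPt (hcone x hmem t hxt)
    obtain ⟨r, hr, hr0⟩ := intermediate_value_Icc hxt hPc.continuousOn
      ⟨h1.le.trans (neg_nonpos.2 hp.le), hPt.le⟩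
    simp only at hr0
    have := h.decay hκ hS hFS (fun t _ => hy t) (fun t ht => hmem t (hr.1.trans ht))
      (fun t ht => hcone x hmem t (hr.1.trans ht)) hr.2
    rw [hr0] at this
    nlinarith [sq_pos_of_pos hPt]

theorem dist_le_of_P (h : IsSaddleField P Q κ F U) (hκ : 0 < κ) {M : ℝ}
    (hM : ∀ y ∈ U, ∀ z ∈ U, Q (y - z) ^ 2 - P (y - z) ^ 2 ≤ M) {e f : ℝ²}
    (hdec : ∀ d, d = P d • e + Q d • f) {G : ℝ² → ℝ²} {ε : ℝ}
    (hFG : ∀ z ∈ U, dist (F z) (G z) ≤ ε) {y z : ℝ → ℝ²} {x : ℝ}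
    (hy : ∀ t, x ≤ t → HasDerivAt y (F (y t)) t) (hz : ∀ t, x ≤ t → HasDerivAt z (G (z t)) t)
    (hyU : ∀ t, x ≤ t → y t ∈ U) (hzU : ∀ t, x ≤ t → z t ∈ U) :
    dist (y x) (z x) ≤ (‖e‖ + ‖f‖) * (|P (y x - z x)| + (‖P‖ + ‖Q‖) / κ * ε) := by
  have hε : 0 ≤ ε := dist_nonneg.trans (hFG _ (hyU x le_rfl))
  have hL : ∀ L : ℝ² →L[ℝ] ℝ, ∀ w ∈ U, L (F w - G w) ^ 2 ≤ (‖L‖ * ε) ^ 2 := fun L w hw => by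
    rw [← sq_abs, ← norm_eq_abs]
    refine pow_le_pow_left₀ (norm_nonneg _) ((L.le_opNorm _).trans ?_) 2
    rw [← dist_eq_norm]
    exact mul_le_mul_of_nonneg_left (hFG w hw) (norm_nonneg _)
  have hP0 := norm_nonneg P
  have hQ0 := norm_nonneg Q
  have h1 := h.compare hκ (ω := ((‖P‖ + ‖Q‖) / κ * ε) ^ 2) hy hz hyU hzU
    (fun t ht => hM _ (hyU t ht) _ (hzU t ht)) (fun t ht => ?_) (le_refl x)
  · have h2 : |Q (y x - z x)| ≤ |P (y x - z x)| + (‖P‖ + ‖Q‖) / κ * ε := by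
      refine abs_le_of_sq_le_sq ?_ (by positivity)
      have : 0 ≤ (‖P‖ + ‖Q‖) / κ * ε := by positivity
      nlinarith [sq_abs (P (y x - z x)), mul_nonneg (abs_nonneg (P (y x - z x))) this]
    have h3 : |P (y x - z x)| ≤ |P (y x - z x)| + (‖P‖ + ‖Q‖) / κ * ε :=
      le_add_of_nonneg_right (by positivity)
    rw [dist_eq_norm]
    exact norm_le_of_decomp (hdec _) h3 h2
  · have e1 : κ ^ 2 * ((‖P‖ + ‖Q‖) / κ * ε) ^ 2 = ((‖P‖ + ‖Q‖) * ε) ^ 2 := by field_simp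
    rw [e1]
    nlinarith [hL P _ (hzU t ht), hL Q _ (hzU t ht), mul_nonneg (mul_nonneg hP0 hQ0) (sq_nonneg ε)]

end IsSaddleField

/-! ### A strict Lyapunov function, and the side from which a profile approaches its end state -/

namespace MHD

/-- The profile equations are `τ v' = v ∂pot/∂v`, `μ w' = v ∂pot/∂w`. -/
def pot (m : MHD) (a : ℝ) (y : ℝ²) : ℝ :=
  (y.1 - 1) ^ 2 / 2 + a * ((∫ s in (1 : ℝ)..y.1, s ^ (-m.γ)) - y.1) - m.J * y.1 -
    (m.Bm + m.I * y.2) ^ 2 / (2 * m.μ₀ * y.1) + y.2 ^ 2 / 2 + m.I * m.Bm / m.μ₀ * y.2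

variable {m : MHD}

theorem hasDerivAt_integral_rpow {v : ℝ} (hv : 0 < v) :
    HasDerivAt (fun v => ∫ s in (1 : ℝ)..v, s ^ (-m.γ)) (v ^ (-m.γ)) v := by
  have hc : ∀ s : ℝ, 0 < s → ContinuousAt (fun s : ℝ => s ^ (-m.γ)) s := fun s hs =>
    continuousAt_id.rpow_const (Or.inl hs.ne')
  refine intervalIntegral.integral_hasDerivAt_right (ContinuousOn.intervalIntegrable fun s hs => ?_)
    (by fun_prop : Measurable fun s : ℝ => s ^ (-m.γ)).stronglyMeasurable.stronglyMeasurableAtFilter (hc v hv)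
  exact (hc s ((lt_min one_pos hv).trans_le hs.1)).continuousWithinAt

theorem continuousAt_pot {a : ℝ} {y : ℝ²} (hy : 0 < y.1) : ContinuousAt (m.pot a) y := by
  have h1 : ContinuousAt (fun y : ℝ² => ∫ s in (1 : ℝ)..y.1, s ^ (-m.γ)) y :=
    ContinuousAt.comp (f := fun y : ℝ² => y.1) (m.hasDerivAt_integral_rpow hy).continuousAt continuousAt_fst
  have h2 : 2 * m.μ₀ * y.1 ≠ 0 := by have := m.μ₀_pos; positivity
  unfold pot
  fun_prop (disch := assumption)

def dissipation (m : MHD) (a : ℝ) (y : ℝ²) : ℝ :=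
  (m.τ * (m.fld a y).1 ^ 2 + m.μ * (m.fld a y).2 ^ 2) / y.1

theorem dissipation_nonneg {a : ℝ} {y : ℝ²} (hy : 0 < y.1) : 0 ≤ m.dissipation a y := by
  have := m.tau_pos
  have := m.μ_pos
  unfold dissipation; positivity

theorem dissipation_pos {a : ℝ} {y : ℝ²} (hy : 0 < y.1) (h : m.fld a y ≠ 0) :
    0 < m.dissipation a y := by
  have h1 := m.tau_pos
  have h2 := m.μ_pos
  refine div_pos ?_ hy
  by_cases h3 : (m.fld a y).1 = 0
  · have h4 : (m.fld a y).2 ≠ 0 := fun h4 => h (Prod.ext h3 h4)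
    positivity
  · positivity

theorem hasDerivAt_pot {a : ℝ} {y : ℝ → ℝ²} {t : ℝ} (hy : HasDerivAt y (m.fld a (y t)) t)
    (hpos : 0 < (y t).1) : HasDerivAt (fun t => m.pot a (y t)) (m.dissipation a (y t)) t := by
  have hτ := m.tau_pos.ne'
  have hμ := m.μ_pos.ne'
  have hμ₀ := m.μ₀_pos.ne'
  have hv' := hpos.ne'
  obtain ⟨h1, h2⟩ := hasDerivAt_fst_snd hy
  have h3 := HasDerivAt.comp t (h₂ := fun v => ∫ s in (1 : ℝ)..v, s ^ (-m.γ))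
    (m.hasDerivAt_integral_rpow hpos) h1
  have hd := (((((h1.sub_const 1).pow 2).div_const 2).add ((h3.sub h1).const_mul a)).sub
    (h1.const_mul m.J)).sub ((((h2.const_mul m.I).const_add m.Bm).pow 2).div (h1.const_mul (2 * m.μ₀))
      (by positivity)) |>.add ((h2.pow 2).div_const 2) |>.add (h2.const_mul (m.I * m.Bm / m.μ₀))
  have eV : m.τ * (m.fld a (y t)).1 = (y t).1 * ((y t).1 - 1) + (y t).1 * (a * ((y t).1 ^ (-m.γ) - 1)) +
      ((m.Bm + m.I * (y t).2) ^ 2 - (y t).1 ^ 2 * m.Bm ^ 2) / (2 * m.μ₀ * (y t).1) := by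
    rw [fld, fieldV, pressure, pressure, one_rpow]; field_simp
  have eW : m.μ * (m.fld a (y t)).2 = (y t).1 * (y t).2 - m.I / m.μ₀ * (m.Bm * (1 - (y t).1) + m.I * (y t).2) := by
    rw [fld, fieldW]; field_simp
  refine hd.congr_deriv ?_
  have e : m.dissipation a (y t) = (m.τ * (m.fld a (y t)).1 * (m.fld a (y t)).1 +
      m.μ * (m.fld a (y t)).2 * (m.fld a (y t)).2) / (y t).1 := by rw [dissipation]; ring
  rw [e, eV, eW, J]
  simp only [Pi.pow_apply, Nat.cast_ofNat, show (2 : ℕ) - 1 = 1 from rfl, pow_one]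
  field_simp
  ring

theorem pot_lt_of_tendsto {a T : ℝ} {y : ℝ → ℝ²} {S : ℝ²}
    (hy : ∀ t, T ≤ t → HasDerivAt y (m.fld a (y t)) t) (hpos : ∀ t, T ≤ t → 0 < (y t).1)
    (hlim : Tendsto y atTop (𝓝 S)) (hS : 0 < S.1) (hne : y T ≠ S) : m.pot a (y T) < m.pot a S := by
  have hrest : ∀ t, T < t → m.fld a (y t) ≠ 0 := by
    intro t ht h0
    have e := fld_unique (a := a) isOpen_Ioi isPreconnected_Ioi (y := y) (z := fun _ => y t)
      (fun s hs => hy s (le_of_lt hs)) (fun s _ => by rw [h0]; exact hasDerivAt_const s (y t))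
      (fun s hs => hpos s (le_of_lt hs)) ht rfl
    have h1 : y t = S := tendsto_nhds_unique (tendsto_const_nhds.congr'
      ((eventually_gt_atTop T).mono fun s hs => (e s hs).symm)) hlim
    have h2 : y T = y t := tendsto_nhds_unique ((hy T le_rfl).continuousAt.tendsto.mono_left
      (nhdsWithin_le_nhds (s := Ioi T))) (tendsto_const_nhds.congr'
      (eventually_mem_nhdsWithin.mono fun s hs => (e s hs).symm))
    exact hne (h2.trans h1)
  have hmono : StrictMonoOn (fun t => m.pot a (y t)) (Ici T) := by
    refine strictMonoOn_of_deriv_pos (convex_Ici T)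
      (fun t ht => (hasDerivAt_pot (hy t ht) (hpos t ht)).continuousAt.continuousWithinAt) fun t ht => ?_
    rw [interior_Ici] at ht
    rw [(hasDerivAt_pot (hy t (le_of_lt ht)) (hpos t (le_of_lt ht))).deriv]
    exact dissipation_pos (hpos t (le_of_lt ht)) (hrest t ht)
  have h1 : T < T + 1 := by linarith
  refine (hmono (mem_Ici.2 le_rfl) (mem_Ici.2 h1.le) h1).trans_le ?_
  refine ge_of_tendsto ((continuousAt_pot (m := m) (a := a) hS).tendsto.comp hlim)
    ((eventually_ge_atTop (T + 1)).mono fun t ht => ?_)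
  exact hmono.monotoneOn (mem_Ici.2 h1.le) (mem_Ici.2 (h1.le.trans ht)) ht

theorem pot_wRest_le {a v w : ℝ} (hv : 0 < v) (hK : m.K < v) :
    m.pot a (v, m.wRest v) ≤ m.pot a (v, w) := by
  have hμ₀ := m.μ₀_pos.ne'
  have hv' := hv.ne'
  have hvK : v - m.K ≠ 0 := (sub_pos.2 hK).ne'
  have h0 : m.wRest v * (v - m.K) = m.I * m.Bm / m.μ₀ * (1 - v) := by rw [wRest, div_mul_cancel₀ _ hvK]
  have e : m.pot a (v, w) - m.pot a (v, m.wRest v) = (1 - m.K / v) / 2 * (w - m.wRest v) ^ 2 +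
      (w - m.wRest v) / v * (m.wRest v * (v - m.K) - m.I * m.Bm / m.μ₀ * (1 - v)) := by
    rw [pot, pot, K]; field_simp; ring
  rw [h0, sub_self, mul_zero, add_zero] at e
  have h1 : 0 ≤ (1 - m.K / v) / 2 * (w - m.wRest v) ^ 2 := by
    have : m.K / v ≤ 1 := (div_le_one hv).2 hK.le
    have : 0 ≤ 1 - m.K / v := by linarith
    positivity
  linarith

theorem IsProfile.hasDerivAt_curve {a : ℝ} {φ : Profile} (h : m.IsProfile a φ) (t : ℝ) :
    HasDerivAt φ.curve (m.fld a (φ.curve t)) t := (h.ode_v t).prodMk (h.ode_w t)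

theorem IsProfile.tendsto_curve {a : ℝ} {φ : Profile} (h : m.IsProfile a φ) :
    Tendsto φ.curve atTop (𝓝 (φ.vR, φ.wR)) ∧ Tendsto φ.curve atBot (𝓝 (1, 0)) :=
  ⟨h.v_right.prodMk_nhds h.w_right, h.v_left.prodMk_nhds h.w_left⟩

theorem wRest_one : m.wRest 1 = 0 := by simp [wRest]

theorem IsLaxOneProfile.vR_ne_one (hJ : 0 < m.J) (hK : m.K < 1) {a : ℝ} (ha : 0 ≤ a) {φ : Profile}
    (h : m.IsLaxOneProfile a φ) : φ.vR ≠ 1 := by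
  intro h1
  have h2 := (h.isEndState hJ hK ha).2
  obtain ⟨hL, -, hc⟩ := h.2
  rw [h2, h1, wRest_one] at hc
  obtain ⟨s, hs⟩ := Multiset.card_pos_iff_exists_mem.1 (hc ▸ one_pos)
  obtain ⟨hs1, hs2⟩ := Multiset.mem_filter.1 hs
  exact (hL s hs1).not_gt hs2

theorem IsLaxOneProfile.curve_ne (hJ : 0 < m.J) (hK : m.K < 1) {a : ℝ} (ha : 0 ≤ a) {φ : Profile}
    (h : m.IsLaxOneProfile a φ) (t : ℝ) {S : ℝ²} (hS : m.fld a S = 0) : φ.curve t ≠ S := by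
  intro h0
  have e := fld_unique (a := a) isOpen_univ isPreconnected_univ (y := φ.curve) (z := fun _ => S)
    (fun s _ => h.1.hasDerivAt_curve s) (fun s _ => by rw [hS]; exact hasDerivAt_const s S)
    (fun s _ => h.1.v_pos s) (mem_univ t) h0
  have e' : φ.curve = fun _ => S := funext fun s => e s trivial
  have h1 := h.1.tendsto_curve
  rw [e'] at h1
  have := (tendsto_nhds_unique h1.1 tendsto_const_nhds).trans (tendsto_nhds_unique h1.2 tendsto_const_nhds).symm
  exact h.vR_ne_one hJ hK ha (congrArg Prod.fst this)

theorem IsEndState.le_one (hJ : 0 ≤ m.J) (hK : m.K < 1) {a v : ℝ} (ha : 0 ≤ a) (h : m.IsEndState a v)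
    (hv : m.K < v) : v ≤ 1 := by
  by_contra! h1
  have := h.restFun_pos hJ ha one_pos (mul_pos (sub_pos.2 hv) (sub_pos.2 hK))
    (mul_neg_of_pos_of_neg (sub_pos.2 hv) (sub_neg.2 h1))
  rw [restFun_one hK] at this
  exact lt_irrefl _ this

theorem IsLaxOneProfile.vR_lt (hJ : 0 < m.J) (hK : m.K < 1) {a : ℝ} (ha : 0 ≤ a) {φ : Profile}
    (h : m.IsLaxOneProfile a φ) (hv : m.K < φ.vR) (t : ℝ) : φ.vR < φ.v t := by
  obtain ⟨hE, hw⟩ := h.isEndState hJ hK ha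
  have hrest : m.fld a (φ.vR, φ.wR) = 0 := Prod.ext h.1.rest.1 h.1.rest.2
  have hne : ∀ t, φ.v t ≠ φ.vR := fun t ht => by
    have h1 := pot_lt_of_tendsto (T := t) (fun t _ => h.1.hasDerivAt_curve t) (fun t _ => h.1.v_pos t)
      h.1.tendsto_curve.1 h.1.vR_pos (h.curve_ne hJ hK ha t hrest)
    have h2 := pot_wRest_le (a := a) (w := φ.w t) h.1.vR_pos hv
    rw [hw, Profile.curve, ht] at h1
    exact absurd h1 (not_lt.2 h2)
  have hvR : φ.vR < 1 := lt_of_le_of_ne (hE.le_one hJ.le hK ha hv) (h.vR_ne_one hJ hK ha)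
  by_contra hcon
  obtain ⟨s, hs, hst⟩ := ((h.1.v_left.eventually_const_lt hvR).and (eventually_le_atBot t)).exists
  obtain ⟨r, -, hr⟩ := intermediate_value_Icc' hst
    (fun x _ => (h.1.ode_v x).continuousAt.continuousWithinAt) ⟨not_lt.1 hcon, hs.le⟩
  exact hne r hr

theorem le_of_tendsto_of_deriv_nonpos {f f' : ℝ → ℝ} {T l : ℝ} (hf : ∀ t, HasDerivAt f (f' t) t)
    (h : ∀ t, T ≤ t → f' t ≤ 0) (hl : Tendsto f atTop (𝓝 l)) : l ≤ f T := by
  have := antitoneOn_of_hasDerivAt (convex_Ici T) (fun t _ => hf t) fun t ht =>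
    h t (interior_subset ht)
  exact le_of_tendsto hl ((eventually_ge_atTop T).mono fun t ht => this (mem_Ici.2 le_rfl) ht ht)

theorem IsLaxOneProfile.exists_ge_wR (hJ : 0 < m.J) (hK : m.K < 1) {a : ℝ} (ha : 0 ≤ a) {φ : Profile}
    (h : m.IsLaxOneProfile a φ) (hv : φ.vR < m.K) (T : ℝ) :
    ∃ t, T ≤ t ∧ m.I * m.Bm * φ.wR ≤ m.I * m.Bm * φ.w t := by
  by_contra! hcon
  obtain ⟨hE, hwR⟩ := h.isEndState hJ hK ha
  have hμ := m.μ_pos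
  have hμ₀ := m.μ₀_pos
  have hb0 : m.I * m.Bm ≠ 0 := by
    refine mul_ne_zero (fun h0 => ?_) fun h0 => ?_
    · rw [K, h0] at hv; simp at hv; linarith [hE.pos]
    · rw [J, h0] at hJ; simp at hJ
  obtain ⟨b, hb⟩ : ∃ b, b = m.I * m.Bm := ⟨_, rfl⟩
  rw [← hb] at hb0 hcon
  obtain ⟨c, hc⟩ : ∃ c, c = b ^ 2 / m.μ₀ := ⟨_, rfl⟩
  have hc0 : 0 < c := by rw [hc]; positivity
  set g : ℝ² → ℝ := fun y => b * y.2 * (y.1 - m.K) - c * (1 - y.1) with hg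
  have hgW : ∀ v w, b * m.fieldW v w = g (v, w) / m.μ := fun v w => by
    rw [fieldW, hg, hc, hb, K]; field_simp; ring
  have hwd : ∀ t, HasDerivAt (fun t => b * φ.w t) (g (φ.curve t) / m.μ) t := fun t =>
    ((h.1.ode_w t).const_mul b).congr_deriv (hgW _ _)
  have hcc : Continuous φ.curve := continuous_of_hasDerivAt h.1.hasDerivAt_curve
  have hgc : Continuous g := by rw [hg]; fun_prop
  obtain ⟨T', hT'⟩ := eventually_atTop.1 (h.1.v_right.eventually_lt_const hv)
  obtain ⟨t₁, ht₁, hgt₁⟩ : ∃ t₁, max T T' ≤ t₁ ∧ 0 < g (φ.curve t₁) := by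
    by_contra! hneg
    have := le_of_tendsto_of_deriv_nonpos hwd (T := max T T')
      (fun t ht => div_nonpos_of_nonpos_of_nonneg (hneg t ht) hμ.le) (h.1.w_right.const_mul b)
    exact absurd this (not_le.2 (hcon _ (le_max_left _ _)))
  have hwt₁ := hcon t₁ ((le_max_left _ _).trans ht₁)
  have hUo : IsOpen {y : ℝ² | y.1 < m.K ∧ b * y.2 < b * φ.wR ∧ 0 < g y} :=
    (isOpen_lt continuous_fst continuous_const).and
      ((isOpen_lt (continuous_const.mul continuous_snd) continuous_const).and (isOpen_lt continuous_const hgc))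
  have hstep := forall_mem_of_step hUo (y := fun s => φ.curve (t₁ - s)) (by fun_prop) fun s hs hbef => by
    rcases hs.eq_or_lt with rfl | hs
    · simp only [sub_zero]
      exact ⟨hT' t₁ ((le_max_right _ _).trans ht₁), hwt₁, hgt₁⟩
    obtain ⟨t, ht⟩ : ∃ t, t = t₁ - s := ⟨_, rfl⟩
    simp only [← ht]
    have hin : ∀ r, t < r → r ≤ t₁ → φ.v r < m.K ∧ b * φ.w r < b * φ.wR ∧ 0 < g (φ.curve r) :=
      fun r hr hr1 => by
        have := hbef (t₁ - r) (by linarith) (by linarith)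
        rwa [sub_sub_cancel] at this
    have hev : ∀ᶠ r in 𝓝[>] t, t < r ∧ r ≤ t₁ := Ioc_mem_nhdsGT (by linarith)
    have hvle : φ.v t ≤ m.K := le_of_tendsto ((h.1.ode_v t).continuousAt.tendsto.mono_left
      nhdsWithin_le_nhds) (hev.mono fun r hr => (hin r hr.1 hr.2).1.le)
    have hgle : 0 ≤ g (φ.curve t) := ge_of_tendsto ((hgc.comp hcc).continuousAt.tendsto.mono_left
      nhdsWithin_le_nhds) (hev.mono fun r hr => (hin r hr.1 hr.2).2.2.le)
    have hwlt : b * φ.w t < b * φ.wR := by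
      obtain ⟨r, hr, hr'⟩ := exists_hasDerivAt_eq_slope (fun t => b * φ.w t) _ (by linarith : t < t₁)
        (fun x _ => (hwd x).continuousAt.continuousWithinAt) fun x _ => hwd x
      have := div_pos (hin r hr.1 hr.2.le).2.2 hμ
      rw [hr', div_pos_iff_of_pos_right (by linarith)] at this
      linarith
    have hgt : g (φ.curve t) = b * φ.w t * (φ.v t - m.K) - c * (1 - φ.v t) := rfl
    have hvlt : φ.v t < m.K := by
      refine lt_of_le_of_ne hvle fun h0 => ?_
      rw [hgt, h0] at hgle
      nlinarith
    refine ⟨hvlt, hwlt, lt_of_le_of_ne hgle fun h0 => ?_⟩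
    have hne : φ.v t ≠ m.K := hvlt.ne
    have hw0 : m.fieldW (φ.v t) (φ.w t) = 0 := by
      have h1 := hgW (φ.v t) (φ.w t)
      rw [show g (φ.v t, φ.w t) = 0 from h0.symm, zero_div] at h1
      exact (mul_eq_zero.1 h1).resolve_left hb0
    have hwr : φ.w t = m.wRest (φ.v t) := by
      rw [fieldW_eq hne, div_eq_zero_iff, or_iff_left hμ.ne', mul_eq_zero,
        or_iff_right (sub_ne_zero.2 hne)] at hw0
      exact sub_eq_zero.1 hw0
    rw [hgt] at h0
    have hR : b * φ.wR * (φ.vR - m.K) = c * (1 - φ.vR) := by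
      have := sub_ne_zero.2 hE.ne
      rw [hwR, wRest, hc, hb]; field_simp
    have hvv : φ.vR < φ.v t := by
      have h1 := mul_lt_mul_of_pos_right hwlt (mul_pos_of_neg_of_neg (sub_neg.2 hvlt) (sub_neg.2 hv))
      have h2 : c * ((φ.vR - φ.v t) * (1 - m.K)) < 0 := by
        linear_combination h1 + (φ.vR - m.K) * h0 + (φ.v t - m.K) * hR
      have h3 := (pos_iff_neg_of_mul_neg h2).1 hc0
      have := neg_of_mul_neg_left h3 (by linarith)
      linarith
    have hpos : 0 < m.fieldV a (φ.v t) (φ.w t) := by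
      rw [hwr, fieldV_wRest (h.1.v_pos t) hne]
      refine div_pos (mul_pos (h.1.v_pos t) (hE.restFun_pos hJ.le ha (h.1.v_pos t)
        (mul_pos_of_neg_of_neg (sub_neg.2 hv) (sub_neg.2 hvlt)) ?_)) m.tau_pos
      exact mul_neg_of_neg_of_pos (sub_neg.2 hv) (sub_pos.2 hvv)
    have hgd : HasDerivAt (fun t => g (φ.curve t)) (m.fieldV a (φ.v t) (φ.w t) * (b * φ.w t + c)) t := by
      have := (((h.1.ode_w t).const_mul b).mul ((h.1.ode_v t).sub_const m.K)).sub
        (((h.1.ode_v t).const_sub 1).const_mul c)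
      refine this.congr_deriv ?_
      rw [hw0]; ring
    have hneg : m.fieldV a (φ.v t) (φ.w t) * (b * φ.w t + c) < 0 := by
      refine mul_neg_of_pos_of_neg hpos ?_
      have h1 : 0 < (b * φ.w t + c) * (φ.v t - m.K) := by
        have : (b * φ.w t + c) * (φ.v t - m.K) = c * (1 - m.K) := by linear_combination -h0
        rw [this]; exact mul_pos hc0 (by linarith)
      exact neg_of_mul_pos_left h1 (sub_neg.2 hvlt).le
    have hsl := ((hasDerivAt_iff_tendsto_slope.1 hgd).eventually_lt_const hneg).filter_mono
      (nhdsWithin_mono t (s := Ioi t) fun r hr => (mem_Ioi.1 hr).ne')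
    obtain ⟨r, hr, hr1, hr2⟩ := (hsl.and hev).exists
    rw [slope_def_field, div_neg_iff] at hr
    have hz : g (φ.curve t) = 0 := h0.symm
    rw [hz] at hr
    have := (hin r hr1 hr2).2.2
    rcases hr with hr | hr <;> linarith [hr.1, hr.2]
  obtain ⟨t, ht, htt⟩ := ((h.1.v_left.eventually_const_lt hK).and (eventually_le_atBot t₁)).exists
  have := (hstep (t₁ - t) (by linarith)).1
  simp only [sub_sub_cancel] at this
  exact ht.not_gt this

end MHD

/-! ### Uniform description of the dynamics near the end states -/

namespace MHD

/-- The functional that is positive on the side from which profiles approach the end state. -/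
def side (m : MHD) (v₀ : ℝ) : ℝ² → ℝ :=
  if m.K < v₀ then fun d => 1 * d.1 + 0 * d.2 else fun d => 0 * d.1 + m.I * m.Bm * d.2

/-- A neighbourhood `U` of the saddle `v₀`, the sublevel `r` of the energy at `(1, 0)`, and a box
containing both. -/
structure Setup (m : MHD) (v₀ : ℝ) where
  (P Q : ℝ² →L[ℝ] ℝ)
  (e f : ℝ²)
  (c κ p k r δ M D : ℝ)
  U : Set ℝ²
  vE : ℝ → ℝ
  κ_pos : 0 < κ
  p_pos : 0 < p
  k_pos : 0 < k
  r_pos : 0 < r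
  δ_pos : 0 < δ
  coords : IsSaddleCoords P Q e f (m.side v₀) c
  isOpen_U : IsOpen U
  U_box : U ⊆ box δ M
  rep_box : ∀ y, m.repEnergy y < r → y ∈ box δ M
  U_bdd : ∀ y ∈ U, ∀ z ∈ U, Q (y - z) ^ 2 - P (y - z) ^ 2 ≤ D
  tendsto_vE : Tendsto (fun a => (vE a, m.wRest (vE a))) (𝓝[≥] 0) (𝓝 (v₀, m.wRest v₀))

namespace Setup

variable {m : MHD} {v₀ : ℝ} (s : m.Setup v₀)

/-- The saddle end state. -/
def S (a : ℝ) : ℝ² := (s.vE a, m.wRest (s.vE a))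

/-- The properties that hold for all sufficiently small `a ≥ 0`. -/
structure Good (a : ℝ) : Prop where
  nonneg : 0 ≤ a
  mem : a ∈ Icc (-1 : ℝ) 1
  endState : m.IsEndState a (s.vE a)
  kind : m.K < s.vE a ↔ m.K < v₀
  saddle : IsSaddleField s.P s.Q s.κ (m.fld a) s.U
  ball : ∀ y, s.P (y - s.S a) ^ 2 + s.Q (y - s.S a) ^ 2 ≤ 5 * s.p ^ 2 → y ∈ s.U
  repel : ∀ y, m.repEnergy y < s.r → s.k * m.repEnergy y ≤
    2 * (m.τ * (y.1 - 1) * (m.fld a y).1 + m.μ * y.2 * (m.fld a y).2)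
  left_lax : ∀ t ∈ m.charSpeeds a 1 0, 0 < t
  left_end : m.endData a (1, 0) ∈ m.endStates

variable {s}

theorem δ_le : s.δ ≤ s.M := by
  have h := s.rep_box (1, 0) (by simpa [repEnergy] using s.r_pos)
  exact h.1.trans ((le_abs_self _).trans ((norm_fst_le (((1 : ℝ), (0 : ℝ)))).trans h.2))

theorem Good.S_mem {a : ℝ} (h : s.Good a) : s.S a ∈ s.U :=
  h.ball _ (by rw [sub_self, map_zero, map_zero]; nlinarith [sq_nonneg s.p])

theorem Good.fld_S {a : ℝ} (h : s.Good a) : m.fld a (s.S a) = 0 :=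
  let h' := (rest_iff h.endState.pos h.endState.ne).2 ⟨rfl, h.endState.zero⟩
  Prod.ext h'.1 h'.2

theorem norm_le_of_cone {d : ℝ²} (h : s.Q d ^ 2 ≤ s.P d ^ 2) : ‖d‖ ≤ (‖s.e‖ + ‖s.f‖) * |s.P d| :=
  norm_le_of_decomp (s.coords.decomp _) le_rfl (sq_le_sq.1 h)

theorem Good.decay {a : ℝ} (h : s.Good a) {y : ℝ → ℝ²} {x : ℝ}
    (hy : ∀ t, x ≤ t → HasDerivAt y (m.fld a (y t)) t) (he : IsEntry s.P s.Q s.U (s.S a) s.p y x)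
    {X t : ℝ} (hX : x ≤ X) (ht : X ≤ t) :
    ‖y t - s.S a‖ ≤ (‖s.e‖ + ‖s.f‖) * s.p * exp (-s.κ * (t - X)) := by
  have h1 := h.saddle.decay s.κ_pos h.S_mem h.fld_S hy he.mem he.cone (hX.trans ht)
  have hp := s.p_pos
  rw [he.P_eq, show -(2 * s.κ) * (t - x) = -s.κ * (t - x) + -s.κ * (t - x) by ring, exp_add, ← sq,
    ← mul_pow] at h1
  have h2 := abs_le_of_sq_le_sq h1 (by positivity)
  have h3 : exp (-s.κ * (t - x)) ≤ exp (-s.κ * (t - X)) := exp_le_exp.2 (by nlinarith [s.κ_pos])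
  refine (norm_le_of_cone (he.cone t (hX.trans ht))).trans ?_
  rw [mul_assoc]
  gcongr
  exact h2.trans (by gcongr)

theorem Good.tendsto {a : ℝ} (h : s.Good a) {y : ℝ → ℝ²} {x : ℝ}
    (hy : ∀ t, x ≤ t → HasDerivAt y (m.fld a (y t)) t) (he : IsEntry s.P s.Q s.U (s.S a) s.p y x) :
    Tendsto y atTop (𝓝 (s.S a)) := by
  rw [tendsto_iff_norm_sub_tendsto_zero]
  refine squeeze_zero' (Eventually.of_forall fun _ => norm_nonneg _)
    ((eventually_ge_atTop x).mono fun t ht => h.decay hy he le_rfl ht) ?_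
  have h1 : Tendsto (fun t => -s.κ * (t - x)) atTop atBot :=
    (tendsto_atTop_add_const_right atTop (-x) tendsto_id).const_mul_atTop_of_neg (neg_neg_of_pos s.κ_pos)
  simpa using (tendsto_exp_atBot.comp h1).const_mul ((‖s.e‖ + ‖s.f‖) * s.p)

theorem Good.end_eq {a : ℝ} (h : s.Good a) (hJ : 0 < m.J) (hK : m.K < 1) {φ : Profile}
    (hφ : m.IsLaxOneProfile a φ) (hk : m.K < φ.vR ↔ m.K < v₀) : (φ.vR, φ.wR) = s.S a := by
  obtain ⟨h1, h2⟩ := hφ.isEndState hJ hK h.nonneg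
  rw [h2, h1.unique hJ.le h.nonneg h.endState (hk.trans h.kind.symm)]
  rfl

theorem Good.exists_entry {a : ℝ} (h : s.Good a) (hJ : 0 < m.J) (hK : m.K < 1) {φ : Profile}
    (hφ : m.IsLaxOneProfile a φ) (hk : m.K < φ.vR ↔ m.K < v₀) :
    ∃ x, IsEntry s.P s.Q s.U (s.S a) s.p φ.curve x := by
  have hS := h.end_eq hJ hK hφ hk
  have hlim := hφ.1.tendsto_curve
  rw [hS] at hlim
  obtain ⟨t₁, ht₁⟩ : ∃ t, φ.curve t ∉ s.U := by
    by_contra! hcon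
    have h1 : ∀ t, s.Q (φ.curve t - s.S a) ^ 2 ≤ s.P (φ.curve t - s.S a) ^ 2 := fun t =>
      h.saddle.cone s.κ_pos h.S_mem h.fld_S (fun t _ => hφ.1.hasDerivAt_curve t) (fun t _ => hcon t)
        (fun t _ => s.U_bdd _ (hcon t) _ h.S_mem) le_rfl
    have h2 : Tendsto (fun t => s.P (φ.curve t - s.S a) ^ 2) atBot (𝓝 (s.P ((1, 0) - s.S a) ^ 2)) :=
      ((s.P.continuous.tendsto _).comp (hlim.2.sub_const _)).pow 2
    have h3 : Tendsto (fun T => s.P (φ.curve T - s.S a) ^ 2 * exp (-(2 * s.κ) * (0 - T))) atBot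
        (𝓝 (s.P ((1, 0) - s.S a) ^ 2 * 0)) := by
      refine h2.mul (tendsto_exp_atBot.comp ?_)
      simpa using tendsto_id.const_mul_atBot (mul_pos two_pos s.κ_pos)
    rw [mul_zero] at h3
    have h4 : s.P (φ.curve 0 - s.S a) ^ 2 ≤ 0 := ge_of_tendsto h3 ((eventually_le_atBot 0).mono fun T hT =>
      h.saddle.decay s.κ_pos h.S_mem h.fld_S (fun t _ => hφ.1.hasDerivAt_curve t) (fun t _ => hcon t)
        (fun t _ => h1 t) hT)
    have h5 := norm_le_of_cone (h1 0)
    rw [sq_nonpos_iff _ |>.1 h4, abs_zero, mul_zero] at h5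
    exact hφ.curve_ne hJ hK h.nonneg 0 h.fld_S (sub_eq_zero.1 (norm_le_zero_iff.1 h5))
  refine h.saddle.exists_entry s.κ_pos s.isOpen_U s.U_bdd h.S_mem h.fld_S hφ.1.hasDerivAt_curve
    hlim.1 s.p_pos h.ball ht₁ fun T => ?_
  obtain ⟨t, ht, hl⟩ : ∃ t, T ≤ t ∧ 0 ≤ m.side v₀ (φ.curve t - s.S a) := by
    rw [← hS, side]
    split_ifs with hv
    · exact ⟨T, le_rfl, by simpa [Profile.curve] using (hφ.vR_lt hJ hK h.nonneg (hk.2 hv) T).le⟩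
    · have hne := (hφ.isEndState hJ hK h.nonneg).1.ne
      obtain ⟨t, ht, h1⟩ := hφ.exists_ge_wR hJ hK h.nonneg (lt_of_le_of_ne (not_lt.1 (mt hk.1 hv)) hne) T
      exact ⟨t, ht, by simpa [Profile.curve, mul_sub] using h1⟩
  refine ⟨t, ht, fun hc => ?_⟩
  by_contra! hneg
  have h1 := s.coords.side _ hc
  have h2 := mul_nonpos_of_nonneg_of_nonpos hl hneg
  have h3 : s.P (φ.curve t - s.S a) ^ 2 ≤ 0 := by
    by_contra! h4
    linarith [mul_pos s.coords.c_pos h4]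
  have h5 := norm_le_of_cone hc
  rw [sq_nonpos_iff _ |>.1 h3, abs_zero, mul_zero] at h5
  exact hφ.curve_ne hJ hK h.nonneg t h.fld_S (sub_eq_zero.1 (norm_le_zero_iff.1 h5))

theorem Good.exists_stable {a : ℝ} (h : s.Good a) : ∃ y : ℝ → ℝ²,
    (∀ t, HasDerivAt y (m.cfld s.δ s.M a (y t)) t) ∧ IsEntry s.P s.Q s.U (s.S a) s.p y 0 := by
  obtain ⟨K, hK, -⟩ := m.exists_lipschitz_cfld s.δ_pos s.δ_le
  have hU : ∀ y ∈ s.U, m.cfld s.δ s.M a y = m.fld a y := fun y hy => m.cfld_eq (s.U_box hy)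
  obtain ⟨y, hy, hy0, hyU⟩ := IsSaddleField.exists_stable (F := m.cfld s.δ s.M a) (U := s.U) (κ := s.κ)
    ⟨fun y hy z hz => by rw [hU y hy, hU z hz]; exact h.saddle.contract y hy z hz,
      fun y hy z hz => by rw [hU y hy, hU z hz]; exact h.saddle.expand y hy z hz⟩
    s.κ_pos (hK a h.mem) s.isOpen_U ((hU _ h.S_mem).trans h.fld_S) s.p_pos h.ball
    s.coords.Pe s.coords.Qe s.coords.Pf s.coords.Qf le_rfl
  exact ⟨y, hy, fun t ht => (hyU t ht).1, hy0, fun t ht => (hyU t ht).2⟩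

/-- An orbit entering the saddle and leaving the repelling end state is a profile. -/
theorem Good.isLaxOneProfile {a : ℝ} (h : s.Good a) {y : ℝ → ℝ²}
    (hy : ∀ t, HasDerivAt y (m.cfld s.δ s.M a (y t)) t) {x T : ℝ}
    (he : IsEntry s.P s.Q s.U (s.S a) s.p y x) (hT : m.repEnergy (y T) < s.r)
    (hbox : ∀ t, T ≤ t → t ≤ x → y t ∈ box s.δ s.M) :
    m.IsLaxOneProfile a ⟨fun t => (y t).1, fun t => (y t).2, s.vE a, m.wRest (s.vE a)⟩ := by
  have hrep := fun t (ht : t ≤ T) => repEnergy_decay s.k_pos.le (F := m.cfld s.δ s.M a)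
    (fun z hz => by rw [m.cfld_eq (s.rep_box z hz)]; exact h.repel z hz) hy hT ht
  have hb : ∀ t, y t ∈ box s.δ s.M := fun t => by
    rcases le_total t T with h1 | h1
    · exact s.rep_box _ (hrep t h1).1
    · rcases le_total t x with h2 | h2
      · exact hbox t h1 h2
      · exact s.U_box (he.mem t h2)
  have hy' : ∀ t, HasDerivAt y (m.fld a (y t)) t := fun t => (hy t).congr_deriv (m.cfld_eq (hb t))
  have hlim := h.tendsto (fun t _ => hy' t) he
  have hE : Tendsto (fun t => m.repEnergy (y t)) atBot (𝓝 0) := by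
    refine squeeze_zero' (Eventually.of_forall fun t => ?_)
      ((eventually_le_atBot T).mono fun t ht => (hrep t ht).2) ?_
    · have := m.tau_pos; have := m.μ_pos; rw [repEnergy]; positivity
    · have h1 : Tendsto (fun t => -s.k * (T - t)) atBot atBot := by
        have := (tendsto_atBot_add_const_right atBot (-T) tendsto_id).const_mul_atBot s.k_pos
        exact this.congr fun t => by simp only [id]; ring
      simpa using (tendsto_exp_atBot.comp h1).const_mul (m.repEnergy (y T))
  have hsq : ∀ {g : ℝ → ℝ} {q : ℝ}, 0 < q → (∀ t, q * g t ^ 2 ≤ m.repEnergy (y t)) →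
      Tendsto g atBot (𝓝 0) := fun {g q} hq hg => by
    have h2 : Tendsto (fun t => g t ^ 2) atBot (𝓝 0) := by
      refine squeeze_zero (fun t => sq_nonneg _) (fun t => (le_div_iff₀ hq).2 ?_) (by simpa using hE.div_const q)
      rw [mul_comm]; exact hg t
    have h3 := h2.sqrt
    simp only [Real.sqrt_sq_eq_abs, Real.sqrt_zero] at h3
    exact tendsto_zero_iff_abs_tendsto_zero g |>.2 h3
  have hτ := m.tau_pos
  have hμ := m.μ_pos
  refine ⟨⟨fun t => s.δ_pos.trans_le (hb t).1, h.endState.pos,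
    fun t => (hasDerivAt_fst_snd (hy' t)).1, fun t => (hasDerivAt_fst_snd (hy' t)).2, ?_, ?_,
    hlim.fst_nhds, hlim.snd_nhds⟩, h.left_lax, h.endState.right_lax h.nonneg⟩
  · have := hsq (g := fun t => (y t).1 - 1) hτ fun t => by rw [repEnergy]; nlinarith [sq_nonneg (y t).2]
    simpa using this.add_const 1
  · exact hsq (g := fun t => (y t).2) hμ fun t => by rw [repEnergy]; nlinarith [sq_nonneg ((y t).1 - 1)]

theorem exists_dist_entry {z : ℝ → ℝ²} (hz : ∀ t, HasDerivAt z (m.fld 0 (z t)) t) {x₀ : ℝ}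
    (hz₀ : IsEntry s.P s.Q s.U (v₀, m.wRest v₀) s.p z x₀) {η : ℝ} (hη : 0 < η) :
    ∀ᶠ a in 𝓝[≥] 0, s.Good a → ∀ y x, (∀ t, x ≤ t → HasDerivAt y (m.fld a (y t)) t) →
      IsEntry s.P s.Q s.U (s.S a) s.p y x → dist (y x) (z x₀) < η := by
  obtain ⟨K, -, hK⟩ := m.exists_lipschitz_cfld s.δ_pos s.δ_le
  have hlim : Tendsto (fun a : ℝ => (‖s.e‖ + ‖s.f‖) * (|s.P (s.S a - (v₀, m.wRest v₀))| +
      (‖s.P‖ + ‖s.Q‖) / s.κ * (K * |a|))) (𝓝[≥] 0) (𝓝 ((‖s.e‖ + ‖s.f‖) *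
      (|s.P ((v₀, m.wRest v₀) - (v₀, m.wRest v₀))| + (‖s.P‖ + ‖s.Q‖) / s.κ * (K * |(0 : ℝ)|)))) := by
    have h1 : Tendsto (fun a : ℝ => |a|) (𝓝[≥] 0) (𝓝 |(0 : ℝ)|) :=
      (continuous_abs.tendsto 0).mono_left nhdsWithin_le_nhds
    exact (((s.P.continuous.tendsto _).comp (s.tendsto_vE.sub_const _)).abs.add
      ((h1.const_mul _).const_mul _)).const_mul _
  rw [sub_self, map_zero, abs_zero, mul_zero, mul_zero, add_zero, mul_zero] at hlim
  filter_upwards [hlim.eventually_lt_const hη] with a ha hg y x hy he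
  refine lt_of_le_of_lt ?_ ha
  have h1 := hg.saddle.dist_le_of_P s.κ_pos s.U_bdd s.coords.decomp (G := m.fld 0) (ε := K * |a|)
    (fun w hw => by rw [dist_comm]; exact hK a hg.mem w (s.U_box hw)) (x := 0)
    (y := fun t => y (t + x)) (z := fun t => z (t + x₀))
    (fun t ht => (hy (t + x) (by linarith)).comp_add_const t x) (fun t _ => (hz _).comp_add_const t x₀)
    (fun t ht => he.mem _ (by linarith)) (fun t ht => hz₀.mem _ (by linarith))
  simp only [zero_add] at h1
  rwa [show s.P (y x - z x₀) = s.P (s.S a - (v₀, m.wRest v₀)) by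
    have := he.P_eq.trans hz₀.P_eq.symm
    rw [map_sub, map_sub] at this ⊢; linarith] at h1

end Setup

variable {m : MHD}

theorem IsEndState.exists_setup (hJ : 0 < m.J) (h2 : 2 * m.J + m.K < 1) {v₀ : ℝ} (h : m.IsEndState 0 v₀)
    {δ₀ M₀ : ℝ} (hδ₀ : 0 < δ₀) : ∃ s : m.Setup v₀, s.δ ≤ δ₀ ∧ M₀ ≤ s.M ∧ s.vE 0 = v₀ ∧
      ∀ᶠ a in 𝓝[≥] 0, s.Good a := by
  have hK : m.K < 1 := by linarith
  have hτ := m.tau_pos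
  have hμ := m.μ_pos
  have hv := h.pos
  obtain ⟨vE, hvE0, hvE, hvEg⟩ := h.exists_family hJ.le
  obtain ⟨P, Q, e, f, c, κ, ρ, hκ, hρ, hc, hsad⟩ := h.exists_saddleField hJ hK rfl
  obtain ⟨k, hk, r, hr, hrep⟩ := exists_repeller h2 hJ
  obtain ⟨S₀, hS₀⟩ : ∃ S, S = (v₀, m.wRest v₀) := ⟨_, rfl⟩
  rw [← hS₀] at hsad
  obtain ⟨ρ₁, hρ₁⟩ : ∃ x, x = min ρ (v₀ / 2) := ⟨_, rfl⟩
  have hρ₁0 : 0 < ρ₁ := by rw [hρ₁]; positivity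
  have hUρ : ball S₀ ρ₁ ⊆ ball S₀ ρ := Metric.ball_subset_ball (hρ₁ ▸ min_le_left _ _)
  obtain ⟨p, hp⟩ : ∃ p, p = ρ₁ / (6 * (‖e‖ + ‖f‖ + 1)) := ⟨_, rfl⟩
  have hp0 : 0 < p := by rw [hp]; positivity
  have hpρ : 3 * p * (‖e‖ + ‖f‖) < ρ₁ / 2 := by
    have : 3 * p * (‖e‖ + ‖f‖ + 1) = ρ₁ / 2 := by rw [hp]; field_simp; norm_num
    linarith
  have hSlim : Tendsto (fun a => (vE a, m.wRest (vE a))) (𝓝[≥] 0) (𝓝 S₀) := by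
    rw [hS₀]
    have h1 : ContinuousAt m.wRest v₀ := by
      have := sub_ne_zero.2 h.ne
      unfold wRest
      fun_prop (disch := assumption)
    exact hvE.prodMk_nhds (h1.tendsto.comp hvE)
  refine ⟨⟨P, Q, e, f, c, κ, p, k, min r (min (m.τ / 4) m.μ), min (v₀ / 2) (min δ₀ (1 / 2)),
    max M₀ (max 2 (‖S₀‖ + ρ₁)), (‖Q‖ * (2 * ρ₁)) ^ 2, ball S₀ ρ₁, vE, hκ, hp0, hk, by positivity,
    by positivity, hc, isOpen_ball, fun y hy => ?_, fun y hy => ?_, fun y hy z hz => ?_,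
    hS₀ ▸ hSlim⟩, (min_le_right _ _).trans (min_le_left _ _), le_max_left _ _, hvE0, ?_⟩
  · rw [mem_ball_iff_norm] at hy
    refine ⟨?_, ?_⟩
    · have h1 := (abs_lt.1 ((norm_fst_le (y - S₀)).trans_lt hy)).1
      have h3 : ρ₁ ≤ v₀ / 2 := hρ₁ ▸ min_le_right _ _
      rw [hS₀] at h1
      simp only [Prod.fst_sub] at h1
      exact (min_le_left _ _).trans (by linarith)
    · have := norm_le_norm_add_norm_sub S₀ y
      rw [norm_sub_rev] at this
      exact le_max_of_le_right (le_max_of_le_right (by linarith))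
  · rw [repEnergy] at hy
    have h1 := hy.trans_le ((min_le_right _ _).trans (min_le_left _ _))
    have h3 := hy.trans_le ((min_le_right _ _).trans (min_le_right _ _))
    have h4 := abs_lt.1 (abs_lt_of_sq_lt_sq (a := y.1 - 1) (b := 1 / 2) (lt_of_mul_lt_mul_left
      (by nlinarith [mul_nonneg hμ.le (sq_nonneg y.2)]) hτ.le) (by norm_num))
    have h5 := abs_lt_of_sq_lt_sq (a := y.2) (b := 1) (lt_of_mul_lt_mul_left
      (by nlinarith [mul_nonneg hτ.le (sq_nonneg (y.1 - 1))]) hμ.le) zero_le_one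
    refine ⟨(min_le_right _ _).trans ((min_le_right _ _).trans (by linarith [h4.1])),
      le_max_of_le_right (le_max_of_le_left (max_le (abs_le.2 ⟨?_, ?_⟩) (h5.le.trans one_le_two)))⟩ <;>
    linarith [h4.1, h4.2]
  · have h1 : ‖y - z‖ ≤ 2 * ρ₁ := by
      rw [← dist_eq_norm]
      linarith [dist_triangle_right y z S₀, mem_ball.1 hy, mem_ball.1 hz]
    have h3 : |Q (y - z)| ≤ ‖Q‖ * (2 * ρ₁) := (Q.le_opNorm _).trans (by gcongr)
    nlinarith [sq_abs (Q (y - z)), pow_le_pow_left₀ (abs_nonneg _) h3 2, sq_nonneg (P (y - z))]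
  · have hsmall : ∀ q > 0, ∀ᶠ a in 𝓝[≥] (0 : ℝ), |a| < q := fun q hq =>
      nhdsWithin_le_nhds ((continuous_abs.tendsto (0 : ℝ)).eventually_lt_const (by simpa using hq))
    filter_upwards [self_mem_nhdsWithin, hsmall 1 one_pos, hsmall ρ hρ, hsmall r hr, hvEg,
      left_mem_endStates h2, nhdsWithin_le_nhds (left_lax_of_lt m h2 hJ.le),
      hSlim (Metric.ball_mem_nhds S₀ (half_pos hρ₁0))] with a h0 h1 h3 h4 h5 h6 h7 h8
    refine ⟨h0, abs_le.1 h1.le, h5.1, h5.2, ?_, fun y hy => ?_, fun y hy => hrep a h4 y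
      (hy.trans_le (min_le_left _ _)), h7 h0, h6⟩
    · exact ⟨fun y hy z hz => (hsad a h3).contract y (hUρ hy) z (hUρ hz),
        fun y hy z hz => (hsad a h3).expand y (hUρ hy) z (hUρ hz)⟩
    · obtain ⟨d, hd⟩ : ∃ d, d = y - (vE a, m.wRest (vE a)) := ⟨_, rfl⟩
      change P (y - (vE a, m.wRest (vE a))) ^ 2 + Q (y - (vE a, m.wRest (vE a))) ^ 2 ≤ 5 * p ^ 2 at hy
      rw [← hd] at hy
      have b1 : |P d| ≤ 3 * p := abs_le_of_sq_le_sq (by nlinarith [sq_nonneg (Q d), sq_nonneg p]) (by positivity)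
      have b2 : |Q d| ≤ 3 * p := abs_le_of_sq_le_sq (by nlinarith [sq_nonneg (P d), sq_nonneg p]) (by positivity)
      have b3 := norm_le_of_decomp (hc.decomp d) b1 b2
      rw [hd, ← dist_eq_norm] at b3
      exact mem_ball.2 (by linarith [dist_triangle y (vE a, m.wRest (vE a)) S₀, mem_ball.1 h8])

end MHD

/-! ### Profiles for small pressure -/

namespace MHD

variable {m : MHD} {v₀ : ℝ} {s : m.Setup v₀}

theorem IsProfile.exists_box {a : ℝ} {φ : Profile} (h : m.IsProfile a φ) :
    ∃ δ M, 0 < δ ∧ ∀ t, φ.curve t ∈ box δ M := by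
  have hc : Continuous φ.curve := continuous_of_hasDerivAt h.hasDerivAt_curve
  obtain ⟨h1, h2⟩ := h.tendsto_curve
  have hpos := h.vR_pos
  have hev : ∀ q : ℝ², 0 < q.1 → ∀ᶠ y in 𝓝 q, y ∈ box (q.1 / 2) (‖q‖ + 1) := fun q hq =>
    ((continuous_fst.tendsto q).eventually_const_le (half_lt_self hq)).and
      ((continuous_norm.tendsto q).eventually_le_const (lt_add_one _))
  obtain ⟨b, hb⟩ := eventually_atTop.1 (h1.eventually (hev (φ.vR, φ.wR) hpos))
  obtain ⟨a', ha'⟩ := eventually_atBot.1 (h2.eventually (hev (1, 0) one_pos))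
  have hne : (uIcc a' b).Nonempty := ⟨a', left_mem_uIcc⟩
  obtain ⟨x, -, hx⟩ := isCompact_uIcc.exists_isMinOn hne (continuous_fst.comp hc).continuousOn
  obtain ⟨z, -, hz⟩ := isCompact_uIcc.exists_isMaxOn hne hc.norm.continuousOn
  refine ⟨min (φ.v x) (min (φ.vR / 2) (1 / 2)), max ‖φ.curve z‖ (max (‖(φ.vR, φ.wR)‖ + 1)
    (‖((1 : ℝ), (0 : ℝ))‖ + 1)), by have := h.v_pos x; positivity, fun t => ?_⟩
  rcases le_total t a' with h3 | h3
  · exact box_mono ((min_le_right _ _).trans (min_le_right _ _)) (by simp) (ha' t h3)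
  rcases le_total b t with h4 | h4
  · exact box_mono ((min_le_right _ _).trans (min_le_left _ _)) (by simp) (hb t h4)
  · have ht : t ∈ uIcc a' b := Icc_subset_uIcc ⟨h3, h4⟩
    exact ⟨(min_le_left _ _).trans (hx ht), (hz ht).trans (le_max_left _ _)⟩

/-- A reference profile for `a = 0`, together with adapted constants. -/
structure Setup.IsReference (s : m.Setup v₀) (φ₀ : Profile) (x₀ δ₁ M₁ : ℝ) : Prop where
  profile : m.IsLaxOneProfile 0 φ₀
  entry : IsEntry s.P s.Q s.U (v₀, m.wRest v₀) s.p φ₀.curve x₀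
  δ_pos : 0 < δ₁
  mem : ∀ t, φ₀.curve t ∈ box δ₁ M₁
  δ_le : s.δ ≤ δ₁ / 2
  le_M : M₁ + δ₁ ≤ s.M
  good : ∀ᶠ a in 𝓝[≥] 0, s.Good a

variable {φ₀ : Profile} {x₀ δ₁ M₁ : ℝ}

theorem IsLaxOneProfile.exists_reference (hJ : 0 < m.J) (h : m.IsLaxOneProfile 0 φ₀) :
    ∃ (s : m.Setup φ₀.vR) (x₀ δ₁ M₁ : ℝ), s.IsReference φ₀ x₀ δ₁ M₁ := by
  have h2 := left_lax_zero m h.2.1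
  have hK : m.K < 1 := by linarith
  obtain ⟨δ₁, M₁, hδ, hb⟩ := h.1.exists_box
  obtain ⟨s, h3, h4, h5, h6⟩ := (h.isEndState hJ hK le_rfl).1.exists_setup hJ h2 (M₀ := M₁ + δ₁) (half_pos hδ)
  obtain ⟨x₀, hx₀⟩ := (h6.self_of_nhdsWithin (mem_Ici.2 le_rfl)).exists_entry hJ hK h Iff.rfl
  rw [Setup.S, h5] at hx₀
  exact ⟨s, x₀, δ₁, M₁, h, hx₀, hδ, hb, h3, h4, h6⟩

namespace Setup.IsReference

theorem eventually_abs_lt {d : ℝ} (hd : 0 < d) : ∀ᶠ a in 𝓝[≥] (0 : ℝ), |a| < d :=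
  nhdsWithin_le_nhds ((continuous_abs.tendsto (0 : ℝ)).eventually_lt_const (by simpa using hd))

theorem continuous_repEnergy : Continuous m.repEnergy := by unfold repEnergy; fun_prop

theorem exists_energy_lt (h : s.IsReference φ₀ x₀ δ₁ M₁) {ε : ℝ} (hε : 0 < ε) :
    ∃ T, ∀ t, t ≤ T → m.repEnergy (φ₀.curve t) < ε :=
  eventually_atBot.1 (((continuous_repEnergy.tendsto _).comp h.profile.1.tendsto_curve.2).eventually_lt_const
    (by simpa [repEnergy] using hε))

theorem exists_shadow (h : s.IsReference φ₀ x₀ δ₁ M₁) (x₁ T : ℝ) {η : ℝ} (hη : 0 < η) :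
    ∃ d > 0, ∀ a, |a| < d → ∀ y : ℝ → ℝ², (∀ t, HasDerivAt y (m.fld a (y t)) t) →
      (∀ t, 0 < (y t).1) → ∀ x, dist (y x) (φ₀.curve x₁) < d → ∀ t, |t| ≤ T →
        dist (y (x + t)) (φ₀.curve (x₁ + t)) ≤ η := by
  obtain ⟨d, hd, H⟩ := MHD.exists_shadow h.δ_pos ((h.mem 0).1.trans ((le_abs_self _).trans
    ((norm_fst_le _).trans (h.mem 0).2))) (z := fun t => φ₀.curve (x₁ + t))
    (fun t => (h.profile.1.hasDerivAt_curve _).comp_const_add x₁ t) (fun t => h.mem _) T hη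
  exact ⟨d, hd, fun a ha y hy hpos x hx => H a ha (fun t => y (x + t))
    (fun t => (hy _).comp_const_add x t) (fun t => hpos _) (by simpa using hx)⟩

theorem eventually_exists (h : s.IsReference φ₀ x₀ δ₁ M₁) :
    ∀ᶠ a in 𝓝[≥] 0, ∃ φ, m.IsLaxOneProfile a φ ∧ (m.K < φ.vR ↔ m.K < v₀) := by
  obtain ⟨T, hT⟩ := h.exists_energy_lt s.r_pos
  obtain ⟨η, hη, hηr⟩ := Metric.eventually_nhds_iff.1
    ((continuous_repEnergy.tendsto _).eventually_lt_const (hT _ (min_le_left T x₀)))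
  have hη' : 0 < min (η / 2) (δ₁ / 2) := lt_min (half_pos hη) (half_pos h.δ_pos)
  have h1 := h.δ_pos
  have h2 := h.δ_le
  have h3 := h.le_M
  obtain ⟨d, hd, H⟩ := exists_shadow_cfld (m := m) s.δ_pos s.δ_le (z := fun t => φ₀.curve (x₀ + t))
    (fun t => (h.profile.1.hasDerivAt_curve _).comp_const_add x₀ t)
    (fun t => box_mono (by linarith) (by linarith) (h.mem _)) |min T x₀ - x₀| hη'
  filter_upwards [h.good, eventually_abs_lt hd,
    exists_dist_entry h.profile.1.hasDerivAt_curve h.entry hd] with a hg ha hD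
  obtain ⟨y, hy, he⟩ := hg.exists_stable
  have h0 := hD hg y 0 (fun t ht => (hy t).congr_deriv (m.cfld_eq (s.U_box (he.mem t ht)))) he
  have hnear := H a ha y hy (by simpa using h0)
  have hle : min T x₀ - x₀ ≤ 0 := sub_nonpos.2 (min_le_right _ _)
  refine ⟨_, hg.isLaxOneProfile hy he (T := min T x₀ - x₀) ?_ fun t ht ht0 => ?_, hg.kind⟩
  · have := hnear _ le_rfl
    rw [add_sub_cancel] at this
    exact hηr (this.trans_lt ((min_le_left _ _).trans_lt (half_lt_self hη)))
  · refine box_mono ?_ ?_ (mem_box_of_dist_le (h.mem _) (hnear t (by rwa [abs_of_nonpos hle, abs_of_nonpos ht0, neg_le_neg_iff]))) <;>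
    linarith [min_le_right (η / 2) (δ₁ / 2)]

theorem eventually_dist_lt (h : s.IsReference φ₀ x₀ δ₁ M₁) (x₁ : ℝ) {η : ℝ} (hη : 0 < η) :
    ∀ᶠ a in 𝓝[≥] 0, ∀ φ, m.IsLaxOneProfile a φ → ∀ x, IsEntry s.P s.Q s.U (s.S a) s.p φ.curve x →
      dist (φ.curve (x - x₀ + x₁)) (φ₀.curve x₁) ≤ η := by
  obtain ⟨d, hd, H⟩ := h.exists_shadow x₀ |x₁ - x₀| hη
  filter_upwards [h.good, eventually_abs_lt hd,
    exists_dist_entry h.profile.1.hasDerivAt_curve h.entry hd] with a hg ha hD φ hφ x hx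
  have := H a ha φ.curve hφ.1.hasDerivAt_curve hφ.1.v_pos x
    (hD hg _ x (fun t _ => hφ.1.hasDerivAt_curve t) hx) (x₁ - x₀) le_rfl
  rwa [add_sub_cancel, ← add_comm_sub] at this

theorem exists_shift (h : s.IsReference φ₀ x₀ δ₁ M₁) (hJ : 0 < m.J) {φ : ℝ → Profile}
    (hφ : ∀ᶠ a in 𝓝[>] 0, m.IsLaxOneProfile a (φ a) ∧ (m.K < (φ a).vR ↔ m.K < v₀)) :
    ∃ x : ℝ → ℝ, Tendsto (fun a => (φ a).curve (x a)) (𝓝[>] 0) (𝓝 (φ₀.curve 0)) := by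
  classical
  have hK : m.K < 1 := by linarith [left_lax_zero m h.profile.2.1]
  have hle : 𝓝[>] (0 : ℝ) ≤ 𝓝[≥] 0 := nhdsWithin_mono _ Ioi_subset_Ici_self
  refine ⟨fun a => if hx : ∃ x, IsEntry s.P s.Q s.U (s.S a) s.p (φ a).curve x then hx.choose - x₀ else 0,
    Metric.tendsto_nhds.2 fun ε hε => ?_⟩
  filter_upwards [hφ, hle h.good, hle (h.eventually_dist_lt 0 (half_pos hε))] with a h1 hg h2
  have hx := hg.exists_entry hJ hK h1.1 h1.2
  rw [dif_pos hx]
  have := h2 _ h1.1 _ hx.choose_spec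
  rw [add_zero] at this
  exact this.trans_lt (half_lt_self hε)

theorem exists_tame (h : s.IsReference φ₀ x₀ δ₁ M₁) (hJ : 0 < m.J) :
    ∃ d > 0, ∃ C θ : ℝ, 0 < θ ∧ ∀ᶠ a in 𝓝[≥] 0, ∀ φ, m.IsLaxOneProfile a φ → (m.K < φ.vR ↔ m.K < v₀) →
      dist (φ.curve 0) (φ₀.curve 0) < d → m.IsTameProfile a φ C θ s.δ s.M := by
  have hK : m.K < 1 := by linarith [left_lax_zero m h.profile.2.1]
  have hτ := m.tau_pos
  have hμ := m.μ_pos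
  have hk := s.k_pos
  have hκ := s.κ_pos
  have hr := s.r_pos
  have hE0 : 0 < m.repEnergy (φ₀.curve 0) := by
    have hne := h.profile.curve_ne hJ hK le_rfl 0 (S := (1, 0)) (by simp [fld, fieldV, fieldW])
    have h1 : 0 ≤ m.repEnergy (φ₀.curve 0) := by rw [repEnergy]; positivity
    refine lt_of_le_of_ne h1 fun h0 => hne ?_
    rw [repEnergy, eq_comm, add_eq_zero_iff_of_nonneg (by positivity) (by positivity)] at h0
    simp only [mul_eq_zero, hτ.ne', hμ.ne', false_or, pow_eq_zero_iff two_ne_zero] at h0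
    exact Prod.ext (sub_eq_zero.1 h0.1) h0.2
  obtain ⟨ε, hε⟩ : ∃ ε, ε = min s.r (m.repEnergy (φ₀.curve 0) / 2) := ⟨_, rfl⟩
  have hε0 : 0 < ε := by rw [hε]; positivity
  obtain ⟨T₀, hT₀⟩ := h.exists_energy_lt hε0
  obtain ⟨T, hT⟩ : ∃ T, T = |T₀| + |x₀| := ⟨_, rfl⟩
  have hTT : -T ≤ T₀ := by rw [hT]; linarith [neg_abs_le T₀, abs_nonneg x₀]
  have hT0 : 0 ≤ T := by rw [hT]; positivity
  have hnear : ∀ q : ℝ², m.repEnergy q < ε → ∃ η > 0, ∀ y, dist y q ≤ η → m.repEnergy y < ε := fun q hq => by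
    obtain ⟨η, hη, H⟩ := Metric.eventually_nhds_iff.1 ((continuous_repEnergy.tendsto q).eventually_lt_const hq)
    exact ⟨η / 2, half_pos hη, fun y hy => H (hy.trans_lt (half_lt_self hη))⟩
  obtain ⟨η₁, hη₁, H₁⟩ := hnear _ (hT₀ (-T) hTT)
  obtain ⟨η₂, hη₂, H₂⟩ := Metric.eventually_nhds_iff.1
    ((continuous_repEnergy.tendsto (φ₀.curve 0)).eventually_const_lt (half_lt_self hE0))
  obtain ⟨d, hd, H₃⟩ := h.exists_shadow 0 (T + T) (lt_min hη₁ (half_pos h.δ_pos))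
  obtain ⟨E, hE⟩ : ∃ E, E = (‖s.e‖ + ‖s.f‖) * s.p + 2 * s.M := ⟨_, rfl⟩
  have hM : 0 < s.M := s.δ_pos.trans_le s.δ_le
  have hE0 : 0 ≤ E := by have := s.p_pos; rw [hE]; positivity
  obtain ⟨L, hL⟩ : ∃ L, L = √(s.r * (1 / m.τ + 1 / m.μ)) + 2 * s.M := ⟨_, rfl⟩
  have hL0 : 0 ≤ L := by rw [hL]; positivity
  refine ⟨min d η₂, lt_min hd hη₂, max (E * exp (s.κ * (T + T))) (L * exp (s.k / 2 * T)),
    min s.κ (s.k / 2), by positivity, ?_⟩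
  filter_upwards [h.good, eventually_abs_lt hd, h.eventually_dist_lt (-T) hη₁] with a hg ha hD φ hφ hkd h0
  have hS := hg.end_eq hJ hK hφ hkd
  have hy := hφ.1.hasDerivAt_curve
  obtain ⟨x, hx⟩ := hg.exists_entry hJ hK hφ hkd
  have hsh := H₃ a ha φ.curve hy hφ.1.v_pos 0 (h0.trans_le (min_le_left _ _))
  simp only [zero_add] at hsh
  have hET : m.repEnergy (φ.curve (-T)) < ε :=
    H₁ _ ((hsh _ (by rw [abs_neg, abs_of_nonneg hT0]; linarith)).trans (min_le_left _ _))
  have hrep := fun {T t : ℝ} (hT : m.repEnergy (φ.curve T) < ε) (ht : t ≤ T) =>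
    repEnergy_decay hk.le hg.repel hy (hT.trans_le (hε ▸ min_le_left _ _)) ht
  have hxT : x ≤ T + T := by
    by_contra! hcon
    have h1 := H₁ _ (hD φ hφ x hx)
    have h2 := (hrep h1 (t := 0) (by rw [hT] at hcon ⊢; linarith [le_abs_self x₀, abs_nonneg T₀])).2
    have h3 := H₂ (h0.trans_le (min_le_right _ _))
    have h4 : m.repEnergy (φ.curve (x - x₀ + -T)) * exp (-s.k * (x - x₀ + -T - 0)) ≤
        m.repEnergy (φ.curve (x - x₀ + -T)) := mul_le_of_le_one_right (by rw [repEnergy]; positivity)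
      (exp_le_one_iff.2 (by
        rw [hT] at hcon ⊢; nlinarith [le_abs_self x₀, abs_nonneg T₀]))
    linarith [hε ▸ min_le_right s.r (m.repEnergy (φ₀.curve 0) / 2)]
  have hbox : ∀ t, φ.curve t ∈ box s.δ s.M := fun t => by
    rcases le_total t (-T) with h1 | h1
    · exact s.rep_box _ (hrep hET h1).1
    rcases le_total (T + T) t with h2 | h2
    · exact s.U_box (hx.mem t (hxT.trans h2))
    · refine box_mono ?_ ?_ (mem_box_of_dist_le (h.mem t) (hsh t (abs_le.2 ⟨by linarith, h2⟩))) <;>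
      linarith [min_le_right η₁ (δ₁ / 2), h.δ_le, h.le_M, h.δ_pos]
  have hcc : Continuous φ.curve := continuous_of_hasDerivAt hy
  have hdist : ∀ t q, q ∈ box s.δ s.M → ‖φ.curve t - q‖ ≤ 2 * s.M := fun t q hq =>
    (norm_sub_le _ _).trans (by linarith [(hbox t).2, hq.2])
  have hfin : ∀ {A θ X n t : ℝ}, 0 ≤ A → min s.κ (s.k / 2) ≤ θ →
      A * exp (θ * X) ≤ max (E * exp (s.κ * (T + T))) (L * exp (s.k / 2 * T)) → 0 ≤ t →
      n ≤ A * exp (-θ * (t - X)) → n ≤ max (E * exp (s.κ * (T + T)))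
        (L * exp (s.k / 2 * T)) * exp (-min s.κ (s.k / 2) * t) := by
    intro A θ X n t hA hθ hC ht hn
    refine hn.trans ?_
    rw [show -θ * (t - X) = θ * X + -θ * t by ring, exp_add, ← mul_assoc]
    exact mul_le_mul hC (exp_le_exp.2 (by nlinarith)) (exp_pos _).le (by positivity)
  have hone : ((1 : ℝ), (0 : ℝ)) ∈ box s.δ s.M := s.rep_box _ (by simpa [repEnergy] using hr)
  have hearly : ∀ {A θ X t : ℝ}, 0 ≤ θ → 2 * s.M ≤ A → t ≤ X → 2 * s.M ≤ A * exp (-θ * (t - X)) :=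
    fun hθ hA ht => hA.trans (le_mul_of_one_le_right (by linarith) (one_le_exp (by nlinarith)))
  refine ⟨⟨hcc, hbox, hS ▸ s.U_box hg.S_mem, fun t ht => ?_⟩, ⟨hcc.comp continuous_neg,
    fun t => hbox _, hone, fun t ht => ?_⟩, hφ.1.rest.1, hφ.1.rest.2, ?_, hg.left_end⟩
  · rw [hS]
    refine hfin hE0 (min_le_left _ _) (le_max_left _ _) ht ?_
    rcases le_total (T + T) t with h1 | h1
    · refine (hg.decay (fun t _ => hy t) hx hxT h1).trans (mul_le_mul_of_nonneg_right ?_ (exp_pos _).le)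
      rw [hE]; linarith
    · exact (hdist t _ (s.U_box hg.S_mem)).trans (hearly hκ.le
        (by have := s.p_pos; rw [hE]; exact le_add_of_nonneg_left (by positivity)) h1)
  · refine hfin hL0 (min_le_right _ _) (le_max_right _ _) ht ?_
    rcases le_total T t with h1 | h1
    · obtain ⟨h2, h3⟩ := hrep hET (neg_le_neg h1)
      have h4 := h3.trans (mul_le_mul_of_nonneg_right (hET.le.trans (hε ▸ min_le_left _ _)) (exp_pos _).le)
      have h5 : -s.k * (-T - -t) = -(s.k / 2) * (t - T) + -(s.k / 2) * (t - T) := by ring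
      rw [h5, exp_add, ← sq] at h4
      obtain ⟨X, hX⟩ : ∃ X, X = exp (-(s.k / 2) * (t - T)) := ⟨_, rfl⟩
      have hX0 : 0 < X := hX ▸ exp_pos _
      rw [← hX] at h4 ⊢
      have h6 : ∀ g q : ℝ, 0 < q → 1 / q ≤ 1 / m.τ + 1 / m.μ → q * g ^ 2 ≤ s.r * X ^ 2 → |g| ≤ L * X := by
        intro g q hq hq1 hg
        have h7 : g ^ 2 ≤ (√(s.r * (1 / m.τ + 1 / m.μ)) * X) ^ 2 := by
          rw [mul_pow, sq_sqrt (by positivity)]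
          calc g ^ 2 = 1 / q * (q * g ^ 2) := by field_simp
            _ ≤ (1 / m.τ + 1 / m.μ) * (s.r * X ^ 2) := mul_le_mul hq1 hg (by positivity) (by positivity)
            _ = _ := by ring
        refine (abs_le_of_sq_le_sq h7 (by positivity)).trans (mul_le_mul_of_nonneg_right ?_ hX0.le)
        rw [hL]; linarith
      rw [repEnergy] at h4
      have hτ' : 0 ≤ 1 / m.τ := by positivity
      have hμ' : 0 ≤ 1 / m.μ := by positivity
      refine max_le (h6 _ m.τ hτ (by linarith) ?_) (h6 _ m.μ hμ (by linarith) ?_)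
      · exact (le_add_of_nonneg_right (by positivity)).trans h4
      · rw [Prod.snd_sub, sub_zero]
        exact (le_add_of_nonneg_left (by positivity)).trans h4
    · have h2 : 2 * s.M ≤ L := hL ▸ le_add_of_nonneg_left (sqrt_nonneg _)
      exact (hdist _ _ hone).trans (hearly (by positivity) h2 h1)
  · rw [hS]; exact hg.endState.mem_endStates hg.nonneg

end Setup.IsReference

end MHD

/-! ### The zero-pressure profile of an ordinary shock -/

namespace MHD

variable {m : MHD}

theorem restFun_zero_eq {v : ℝ} (hv : m.K < v) : m.restFun 0 v =
    (v - 1) * ((v - m.K) ^ 2 - m.J * (v - m.K + (1 - m.K))) / (v - m.K) ^ 2 := by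
  have := (sub_pos.2 hv).ne'
  rw [restFun]; field_simp; ring

theorem exists_isEndState_zero (hJ : 0 < m.J) (h : 2 * m.J + m.K < 1) : ∃ v₀, m.K < v₀ ∧
    m.IsEndState 0 v₀ ∧ ∀ v, m.K < v → m.restFun 0 v = 0 → v = 1 ∨ v = v₀ := by
  have hK := m.K_nonneg
  obtain ⟨x, hx⟩ : ∃ x, x = (m.J + √(m.J ^ 2 + 4 * m.J * (1 - m.K))) / 2 := ⟨_, rfl⟩
  have hpos : 0 < 4 * m.J * (1 - m.K) := mul_pos (by linarith) (by linarith)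
  have hsq := sq_sqrt (add_nonneg (sq_nonneg m.J) hpos.le)
  have hx2 : x ^ 2 = m.J * (x + (1 - m.K)) := by rw [hx]; linear_combination hsq / 4
  have hxJ : m.J < x := by
    have := Real.lt_sqrt_of_sq_lt (lt_add_of_pos_right (m.J ^ 2) hpos)
    linarith
  have hx0 := hJ.trans hxJ
  have hx1 : x < 1 - m.K := by
    by_contra! hcon
    nlinarith [mul_le_mul_of_nonneg_right hcon hx0.le]
  have hv : m.K < m.K + x := by linarith
  have hxK : m.K + x - m.K = x := by ring
  refine ⟨m.K + x, hv, ⟨by linarith, hv.ne', ?_, ?_⟩, fun v hKv h0 => ?_⟩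
  · rw [restFun_zero_eq hv, hxK, hx2]; simp
  · rw [restFunDeriv, hxK]
    refine mul_neg_of_pos_of_neg hx0 ?_
    rw [zero_mul, zero_mul, sub_zero, sub_neg, lt_div_iff₀ (by positivity), one_mul]
    have e : x ^ 3 = m.J * (x ^ 2 + (1 - m.K) * x) := by linear_combination x * hx2
    rw [e, mul_comm 2, mul_assoc]
    exact mul_lt_mul_of_pos_left (by nlinarith) hJ
  · rw [restFun_zero_eq hKv, div_eq_zero_iff, or_iff_left (pow_ne_zero 2 (sub_pos.2 hKv).ne'), mul_eq_zero] at h0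
    refine h0.imp sub_eq_zero.1 fun h1 => ?_
    have h2 : (v - m.K - x) * (v - m.K + x - m.J) = 0 := by linear_combination h1 - hx2
    rcases mul_eq_zero.1 h2 with h3 | h3 <;> linarith

theorem exists_norm_le_of_pot_le {v₀ : ℝ} (hJ : 0 ≤ m.J) (h0 : 0 < v₀) (hv₀ : m.K < v₀) (C : ℝ) :
    ∃ M, ∀ y : ℝ², v₀ ≤ y.1 → m.pot 0 y ≤ C → ‖y‖ ≤ M := by
  have hμ₀ := m.μ₀_pos
  have hK := m.K_nonneg
  obtain ⟨k, hk⟩ : ∃ k, k = 1 - m.K / v₀ := ⟨_, rfl⟩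
  have hk0 : 0 < k := by rw [hk, sub_pos, div_lt_one h0]; exact hv₀
  obtain ⟨b, hb⟩ : ∃ b, b = m.I * m.Bm / m.μ₀ := ⟨_, rfl⟩
  obtain ⟨n, hn⟩ : ∃ n, n = |b| * (1 + 1 / v₀) / k := ⟨_, rfl⟩
  have hn0 : 0 ≤ n := by rw [hn]; positivity
  have hnk : |b| * (1 + 1 / v₀) = k * n := by rw [hn]; field_simp
  obtain ⟨A, hA⟩ : ∃ A, A = C + k / 2 * n ^ 2 + m.J + m.J ^ 2 / 2 + m.J / v₀ := ⟨_, rfl⟩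
  refine ⟨1 + m.J + (2 * A + 1) + (n + (2 * A / k + 1)), fun ⟨v, w⟩ hv hC => ?_⟩
  simp only at hv
  have hv0 := h0.trans_le hv
  have e : m.pot 0 (v, w) = (v - 1 - m.J) ^ 2 / 2 - m.J - m.J ^ 2 / 2 - m.J / v +
      (1 - m.K / v) / 2 * w ^ 2 + b * (1 - 1 / v) * w := by
    rw [pot, hb, J, K]; field_simp; ring
  have h1 : m.J / v ≤ m.J / v₀ := div_le_div_of_nonneg_left hJ h0 hv
  have h2 : k * w ^ 2 ≤ (1 - m.K / v) * w ^ 2 := by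
    rw [hk]; have := div_le_div_of_nonneg_left hK h0 hv; gcongr
  have h3 : |b * (1 - 1 / v) * w| ≤ k * n * |w| := by
    rw [← hnk, abs_mul, abs_mul]
    have h4 : 0 < 1 / v := by positivity
    have h5 : 1 / v ≤ 1 / v₀ := one_div_le_one_div_of_le h0 hv
    gcongr
    exact abs_le.2 ⟨by linarith, by linarith⟩
  have h6 : (v - 1 - m.J) ^ 2 / 2 + k / 2 * (|w| - n) ^ 2 ≤ A := by
    rw [e] at hC
    have : k / 2 * (|w| - n) ^ 2 = k * w ^ 2 / 2 - k * n * |w| + k / 2 * n ^ 2 := by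
      rw [← sq_abs w]; ring
    linarith [neg_le_of_abs_le h3]
  have h7 : (v - 1 - m.J) ^ 2 ≤ 2 * A := by nlinarith only [h6, mul_nonneg hk0.le (sq_nonneg (|w| - n))]
  have h8 : (|w| - n) ^ 2 ≤ 2 * A / k := by
    rw [le_div_iff₀ hk0]; nlinarith only [h6, sq_nonneg (v - 1 - m.J)]
  have hA0 : 0 ≤ A := by nlinarith only [h7, sq_nonneg (v - 1 - m.J)]
  have hA1 : 0 ≤ 2 * A / k := by positivity
  have h9 : v ≤ 1 + m.J + (2 * A + 1) := by nlinarith only [h7, sq_nonneg (v - 1 - m.J - 1)]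
  have h10 : |w| ≤ n + (2 * A / k + 1) := by nlinarith only [h8, sq_nonneg (|w| - n - 1)]
  exact max_le (by rw [norm_eq_abs, abs_of_pos hv0]; linarith) (by rw [norm_eq_abs]; linarith)

theorem exists_ordinary_profile (hJ : 0 < m.J) (h : 2 * m.J + m.K < 1) :
    ∃ φ, m.IsLaxOneProfile 0 φ ∧ m.K < φ.vR := by
  obtain ⟨v₀, hKv, hE, hzero⟩ := exists_isEndState_zero hJ h
  obtain ⟨M₀, hM₀⟩ := exists_norm_le_of_pot_le hJ.le hE.pos hKv (m.pot 0 (v₀, m.wRest v₀))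
  obtain ⟨s, hs1, hs2, hs3, hs4⟩ := hE.exists_setup hJ h (M₀ := M₀) hE.pos
  have hg := hs4.self_of_nhdsWithin (mem_Ici.2 le_rfl)
  have hS : s.S 0 = (v₀, m.wRest v₀) := by rw [Setup.S, hs3]
  obtain ⟨y, hy, he⟩ := hg.exists_stable
  have hyc : Continuous y := continuous_of_hasDerivAt hy
  have hp := s.p_pos
  have hfw : ∀ t, 0 ≤ t → HasDerivAt y (m.fld 0 (y t)) t := fun t ht =>
    (hy t).congr_deriv (m.cfld_eq (s.U_box (he.mem t ht)))
  have hpot0 : m.pot 0 (y 0) < m.pot 0 (v₀, m.wRest v₀) := by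
    rw [← hS]
    refine pot_lt_of_tendsto hfw (fun t ht => s.δ_pos.trans_le (s.U_box (he.mem t ht)).1)
      (hg.tendsto hfw he) (by rw [hS]; exact hE.pos) fun h0 => ?_
    have := he.P_eq
    rw [h0, sub_self, map_zero] at this
    exact hp.ne this
  have hv0 : v₀ < (y 0).1 := by
    have h1 := s.coords.side _ (he.cone 0 le_rfl)
    rw [he.P_eq, side, if_pos hKv, hS] at h1
    have h2 := (mul_pos s.coords.c_pos (pow_pos hp 2)).trans_le h1
    have := pos_of_mul_pos_left h2 hp.le
    simp only [Prod.fst_sub, one_mul, zero_mul, add_zero] at this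
    linarith
  have hbox : ∀ q : ℝ², v₀ ≤ q.1 → m.pot 0 q ≤ m.pot 0 (v₀, m.wRest v₀) → q ∈ box s.δ s.M :=
    fun q h1 h2 => ⟨hs1.trans h1, (hM₀ q h1 h2).trans hs2⟩
  have hcont : ContinuousOn (m.pot 0) {q : ℝ² | v₀ < q.1} := fun q hq =>
    (continuousAt_pot (hE.pos.trans hq)).continuousWithinAt
  have hback := forall_mem_of_step (y := fun t => y (-t)) (hcont.isOpen_inter_preimage
      (isOpen_lt continuous_const continuous_fst) (isOpen_Iio (a := m.pot 0 (v₀, m.wRest v₀))))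
    (hyc.comp continuous_neg) fun t ht hbef => by
      rcases ht.eq_or_lt with rfl | ht
      · simpa using ⟨hv0, hpot0⟩
      have hin : ∀ r, -t < r → r ≤ 0 → v₀ < (y r).1 ∧ m.pot 0 (y r) < m.pot 0 (v₀, m.wRest v₀) :=
        fun r h1 h2 => by simpa using hbef (-r) (by linarith) (by linarith)
      have hvle : v₀ ≤ (y (-t)).1 := ge_of_tendsto (((continuous_fst.comp hyc).tendsto (-t)).mono_left
        nhdsWithin_le_nhds) (eventually_of_mem (Ioc_mem_nhdsGT (by linarith : -t < 0)) fun r hr => (hin r hr.1 hr.2).1.le)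
      have hge : ∀ r ∈ Icc (-t) 0, v₀ ≤ (y r).1 := fun r hr => by
        rcases hr.1.eq_or_lt with h1 | h1
        · rwa [← h1]
        · exact (hin r h1 hr.2).1.le
      have hmono : MonotoneOn (fun r => m.pot 0 (y r)) (Icc (-t) 0) := by
        have hd : ∀ r ∈ interior (Icc (-t) 0), HasDerivAt (fun r => m.pot 0 (y r)) (m.dissipation 0 (y r)) r :=
          fun r hr => by
            rw [interior_Icc] at hr
            have h1 := hin r hr.1 hr.2.le
            exact hasDerivAt_pot ((hy r).congr_deriv (m.cfld_eq (hbox _ h1.1.le h1.2.le))) (hE.pos.trans h1.1)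
        refine monotoneOn_of_deriv_nonneg (convex_Icc _ _) (fun r hr => ?_)
          (fun r hr => (hd r hr).differentiableAt.differentiableWithinAt) fun r hr => ?_
        · exact ((continuousAt_pot (hE.pos.trans_le (hge r hr))).comp hyc.continuousAt).continuousWithinAt
        · rw [(hd r hr).deriv]
          exact dissipation_nonneg (hE.pos.trans_le (hge r (interior_subset hr)))
      have hlt := (hmono (left_mem_Icc.2 (by linarith)) (right_mem_Icc.2 (by linarith)) (by linarith)).trans_lt hpot0
      refine ⟨lt_of_le_of_ne hvle fun h0 => ?_, hlt⟩
      have h1 := pot_wRest_le (a := 0) (w := (y (-t)).2) hE.pos hKv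
      rw [h0] at h1 hlt
      exact h1.not_gt hlt
  have hin : ∀ t, t ≤ 0 → v₀ < (y t).1 ∧ m.pot 0 (y t) < m.pot 0 (v₀, m.wRest v₀) := fun t ht => by
    simpa using hback (-t) (by linarith)
  have hbx : ∀ t, t ≤ 0 → y t ∈ box s.δ s.M := fun t ht => hbox _ (hin t ht).1.le (hin t ht).2.le
  have hd : ∀ t, t ≤ 0 → HasDerivAt (fun t => m.pot 0 (y t)) (m.dissipation 0 (y t)) t := fun t ht =>
    hasDerivAt_pot ((hy t).congr_deriv (m.cfld_eq (hbx t ht))) (hE.pos.trans (hin t ht).1)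
  obtain ⟨T, hT, hTr⟩ : ∃ T, T ≤ 0 ∧ m.repEnergy (y T) < s.r := by
    by_contra! hcon
    have hmono : ∀ ε, (∀ t, t ≤ 0 → ε ≤ m.dissipation 0 (y t)) → ∀ t, t ≤ 0 →
        m.pot 0 (y t) - ε * t ≤ m.pot 0 (y 0) := fun ε hε t ht => by
      have hi : ∀ t ∈ interior (Iic (0 : ℝ)), t ≤ 0 := fun t ht => mem_Iic.1 (interior_subset ht)
      have hd' := fun t ht => (hd t ht).sub ((hasDerivAt_id t).const_mul ε)
      have := monotoneOn_of_hasDerivAt (convex_Iic 0) hd' (fun t ht => by linarith [hε t (hi t ht)]) ht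
        (mem_Iic.2 le_rfl) ht
      simpa using this
    have hc : ContinuousOn (m.pot 0) (box v₀ M₀) := fun q hq =>
      (continuousAt_pot (hE.pos.trans_le hq.1)).continuousWithinAt
    set Z := (box v₀ M₀ ∩ m.pot 0 ⁻¹' Iic (m.pot 0 (y 0))) ∩ m.repEnergy ⁻¹' Ici s.r
    have hZ : IsCompact Z :=
      (isCompact_box.of_isClosed_subset (hc.preimage_isClosed_of_isClosed isCompact_box.isClosed isClosed_Iic)
        inter_subset_left).inter_right (isClosed_Ici.preimage Setup.IsReference.continuous_repEnergy)
    have hyZ : ∀ t, t ≤ 0 → y t ∈ Z := fun t ht => ⟨⟨⟨(hin t ht).1.le, hM₀ _ (hin t ht).1.le (hin t ht).2.le⟩, by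
        simpa using hmono 0 (fun t ht => dissipation_nonneg (hE.pos.trans (hin t ht).1)) t ht⟩, hcon t ht⟩
    have hdc : ContinuousOn (m.dissipation 0) Z := fun q hq => by
      have h1 : 0 < q.1 := hE.pos.trans_le hq.1.1.1
      have h2 : ContinuousAt (m.fld 0) q := continuousAt_fld h1
      have h3 := h1.ne'
      exact (((continuousAt_const.mul (h2.fst.pow 2)).add (continuousAt_const.mul (h2.snd.pow 2))).div
        continuousAt_fst h3).continuousWithinAt
    obtain ⟨q, hq, hqmin⟩ := hZ.exists_isMinOn ⟨_, hyZ 0 le_rfl⟩ hdc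
    have hε : 0 < m.dissipation 0 q := by
      refine dissipation_pos (hE.pos.trans_le hq.1.1.1) fun h0 => ?_
      have hKq : m.K < q.1 := hKv.trans_le hq.1.1.1
      obtain ⟨h1, h2⟩ := (rest_iff (hE.pos.trans_le hq.1.1.1) hKq.ne').1
        ⟨congrArg Prod.fst h0, congrArg Prod.snd h0⟩
      rcases hzero q.1 hKq h2 with h3 | h3
      · have h4 : s.r ≤ m.repEnergy q := hq.2
        rw [h3, wRest_one] at h1
        rw [repEnergy, h3, h1] at h4
        simp at h4
        exact h4.not_gt s.r_pos
      · have h4 : m.pot 0 q ≤ m.pot 0 (y 0) := hq.1.2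
        rw [h3] at h1
        rw [show q = (v₀, m.wRest v₀) from Prod.ext h3 h1] at h4
        exact h4.not_gt hpot0
    obtain ⟨q', hq', hmin'⟩ := hZ.exists_isMinOn ⟨_, hyZ 0 le_rfl⟩ (hc.mono fun q hq => hq.1.1)
    have h1 := fun t ht => hmono _ (fun t ht => hqmin (hyZ t ht)) t ht
    obtain ⟨T, hT⟩ : ∃ T, T = (m.pot 0 q' - m.pot 0 (y 0) - 1) / m.dissipation 0 q := ⟨_, rfl⟩
    have h2 : m.dissipation 0 q * T = m.pot 0 q' - m.pot 0 (y 0) - 1 := by rw [hT]; field_simp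
    have h3 : m.pot 0 q' ≤ m.pot 0 (y 0) := hmin' (hyZ 0 le_rfl)
    have hT0 : T ≤ 0 := by rw [hT]; exact div_nonpos_of_nonpos_of_nonneg (by linarith) hε.le
    have h4 : m.pot 0 q' ≤ m.pot 0 (y T) := hmin' (hyZ T hT0)
    linarith [h1 T hT0]
  exact ⟨_, hg.isLaxOneProfile hy he hTr fun t _ ht => hbx t ht, by simpa [hs3] using hKv⟩

end MHD

end

end

theorem proposition5p5 (m : MHD) (hJ : 0 < m.J) :
    -- ordinary Lax 1-shocks: the zero-pressure limit has a profile
    (2 * m.J + m.K < 1 → ∃ φ₀, m.IsLaxOneProfile 0 φ₀ ∧ m.K < φ₀.vR) ∧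
    -- ordinary and intermediate Lax 1-shocks
    ∀ φ₀ : MHD.Profile, m.IsLaxOneProfile 0 φ₀ →
      -- existence of profiles of the same kind for small positive pressure
      (∀ᶠ a in 𝓝[>] (0 : ℝ), ∃ φ, m.IsLaxOneProfile a φ ∧ m.SameKind φ φ₀) ∧
      -- any such profiles converge to the limiting one after translation
      (∀ φ : ℝ → MHD.Profile,
        (∀ᶠ a in 𝓝[>] (0 : ℝ), m.IsLaxOneProfile a (φ a) ∧ m.SameKind (φ a) φ₀) →
        ∃ h : ℝ → ℝ, Tendsto (fun a => ((φ a).v (h a), (φ a).w (h a))) (𝓝[>] (0 : ℝ))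
          (𝓝 (φ₀.v 0, φ₀.w 0))) ∧
      -- existence and convergence of the Evans functions
      (∀ φ : ℝ → MHD.Profile,
        (∀ᶠ a in 𝓝[>] (0 : ℝ), m.IsLaxOneProfile a (φ a) ∧ m.SameKind (φ a) φ₀) →
        Tendsto (fun a => ((φ a).v 0, (φ a).w 0)) (𝓝[>] (0 : ℝ)) (𝓝 (φ₀.v 0, φ₀.w 0)) →
        ∀ (z₀ : ℂ), 0 < z₀.re →
        ∀ (bm : ℝ → Fin 2 → Fin 6 → ℂ) (bp : ℝ → Fin 4 → Fin 6 → ℂ)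
          (bm₀ : Fin 2 → Fin 6 → ℂ) (bp₀ : Fin 4 → Fin 6 → ℂ),
        IsFrame (unstableSubspace (m.limLeft 0 z₀)) bm₀ →
        IsFrame (stableSubspace (m.limRight 0 φ₀ z₀)) bp₀ →
        (∀ᶠ a in 𝓝[>] (0 : ℝ), IsFrame (unstableSubspace (m.limLeft a z₀)) (bm a) ∧
          IsFrame (stableSubspace (m.limRight a (φ a) z₀)) (bp a)) →
        Tendsto bm (𝓝[>] (0 : ℝ)) (𝓝 bm₀) → Tendsto bp (𝓝[>] (0 : ℝ)) (𝓝 bp₀) →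
        (∃ D₀, m.IsEvansFunction 0 φ₀ z₀ bm₀ bp₀ D₀) ∧
        (∀ᶠ a in 𝓝[>] (0 : ℝ), ∃ D, m.IsEvansFunction a (φ a) z₀ (bm a) (bp a) D) ∧
        ∀ (D₀ : ℂ → ℂ) (D : ℝ → ℂ → ℂ),
          m.IsEvansFunction 0 φ₀ z₀ bm₀ bp₀ D₀ →
          (∀ᶠ a in 𝓝[>] (0 : ℝ), m.IsEvansFunction a (φ a) z₀ (bm a) (bp a) (D a)) →
          ∀ S : Set ℂ, IsCompact S → S ⊆ {z : ℂ | 0 ≤ z.re} →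
            TendstoUniformlyOn D D₀ (𝓝[>] (0 : ℝ)) S) := by
  refine ⟨fun h => MHD.exists_ordinary_profile hJ h, fun φ₀ h₀ => ?_⟩
  obtain ⟨s, x₀, δ₁, M₁, hs⟩ := h₀.exists_reference hJ
  have hK : m.K < 1 := by linarith [MHD.left_lax_zero m h₀.2.1]
  have hle : 𝓝[>] (0 : ℝ) ≤ 𝓝[≥] 0 := nhdsWithin_mono _ Ioi_subset_Ici_self
  refine ⟨hle hs.eventually_exists, fun φ hφ => hs.exists_shift hJ hφ,
    fun φ hφ hlim z₀ hz₀ bm bp bm₀ bp₀ hm₀ hp₀ hfr hbm hbp => ?_⟩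
  obtain ⟨d, hd, C, θ, hθ, ht⟩ := hs.exists_tame hJ
  have ht₀ := ht.self_of_nhdsWithin (mem_Ici.2 le_rfl) φ₀ h₀ Iff.rfl (by simpa using hd)
  have htφ : ∀ᶠ a in 𝓝[>] 0, m.IsTameProfile a (φ a) C θ s.δ s.M := by
    filter_upwards [hle ht, hφ, Metric.tendsto_nhds.1 hlim d hd] with a h1 h2 h3
    exact h1 _ h2.1 h2.2 h3
  have hend : Tendsto (fun a => ((φ a).vR, (φ a).wR)) (𝓝[>] 0) (𝓝 (φ₀.vR, φ₀.wR)) := by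
    rw [(h₀.isEndState hJ hK le_rfl).2]
    refine (s.tendsto_vE.mono_left hle).congr' ?_
    filter_upwards [hle hs.good, hφ] with a h1 h2
    exact (h1.end_eq hJ hK h2.1 h2.2).symm
  have hloc : ∀ X η : ℝ, 0 < η → ∀ᶠ a in 𝓝[>] 0, ∀ x, |x| ≤ X → ‖(φ a).curve x - φ₀.curve x‖ ≤ η := by
    intro X η hη
    obtain ⟨d, hd, H⟩ := hs.exists_shadow 0 X hη
    filter_upwards [hle (MHD.Setup.IsReference.eventually_abs_lt hd), hφ,
      Metric.tendsto_nhds.1 hlim d hd] with a h1 h2 h3 x hx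
    have := H a h1 _ h2.1.1.hasDerivAt_curve h2.1.1.v_pos 0 h3 x hx
    rwa [zero_add, dist_eq_norm] at this
  refine ⟨ht₀.exists_evansFunction hz₀ hθ s.δ_pos hm₀ hp₀, ?_, fun D₀ D hD₀ hD S hS hSre =>
    MHD.tendstoUniformlyOn_evansFunction hz₀ hθ s.δ_pos nhdsWithin_le_nhds ht₀ htφ hend hloc hbm hbp
      hD₀ hD hS hSre⟩
  filter_upwards [htφ, hfr] with a h1 h2
  exact h1.exists_evansFunction hz₀ hθ s.δ_pos h2.1 h2.2
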